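/- **Theorem 1.1 (Local well-posedness).** Let $s\ge 2$ be an integer, $k\in\{1,-1\}$, $\nu\ge 0$. Let $c=c(t,x)$ be a background state on $[0,\infty)\times\mathbb R$ with $0<c_-\le c\le c_+$ for constants $c_\pm$, with $\partial_t c\in L^\infty(\mathbb R_+;H^s\cap\dot H^{-1}(\mathbb R))$ and $\partial_x c\in L^\infty(\mathbb R_+;H^s(\mathbb R))$, and write $c_0=c(0,\cdot)$. Consider the pressureless Euler–Poisson system $$\partial_t\rho+\partial_x(\rho u)=0,\qquad \partial_t u+u\,\partial_x u=-\nu u-k\,\partial_x\phi,\qquad -\partial_{xx}\phi=\rho-c,\qquad (\rho,u)|_{t=0}=(\rho_0,u_0)$$ on $\mathbb R$. Suppose that $(\rho_0-c_0,u_0)\in (H^s\cap\dot H^{-1}(\mathbb R))\times H^{s+1}(\mathbb R)$. Then there is $T>0$ such that the system has a unique solution $(\rho,u)$ on $[0,T]$ with $$(\rho-c,u)\in L^\infty(0,T;H^s\cap\dot H^{-1}(\mathbb R))\times L^\infty(0,T;H^{s+1}(\mathbb R)).$$ Here a solution satisfies the equations pointwise on $[0,T]\times\mathbb R$ for some potential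 $\phi$, and attains the initial data almost everywhere in $x$. Moreover, there are constants $C,K>0$ that depend only on $s$ such that the following holds for every $T>0$. If $(\rho,u)$ is a solution on $[0,T]$ of the above class and $$M_T:=\sup_{0\le t\le T}\big(\|\rho(t)\|_{L^\infty}+\|\partial_x u(t)\|_{L^\infty}\big)<\infty,$$ then, with $X(t):=\|(\rho-c)(t)\|_{H^s\cap\dot H^{-1}}+\|u(t)\|_{H^{s+1}}$ and $X_0:=\|\rho_0-c_0\|_{H^s\cap\dot H^{-1}}+\|u_0\|_{H^{s+1}}$, $$\sup_{0\le t\le T}X(t)\le C\big(X_0+T\,\|\partial_t c\|_{L^\infty(0,T;H^s\cap\dot H^{-1})}\big)\,e^{\eta T},$$ where $\eta=K\big(M_T+\|\partial_t c\|_{L^\infty(0,T;H^s\cap\dot H^{-1})}+\|\partial_x c\|_{L^\infty(0,T;H^s)}+1\big)$. -/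

import Mathlib

open MeasureTheory Set
open scoped ENNReal ContDiff FourierTransform

/-- `g` is the `j`-th weak (distributional) derivative of `f` on the real line. -/
def IsWeakDeriv (j : ℕ) (f g : ℝ → ℝ) : Prop :=
  LocallyIntegrable f ∧ LocallyIntegrable g ∧
    ∀ ψ : ℝ → ℝ, ContDiff ℝ ∞ ψ → HasCompactSupport ψ →
      ∫ x, f x * iteratedDeriv j ψ x = (-1) ^ j * ∫ x, g x * ψ x

/-- `‖∂ₓʲ f‖_{L²}`, with value `∞` if `f` has no `j`-th weak derivative. Weak derivatives are
unique almost everywhere, so that the infimum runs over a single value. -/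
noncomputable def weakDerivNorm (j : ℕ) (f : ℝ → ℝ) : ℝ≥0∞ :=
  ⨅ (g : ℝ → ℝ) (_ : IsWeakDeriv j f g), eLpNorm g 2 volume

/-- The norm of `Hᵐ(ℝ)`: the square root of the sum of `‖∂ₓʲ f‖²_{L²}` over `0 ≤ j ≤ m`.
It is finite exactly when `f` lies in `Hᵐ(ℝ)`. -/
noncomputable def sobolevNorm (m : ℕ) (f : ℝ → ℝ) : ℝ≥0∞ :=
  (∑ j ∈ Finset.range (m + 1), weakDerivNorm j f ^ 2) ^ (1 / 2 : ℝ)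

open Classical in
/-- The norm of the homogeneous space `Ḣ⁻¹(ℝ)` of a square integrable function: the `L²` norm of
its (Plancherel) Fourier transform divided by `|ξ|`. In Mathlib's normalization of the Fourier
transform the frequency of `exp (2 π i x ξ)` is `2 π ξ`. -/
noncomputable def hMinusOneNorm (f : ℝ → ℝ) : ℝ≥0∞ :=
  if h : MemLp (fun x => (f x : ℂ)) 2 volume then
    eLpNorm (fun ξ : ℝ => (((2 * Real.pi * |ξ|)⁻¹ : ℝ) : ℂ) * (𝓕 (h.toLp _) : Lp ℂ 2 volume) ξ)
      2 volume
  else ⊤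

/-- The norm of `Hᵐ ∩ Ḣ⁻¹(ℝ)`. -/
noncomputable def capNorm (m : ℕ) (f : ℝ → ℝ) : ℝ≥0∞ :=
  sobolevNorm m f + hMinusOneNorm f

/-- The norm of `(Hˢ ∩ Ḣ⁻¹) × Hˢ⁺¹` of a density fluctuation `n` and a velocity `v`. -/
noncomputable def stateNorm (s : ℕ) (n v : ℝ → ℝ) : ℝ≥0∞ :=
  capNorm s n + sobolevNorm (s + 1) v

/-- The norm of `L^∞(I; X)` of a function of time whose `X`-norm at time `t` is `N t`. -/
noncomputable def timeEssSup (I : Set ℝ) (N : ℝ → ℝ≥0∞) : ℝ≥0∞ :=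
  essSup N (volume.restrict I)

/-- `c` is an admissible background state with lower bound `cm > 0` and upper bound `cp`, and `ct`
is its time derivative (in the sense of absolutely continuous functions of time):
`∂ₜ c ∈ L^∞(ℝ₊; Hˢ ∩ Ḣ⁻¹)` and `∂ₓ c ∈ L^∞(ℝ₊; Hˢ)`. -/
structure IsBackground (s : ℕ) (cm cp : ℝ) (c ct : ℝ → ℝ → ℝ) : Prop where
  pos : 0 < cm
  bounds : ∀ t, 0 ≤ t → ∀ x, cm ≤ c t x ∧ c t x ≤ cp
  diff_x : ∀ t, 0 ≤ t → Differentiable ℝ (c t)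
  measurable_ct : Measurable (Function.uncurry ct)
  integrable_ct : ∀ t, 0 ≤ t → ∀ x, IntervalIntegrable (fun τ => ct τ x) volume 0 t
  eq_integral : ∀ t, 0 ≤ t → ∀ x, c t x = c 0 x + ∫ τ in (0 : ℝ)..t, ct τ x
  ct_mem : timeEssSup (Ioi 0) (fun t => capNorm s (ct t)) < ⊤
  cx_mem : timeEssSup (Ioi 0) (fun t => sobolevNorm s (deriv (c t))) < ⊤

/-- `(ρ, u)`, with the potential `φ`, solves the pressureless Euler-Poisson system with damping
`ν`, forcing parameter `k` and background `c` pointwise on `[0, T] × ℝ`, with initial data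
`(ρ₀, u₀)`. Time derivatives are one-sided at the end points of `[0, T]`. Initial data are elements
of Sobolev spaces and hence are attained up to a null set. -/
structure SolvesEP (k ν : ℝ) (c : ℝ → ℝ → ℝ) (T : ℝ) (ρ₀ u₀ : ℝ → ℝ)
    (ρ u φ : ℝ → ℝ → ℝ) : Prop where
  diff_ρ : ∀ t ∈ Icc 0 T, Differentiable ℝ (ρ t)
  diff_u : ∀ t ∈ Icc 0 T, Differentiable ℝ (u t)
  diff_φ : ∀ t ∈ Icc 0 T, Differentiable ℝ (φ t)
  diff_φx : ∀ t ∈ Icc 0 T, Differentiable ℝ (deriv (φ t))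
  mass : ∀ t ∈ Icc 0 T, ∀ x,
    HasDerivWithinAt (fun τ => ρ τ x) (-deriv (fun y => ρ t y * u t y) x) (Icc 0 T) t
  momentum : ∀ t ∈ Icc 0 T, ∀ x,
    HasDerivWithinAt (fun τ => u τ x)
      (-(u t x * deriv (u t) x) - ν * u t x - k * deriv (φ t) x) (Icc 0 T) t
  poisson : ∀ t ∈ Icc 0 T, ∀ x, -deriv (deriv (φ t)) x = ρ t x - c t x
  init_ρ : ρ 0 =ᵐ[volume] ρ₀
  init_u : u 0 =ᵐ[volume] u₀

/-- `(ρ, u)` is a solution on `[0, T]` (for some potential) with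
`(ρ - c, u) ∈ L^∞(0, T; Hˢ ∩ Ḣ⁻¹) × L^∞(0, T; Hˢ⁺¹)`. -/
def IsEPSolution (s : ℕ) (k ν : ℝ) (c : ℝ → ℝ → ℝ) (T : ℝ) (ρ₀ u₀ : ℝ → ℝ)
    (ρ u : ℝ → ℝ → ℝ) : Prop :=
  (∃ φ : ℝ → ℝ → ℝ, SolvesEP k ν c T ρ₀ u₀ ρ u φ) ∧
    timeEssSup (Ioo 0 T) (fun t => capNorm s (fun x => ρ t x - c t x)) < ⊤ ∧
    timeEssSup (Ioo 0 T) (fun t => sobolevNorm (s + 1) (u t)) < ⊤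

/-- `sup_{0 ≤ t ≤ T} (‖ρ(t)‖_{L^∞} + ‖∂ₓ u(t)‖_{L^∞})`. -/
noncomputable def lowNorm (T : ℝ) (ρ u : ℝ → ℝ → ℝ) : ℝ≥0∞ :=
  ⨆ t ∈ Icc 0 T, (eLpNorm (ρ t) ⊤ volume + eLpNorm (deriv (u t)) ⊤ volume)

/-- `sup (‖ρ‖_∞ + ‖∂ₓ u‖_∞) + ‖∂ₜ c‖_{L^∞(0,T; Hˢ ∩ Ḣ⁻¹)} + ‖∂ₓ c‖_{L^∞(0,T; Hˢ)} + 1`. -/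
noncomputable def growthRate (s : ℕ) (c ct : ℝ → ℝ → ℝ) (T : ℝ) (ρ u : ℝ → ℝ → ℝ) : ℝ≥0∞ :=
  lowNorm T ρ u + timeEssSup (Ioo 0 T) (fun t => capNorm s (ct t)) +
    timeEssSup (Ioo 0 T) (fun t => sobolevNorm s (deriv (c t))) + 1

/-! Write c₀ for the background at time 0. Let N(t) and B(t) be the square integrable primitives in
x of ρ - c₀ and c - c₀. Then N - B is a primitive of ρ - c, and the Poisson equation says that ∂ₓφ +
(N - B) depends on time only. Its contribution to u would be constant in x, and constants are not
square integrable, so it drops out. The system becomes ∂ₜN = -(∂ₓN + c₀) u, ∂ₜu + u ∂ₓu = -νu + k (N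
- B), that is, two transport equations along the same field u, coupled without loss of derivatives.
A bound for ρ - c in Hˢ ∩ Ḣ⁻¹ is a bound for N - B in Hˢ⁺¹, by `exists_prim_of_hMinusOneNorm` and
`hMinusOneNorm_le_of_prim`. The structure `RegSol` is the system for (N, u);
`IsEPSolution.exists_regSol` and `RegSol.isEPSolution` translate in both directions.

Existence is an ordinary differential equation in Lagrangian variables. If C₀' = c₀, then N + C₀ is
constant along trajectories, so the force on a particle is an explicit function of its displacement
(`lagForce`). The Picard map preserves a ball of Hˢ⁺¹ and contracts in the uniform norm, and the
ball is closed under uniform limits (`exists_lagrangian_velocity`). Inverting the particle map gives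
N and u (`exists_regSol_of_velocity`). Uniqueness is a Gronwall argument in the uniform norm along
the flow of one solution (`RegSol.unique`).

For the growth estimate each derivative of N and u of order at most s satisfies a transport equation
with a commutator source (`Transport.transported`). The L² bounds come from duality: a pairing with
a test function is carried to Lagrangian variables at the price of e^{M|t - τ|/2}, and for the order
s + 1 the last derivative is moved by integration by parts, so that no equation for it is needed
(`VFlow.l2_le`, `VFlow.l2_deriv_le`). The sources are products of derivatives of ∂ₓu and of ∂ₓw + e,
where e = 0 for w = u and e = c₀ for w = N. Both factors are bounded by M, and the
Gagliardo–Nirenberg inequality bounds the products by (M + κ) times the norm (`BddJet.l2_mul_le`,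
`Transport.l2_product_le`). The sum ∂ₓN + c₀ is the density itself, so the size of the background
never enters. Gronwall's inequality concludes (`RegSol.jetNorm_le`).

The hypotheses control Sobolev norms only at almost every time. By Hahn–Banach and Riesz, a Sobolev
bound is equivalent to |∫ f ψ⁽ʲ⁾| ≤ R‖ψ‖ for all test functions ψ (`IsWeakDeriv.of_bound`,
`HB.of_dual`). In this form it passes to pointwise limits and to time integrals, and so it holds at
every time. -/

open Filter Topology

/-! ### Absolutely continuous functions, test functions and weak derivatives. -/

/-- `f` is a primitive of the locally integrable function `g`. -/
def Prim (f g : ℝ → ℝ) : Prop :=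
  LocallyIntegrable g ∧ ∀ a b, f b - f a = ∫ x in a..b, g x

/-- Smooth compactly supported functions. -/
def IsTest (ψ : ℝ → ℝ) : Prop := ContDiff ℝ ∞ ψ ∧ HasCompactSupport ψ

theorem LocallyIntegrable.intInt {g : ℝ → ℝ} (hg : LocallyIntegrable g) (a b : ℝ) :
    IntervalIntegrable g volume a b :=
  intervalIntegrable_iff.2
    ((hg.integrableOn_isCompact isCompact_uIcc).mono_set uIoc_subset_uIcc)

theorem locallyIntegrable_of_intInt {g : ℝ → ℝ} (h : ∀ a b, IntervalIntegrable g volume a b) :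
    LocallyIntegrable g := by
  intro x
  refine ⟨Icc (x - 1) (x + 1), Icc_mem_nhds (by linarith) (by linarith), ?_⟩
  have := (intervalIntegrable_iff_integrableOn_Icc_of_le (by linarith)).1 (h (x - 1) (x + 1))
  exact this

namespace Prim

variable {f g f₁ f₂ g₁ g₂ : ℝ → ℝ}

theorem eq_add (h : Prim f g) (a x : ℝ) : f x = f a + ∫ y in a..x, g y := by
  linarith [h.2 a x]

theorem ac (h : Prim f g) (a b : ℝ) : AbsolutelyContinuousOnInterval f a b := by
  have h1 := (LocallyIntegrable.intInt h.1 a b).absolutelyContinuousOnInterval_intervalIntegral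
    (left_mem_uIcc)
  have h2 : AbsolutelyContinuousOnInterval (fun _ : ℝ => f a) a b :=
    (contDiff_const.contDiffOn).absolutelyContinuousOnInterval
  have := h2.add h1
  have hf : f = (fun _ : ℝ => f a) + fun x => ∫ v in a..x, g v := funext fun x => h.eq_add a x
  rw [hf]
  exact this

theorem continuous (h : Prim f g) : Continuous f := by
  have : f = fun x => f 0 + ∫ y in (0 : ℝ)..x, g y := by
    ext x; exact h.eq_add 0 x
  rw [this]
  exact continuous_const.add
    (intervalIntegral.continuous_primitive (fun a b => LocallyIntegrable.intInt h.1 a b) 0)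

theorem ae_hasDerivAt (h : Prim f g) : ∀ᵐ x, HasDerivAt f (g x) x := by
  filter_upwards [LocallyIntegrable.ae_hasDerivAt_integral h.1] with x hx
  rw [show f = fun x => f 0 + ∫ y in (0 : ℝ)..x, g y from funext (h.eq_add 0)]
  exact (hx 0).const_add (f 0)

theorem ae_deriv (h : Prim f g) : deriv f =ᵐ[volume] g := by
  filter_upwards [h.ae_hasDerivAt] with x hx using hx.deriv

/-- This is the passage from weak to classical derivatives: below the top order every weak
derivative has a continuous representative, and then the derivative exists at every point. -/
theorem hasDerivAt (h : Prim f g) (hg : Continuous g) (x : ℝ) : HasDerivAt f (g x) x := by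
  rw [show f = fun x => f 0 + ∫ y in (0 : ℝ)..x, g y from funext (h.eq_add 0)]
  exact (intervalIntegral.integral_hasDerivAt_right
    (LocallyIntegrable.intInt h.1 0 x) (hg.stronglyMeasurableAtFilter _ _)
    hg.continuousAt).const_add (f 0)

theorem deriv_eq (h : Prim f g) (hg : Continuous g) : deriv f = g :=
  funext fun x => (h.hasDerivAt hg x).deriv

theorem congr_right (h : Prim f g₁) (hg : g₁ =ᵐ[volume] g₂) : Prim f g₂ := by
  refine ⟨(locallyIntegrable_congr hg).1 h.1, fun a b => ?_⟩
  rw [h.2 a b]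
  exact intervalIntegral.integral_congr_ae (hg.mono fun x hx _ => hx)

theorem to_deriv (h : Prim f g) : Prim f (deriv f) := h.congr_right h.ae_deriv.symm

theorem of_ac (h : ∀ a b, AbsolutelyContinuousOnInterval f a b) : Prim f (deriv f) :=
  ⟨locallyIntegrable_of_intInt fun a b => (h a b).intervalIntegrable_deriv,
    fun a b => ((h a b).integral_deriv_eq_sub).symm⟩

theorem of_hasDerivAt (h : ∀ x, HasDerivAt f (g x) x) (hg : LocallyIntegrable g) : Prim f g :=
  ⟨hg, fun a b => (intervalIntegral.integral_eq_sub_of_hasDerivAt (fun x _ => h x)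
    (LocallyIntegrable.intInt hg a b)).symm⟩

theorem of_hasDerivAt_continuous (h : ∀ x, HasDerivAt f (g x) x) (hg : Continuous g) : Prim f g :=
  of_hasDerivAt h hg.locallyIntegrable

theorem of_contDiff {n : WithTop ℕ∞} (h : ContDiff ℝ n f) (hn : 1 ≤ n) : Prim f (deriv f) :=
  of_hasDerivAt_continuous
    (fun x => ((h.differentiable (by rintro rfl; simp at hn)) x).hasDerivAt)
    (h.continuous_deriv hn)

theorem add (h₁ : Prim f₁ g₁) (h₂ : Prim f₂ g₂) :
    Prim (fun x => f₁ x + f₂ x) (fun x => g₁ x + g₂ x) := by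
  refine ⟨h₁.1.add h₂.1, fun a b => ?_⟩
  rw [intervalIntegral.integral_add (LocallyIntegrable.intInt h₁.1 a b)
    (LocallyIntegrable.intInt h₂.1 a b), ← h₁.2, ← h₂.2]
  ring

theorem const_mul (c : ℝ) (h : Prim f g) : Prim (fun x => c * f x) (fun x => c * g x) := by
  refine ⟨h.1.smul c, fun a b => ?_⟩
  rw [intervalIntegral.integral_const_mul, ← h.2]
  ring

theorem sub (h₁ : Prim f₁ g₁) (h₂ : Prim f₂ g₂) :
    Prim (fun x => f₁ x - f₂ x) (fun x => g₁ x - g₂ x) := by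
  have := h₁.add (h₂.const_mul (-1))
  convert this using 2 <;> ring

theorem mul (h₁ : Prim f₁ g₁) (h₂ : Prim f₂ g₂) :
    Prim (fun x => f₁ x * f₂ x) (fun x => g₁ x * f₂ x + f₁ x * g₂ x) := by
  have h : Prim (fun x => f₁ x * f₂ x) _ := of_ac fun a b => (h₁.ac a b).fun_mul (h₂.ac a b)
  refine h.congr_right ?_
  filter_upwards [h₁.ae_hasDerivAt, h₂.ae_hasDerivAt] with x hx₁ hx₂
  exact (hx₁.mul hx₂).deriv

/-- Lipschitz maps preserve absolute continuity, and the Lipschitz bound is needed only on the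
compact image of each interval. The density is then found from the chain rule at almost every point.
-/
theorem comp_lipschitz {θ θ' : ℝ → ℝ} (h : Prim f g)
    (hL : ∀ a b, ∃ K, LipschitzOnWith K θ (f '' uIcc a b))
    (hθ : ∀ x, HasDerivAt θ (θ' (f x)) (f x)) :
    Prim (fun x => θ (f x)) (fun x => θ' (f x) * g x) := by
  have hP : Prim (fun x => θ (f x)) _ := of_ac fun a b => by
    obtain ⟨K, hK⟩ := hL a b
    have hac := h.ac a b
    rw [absolutelyContinuousOnInterval_iff] at hac ⊢
    intro ε hε
    -- K + 1 instead of K covers K = 0 and makes the final inequality strict.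
    obtain ⟨δ, hδ, H⟩ := hac (ε / (K + 1)) (by positivity)
    refine ⟨δ, hδ, fun E hE hEδ => ?_⟩
    have := H E hE hEδ
    have hb : ∀ i ∈ Finset.range E.1, dist (θ (f (E.2 i).1)) (θ (f (E.2 i).2)) ≤
        K * dist (f (E.2 i).1) (f (E.2 i).2) := by
      intro i hi
      exact hK.dist_le_mul _ (mem_image_of_mem _ (hE.1 i hi).1) _
        (mem_image_of_mem _ (hE.1 i hi).2)
    calc _ ≤ ∑ i ∈ Finset.range E.1, K * dist (f (E.2 i).1) (f (E.2 i).2) :=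
          Finset.sum_le_sum hb
      _ = K * ∑ i ∈ Finset.range E.1, dist (f (E.2 i).1) (f (E.2 i).2) := by
          rw [Finset.mul_sum]
      _ ≤ K * (ε / (K + 1)) := by gcongr
      _ < (K + 1) * (ε / (K + 1)) := by gcongr; linarith
      _ = ε := by field
  refine hP.congr_right ?_
  filter_upwards [h.ae_hasDerivAt] with x hx
  exact ((hθ x).comp x hx).deriv

theorem inv {κ : ℝ} (h : Prim f g) (hκ : 0 < κ) (hf : ∀ x, κ ≤ f x) :
    Prim (fun x => (f x)⁻¹) (fun x => -(f x ^ 2)⁻¹ * g x) := by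
  have hpos : ∀ x, 0 < f x := fun x => hκ.trans_le (hf x)
  refine h.comp_lipschitz (θ := fun y => y⁻¹) (θ' := fun y => -(y ^ 2)⁻¹) (fun a b => ?_)
    fun x => hasDerivAt_inv (hpos x).ne'
  refine ⟨(κ⁻¹ * κ⁻¹).toNNReal, LipschitzOnWith.of_dist_le_mul ?_⟩
  rintro _ ⟨x, _, rfl⟩ _ ⟨y, _, rfl⟩
  rw [Real.coe_toNNReal _ (by positivity), Real.dist_eq, Real.dist_eq,
    inv_sub_inv (hpos x).ne' (hpos y).ne', abs_div, abs_of_pos (mul_pos (hpos x) (hpos y)),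
    abs_sub_comm, div_eq_inv_mul, mul_inv]
  have h1 := inv_anti₀ hκ (hf x)
  have h2 := inv_anti₀ hκ (hf y)
  have h3 := inv_pos.2 (hpos x)
  have h4 := inv_pos.2 (hpos y)
  gcongr

/-- Composition with an increasing diffeomorphism. -/
theorem comp_diffeo {Φ Φ' : ℝ → ℝ} (h : Prim f g) (hΦ : ∀ x, HasDerivAt Φ (Φ' x) x)
    (hpos : ∀ x, 0 < Φ' x) :
    Prim (fun x => f (Φ x)) (fun x => g (Φ x) * Φ' x) := by
  have hmono : StrictMono Φ := strictMono_of_deriv_pos fun x => by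
    rw [(hΦ x).deriv]; exact hpos x
  have hcont : Continuous Φ := continuous_iff_continuousAt.2 fun x => (hΦ x).continuousAt
  have himg : ∀ a b, a ≤ b → Φ '' Icc a b = Icc (Φ a) (Φ b) := fun a b hab =>
    le_antisymm (by
      rintro _ ⟨x, hx, rfl⟩
      exact ⟨hmono.monotone hx.1, hmono.monotone hx.2⟩)
      (intermediate_value_Icc hab hcont.continuousOn)
  have hint : ∀ a b, a ≤ b → IntegrableOn (fun x => g (Φ x) * Φ' x) (Icc a b) := by
    intro a b hab
    have := (integrableOn_image_iff_integrableOn_abs_deriv_smul (measurableSet_Icc (a := a) (b := b))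
      (fun x _ => (hΦ x).hasDerivWithinAt) hmono.injective.injOn g).1
      (by rw [himg a b hab]; exact h.1.integrableOn_isCompact isCompact_Icc)
    refine this.congr_fun (fun x _ => ?_) measurableSet_Icc
    simp [abs_of_pos (hpos x), mul_comm]
  have hle : ∀ a b, a ≤ b → f (Φ b) - f (Φ a) = ∫ x in a..b, g (Φ x) * Φ' x := by
    intro a b hab
    rw [h.2, intervalIntegral.integral_of_le hab, intervalIntegral.integral_of_le
      (hmono.monotone hab), ← integral_Icc_eq_integral_Ioc, ← integral_Icc_eq_integral_Ioc,
      ← himg a b hab, integral_image_eq_integral_abs_deriv_smul measurableSet_Icc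
      (fun x _ => (hΦ x).hasDerivWithinAt) hmono.injective.injOn]
    refine setIntegral_congr_fun measurableSet_Icc fun x _ => ?_
    simp [abs_of_pos (hpos x), mul_comm]
  refine ⟨?_, fun a b => ?_⟩
  · refine locallyIntegrable_of_intInt fun a b => ?_
    rcases le_total a b with hab | hab
    · exact (intervalIntegrable_iff_integrableOn_Icc_of_le hab).2 (hint a b hab)
    · exact ((intervalIntegrable_iff_integrableOn_Icc_of_le hab).2 (hint b a hab)).symm
  · rcases le_total a b with hab | hab
    · exact hle a b hab
    · rw [intervalIntegral.integral_symm, ← hle b a hab]; ring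

/-- The integral of the derivative of a compactly supported function vanishes. -/
theorem integral_eq_zero (h : Prim f g) (R : ℝ) (hf : ∀ x, R < |x| → f x = 0)
    (hg : ∀ x, R < |x| → g x = 0) : ∫ x, g x = 0 := by
  set S := |R| + 1 with hS
  have hR : R < S := by have := le_abs_self R; linarith
  have hS0 : 0 < S := by have := abs_nonneg R; linarith
  rw [← intervalIntegral.integral_eq_integral_of_support_subset (a := -S) (b := S), ← h.2,
    hf S (by rw [abs_of_pos hS0]; exact hR), hf (-S) (by rw [abs_neg, abs_of_pos hS0]; exact hR)]
  · simp
  · intro x hx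
    by_contra hcon
    apply hx
    apply hg
    by_contra hle
    have := abs_le.1 (not_lt.1 hle)
    exact hcon ⟨by linarith, by linarith⟩

theorem integral_mul_deriv (h : Prim f g) {ψ : ℝ → ℝ} (hψ : ContDiff ℝ 1 ψ)
    (hc : HasCompactSupport ψ) : ∫ x, f x * deriv ψ x = -∫ x, g x * ψ x := by
  have hP := h.mul (of_contDiff hψ le_rfl)
  obtain ⟨R, hR⟩ := hc.isCompact.isBounded.subset_closedBall 0
  have h0 : ∀ x, R < |x| → x ∉ tsupport ψ := fun x hx hx' => by
    have := hR hx'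
    simp at this; linarith
  have h1 : ∀ x, R < |x| → ψ x = 0 := fun x hx => image_eq_zero_of_notMem_tsupport (h0 x hx)
  have h2 : ∀ x, R < |x| → deriv ψ x = 0 := fun x hx =>
    image_eq_zero_of_notMem_tsupport fun h => h0 x hx (tsupport_deriv_subset (𝕜 := ℝ) h)
  have := hP.integral_eq_zero R (fun x hx => by simp [h1 x hx])
    (fun x hx => by simp [h1 x hx, h2 x hx])
  have hi1 : Integrable (fun x => g x * ψ x) :=
    h.1.integrable_smul_right_of_hasCompactSupport hψ.continuous hc
  have hi2 : Integrable (fun x => f x * deriv ψ x) :=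
    (h.continuous.mul (hψ.continuous_deriv le_rfl)).integrable_of_hasCompactSupport
      (hc.deriv.mul_left)
  rw [integral_add hi1 hi2] at this
  linarith

end Prim

namespace IsTest

variable {ψ : ℝ → ℝ}

theorem deriv (h : IsTest ψ) : IsTest (deriv ψ) :=
  ⟨h.1.deriv' , h.2.deriv⟩

theorem iteratedDeriv (h : IsTest ψ) (j : ℕ) : IsTest (iteratedDeriv j ψ) := by
  induction j with
  | zero => simpa using h
  | succ j ih => rw [iteratedDeriv_succ]; exact ih.deriv

theorem integrable (h : IsTest ψ) : Integrable ψ :=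
  h.1.continuous.integrable_of_hasCompactSupport h.2

theorem memLp (h : IsTest ψ) (p : ℝ≥0∞) : MemLp ψ p volume :=
  h.1.continuous.memLp_of_hasCompactSupport h.2

theorem mul_integrable (h : IsTest ψ) {f : ℝ → ℝ} (hf : LocallyIntegrable f) :
    Integrable (fun x => f x * ψ x) :=
  hf.integrable_smul_right_of_hasCompactSupport h.1.continuous h.2

theorem exists_radius (h : IsTest ψ) : ∃ R, 0 < R ∧ ∀ x, R < |x| → ψ x = 0 := by
  obtain ⟨R, hR⟩ := h.2.isCompact.isBounded.subset_closedBall 0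
  refine ⟨max R 1, by positivity, fun x hx => image_eq_zero_of_notMem_tsupport fun hx' => ?_⟩
  have := hR hx'
  simp at this
  have := le_max_left R 1
  linarith

end IsTest

theorem exists_test_integral_one : ∃ ψ, IsTest ψ ∧ ∫ x, ψ x = 1 := by
  let b : ContDiffBump (0 : ℝ) := ⟨1, 2, by norm_num, by norm_num⟩
  exact ⟨b.normed volume, ⟨b.contDiff_normed, b.hasCompactSupport_normed⟩, b.integral_normed⟩

/-- A test function of vanishing integral is the derivative of a test function. -/
theorem IsTest.exists_primitive {ψ : ℝ → ℝ} (h : IsTest ψ) (h0 : ∫ x, ψ x = 0) :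
    ∃ χ, IsTest χ ∧ _root_.deriv χ = ψ := by
  obtain ⟨R, hR0, hR⟩ := h.exists_radius
  have hd : ∀ x, HasDerivAt (fun x => ∫ y in (-R - 1)..x, ψ y) (ψ x) x := fun x =>
    intervalIntegral.integral_hasDerivAt_right (h.1.continuous.intervalIntegrable _ _)
      (h.1.continuous.stronglyMeasurableAtFilter _ _) h.1.continuous.continuousAt
  have hder : _root_.deriv (fun x => ∫ y in (-R - 1)..x, ψ y) = ψ := funext fun x => (hd x).deriv
  refine ⟨fun x => ∫ y in (-R - 1)..x, ψ y, ⟨?_, ?_⟩, hder⟩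
  · rw [contDiff_infty_iff_deriv, hder]
    exact ⟨fun x => (hd x).differentiableAt, h.1⟩
  · refine HasCompactSupport.intro (isCompact_Icc (a := -R - 1) (b := R + 1)) fun x hx => ?_
    rcases lt_or_ge x (-R - 1) with hlt | hge
    · apply intervalIntegral.integral_zero_ae
      refine Eventually.of_forall fun y hy => hR y ?_
      rw [uIoc_of_ge hlt.le] at hy
      rw [abs_of_neg (by linarith [hy.2])]
      linarith [hy.2]
    · have hx' : R + 1 < x := by
        by_contra hcon
        exact hx ⟨hge, not_lt.1 hcon⟩
      show ∫ y in (-R - 1)..x, ψ y = 0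
      rw [intervalIntegral.integral_eq_integral_of_support_subset, h0]
      intro y hy
      by_contra hcon
      apply hy
      apply hR
      by_contra hle
      have := abs_le.1 (not_lt.1 hle)
      exact hcon ⟨by linarith, by linarith⟩

/-- The du Bois-Reymond lemma. -/
theorem ae_const_of_integral_mul_deriv {f : ℝ → ℝ} (hf : LocallyIntegrable f)
    (h : ∀ ψ, IsTest ψ → ∫ x, f x * deriv ψ x = 0) : ∃ c : ℝ, f =ᵐ[volume] fun _ => c := by
  obtain ⟨η, hη, hη1⟩ := exists_test_integral_one
  refine ⟨∫ x, f x * η x, ae_eq_of_integral_contDiff_smul_eq hf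
    (continuous_const.locallyIntegrable) fun ψ h1 h2 => ?_⟩
  have hψ : IsTest ψ := ⟨h1, h2⟩
  -- The correction makes the integral zero, so this is the derivative of a test function and `f`
  -- annihilates it. What remains identifies the constant as ∫ f η.
  have hχ : IsTest (fun x => ψ x - (∫ y, ψ y) * η x) :=
    ⟨h1.sub (contDiff_const.mul hη.1), h2.sub (hη.2.mul_left)⟩
  obtain ⟨χ, hχt, hd⟩ := hχ.exists_primitive (by
    rw [integral_sub hψ.integrable (hη.integrable.const_mul _), integral_const_mul, hη1]; ring)
  have := h χ hχt
  rw [hd] at this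
  have h3 : ∀ x, f x * (ψ x - (∫ y, ψ y) * η x) = f x * ψ x - (∫ y, ψ y) * (f x * η x) :=
    fun x => by ring
  simp_rw [h3] at this
  rw [integral_sub (hψ.mul_integrable hf) ((hη.mul_integrable hf).const_mul _),
    integral_const_mul] at this
  simp only [smul_eq_mul]
  rw [integral_mul_const]
  simp_rw [mul_comm (ψ _)]
  linarith

/-- The difference of `f` and an integral of `g` has vanishing weak derivative, hence is constant
almost everywhere by the du Bois-Reymond lemma. -/
theorem exists_prim_of_weak {f g : ℝ → ℝ} (hf : LocallyIntegrable f) (hg : LocallyIntegrable g)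
    (h : ∀ ψ, IsTest ψ → ∫ x, f x * deriv ψ x = -∫ x, g x * ψ x) :
    ∃ F, f =ᵐ[volume] F ∧ Prim F g := by
  have hF : Prim (fun x => ∫ y in (0 : ℝ)..x, g y) g := ⟨hg, fun a b => by
    rw [intervalIntegral.integral_interval_sub_left] <;> exact LocallyIntegrable.intInt hg _ _⟩
  obtain ⟨c, hc⟩ := ae_const_of_integral_mul_deriv
    (f := fun x => f x - ∫ y in (0 : ℝ)..x, g y) (hf.sub hF.continuous.locallyIntegrable)
    fun ψ hψ => by
      have h3 : ∀ x, (f x - ∫ y in (0 : ℝ)..x, g y) * deriv ψ x =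
        f x * deriv ψ x - (∫ y in (0 : ℝ)..x, g y) * deriv ψ x := fun x => by ring
      simp_rw [h3]
      rw [integral_sub (hψ.deriv.mul_integrable hf)
        (hψ.deriv.mul_integrable hF.continuous.locallyIntegrable), h ψ hψ,
        hF.integral_mul_deriv (hψ.1.of_le (by exact_mod_cast le_top)) hψ.2]
      ring
  refine ⟨fun x => c + ∫ y in (0 : ℝ)..x, g y, ?_, hg, fun a b => ?_⟩
  · filter_upwards [hc] with x hx
    linarith
  · rw [← hF.2 a b]; ring

/-! ### Duality in L² and the dual description of weak derivatives. -/

/-- The real-valued `L²` norm. -/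
noncomputable def l2 (f : ℝ → ℝ) : ℝ := (eLpNorm f 2 volume).toReal

theorem l2_nonneg (f : ℝ → ℝ) : 0 ≤ l2 f := ENNReal.toReal_nonneg

theorem l2_le_of_le {f : ℝ → ℝ} {B : ℝ} (hB : 0 ≤ B)
    (h : eLpNorm f 2 volume ≤ ENNReal.ofReal B) : l2 f ≤ B := by
  have := ENNReal.toReal_mono ENNReal.ofReal_ne_top h
  rwa [ENNReal.toReal_ofReal hB] at this

theorem MeasureTheory.MemLp.ofReal_l2 {f : ℝ → ℝ} (h : MemLp f 2 volume) :
    ENNReal.ofReal (l2 f) = eLpNorm f 2 volume := ENNReal.ofReal_toReal h.2.ne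

theorem MeasureTheory.MemLp.mul_integrable {f g : ℝ → ℝ} (hf : MemLp f 2 volume)
    (hg : MemLp g 2 volume) :
    Integrable (fun x => f x * g x) := hf.integrable_mul hg

theorem abs_integral_mul_le {f g : ℝ → ℝ} (hf : MemLp f 2 volume) (hg : MemLp g 2 volume) :
    |∫ x, f x * g x| ≤ l2 f * l2 g := by
  have h1 := abs_real_inner_le_norm (hf.toLp f) (hg.toLp g)
  rw [L2.inner_def, Lp.norm_toLp, Lp.norm_toLp] at h1
  have h2 : ∫ a, inner ℝ ((hf.toLp f) a) ((hg.toLp g) a) = ∫ x, f x * g x := by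
    refine integral_congr_ae ?_
    filter_upwards [hf.coeFn_toLp, hg.coeFn_toLp] with x h1 h2
    rw [h1, h2]; simp [mul_comm]
  rwa [h2] at h1

theorem integral_abs_mul_le {f g : ℝ → ℝ} (hf : MemLp f 2 volume) (hg : MemLp g 2 volume) :
    ∫ x, |f x * g x| ≤ l2 f * l2 g := by
  have h := abs_integral_mul_le hf.norm hg.norm
  simp only [Real.norm_eq_abs, ← abs_mul] at h
  have h1 : l2 (fun x => |f x|) = l2 f := by
    unfold l2; exact congrArg _ (eLpNorm_norm f)
  have h2 : l2 (fun x => |g x|) = l2 g := by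
    unfold l2; exact congrArg _ (eLpNorm_norm g)
  rw [h1, h2] at h
  exact (le_abs_self _).trans h

/-- A functional dominated by the `L²` norm of a linear image is represented by an `L²` function. -/
theorem exists_l2_representation {V : Type*} [AddCommGroup V] [Module ℝ V]
    (p : V →ₗ[ℝ] Lp ℝ 2 (volume : Measure ℝ)) (ℓ : V →ₗ[ℝ] ℝ) {B : ℝ} (hB : 0 ≤ B)
    (h : ∀ v, |ℓ v| ≤ B * ‖p v‖) :
    ∃ g : ℝ → ℝ, MemLp g 2 volume ∧ eLpNorm g 2 volume ≤ ENNReal.ofReal B ∧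
      ∀ v, ℓ v = ∫ x, g x * p v x := by
  -- A linear section of `p` turns ℓ into a functional on the range of `p`. The bound forces ℓ to
  -- vanish on the kernel of `p`, so the choice of preimage is irrelevant. Hahn–Banach and Riesz
  -- then produce the representing function.
  obtain ⟨r, hr⟩ := p.rangeRestrict.exists_rightInverse_of_surjective
    (LinearMap.range_eq_top.2 p.surjective_rangeRestrict)
  have hr' : ∀ y, p (r y) = y := fun y => by
    have := LinearMap.congr_fun hr y
    exact congrArg Subtype.val this
  let L : LinearMap.range p →L[ℝ] ℝ := (ℓ.comp r).mkContinuous B fun y => by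
    have := h (r y)
    rw [hr'] at this
    exact this
  obtain ⟨G, hG, hGn⟩ := exists_extension_norm_eq _ L
  have hL : ‖L‖ ≤ B := LinearMap.mkContinuous_norm_le _ hB _
  set g := (InnerProductSpace.toDual ℝ (Lp ℝ 2 (volume : Measure ℝ))).symm G
  have hgn : ‖g‖ ≤ B := by
    rw [LinearIsometryEquiv.norm_map, hGn]; exact hL
  refine ⟨g, Lp.memLp g, ?_, fun v => ?_⟩
  · rw [← ENNReal.ofReal_toReal (Lp.eLpNorm_ne_top g)]
    exact ENNReal.ofReal_le_ofReal hgn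
  · have h1 : ℓ v = ℓ (r ⟨p v, LinearMap.mem_range_self p v⟩) := by
      have := h (v - r ⟨p v, LinearMap.mem_range_self p v⟩)
      rw [map_sub, map_sub, hr', sub_self, norm_zero, mul_zero] at this
      linarith [abs_nonpos_iff.1 this]
    have h2 : G (p v) = ℓ (r ⟨p v, LinearMap.mem_range_self p v⟩) :=
      hG ⟨p v, LinearMap.mem_range_self p v⟩
    have h3 : inner ℝ g (p v) = G (p v) := InnerProductSpace.toDual_symm_apply
    rw [h1, ← h2, ← h3, L2.inner_def]
    refine integral_congr_ae (Eventually.of_forall fun x => ?_)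
    simp [mul_comm]

/-- The space of test functions. -/
def testSpace : Submodule ℝ (ℝ → ℝ) where
  carrier := {ψ | IsTest ψ}
  add_mem' h₁ h₂ := ⟨h₁.1.add h₂.1, h₁.2.add h₂.2⟩
  zero_mem' := ⟨contDiff_const, HasCompactSupport.zero⟩
  smul_mem' c _ h := ⟨contDiff_const.smul h.1, h.2.smul_left (f := fun _ => c)⟩

theorem IsTest.contDiffAt {ψ : ℝ → ℝ} (h : IsTest ψ) (n : ℕ) (x : ℝ) : ContDiffAt ℝ n ψ x :=
  (h.1.of_le (by exact_mod_cast le_top)).contDiffAt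

/-- A distribution dominated by the `L²` norm of a derivative of the test function. -/
theorem exists_l2_of_test_bound (i : ℕ) {B : ℝ} (hB : 0 ≤ B)
    (m : (ℝ → ℝ) → ℝ)
    (hadd : ∀ ψ χ, IsTest ψ → IsTest χ → m (ψ + χ) = m ψ + m χ)
    (hsmul : ∀ (c : ℝ) ψ, IsTest ψ → m (c • ψ) = c * m ψ)
    (h : ∀ ψ, IsTest ψ → |m ψ| ≤ B * l2 (iteratedDeriv i ψ)) :
    ∃ g : ℝ → ℝ, MemLp g 2 volume ∧ eLpNorm g 2 volume ≤ ENNReal.ofReal B ∧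
      ∀ ψ, IsTest ψ → m ψ = ∫ x, g x * iteratedDeriv i ψ x := by
  let p : testSpace →ₗ[ℝ] Lp ℝ 2 (volume : Measure ℝ) :=
    { toFun := fun ψ => ((IsTest.iteratedDeriv ψ.2 i).memLp 2).toLp (iteratedDeriv i ψ.1)
      map_add' := fun ψ χ => by
        rw [← MemLp.toLp_add]
        congr 1
        ext x
        exact iteratedDeriv_add (IsTest.contDiffAt ψ.2 i x) (IsTest.contDiffAt χ.2 i x)
      map_smul' := fun c ψ => by
        rw [RingHom.id_apply, ← MemLp.toLp_const_smul]
        congr 1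
        ext x
        exact iteratedDeriv_const_smul (IsTest.contDiffAt ψ.2 i x) c }
  let L : testSpace →ₗ[ℝ] ℝ :=
    { toFun := fun ψ => m ψ.1
      map_add' := fun ψ χ => hadd _ _ ψ.2 χ.2
      map_smul' := fun c ψ => hsmul c _ ψ.2 }
  obtain ⟨g, h1, h2, h3⟩ := exists_l2_representation p L hB fun ψ => by
    have := h ψ.1 ψ.2
    show |m ψ.1| ≤ B * ‖((IsTest.iteratedDeriv ψ.2 i).memLp 2).toLp (iteratedDeriv i ψ.1)‖
    rwa [Lp.norm_toLp]
  refine ⟨g, h1, h2, fun ψ hψ => (h3 ⟨ψ, hψ⟩).trans (integral_congr_ae ?_)⟩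
  filter_upwards [((IsTest.iteratedDeriv hψ i).memLp 2).coeFn_toLp] with x hx
  show g x * ((IsTest.iteratedDeriv hψ i).memLp 2).toLp (iteratedDeriv i ψ) x = _
  rw [hx]

theorem integral_mul_test_add {f : ℝ → ℝ} (hf : LocallyIntegrable f) (j : ℕ) {ψ χ : ℝ → ℝ}
    (hψ : IsTest ψ) (hχ : IsTest χ) :
    ∫ x, f x * iteratedDeriv j (ψ + χ) x =
      (∫ x, f x * iteratedDeriv j ψ x) + ∫ x, f x * iteratedDeriv j χ x := by
  rw [← integral_add ((hψ.iteratedDeriv j).mul_integrable hf)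
    ((hχ.iteratedDeriv j).mul_integrable hf)]
  refine integral_congr_ae (Eventually.of_forall fun x => ?_)
  simp only
  rw [iteratedDeriv_add (hψ.contDiffAt j x) (hχ.contDiffAt j x)]
  ring

theorem integral_mul_test_smul {f : ℝ → ℝ} (j : ℕ) (c : ℝ) {ψ : ℝ → ℝ}
    (hψ : IsTest ψ) :
    ∫ x, f x * iteratedDeriv j (c • ψ) x = c * ∫ x, f x * iteratedDeriv j ψ x := by
  rw [← integral_const_mul]
  refine integral_congr_ae (Eventually.of_forall fun x => ?_)
  simp only
  rw [iteratedDeriv_const_smul (hψ.contDiffAt j x) c, smul_eq_mul]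
  ring

/-- The distribution (-1)ʲ ∫ f ψ⁽ʲ⁾ is bounded in the L² norm of ψ, hence is represented by an L²
function. The converse is `IsWeakDeriv.bound`; together they replace Sobolev norms by estimates that
are linear in `f`. -/
theorem IsWeakDeriv.of_bound {f : ℝ → ℝ} (hf : LocallyIntegrable f) (j : ℕ) {B : ℝ} (hB : 0 ≤ B)
    (h : ∀ ψ, IsTest ψ → |∫ x, f x * iteratedDeriv j ψ x| ≤ B * l2 ψ) :
    ∃ g, IsWeakDeriv j f g ∧ MemLp g 2 volume ∧ eLpNorm g 2 volume ≤ ENNReal.ofReal B := by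
  obtain ⟨g, h1, h2, h3⟩ := exists_l2_of_test_bound 0 hB
    (fun ψ => (-1) ^ j * ∫ x, f x * iteratedDeriv j ψ x)
    (fun ψ χ hψ hχ => by rw [integral_mul_test_add hf j hψ hχ]; ring)
    (fun c ψ hψ => by rw [integral_mul_test_smul j c hψ]; ring)
    (fun ψ hψ => by
      rw [abs_mul, abs_pow, abs_neg, abs_one, one_pow, one_mul, iteratedDeriv_zero]
      exact h ψ hψ)
  refine ⟨g, ⟨hf, h1.locallyIntegrable (by norm_num), fun ψ hψ1 hψ2 => ?_⟩, h1, h2⟩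
  have := h3 ψ ⟨hψ1, hψ2⟩
  rw [iteratedDeriv_zero] at this
  rw [← this, ← mul_assoc, ← mul_pow]; simp

theorem IsWeakDeriv.bound {f g : ℝ → ℝ} {j : ℕ} (h : IsWeakDeriv j f g) {B : ℝ} (hB : 0 ≤ B)
    (hg : eLpNorm g 2 volume ≤ ENNReal.ofReal B) {ψ : ℝ → ℝ} (hψ : IsTest ψ) :
    |∫ x, f x * iteratedDeriv j ψ x| ≤ B * l2 ψ := by
  have hm : MemLp g 2 volume := ⟨h.2.1.aestronglyMeasurable, hg.trans_lt ENNReal.ofReal_lt_top⟩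
  rw [h.2.2 ψ hψ.1 hψ.2, abs_mul, abs_pow, abs_neg, abs_one, one_pow, one_mul]
  exact (abs_integral_mul_le hm (hψ.memLp 2)).trans
    (mul_le_mul_of_nonneg_right (l2_le_of_le hB hg) (l2_nonneg _))

theorem IsWeakDeriv.unique {f g₁ g₂ : ℝ → ℝ} {j : ℕ} (h₁ : IsWeakDeriv j f g₁)
    (h₂ : IsWeakDeriv j f g₂) : g₁ =ᵐ[volume] g₂ := by
  refine ae_eq_of_integral_contDiff_smul_eq h₁.2.1 h₂.2.1 fun ψ hψ1 hψ2 => ?_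
  have := (h₁.2.2 ψ hψ1 hψ2).symm.trans (h₂.2.2 ψ hψ1 hψ2)
  simp only [smul_eq_mul, mul_comm (ψ _)]
  exact mul_left_cancel₀ (by positivity) (show (-1 : ℝ) ^ j * _ = _ from this)

theorem IsWeakDeriv.norm_eq {f g : ℝ → ℝ} {j : ℕ} (h : IsWeakDeriv j f g) :
    weakDerivNorm j f = eLpNorm g 2 volume := by
  refine le_antisymm (iInf₂_le g h) (le_iInf₂ fun g' hg' => ?_)
  rw [eLpNorm_congr_ae (h.unique hg')]

theorem exists_isWeakDeriv {f : ℝ → ℝ} {j : ℕ} (h : weakDerivNorm j f < ⊤) :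
    ∃ g, IsWeakDeriv j f g := by
  by_contra hcon
  push Not at hcon
  have : weakDerivNorm j f = ⊤ := by
    unfold weakDerivNorm
    simp [hcon]
  exact h.ne this

theorem IsWeakDeriv.congr {f₁ f₂ g : ℝ → ℝ} {j : ℕ} (h : IsWeakDeriv j f₁ g)
    (hf : f₁ =ᵐ[volume] f₂) : IsWeakDeriv j f₂ g :=
  ⟨(locallyIntegrable_congr hf).1 h.1, h.2.1, fun ψ h1 h2 => by
    rw [← h.2.2 ψ h1 h2]
    exact integral_congr_ae (hf.mono fun x hx => by simp only [hx])⟩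

theorem weakDerivNorm_congr {f₁ f₂ : ℝ → ℝ} (j : ℕ) (hf : f₁ =ᵐ[volume] f₂) :
    weakDerivNorm j f₁ = weakDerivNorm j f₂ := by
  unfold weakDerivNorm
  congr! 3 with g
  exact ⟨fun h => h.congr hf, fun h => h.congr hf.symm⟩

theorem sobolevNorm_congr {f₁ f₂ : ℝ → ℝ} (m : ℕ) (hf : f₁ =ᵐ[volume] f₂) :
    sobolevNorm m f₁ = sobolevNorm m f₂ := by
  simp only [sobolevNorm, weakDerivNorm_congr _ hf]

theorem weakDerivNorm_le_sobolevNorm {f : ℝ → ℝ} {m j : ℕ} (hj : j ≤ m) :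
    weakDerivNorm j f ≤ sobolevNorm m f := by
  have h1 : weakDerivNorm j f = (weakDerivNorm j f ^ 2) ^ (1 / 2 : ℝ) := by
    rw [← ENNReal.rpow_natCast, ← ENNReal.rpow_mul]; norm_num
  rw [h1]
  refine ENNReal.rpow_le_rpow ?_ (by norm_num)
  exact Finset.single_le_sum (f := fun j => weakDerivNorm j f ^ 2) (fun _ _ => zero_le)
    (Finset.mem_range.2 (by omega))

theorem sobolevNorm_le_sum (m : ℕ) (f : ℝ → ℝ) :
    sobolevNorm m f ≤ ∑ j ∈ Finset.range (m + 1), weakDerivNorm j f := by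
  unfold sobolevNorm
  rw [one_div, ENNReal.rpow_inv_le_iff (by norm_num)]
  have : (2 : ℝ) = ((2 : ℕ) : ℝ) := by norm_num
  rw [this, ENNReal.rpow_natCast]
  exact Finset.sum_sq_le_sq_sum_of_nonneg (fun _ _ => zero_le)

theorem isWeakDeriv_zero {f : ℝ → ℝ} (hf : LocallyIntegrable f) : IsWeakDeriv 0 f f :=
  ⟨hf, hf, fun ψ _ _ => by simp⟩

/-- Testing the first relation with ψ' and the second with ψ shows that `g₂` is the first weak
derivative of `g₁`. -/
theorem IsWeakDeriv.succ_of {f g₁ g₂ : ℝ → ℝ} {j : ℕ} (h₁ : IsWeakDeriv j f g₁)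
    (h₂ : IsWeakDeriv (j + 1) f g₂) : ∃ F, g₁ =ᵐ[volume] F ∧ Prim F g₂ := by
  refine exists_prim_of_weak h₁.2.1 h₂.2.1 fun ψ hψ => ?_
  have e1 := h₁.2.2 (deriv ψ) hψ.deriv.1 hψ.deriv.2
  have e2 := h₂.2.2 ψ hψ.1 hψ.2
  rw [iteratedDeriv_succ', e1, pow_succ, mul_assoc] at e2
  have := mul_left_cancel₀ (by positivity) e2
  linarith

/-- Integration by parts `j` times against a test function. -/
theorem isWeakDeriv_of_prim {f : ℝ → ℝ} (hf : LocallyIntegrable f) (j : ℕ)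
    (h : ∀ i < j, Prim (iteratedDeriv i f) (iteratedDeriv (i + 1) f)) :
    IsWeakDeriv j f (iteratedDeriv j f) := by
  induction j with
  | zero => simpa using isWeakDeriv_zero hf
  | succ j ih =>
    have ih' := ih fun i hi => h i (by omega)
    have hP := h j (by omega)
    refine ⟨hf, hP.1, fun ψ h1 h2 => ?_⟩
    have hψ : IsTest ψ := ⟨h1, h2⟩
    rw [iteratedDeriv_succ', ih'.2.2 _ hψ.deriv.1 hψ.deriv.2,
      hP.integral_mul_deriv (hψ.1.of_le (by exact_mod_cast le_top)) hψ.2]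
    ring

/-- A chain of primitives consists of iterated derivatives. -/
theorem iteratedDeriv_of_chain {m : ℕ} {G : ℕ → ℝ → ℝ} (h : ∀ j < m, Prim (G j) (G (j + 1))) :
    (∀ j < m, iteratedDeriv j (G 0) = G j) ∧ iteratedDeriv m (G 0) =ᵐ[volume] G m := by
  have h1 : ∀ j < m, iteratedDeriv j (G 0) = G j := by
    intro j
    induction j with
    | zero => intro _; simp
    | succ j ih =>
      intro hj
      rw [iteratedDeriv_succ, ih (by omega)]
      exact (h j (by omega)).deriv_eq (h (j + 1) hj).continuous
  refine ⟨h1, ?_⟩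
  rcases m with _ | m
  · simp
  · rw [iteratedDeriv_succ, h1 m (by omega)]
    exact (h m (by omega)).ae_deriv

theorem prim_of_chain {m : ℕ} {G : ℕ → ℝ → ℝ} (h : ∀ j < m, Prim (G j) (G (j + 1))) :
    ∀ j < m, Prim (iteratedDeriv j (G 0)) (iteratedDeriv (j + 1) (G 0)) := by
  obtain ⟨h1, h2⟩ := iteratedDeriv_of_chain h
  intro j hj
  rw [h1 j hj, iteratedDeriv_succ, h1 j hj]
  exact (h j hj).to_deriv

/-- A continuous function with weak derivatives up to order `m` is classically differentiable. -/
theorem chain_of_isWeakDeriv {f : ℝ → ℝ} (hf : Continuous f) {m : ℕ} {g : ℕ → ℝ → ℝ}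
    (h : ∀ j, 1 ≤ j → j ≤ m → IsWeakDeriv j f (g j)) :
    (∀ j < m, Prim (iteratedDeriv j f) (iteratedDeriv (j + 1) f)) ∧
      ∀ j, 1 ≤ j → j ≤ m → iteratedDeriv j f =ᵐ[volume] g j := by
  -- The given derivatives start at order 1; at order 0 the function itself is put in.
  set g' : ℕ → ℝ → ℝ := fun j => if j = 0 then f else g j with hg'
  have hw : ∀ j ≤ m, IsWeakDeriv j f (g' j) := by
    intro j hj
    rcases Nat.eq_zero_or_pos j with rfl | hpos
    · simpa [hg'] using isWeakDeriv_zero hf.locallyIntegrable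
    · have : g' j = g j := by simp [hg', hpos.ne']
      rw [this]; exact h j hpos hj
  have hex : ∀ j, ∃ F, j < m → g' j =ᵐ[volume] F ∧ Prim F (g' (j + 1)) := by
    intro j
    by_cases hj : j < m
    · obtain ⟨F, hF⟩ := (hw j hj.le).succ_of (hw (j + 1) hj)
      exact ⟨F, fun _ => hF⟩
    · exact ⟨0, fun h => absurd h hj⟩
  choose F hF using hex
  -- Below order `m` each weak derivative is replaced by its absolutely continuous representative;
  -- at order `m` only the class modulo null sets is available.
  set G : ℕ → ℝ → ℝ := fun j => if j < m then F j else g' j with hG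
  have hgG : ∀ j ≤ m, g' j =ᵐ[volume] G j := by
    intro j hj
    by_cases hj' : j < m
    · simpa [hG, hj'] using (hF j hj').1
    · simp [hG, hj']
  have hch : ∀ j < m, Prim (G j) (G (j + 1)) := by
    intro j hj
    have : G j = F j := by simp [hG, hj]
    rw [this]
    exact (hF j hj).2.congr_right (hgG (j + 1) hj)
  rcases Nat.eq_zero_or_pos m with rfl | hm
  · exact ⟨fun j hj => absurd hj (Nat.not_lt_zero j), fun j h1 h2 => by omega⟩
  have hG0 : G 0 = f := by
    have := hgG 0 hm.le
    have h3 : g' 0 = f := by simp [hg']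
    rw [h3] at this
    exact ((hf.ae_eq_iff_eq volume (hch 0 hm).continuous).1 this).symm
  have hP := prim_of_chain hch
  obtain ⟨h1, h2⟩ := iteratedDeriv_of_chain hch
  rw [hG0] at hP h1 h2
  refine ⟨hP, fun j hj1 hjm => ?_⟩
  have h3 : g' j = g j := by
    have : j ≠ 0 := by omega
    simp [hg', this]
  rcases hjm.lt_or_eq with hlt | rfl
  · rw [h1 j hlt, ← h3]; exact (hgG j hjm).symm
  · rw [← h3]; exact h2.trans (hgG j le_rfl).symm

/-! ### Sobolev bounds and the one-dimensional Sobolev embedding. -/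

/-- `f` belongs to `Hᵐ(ℝ)`, and the `L²` norms of its derivatives up to order `m` are at most
`R`. -/
structure HB (m : ℕ) (R : ℝ) (f : ℝ → ℝ) : Prop where
  prim : ∀ j < m, Prim (iteratedDeriv j f) (iteratedDeriv (j + 1) f)
  meas : ∀ j ≤ m, AEStronglyMeasurable (iteratedDeriv j f) volume
  le : ∀ j ≤ m, eLpNorm (iteratedDeriv j f) 2 volume ≤ ENNReal.ofReal R

namespace HB

variable {m : ℕ} {R : ℝ} {f : ℝ → ℝ}

theorem memLp (h : HB m R f) {j : ℕ} (hj : j ≤ m) : MemLp (iteratedDeriv j f) 2 volume :=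
  ⟨h.meas j hj, (h.le j hj).trans_lt ENNReal.ofReal_lt_top⟩

theorem memLp' (h : HB m R f) : MemLp f 2 volume := by
  simpa using h.memLp (Nat.zero_le m)

theorem locallyIntegrable (h : HB m R f) : LocallyIntegrable f :=
  h.memLp'.locallyIntegrable (by norm_num)

theorem continuous (h : HB m R f) {j : ℕ} (hj : j < m) : Continuous (iteratedDeriv j f) :=
  (h.prim j hj).continuous

theorem l2_le (h : HB m R f) (hR : 0 ≤ R) {j : ℕ} (hj : j ≤ m) : l2 (iteratedDeriv j f) ≤ R :=
  l2_le_of_le hR (h.le j hj)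

theorem isWeakDeriv (h : HB m R f) {j : ℕ} (hj : j ≤ m) :
    IsWeakDeriv j f (iteratedDeriv j f) :=
  isWeakDeriv_of_prim h.locallyIntegrable j fun i hi => h.prim i (by omega)

theorem weakDerivNorm_eq (h : HB m R f) {j : ℕ} (hj : j ≤ m) :
    weakDerivNorm j f = eLpNorm (iteratedDeriv j f) 2 volume := (h.isWeakDeriv hj).norm_eq

theorem dual (h : HB m R f) (hR : 0 ≤ R) {j : ℕ} (hj : j ≤ m) {ψ : ℝ → ℝ} (hψ : IsTest ψ) :
    |∫ x, f x * iteratedDeriv j ψ x| ≤ R * l2 ψ := (h.isWeakDeriv hj).bound hR (h.le j hj) hψ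

/-- Every term of the hypothesis is linear in `f` before the absolute value is taken, so the
hypothesis is stable under pointwise limits and time integrals. This is how Sobolev bounds are
obtained for limits and integrals below. -/
theorem of_dual (hf : Continuous f) (hR : 0 ≤ R)
    (h : ∀ j ≤ m, ∀ ψ, IsTest ψ → |∫ x, f x * iteratedDeriv j ψ x| ≤ R * l2 ψ) : HB m R f := by
  have hex : ∀ j, ∃ g, j ≤ m → IsWeakDeriv j f g ∧ MemLp g 2 volume ∧
      eLpNorm g 2 volume ≤ ENNReal.ofReal R := by
    intro j
    by_cases hj : j ≤ m
    · obtain ⟨g, hg⟩ := IsWeakDeriv.of_bound hf.locallyIntegrable j hR (h j hj)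
      exact ⟨g, fun _ => hg⟩
    · exact ⟨0, fun h => absurd h hj⟩
  choose g hg using hex
  obtain ⟨h1, h2⟩ := chain_of_isWeakDeriv hf (m := m) (g := g) fun j _ hj => (hg j hj).1
  have h3 : ∀ j ≤ m, iteratedDeriv j f =ᵐ[volume] g j := by
    intro j hj
    rcases Nat.eq_zero_or_pos j with rfl | hpos
    · rw [iteratedDeriv_zero]
      exact (isWeakDeriv_zero hf.locallyIntegrable).unique (hg 0 hj).1
    · exact h2 j hpos hj
  refine ⟨h1, fun j hj => ?_, fun j hj => ?_⟩
  · exact (hg j hj).2.1.1.congr (h3 j hj).symm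
  · rw [eLpNorm_congr_ae (h3 j hj)]; exact (hg j hj).2.2

theorem mono (h : HB m R f) {m' : ℕ} (hm : m' ≤ m) {R' : ℝ} (hR : R ≤ R') : HB m' R' f :=
  ⟨fun j hj => h.prim j (by omega), fun j hj => h.meas j (by omega),
    fun j hj => (h.le j (by omega)).trans (ENNReal.ofReal_le_ofReal hR)⟩

theorem deriv (h : HB (m + 1) R f) : HB m R (deriv f) := by
  refine ⟨fun j hj => ?_, fun j hj => ?_, fun j hj => ?_⟩
  · simpa only [iteratedDeriv_succ'] using h.prim (j + 1) (by omega)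
  · simpa only [iteratedDeriv_succ'] using h.meas (j + 1) (by omega)
  · simpa only [iteratedDeriv_succ'] using h.le (j + 1) (by omega)

theorem prim' (h : HB (m + 1) R f) : Prim f (_root_.deriv f) := by
  simpa using h.prim 0 (by omega)

theorem continuous' (h : HB (m + 1) R f) : Continuous f := h.prim'.continuous

theorem zero_iff : HB 0 R f ↔ AEStronglyMeasurable f volume ∧
    eLpNorm f 2 volume ≤ ENNReal.ofReal R := by
  refine ⟨fun h => ⟨by simpa using h.meas 0 le_rfl, by simpa using h.le 0 le_rfl⟩,
    fun h => ⟨fun j hj => absurd hj (Nat.not_lt_zero j), fun j hj => ?_, fun j hj => ?_⟩⟩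
  · rw [Nat.le_zero.1 hj]; simpa using h.1
  · rw [Nat.le_zero.1 hj]; simpa using h.2

/-- The induction step for all constructions in Hᵐ: it suffices to know some density of `f`. For m =
0 the derivative agrees with that density only almost everywhere; for larger m the density is
continuous and the two are equal. -/
theorem of_prim {g : ℝ → ℝ} (hf : eLpNorm f 2 volume ≤ ENNReal.ofReal R) (hP : Prim f g)
    (hg : HB m R g) : HB (m + 1) R f := by
  have hd : HB m R (_root_.deriv f) := by
    rcases m with _ | m
    · rw [zero_iff] at hg ⊢
      exact ⟨hg.1.congr hP.ae_deriv.symm, by rw [eLpNorm_congr_ae hP.ae_deriv]; exact hg.2⟩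
    · rw [hP.deriv_eq hg.continuous']; exact hg
  refine ⟨fun j hj => ?_, fun j hj => ?_, fun j hj => ?_⟩
  · rcases j with _ | j
    · simpa using hP.to_deriv
    · simpa only [iteratedDeriv_succ'] using hd.prim j (by omega)
  · rcases j with _ | j
    · simpa using hP.continuous.aestronglyMeasurable
    · simpa only [iteratedDeriv_succ'] using hd.meas j (by omega)
  · rcases j with _ | j
    · simpa using hf
    · simpa only [iteratedDeriv_succ'] using hd.le j (by omega)

theorem sobolevNorm_le (h : HB m R f) :
    sobolevNorm m f ≤ ∑ j ∈ Finset.range (m + 1), eLpNorm (iteratedDeriv j f) 2 volume := by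
  refine (sobolevNorm_le_sum m f).trans (Finset.sum_le_sum fun j hj => ?_)
  rw [h.weakDerivNorm_eq (by have := Finset.mem_range.1 hj; omega)]

end HB

/-- The continuous representative of an element of `Hᵐ`. -/
theorem exists_hb_of_sobolevNorm {m : ℕ} {R : ℝ} {f : ℝ → ℝ} (hm : 1 ≤ m)
    (h : sobolevNorm m f ≤ ENNReal.ofReal R) : ∃ F, f =ᵐ[volume] F ∧ HB m R F := by
  have hex : ∀ j, ∃ g, j ≤ m → IsWeakDeriv j f g := by
    intro j
    by_cases hj : j ≤ m
    · obtain ⟨g, hg⟩ := exists_isWeakDeriv (f := f) (j := j)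
        ((weakDerivNorm_le_sobolevNorm hj).trans_lt (h.trans_lt ENNReal.ofReal_lt_top))
      exact ⟨g, fun _ => hg⟩
    · exact ⟨0, fun h => absurd h hj⟩
  choose g hg using hex
  have hfl : LocallyIntegrable f := (hg 0 (by omega)).1
  obtain ⟨F, hF, hFP⟩ := (isWeakDeriv_zero hfl).succ_of (hg 1 hm)
  obtain ⟨h1, h2⟩ := chain_of_isWeakDeriv hFP.continuous (m := m) (g := g)
    fun j _ hj => (hg j hj).congr hF
  have hn : ∀ j ≤ m, eLpNorm (g j) 2 volume ≤ ENNReal.ofReal R := fun j hj => by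
    rw [← (hg j hj).norm_eq]; exact (weakDerivNorm_le_sobolevNorm hj).trans h
  have h3 : ∀ j ≤ m, iteratedDeriv j F =ᵐ[volume] g j := by
    intro j hj
    rcases Nat.eq_zero_or_pos j with rfl | hpos
    · rw [iteratedDeriv_zero]
      exact (isWeakDeriv_zero hFP.continuous.locallyIntegrable).unique ((hg 0 hj).congr hF)
    · exact h2 j hpos hj
  refine ⟨F, hF, h1, fun j hj => ?_, fun j hj => ?_⟩
  · exact (hg j hj).2.1.aestronglyMeasurable.congr (h3 j hj).symm
  · rw [eLpNorm_congr_ae (h3 j hj)]; exact hn j hj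

theorem hb_of_sobolevNorm {m : ℕ} {R : ℝ} {f : ℝ → ℝ} (hm : 1 ≤ m) (hf : Continuous f)
    (h : sobolevNorm m f ≤ ENNReal.ofReal R) : HB m R f := by
  obtain ⟨F, hF, hFB⟩ := exists_hb_of_sobolevNorm hm h
  obtain ⟨m, rfl⟩ := Nat.exists_eq_succ_of_ne_zero (by omega : m ≠ 0)
  rwa [(hf.ae_eq_iff_eq volume hFB.continuous').1 hF]

theorem eLpNorm_mul_le_of_bdd {f g : ℝ → ℝ} {S : ℝ} (hg : ∀ x, |g x| ≤ S) :
    eLpNorm (fun x => f x * g x) 2 volume ≤ ENNReal.ofReal S * eLpNorm f 2 volume :=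
  eLpNorm_le_mul_eLpNorm_of_ae_le_mul (Eventually.of_forall fun x => by
    rw [Real.norm_eq_abs, Real.norm_eq_abs, abs_mul, mul_comm]
    exact mul_le_mul_of_nonneg_right (hg x) (abs_nonneg _)) 2

theorem l2_mul_le_of_bdd {f g : ℝ → ℝ} {S : ℝ} (hS : 0 ≤ S) (hf : MemLp f 2 volume)
    (hg : ∀ x, |g x| ≤ S) : l2 (fun x => f x * g x) ≤ S * l2 f := by
  have := ENNReal.toReal_mono (ENNReal.mul_ne_top ENNReal.ofReal_ne_top hf.2.ne)
    (eLpNorm_mul_le_of_bdd (f := f) hg)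
  rwa [ENNReal.toReal_mul, ENNReal.toReal_ofReal hS] at this

theorem MeasureTheory.MemLp.mul_bdd {f g : ℝ → ℝ} {S : ℝ} (hf : MemLp f 2 volume)
    (hgm : AEStronglyMeasurable g volume) (hg : ∀ x, |g x| ≤ S) :
    MemLp (fun x => f x * g x) 2 volume :=
  ⟨hf.1.mul hgm, (eLpNorm_mul_le_of_bdd hg).trans_lt
    (ENNReal.mul_lt_top ENNReal.ofReal_lt_top hf.2)⟩

theorem l2_add_le {f g : ℝ → ℝ} (hf : MemLp f 2 volume) (hg : MemLp g 2 volume) :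
    l2 (fun x => f x + g x) ≤ l2 f + l2 g := by
  have := ENNReal.toReal_mono (ENNReal.add_ne_top.2 ⟨hf.2.ne, hg.2.ne⟩)
    (eLpNorm_add_le hf.1 hg.1 (by norm_num))
  rwa [ENNReal.toReal_add hf.2.ne hg.2.ne] at this

theorem l2_const_mul (c : ℝ) (f : ℝ → ℝ) : l2 (fun x => c * f x) = |c| * l2 f := by
  have : eLpNorm (fun x => c * f x) 2 volume = ‖c‖ₑ * eLpNorm f 2 volume :=
    eLpNorm_const_smul c f 2 volume
  rw [l2, this, ENNReal.toReal_mul]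
  simp [l2]

theorem l2_sub_le {f g : ℝ → ℝ} (hf : MemLp f 2 volume) (hg : MemLp g 2 volume) :
    l2 (fun x => f x - g x) ≤ l2 f + l2 g := by
  have := l2_add_le hf (hg.const_mul (-1))
  rw [l2_const_mul] at this
  simpa [sub_eq_add_neg] using this

theorem l2_congr_ae {f g : ℝ → ℝ} (h : f =ᵐ[volume] g) : l2 f = l2 g := by
  rw [l2, l2, eLpNorm_congr_ae h]

theorem setIntegral_abs_le {g : ℝ → ℝ} (hg : MemLp g 2 volume) {a b : ℝ} (hab : a ≤ b) :
    ∫ x in Ioc a b, |g x| ≤ √(b - a) * l2 g := by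
  have h1 : MemLp ((Ioc a b).indicator fun _ => (1 : ℝ)) 2 volume :=
    memLp_indicator_const 2 measurableSet_Ioc 1 (Or.inr (by simp))
  have h2 : l2 ((Ioc a b).indicator fun _ => (1 : ℝ)) = √(b - a) := by
    rw [l2, eLpNorm_indicator_const measurableSet_Ioc (by norm_num) (by norm_num)]
    simp [Real.volume_Ioc, ← ENNReal.toReal_rpow, Real.sqrt_eq_rpow,
      ENNReal.toReal_ofReal (sub_nonneg.2 hab)]
  have h3 := integral_abs_mul_le hg h1
  rw [h2, mul_comm] at h3
  refine le_trans (le_of_eq ?_) h3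
  rw [← integral_indicator measurableSet_Ioc]
  congr 1
  ext x
  by_cases hx : x ∈ Ioc a b <;> simp [hx]

/-- Cauchy–Schwarz against the indicator function of the interval. -/
theorem Prim.holder {f g : ℝ → ℝ} (h : Prim f g) (hg : MemLp g 2 volume) (x y : ℝ) :
    |f y - f x| ≤ √|y - x| * l2 g := by
  wlog hxy : x ≤ y generalizing x y
  · rw [abs_sub_comm, abs_sub_comm y]; exact this y x (le_of_not_ge hxy)
  rw [h.2, intervalIntegral.integral_of_le hxy, abs_of_nonneg (sub_nonneg.2 hxy)]
  exact (abs_integral_le_integral_abs).trans (setIntegral_abs_le hg hxy)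

/-- Average |f x| ≤ |f y| + |f x - f y| over y in an interval of length one: the Hölder bound
controls the second term and Cauchy–Schwarz the first. -/
theorem Prim.abs_le {f g : ℝ → ℝ} (h : Prim f g) (hf : MemLp f 2 volume) (hg : MemLp g 2 volume)
    (x : ℝ) : |f x| ≤ l2 f + l2 g := by
  have h1 : ∀ y ∈ Ioc x (x + 1), |f x| ≤ |f y| + l2 g := by
    intro y hy
    have h2 := h.holder hg y x
    have h3 : √|x - y| ≤ 1 := by
      rw [Real.sqrt_le_one]
      rw [abs_of_nonpos (by linarith [hy.1])]; linarith [hy.2]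
    have h4 := mul_le_mul_of_nonneg_right h3 (l2_nonneg g)
    have h5 := abs_sub_abs_le_abs_sub (f x) (f y)
    linarith
  have h2 : ∫ y in Ioc x (x + 1), |f x| ≤ ∫ y in Ioc x (x + 1), (|f y| + l2 g) := by
    refine setIntegral_mono_on (by simp) ?_ measurableSet_Ioc h1
    exact ((h.continuous.abs.add continuous_const).integrableOn_Icc
      (a := x) (b := x + 1)).mono_set Ioc_subset_Icc_self
  rw [integral_add ((h.continuous.abs.integrableOn_Icc (a := x) (b := x + 1)).mono_set
    Ioc_subset_Icc_self) (by simp)] at h2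
  have h3 := setIntegral_abs_le hf (show x ≤ x + 1 by linarith)
  simp at h2 h3
  linarith

namespace HB

variable {m : ℕ} {R S : ℝ} {f g : ℝ → ℝ}

theorem abs_iteratedDeriv_le (h : HB m R f) (hR : 0 ≤ R) {j : ℕ} (hj : j < m) (x : ℝ) :
    |iteratedDeriv j f x| ≤ 2 * R := by
  have := (h.prim j hj).abs_le (h.memLp hj.le) (h.memLp hj) x
  linarith [h.l2_le hR hj.le, h.l2_le hR hj]

theorem abs_le (h : HB (m + 1) R f) (hR : 0 ≤ R) (x : ℝ) : |f x| ≤ 2 * R := by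
  simpa using h.abs_iteratedDeriv_le hR (Nat.succ_pos m) x

theorem add (hf : HB m R f) (hg : HB m S g) (hR : 0 ≤ R) (hS : 0 ≤ S) :
    HB m (R + S) (fun x => f x + g x) := by
  have hn : ∀ {m} {f g : ℝ → ℝ}, HB m R f → HB m S g →
      eLpNorm (fun x => f x + g x) 2 volume ≤ ENNReal.ofReal (R + S) := fun {m} {f} {g} hf hg => by
    rw [ENNReal.ofReal_add hR hS]
    exact (eLpNorm_add_le hf.memLp'.1 hg.memLp'.1 (by norm_num)).trans
      (add_le_add (by simpa using hf.le 0 (Nat.zero_le _)) (by simpa using hg.le 0 (Nat.zero_le _)))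
  induction m generalizing f g with
  | zero => exact zero_iff.2 ⟨hf.memLp'.1.add hg.memLp'.1, hn hf hg⟩
  | succ m ih => exact of_prim (hn hf hg) (hf.prim'.add hg.prim') (ih hf.deriv hg.deriv)

theorem const_mul (c : ℝ) (hf : HB m R f) : HB m (|c| * R) (fun x => c * f x) := by
  have hn : ∀ {m} {f : ℝ → ℝ}, HB m R f →
      eLpNorm (fun x => c * f x) 2 volume ≤ ENNReal.ofReal (|c| * R) := fun {m} {f} hf => by
    have : eLpNorm (fun x => c * f x) 2 volume = ‖c‖ₑ * eLpNorm f 2 volume :=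
      eLpNorm_const_smul c f 2 volume
    rw [this, ENNReal.ofReal_mul (abs_nonneg c), ← Real.norm_eq_abs, ofReal_norm]
    gcongr
    simpa using hf.le 0 (Nat.zero_le _)
  induction m generalizing f with
  | zero => exact zero_iff.2 ⟨hf.memLp'.1.const_mul c, hn hf⟩
  | succ m ih => exact of_prim (hn hf) (hf.prim'.const_mul c) (ih hf.deriv)

theorem sub (hf : HB m R f) (hg : HB m S g) (hR : 0 ≤ R) (hS : 0 ≤ S) :
    HB m (R + S) (fun x => f x - g x) := by
  have h := hg.const_mul (-1)
  rw [abs_neg, abs_one, one_mul] at h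
  simpa [sub_eq_add_neg] using hf.add h hR hS

end HB

/-! ### Multipliers and changes of variables. -/

/-- Bounded functions whose derivative belongs to `H^{M-1}`: these act as multipliers on `Hᵐ`,
`m ≤ M`. -/
structure WB (M : ℕ) (S : ℝ) (g : ℝ → ℝ) : Prop where
  bdd : ∀ x, |g x| ≤ S
  meas : AEStronglyMeasurable g volume
  prim : 1 ≤ M → Prim g (deriv g)
  hb : 1 ≤ M → HB (M - 1) S (deriv g)

namespace WB

variable {M : ℕ} {S : ℝ} {g : ℝ → ℝ}

theorem nonneg (h : WB M S g) : 0 ≤ S := (abs_nonneg _).trans (h.bdd 0)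

theorem mono (h : WB M S g) {M' : ℕ} {S' : ℝ} (hM : M' ≤ M) (hS : S ≤ S') : WB M' S' g :=
  ⟨fun x => (h.bdd x).trans hS, h.meas, fun h1 => h.prim (by omega),
    fun h1 => (h.hb (by omega)).mono (by omega) hS⟩

theorem of_prim {g' : ℝ → ℝ} (hb : ∀ x, |g x| ≤ S) (hP : Prim g g') (hg : HB M S g') :
    WB (M + 1) S g := by
  refine ⟨hb, hP.continuous.aestronglyMeasurable, fun _ => hP.to_deriv, fun _ => ?_⟩
  rcases M with _ | M
  · simp only [zero_add, Nat.sub_self]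
    rw [HB.zero_iff] at hg ⊢
    exact ⟨hg.1.congr hP.ae_deriv.symm, by rw [eLpNorm_congr_ae hP.ae_deriv]; exact hg.2⟩
  · rw [hP.deriv_eq hg.continuous']; exact hg

end WB

namespace HB

variable {m : ℕ} {R S : ℝ} {f g : ℝ → ℝ}

theorem wb (h : HB (m + 1) R f) (hR : 0 ≤ R) : WB (m + 1) (2 * R) f :=
  WB.of_prim (h.abs_le hR) h.prim' (h.deriv.mono le_rfl (by linarith))

theorem eLpNorm_mul_le {M : ℕ} (hf : HB m R f) (hg : WB M S g) :
    eLpNorm (fun x => f x * g x) 2 volume ≤ ENNReal.ofReal (R * S) := by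
  refine (eLpNorm_mul_le_of_bdd hg.bdd).trans ?_
  rw [mul_comm R, ENNReal.ofReal_mul hg.nonneg]
  gcongr
  simpa using hf.le 0 (Nat.zero_le _)

/-- Leibniz' rule and induction. In the term f g' the roles are exchanged: g' is the Sobolev factor,
and `f` is the multiplier, with bound 2R from the Sobolev embedding. Each derivative costs the
factor 3 = 1 + 2. -/
theorem mul {M : ℕ} (hm : m ≤ M) (hf : HB m R f) (hg : WB M S g) (hR : 0 ≤ R) :
    HB m (3 ^ m * (R * S)) (fun x => f x * g x) := by
  induction m generalizing f g R S M with
  | zero =>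
    rw [pow_zero, one_mul]
    exact zero_iff.2 ⟨hf.memLp'.1.mul hg.meas, hf.eLpNorm_mul_le hg⟩
  | succ m ih =>
    have hS := hg.nonneg
    have h3 : (1 : ℝ) ≤ 3 ^ (m + 1) := one_le_pow₀ (by norm_num)
    have hRS : 0 ≤ R * S := mul_nonneg hR hS
    refine of_prim ((hf.eLpNorm_mul_le hg).trans
      (ENNReal.ofReal_le_ofReal (le_mul_of_one_le_left hRS h3)))
      (hf.prim'.mul (hg.prim (by omega))) ?_
    have e1 := ih (by omega) hf.deriv hg hR
    have e2 := ih (by omega) ((hg.hb (by omega)).mono (by omega) le_rfl) (hf.wb hR) hS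
    have e3 := e1.add e2 (by positivity) (by positivity)
    have e4 : 3 ^ m * (R * S) + 3 ^ m * (S * (2 * R)) = 3 ^ (m + 1) * (R * S) := by ring
    rw [e4] at e3
    simpa [mul_comm] using e3

end HB

/-- Reciprocals of multipliers. -/
theorem WB.exists_inv (M : ℕ) {S : ℝ} (hS : 0 ≤ S) : ∃ S', 0 ≤ S' ∧ ∀ b : ℝ → ℝ, WB M S b →
    (∀ x, 1 / 2 ≤ b x) → WB M S' (fun x => (b x)⁻¹) := by
  have hbd : ∀ b : ℝ → ℝ, (∀ x, 1 / 2 ≤ b x) → ∀ x, |(b x)⁻¹| ≤ 2 := by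
    intro b hb x
    have : 0 < b x := by linarith [hb x]
    rw [abs_of_pos (inv_pos.2 this), inv_le_comm₀ this (by norm_num)]
    linarith [hb x]
  induction M with
  | zero =>
    refine ⟨2, by norm_num, fun b hb h => ⟨hbd b h, hb.meas.aemeasurable.inv.aestronglyMeasurable,
      fun h => absurd h (by norm_num), fun h => absurd h (by norm_num)⟩⟩
  | succ M ih =>
    obtain ⟨S', hS', ih⟩ := ih
    refine ⟨max 2 (3 ^ M * (3 ^ M * (S * S') * S')), by positivity, fun b hb h => ?_⟩
    have hw := ih b (hb.mono (by omega) le_rfl) h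
    -- The derivative of 1/b is -b'/b², and both factors 1/b are multipliers of one order less by
    -- induction.
    have e1 := ((hb.hb (by omega)).mul (by omega) hw hS).mul (by omega) hw (by positivity)
    simp only [Nat.add_sub_cancel] at e1
    have e2 := e1.const_mul (-1)
    rw [abs_neg, abs_one, one_mul] at e2
    refine WB.of_prim (fun x => (hbd b h x).trans (le_max_left _ _))
      ((hb.prim (by omega)).inv (by norm_num) h) ?_
    convert e2.mono le_rfl (le_max_right _ _) using 2 with x
    have : b x ≠ 0 := by linarith [h x]
    field_simp

/-- An increasing map with derivative bounded below, in one dimension. -/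
structure Diffeo (κ : ℝ) (Φ Φ' : ℝ → ℝ) : Prop where
  pos : 0 < κ
  hasDerivAt : ∀ x, HasDerivAt Φ (Φ' x) x
  lower : ∀ x, κ ≤ Φ' x

namespace Diffeo

variable {κ : ℝ} {Φ Φ' : ℝ → ℝ}

theorem deriv_pos (h : Diffeo κ Φ Φ') (x : ℝ) : 0 < Φ' x := h.pos.trans_le (h.lower x)

theorem strictMono (h : Diffeo κ Φ Φ') : StrictMono Φ := strictMono_of_deriv_pos fun x => by
  rw [(h.hasDerivAt x).deriv]; exact h.deriv_pos x

theorem continuous (h : Diffeo κ Φ Φ') : Continuous Φ :=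
  continuous_iff_continuousAt.2 fun x => (h.hasDerivAt x).continuousAt

/-- Change of variables with κ ≤ Φ'. Surjectivity is not needed, because the integral over the image
is at most the integral over the line. -/
theorem lintegral_comp_le (h : Diffeo κ Φ Φ') (F : ℝ → ℝ≥0∞) :
    ENNReal.ofReal κ * ∫⁻ x, F (Φ x) ≤ ∫⁻ x, F x := by
  have h1 := lintegral_image_eq_lintegral_abs_deriv_mul (MeasurableSet.univ)
    (fun x _ => (h.hasDerivAt x).hasDerivWithinAt) h.strictMono.injective.injOn F
  rw [Measure.restrict_univ] at h1
  calc ENNReal.ofReal κ * ∫⁻ x, F (Φ x) = ∫⁻ x, ENNReal.ofReal κ * F (Φ x) := by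
        rw [lintegral_const_mul' _ _ ENNReal.ofReal_ne_top]
    _ ≤ ∫⁻ x, ENNReal.ofReal |Φ' x| * F (Φ x) := by
        refine lintegral_mono fun x => ?_
        gcongr
        exact (h.lower x).trans (le_abs_self _)
    _ = ∫⁻ x in Φ '' univ, F x := h1.symm
    _ ≤ ∫⁻ x, F x := setLIntegral_le_lintegral _ _

theorem quasiMeasurePreserving (h : Diffeo κ Φ Φ') :
    Measure.QuasiMeasurePreserving Φ volume volume := by
  refine ⟨h.continuous.measurable, Measure.AbsolutelyContinuous.mk fun s hs hs0 => ?_⟩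
  rw [Measure.map_apply h.continuous.measurable hs]
  have := h.lintegral_comp_le (s.indicator 1)
  rw [lintegral_indicator_one hs, hs0, nonpos_iff_eq_zero, mul_eq_zero] at this
  rcases this with h0 | h0
  · exact absurd h0 (by simpa using h.pos)
  · rw [← h0, ← lintegral_indicator_one (hs.preimage h.continuous.measurable)]
    rfl

theorem eLpNorm_comp_le (h : Diffeo κ Φ Φ') (f : ℝ → ℝ) :
    eLpNorm (fun x => f (Φ x)) 2 volume ≤ ENNReal.ofReal (√κ)⁻¹ * eLpNorm f 2 volume := by
  have h1 := h.lintegral_comp_le (fun x => ‖f x‖ₑ ^ (2 : ℝ))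
  rw [eLpNorm_eq_lintegral_rpow_enorm_toReal (by norm_num) (by norm_num),
    eLpNorm_eq_lintegral_rpow_enorm_toReal (by norm_num) (by norm_num)]
  simp only [ENNReal.toReal_ofNat]
  have h2 : ENNReal.ofReal (√κ)⁻¹ = (ENNReal.ofReal κ⁻¹) ^ (1 / 2 : ℝ) := by
    rw [ENNReal.ofReal_rpow_of_pos (inv_pos.2 h.pos), ← Real.sqrt_eq_rpow, Real.sqrt_inv]
  rw [h2, ← ENNReal.mul_rpow_of_nonneg _ _ (by norm_num)]
  refine ENNReal.rpow_le_rpow ?_ (by norm_num)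
  calc ∫⁻ x, ‖f (Φ x)‖ₑ ^ (2 : ℝ)
      = ENNReal.ofReal κ⁻¹ * (ENNReal.ofReal κ * ∫⁻ x, ‖f (Φ x)‖ₑ ^ (2 : ℝ)) := by
        rw [← mul_assoc, ← ENNReal.ofReal_mul (inv_nonneg.2 h.pos.le),
          inv_mul_cancel₀ h.pos.ne', ENNReal.ofReal_one, one_mul]
    _ ≤ _ := by gcongr

theorem memLp_comp (h : Diffeo κ Φ Φ') {f : ℝ → ℝ} (hf : MemLp f 2 volume) :
    MemLp (fun x => f (Φ x)) 2 volume :=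
  ⟨hf.1.comp_quasiMeasurePreserving h.quasiMeasurePreserving,
    (h.eLpNorm_comp_le f).trans_lt (ENNReal.mul_lt_top ENNReal.ofReal_lt_top hf.2)⟩

theorem l2_comp_le (h : Diffeo κ Φ Φ') {f : ℝ → ℝ} (hf : MemLp f 2 volume) :
    l2 (fun x => f (Φ x)) ≤ (√κ)⁻¹ * l2 f := by
  have := ENNReal.toReal_mono (ENNReal.mul_ne_top ENNReal.ofReal_ne_top hf.2.ne)
    (h.eLpNorm_comp_le f)
  rwa [ENNReal.toReal_mul, ENNReal.toReal_ofReal (by positivity)] at this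

end Diffeo

theorem HB.eLpNorm_comp_le {κ R : ℝ} {m : ℕ} {Φ Φ' f : ℝ → ℝ} (hf : HB m R f)
    (h : Diffeo κ Φ Φ') :
    eLpNorm (fun x => f (Φ x)) 2 volume ≤ ENNReal.ofReal ((√κ)⁻¹ * R) := by
  refine (h.eLpNorm_comp_le f).trans ?_
  rw [ENNReal.ofReal_mul (by positivity)]
  gcongr
  simpa using hf.le 0 (Nat.zero_le _)

/-- Sobolev bounds for compositions with a diffeomorphism whose derivative is a multiplier. -/
theorem HB.exists_comp (m : ℕ) {κ S : ℝ} : ∃ C, 0 ≤ C ∧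
    ∀ (Φ Φ' f : ℝ → ℝ) (R : ℝ) (M : ℕ), Diffeo κ Φ Φ' → WB M S Φ' → m ≤ M + 1 → 0 ≤ R → HB m R f →
      HB m (C * R) (fun x => f (Φ x)) := by
  induction m with
  | zero =>
    refine ⟨(√κ)⁻¹, by positivity, fun Φ Φ' f R M hΦ hw hm hR hf => HB.zero_iff.2 ⟨?_, ?_⟩⟩
    · exact (hΦ.memLp_comp hf.memLp').1
    · exact hf.eLpNorm_comp_le hΦ
  | succ m ih =>
    obtain ⟨C, hC, ih⟩ := ih
    refine ⟨max (√κ)⁻¹ (3 ^ m * (C * S)), by positivity, fun Φ Φ' f R M hΦ hw hm hR hf => ?_⟩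
    refine HB.of_prim ((hf.eLpNorm_comp_le hΦ).trans (ENNReal.ofReal_le_ofReal ?_))
      (hf.prim'.comp_diffeo hΦ.hasDerivAt hΦ.deriv_pos) ?_
    · gcongr; exact le_max_left _ _
    · have e := (ih Φ Φ' (_root_.deriv f) R M hΦ hw (by omega) hR hf.deriv).mul (M := M)
        (by omega) hw (by positivity)
      refine e.mono le_rfl ?_
      calc 3 ^ m * (C * R * S) = 3 ^ m * (C * S) * R := by ring
        _ ≤ _ := by gcongr; exact le_max_right _ _

/-- Sobolev bounds for compositions with an inverse diffeomorphism, whose derivative is a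
multiplier in the original variable. -/
theorem HB.exists_comp_inv (m : ℕ) {κ S : ℝ} : ∃ C, 0 ≤ C ∧
    ∀ (A r f : ℝ → ℝ) (R : ℝ) (M : ℕ), Diffeo κ A (fun x => r (A x)) → WB M S r → m ≤ M + 1 →
      0 ≤ R → HB m R f → HB m (C * R) (fun x => f (A x)) := by
  induction m with
  | zero =>
    refine ⟨(√κ)⁻¹, by positivity, fun Φ Φ' f R M hΦ hw hm hR hf => HB.zero_iff.2 ⟨?_, ?_⟩⟩
    · exact (hΦ.memLp_comp hf.memLp').1
    · exact hf.eLpNorm_comp_le hΦ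
  | succ m ih =>
    obtain ⟨C, hC, ih⟩ := ih
    refine ⟨max (√κ)⁻¹ (C * 3 ^ m * S), by positivity, fun A r f R M hΦ hw hm hR hf => ?_⟩
    refine HB.of_prim ((hf.eLpNorm_comp_le hΦ).trans (ENNReal.ofReal_le_ofReal ?_))
      (hf.prim'.comp_diffeo hΦ.hasDerivAt hΦ.deriv_pos) ?_
    · gcongr; exact le_max_left _ _
    -- The derivative of f ∘ A is (f' r) ∘ A. The product is formed before composing, so regularity
    -- is required of `r` in the original variable and never of r ∘ A.
    · have e := ih A r _ _ M hΦ hw (by omega) (by have := hw.nonneg; positivity)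
        (hf.deriv.mul (M := M) (by omega) hw hR)
      refine e.mono le_rfl ?_
      calc C * (3 ^ m * (R * S)) = C * 3 ^ m * S * R := by ring
        _ ≤ _ := by gcongr; exact le_max_right _ _

/-! ### Time integrals, pointwise limits and joint continuity. -/

/-- Duality pairing of a time integral. -/
theorem abs_integral_timeIntegral_mul_le {g : ℝ → ℝ → ℝ} {χ B : ℝ → ℝ} {a b R : ℝ} (hab : a ≤ b)
    (hm : AEStronglyMeasurable (Function.uncurry g) ((volume.restrict (Ioc a b)).prod volume))
    (hL : ∀ᵐ τ ∂volume.restrict (Ioc a b), MemLp (g τ) 2 volume ∧ l2 (g τ) ≤ R)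
    (hχ : Continuous χ) (hχ2 : MemLp χ 2 volume) (hBi : IntervalIntegrable B volume a b)
    (hB : ∀ᵐ τ ∂volume.restrict (Ioc a b), |∫ x, g τ x * χ x| ≤ B τ) :
    |∫ x, (∫ τ in a..b, g τ x) * χ x| ≤ ∫ τ in a..b, B τ := by
  have hint : Integrable (fun p : ℝ × ℝ => g p.1 p.2 * χ p.2)
      ((volume.restrict (Ioc a b)).prod volume) := by
    have hmm : AEStronglyMeasurable (fun p : ℝ × ℝ => g p.1 p.2 * χ p.2)
        ((volume.restrict (Ioc a b)).prod volume) :=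
      hm.mul (hχ.comp continuous_snd).aestronglyMeasurable
    refine (integrable_prod_iff hmm).2 ⟨?_, ?_⟩
    · filter_upwards [hL] with τ hτ using hτ.1.mul_integrable hχ2
    · refine Integrable.mono' (integrable_const (R * l2 χ)) hmm.norm.integral_prod_right' ?_
      filter_upwards [hL] with τ hτ
      rw [Real.norm_eq_abs, abs_of_nonneg (integral_nonneg fun _ => norm_nonneg _)]
      exact (integral_abs_mul_le hτ.1 hχ2).trans
        (mul_le_mul_of_nonneg_right hτ.2 (l2_nonneg _))
  simp_rw [intervalIntegral.integral_of_le hab, ← integral_mul_const]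
  rw [← integral_integral_swap hint]
  refine (abs_integral_le_integral_abs).trans (integral_mono_ae ?_ ?_ hB)
  · exact hint.integral_prod_left.abs
  · exact (intervalIntegrable_iff_integrableOn_Ioc_of_le hab).1 hBi

/-- Fubini moves the test function inside the time integral, and the dual bounds are integrated in
time. The derivative of order `m`, which need not be continuous, is never differentiated out of an
integral. -/
theorem HB.timeIntegral {m : ℕ} {R : ℝ} (hR : 0 ≤ R) {g : ℝ → ℝ → ℝ}
    (hc : Continuous (Function.uncurry g)) {a b : ℝ} (hab : a ≤ b)
    (h : ∀ τ ∈ Icc a b, HB m R (g τ)) : HB m ((b - a) * R) (fun x => ∫ τ in a..b, g τ x) := by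
  refine HB.of_dual (intervalIntegral.continuous_parametric_intervalIntegral_of_continuous'
    (f := fun x τ => g τ x) (hc.comp continuous_swap) a b) (mul_nonneg (sub_nonneg.2 hab) hR) fun j hj ψ hψ => ?_
  have := abs_integral_timeIntegral_mul_le (g := g) (χ := iteratedDeriv j ψ)
    (B := fun _ => R * l2 ψ) (R := R) hab hc.aestronglyMeasurable
    ((ae_restrict_iff' measurableSet_Ioc).2 (Eventually.of_forall fun τ hτ =>
      ⟨(h τ (Ioc_subset_Icc_self hτ)).memLp', by
        simpa using (h τ (Ioc_subset_Icc_self hτ)).l2_le hR (Nat.zero_le m)⟩))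
    (hψ.iteratedDeriv j).1.continuous ((hψ.iteratedDeriv j).memLp 2) (by simp)
    ((ae_restrict_iff' measurableSet_Ioc).2 (Eventually.of_forall fun τ hτ =>
      (h τ (Ioc_subset_Icc_self hτ)).dual hR hj hψ))
  rwa [intervalIntegral.integral_const, smul_eq_mul, ← mul_assoc] at this

/-- Sobolev bounds pass to pointwise limits. -/
theorem HB.of_tendsto {m : ℕ} {R : ℝ} (hR : 0 ≤ R) {F : ℕ → ℝ → ℝ} {f : ℝ → ℝ}
    (hf : Continuous f) (hF : ∀ n, HB (m + 1) R (F n))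
    (h : ∀ x, Tendsto (fun n => F n x) atTop (𝓝 (f x))) : HB (m + 1) R f := by
  refine HB.of_dual hf hR fun j hj ψ hψ => ?_
  refine le_of_tendsto' (x := atTop) (f := fun n => |∫ x, F n x * iteratedDeriv j ψ x|) (Tendsto.abs ?_) fun n => (hF n).dual hR hj hψ
  refine tendsto_integral_of_dominated_convergence (fun x => 2 * R * |iteratedDeriv j ψ x|)
    (fun n => ((hF n).continuous'.mul (hψ.iteratedDeriv j).1.continuous).aestronglyMeasurable)
    ((hψ.iteratedDeriv j).integrable.abs.const_mul _)
    (fun n => Eventually.of_forall fun x => ?_)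
    (Eventually.of_forall fun x => (h x).mul_const _)
  rw [Real.norm_eq_abs, abs_mul]
  exact mul_le_mul_of_nonneg_right ((hF n).abs_le hR x) (abs_nonneg _)

/-- Joint continuity of functions of time with bounded Sobolev norms. -/
theorem HB.continuous_uncurry {m : ℕ} {R : ℝ} (hR : 0 ≤ R) {f : ℝ → ℝ → ℝ}
    (hf : ∀ t, HB m R (f t)) (hc : ∀ x, Continuous fun t => f t x) {j : ℕ} (hj : j < m) :
    Continuous (Function.uncurry fun t x => iteratedDeriv j (f t) x) := by
  induction j generalizing f m with
  | zero =>
    simp only [iteratedDeriv_zero]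
    rw [continuous_iff_continuousAt]
    rintro ⟨t, x⟩
    have h1 : Tendsto (fun p : ℝ × ℝ => √|p.2 - x| * R + |f p.1 x - f t x|) (𝓝 (t, x)) (𝓝 0) := by
      have : Continuous fun p : ℝ × ℝ => √|p.2 - x| * R + |f p.1 x - f t x| := by
        have := (hc x).comp (continuous_fst (X := ℝ) (Y := ℝ))
        have h2 : Continuous fun p : ℝ × ℝ => f p.1 x := this
        fun_prop
      simpa using this.tendsto (t, x)
    refine tendsto_iff_dist_tendsto_zero.2 (squeeze_zero (fun _ => dist_nonneg) (fun p => ?_) h1)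
    have h2 := ((hf p.1).prim 0 hj).holder ((hf p.1).memLp hj) x p.2
    have h3 := mul_le_mul_of_nonneg_left ((hf p.1).l2_le hR hj) (Real.sqrt_nonneg |p.2 - x|)
    simp only [iteratedDeriv_zero] at h2
    simp only [Function.uncurry, Real.dist_eq]
    exact (abs_sub_le _ (f p.1 x) _).trans (add_le_add (h2.trans h3) le_rfl)
  | succ j ih =>
    obtain ⟨m, rfl⟩ := Nat.exists_eq_succ_of_ne_zero (by omega : m ≠ 0)
    simp only [iteratedDeriv_succ']
    refine ih (m := m) (fun t => (hf t).deriv) (fun x => ?_) (by omega)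
    refine continuous_of_uniform_approx_of_continuous fun u hu => ?_
    obtain ⟨ε, hε, hεu⟩ := Metric.mem_uniformity_dist.1 hu
    obtain ⟨m, rfl⟩ := Nat.exists_eq_succ_of_ne_zero (by omega : m ≠ 0)
    -- The derivative is Hölder continuous of exponent 1/2 in x with constant R at all times. A
    -- difference quotient of step δ, which is continuous in time, is therefore within √δ R < ε of
    -- it uniformly in time.
    set δ : ℝ := (ε / 2 / (R + 1)) ^ 2 with hδ
    have hδ0 : 0 < δ := by positivity
    refine ⟨fun t => (f t (x + δ) - f t x) / δ, ((hc _).sub (hc _)).div_const _, fun t => ?_⟩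
    have hd := (hf t).prim'.hasDerivAt (hf t).deriv.continuous'
    obtain ⟨ξ, hξ, he⟩ := exists_hasDerivAt_eq_slope (f t) (_root_.deriv (f t))
      (show x < x + δ by linarith) (hf t).continuous'.continuousOn fun y _ => hd y
    rw [add_sub_cancel_left] at he
    refine hεu ?_
    simp only
    rw [← he, Real.dist_eq, abs_sub_comm]
    have h2 := (hf t).deriv.prim'.holder (hf t).deriv.deriv.memLp' x ξ
    have h4 : l2 (_root_.deriv (_root_.deriv (f t))) ≤ R := by
      simpa using (hf t).deriv.deriv.l2_le hR (Nat.zero_le _)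
    have h5 : √|ξ - x| ≤ ε / 2 / (R + 1) := by
      rw [Real.sqrt_le_iff]
      refine ⟨by positivity, ?_⟩
      rw [abs_of_pos (by linarith [hξ.1])]
      linarith [hξ.2]
    calc _ ≤ _ := h2
      _ ≤ ε / 2 / (R + 1) * R := mul_le_mul h5 h4 (l2_nonneg _) (by positivity)
      _ ≤ ε / 2 / (R + 1) * (R + 1) := by gcongr; linarith
      _ < ε := by field_simp; linarith

/-! ### The space Ḣ⁻¹ and square integrable primitives. -/

theorem tendsto_zero_of_integrable {G : ℝ → ℝ} {L : ℝ} (hG : Integrable G)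
    (h : Tendsto G atTop (𝓝 L)) : L = 0 := by
  by_contra hL
  have hpos : 0 < |L| / 2 := by positivity
  have h1 := hG.measure_norm_ge_lt_top hpos
  have h2 : ∀ᶠ x in atTop, |L| / 2 < ‖G x‖ :=
    (h.norm).eventually (lt_mem_nhds (by rw [Real.norm_eq_abs]; linarith [abs_pos.2 hL]))
  obtain ⟨a, ha⟩ := eventually_atTop.1 h2
  have h3 : volume (Ici a) ≤ volume {x | |L| / 2 ≤ ‖G x‖} :=
    measure_mono fun x hx => (ha x hx).le
  rw [Real.volume_Ici] at h3
  exact absurd (lt_of_le_of_lt h3 h1) (lt_irrefl _)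

theorem Prim.comp_neg {f g : ℝ → ℝ} (h : Prim f g) : Prim (fun x => f (-x)) (fun x => -g (-x)) := by
  refine ⟨locallyIntegrable_of_intInt fun a b => ?_, fun a b => ?_⟩
  · have := (LocallyIntegrable.intInt h.1 (-a) (-b)).comp_mul_left (c := -1)
    simp only [neg_mul, one_mul, div_neg, div_one, neg_neg] at this
    exact this.neg
  · rw [intervalIntegral.integral_neg, intervalIntegral.integral_comp_neg, ← h.2]; ring

/-- `G` has limits at both ends because G' is integrable, and the limits vanish because `G` is
integrable. This replaces compact support in integrations by parts. -/
theorem Prim.integral_eq_zero_of_integrable {G G' : ℝ → ℝ} (h : Prim G G') (hG : Integrable G)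
    (hG' : Integrable G') : ∫ x, G' x = 0 := by
  have key : ∀ {G G' : ℝ → ℝ}, Prim G G' → Integrable G → Integrable G' →
      ∫ x in Ioi 0, G' x = -G 0 := by
    intro G G' h hG hG'
    have h1 := intervalIntegral_tendsto_integral_Ioi 0 hG'.integrableOn tendsto_id
    have h2 : Tendsto G atTop (𝓝 (G 0 + ∫ x in Ioi 0, G' x)) := by
      rw [show G = fun x => G 0 + ∫ y in (0 : ℝ)..x, G' y from funext (h.eq_add 0)]
      simpa using h1.const_add (G 0)
    linarith [tendsto_zero_of_integrable hG h2]
  have h1 := key h hG hG'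
  have h2 := key h.comp_neg hG.comp_neg hG'.comp_neg.neg
  rw [integral_neg, integral_comp_neg_Ioi (f := G')] at h2
  rw [← intervalIntegral.integral_Iic_add_Ioi (b := 0) hG'.integrableOn hG'.integrableOn, h1]
  simp at h2
  linarith

/-- `ψ` as a complex Schwartz function. -/
noncomputable def IsTest.schwartz {ψ : ℝ → ℝ} (h : IsTest ψ) : SchwartzMap ℝ ℂ :=
  HasCompactSupport.toSchwartzMap (f := fun x => (ψ x : ℂ))
    (h.2.comp_left (g := ((↑) : ℝ → ℂ)) Complex.ofReal_zero)
    (Complex.ofRealCLM.contDiff.comp h.1)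

theorem IsTest.schwartz_apply {ψ : ℝ → ℝ} (h : IsTest ψ) (x : ℝ) : h.schwartz x = ψ x := rfl

theorem IsTest.derivCLM_schwartz {ψ : ℝ → ℝ} (h : IsTest ψ) (x : ℝ) :
    SchwartzMap.derivCLM ℂ ℂ h.schwartz x = (_root_.deriv ψ x : ℝ) := by
  rw [SchwartzMap.derivCLM_apply]
  have h1 : HasDerivAt ψ (_root_.deriv ψ x) x :=
    ((h.1.differentiable (by simp)) x).hasDerivAt
  exact h1.ofReal_comp.deriv

theorem fourier_derivCLM_apply (φ : SchwartzMap ℝ ℂ) (ξ : ℝ) :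
    𝓕 (SchwartzMap.derivCLM ℂ ℂ φ) ξ = (2 * Real.pi * Complex.I * ξ) * 𝓕 φ ξ := by
  have h := Real.fourier_deriv (f := φ) φ.integrable φ.differentiable
    (by
      have := (SchwartzMap.derivCLM ℂ ℂ φ).integrable (μ := volume)
      exact this)
  have h2 := congrFun h ξ
  simp only [smul_eq_mul] at h2
  exact h2

theorem inner_schwartz_toLp (φ : SchwartzMap ℝ ℂ) (G : Lp ℂ 2 (volume : Measure ℝ)) :
    inner ℂ (φ.toLp 2) G = ∫ x, (starRingEnd ℂ) (φ x) * G x := by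
  rw [L2.inner_def]
  refine integral_congr_ae ?_
  filter_upwards [φ.coeFn_toLp 2 volume] with x hx
  rw [hx]; simp [mul_comm]

/-- Plancherel's theorem as an identity of integrals; it lets the transform of an L² function be
tested with functions for which the transform is classical. -/
theorem inner_schwartz_fourier (φ : SchwartzMap ℝ ℂ) (G : Lp ℂ 2 (volume : Measure ℝ)) :
    ∫ x, (starRingEnd ℂ) (𝓕 φ x) * (𝓕 G : Lp ℂ 2 volume) x =
      ∫ x, (starRingEnd ℂ) (φ x) * G x := by
  rw [← inner_schwartz_toLp, ← inner_schwartz_toLp, ← SchwartzMap.toLp_fourier_eq,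
    Lp.inner_fourier_eq]

/-- Multiplication with the symbol of the derivative. -/
noncomputable def derivSymbol (ξ : ℝ) : ℂ := 2 * Real.pi * Complex.I * ξ

theorem enorm_derivSymbol_inv (ξ : ℝ) :
    ‖(derivSymbol ξ)⁻¹‖ₑ = ‖(((2 * Real.pi * |ξ|)⁻¹ : ℝ) : ℂ)‖ₑ := by
  rw [← ofReal_norm, ← ofReal_norm, norm_inv, derivSymbol]
  simp [abs_of_pos Real.pi_pos]

theorem derivSymbol_ne_zero {ξ : ℝ} (h : ξ ≠ 0) : derivSymbol ξ ≠ 0 := by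
  simp [derivSymbol, h, Real.pi_ne_zero]

theorem ae_ne_zero : ∀ᵐ ξ : ℝ, ξ ≠ 0 := by simp [ae_iff]

theorem conj_derivSymbol (ξ : ℝ) : (starRingEnd ℂ) (derivSymbol ξ) = -derivSymbol ξ := by
  simp [derivSymbol, map_ofNat (starRingEnd ℂ) 2]

theorem measurable_derivSymbol : Measurable derivSymbol := by
  unfold derivSymbol; fun_prop

/-- Functions of finite `Ḣ⁻¹` norm have square integrable primitives. -/
theorem exists_prim_of_hMinusOneNorm {f : ℝ → ℝ} (h : hMinusOneNorm f < ⊤) :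
    ∃ E, Prim E f ∧ MemLp E 2 volume ∧ eLpNorm E 2 volume ≤ hMinusOneNorm f := by
  by_cases hf : MemLp (fun x => (f x : ℂ)) 2 volume
  swap
  · simp [hMinusOneNorm, hf] at h
  have hfr : MemLp f 2 volume := by
    refine ⟨?_, ?_⟩
    · have := Complex.continuous_re.comp_aestronglyMeasurable hf.1
      simpa using this
    · rw [← eLpNorm_norm]
      have := hf.2
      rw [← eLpNorm_norm] at this
      simpa using this
  set F : Lp ℂ 2 (volume : Measure ℝ) := hf.toLp _ with hF
  have hn : hMinusOneNorm f = eLpNorm (fun ξ => (derivSymbol ξ)⁻¹ * (𝓕 F : Lp ℂ 2 volume) ξ) 2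
      volume := by
    rw [hMinusOneNorm, dif_pos hf]
    refine eLpNorm_congr_enorm_ae (Eventually.of_forall fun ξ => ?_)
    rw [enorm_mul, enorm_mul, enorm_derivSymbol_inv]
  have hm : MemLp (fun ξ => (derivSymbol ξ)⁻¹ * (𝓕 F : Lp ℂ 2 volume) ξ) 2 volume :=
    ⟨(measurable_derivSymbol.inv.aestronglyMeasurable).mul (Lp.aestronglyMeasurable _), by
      rw [← hn]; exact h⟩
  -- The transform of the primitive: the transform of `f` divided by 2πiξ, which has the same
  -- modulus as the quotient in the definition of the norm.
  set Eh : Lp ℂ 2 (volume : Measure ℝ) := hm.toLp _ with hEh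
  set Ec : Lp ℂ 2 (volume : Measure ℝ) := 𝓕⁻ Eh with hEc
  have hEcF : 𝓕 Ec = Eh := by rw [hEc, FourierTransform.fourier_fourierInv_eq]
  have hEm : MemLp (fun x => (Ec x).re) 2 volume := (Lp.memLp Ec).re
  have hle : eLpNorm (fun x => (Ec x).re) 2 volume ≤ hMinusOneNorm f := by
    have h1 : eLpNorm (fun x => (Ec x).re) 2 volume ≤ eLpNorm Ec 2 volume :=
      eLpNorm_mono fun x => by
        rw [Real.norm_eq_abs]; exact Complex.abs_re_le_norm _
    have h2 : eLpNorm Ec 2 volume = eLpNorm Eh 2 volume := by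
      have : ‖Ec‖ = ‖Eh‖ := by rw [← hEcF, Lp.norm_fourier_eq]
      rw [Lp.norm_def, Lp.norm_def] at this
      exact (ENNReal.toReal_eq_toReal_iff' (Lp.eLpNorm_ne_top _) (Lp.eLpNorm_ne_top _)).1 this
    rw [hn, ← eLpNorm_congr_ae hm.coeFn_toLp, ← h2]
    exact h1
  -- In the pairing with ψ' the symbol of the derivative cancels its inverse, and its conjugate
  -- supplies the sign of the integration by parts. Real parts are taken because the inverse
  -- transform is not known to be real.
  obtain ⟨E, hE, hP⟩ := exists_prim_of_weak (f := fun x => (Ec x).re) (g := f)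
    (hEm.locallyIntegrable (by norm_num)) (hfr.locallyIntegrable (by norm_num)) fun ψ hψ => by
      have e1 := inner_schwartz_fourier (SchwartzMap.derivCLM ℂ ℂ hψ.schwartz) Ec
      have e2 := inner_schwartz_fourier hψ.schwartz F
      rw [hEcF] at e1
      have e3 : ∫ x, (starRingEnd ℂ) (𝓕 (SchwartzMap.derivCLM ℂ ℂ hψ.schwartz) x) * Eh x =
          -∫ x, (starRingEnd ℂ) (𝓕 hψ.schwartz x) * (𝓕 F : Lp ℂ 2 volume) x := by
        rw [← integral_neg]
        refine integral_congr_ae ?_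
        filter_upwards [hm.coeFn_toLp, ae_ne_zero] with ξ h1 h2
        rw [fourier_derivCLM_apply, h1, map_mul]
        have := conj_derivSymbol ξ
        rw [derivSymbol] at this
        rw [this, ← derivSymbol]
        have := derivSymbol_ne_zero h2
        field_simp
      rw [e1, e2] at e3
      have e4 : ∫ x, (starRingEnd ℂ) (hψ.schwartz x) * F x = ((∫ x, f x * ψ x : ℝ) : ℂ) := by
        rw [← integral_complex_ofReal]
        refine integral_congr_ae ?_
        filter_upwards [hf.coeFn_toLp] with x hx
        rw [hx, hψ.schwartz_apply]
        simp [mul_comm]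
      have e5 : Integrable fun x => (starRingEnd ℂ) (SchwartzMap.derivCLM ℂ ℂ hψ.schwartz x) * Ec x := by
        have h1 : MemLp (fun x => ((deriv ψ x : ℝ) : ℂ)) 2 volume := (hψ.deriv.memLp 2).ofReal
        have := h1.integrable_mul (Lp.memLp Ec)
        refine this.congr (Eventually.of_forall fun x => ?_)
        simp [hψ.derivCLM_schwartz]
      have e6 := congrArg Complex.re e3
      rw [e4] at e6
      have e7 := integral_re e5
      simp only [RCLike.re_to_complex] at e7
      rw [← e7] at e6
      simp only [Complex.neg_re, Complex.ofReal_re] at e6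
      rw [← e6]
      refine integral_congr_ae (Eventually.of_forall fun x => ?_)
      simp [hψ.derivCLM_schwartz, mul_comm]
  exact ⟨E, hP, (memLp_congr_ae hE).1 hEm, by rwa [← eLpNorm_congr_ae hE]⟩

theorem Prim.integral_mul_schwartz {E f : ℝ → ℝ} (hP : Prim E f) (hE : MemLp E 2 volume)
    (hf : MemLp f 2 volume) {η η' : ℝ → ℝ} (hη : ∀ x, HasDerivAt η (η' x) x)
    (hηc : Continuous η') (h1 : MemLp η 2 volume) (h2 : MemLp η' 2 volume) :
    ∫ x, η' x * E x = -∫ x, η x * f x := by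
  have hi1 : Integrable fun x => f x * η x := hf.mul_integrable h1
  have hi2 : Integrable fun x => E x * η' x := hE.mul_integrable h2
  have := (hP.mul (of_hasDerivAt_continuous hη hηc)).integral_eq_zero_of_integrable
    (hE.mul_integrable h1) (hi1.add hi2)
  rw [integral_add hi1 hi2] at this
  simp_rw [mul_comm (η' _), mul_comm (η _)]
  linarith

/-- Integration by parts for the real and the imaginary part separately. Schwartz functions are
needed here, since the inverse transform of a test function need not have compact support. -/
theorem Prim.integral_conj_schwartz {E f : ℝ → ℝ} (hP : Prim E f) (hE : MemLp E 2 volume)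
    (hf : MemLp f 2 volume) (φ : SchwartzMap ℝ ℂ) :
    ∫ x, (starRingEnd ℂ) (SchwartzMap.derivCLM ℂ ℂ φ x) * (E x : ℂ) =
      -∫ x, (starRingEnd ℂ) (φ x) * (f x : ℂ) := by
  have hd : ∀ x, HasDerivAt φ (SchwartzMap.derivCLM ℂ ℂ φ x) x := fun x => by
    rw [SchwartzMap.derivCLM_apply]; exact (φ.differentiable x).hasDerivAt
  have m1 := φ.memLp 2 (volume : Measure ℝ)
  have m2 := (SchwartzMap.derivCLM ℂ ℂ φ).memLp 2 (volume : Measure ℝ)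
  have c2 := (SchwartzMap.derivCLM ℂ ℂ φ).continuous
  have hre := hP.integral_mul_schwartz hE hf (η := fun x => (φ x).re)
    (η' := fun x => (SchwartzMap.derivCLM ℂ ℂ φ x).re)
    (fun x => Complex.reCLM.hasFDerivAt.comp_hasDerivAt x (hd x))
    (Complex.continuous_re.comp c2) m1.re m2.re
  have him := hP.integral_mul_schwartz hE hf (η := fun x => (φ x).im)
    (η' := fun x => (SchwartzMap.derivCLM ℂ ℂ φ x).im)
    (fun x => Complex.imCLM.hasFDerivAt.comp_hasDerivAt x (hd x))
    (Complex.continuous_im.comp c2) m1.im m2.im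
  have e1 : Integrable fun x => (starRingEnd ℂ) (SchwartzMap.derivCLM ℂ ℂ φ x) * (E x : ℂ) :=
    m2.star.integrable_mul hE.ofReal
  have e2 : Integrable fun x => (starRingEnd ℂ) (φ x) * (f x : ℂ) :=
    m1.star.integrable_mul hf.ofReal
  refine Complex.ext ?_ ?_
  · have h1 := integral_re e1
    have h2 := integral_re e2
    simp only [RCLike.re_to_complex] at h1 h2
    rw [Complex.neg_re, ← h1, ← h2]
    simpa using hre
  · have h1 := integral_im e1
    have h2 := integral_im e2
    simp only [RCLike.im_to_complex] at h1 h2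
    rw [Complex.neg_im, ← h1, ← h2]
    simp only [Complex.mul_im, Complex.conj_re, Complex.conj_im, Complex.ofReal_re,
      Complex.ofReal_im, mul_zero, zero_add, neg_mul, integral_neg]
    rw [him]

/-- The `Ḣ⁻¹` norm is the `L²` norm of the primitive. -/
theorem hMinusOneNorm_le_of_prim {E f : ℝ → ℝ} (hP : Prim E f) (hE : MemLp E 2 volume)
    (hf : MemLp f 2 volume) : hMinusOneNorm f ≤ eLpNorm E 2 volume := by
  have hfc : MemLp (fun x => (f x : ℂ)) 2 volume := hf.ofReal
  have hEc : MemLp (fun x => (E x : ℂ)) 2 volume := hE.ofReal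
  rw [hMinusOneNorm, dif_pos hfc]
  set F : Lp ℂ 2 (volume : Measure ℝ) := hfc.toLp _ with hF
  set G : Lp ℂ 2 (volume : Measure ℝ) := hEc.toLp _ with hG
  have hsl : LocallyIntegrable fun ξ => derivSymbol ξ * (𝓕 G : Lp ℂ 2 volume) ξ := by
    have h1 : LocallyIntegrable (𝓕 G : Lp ℂ 2 volume) :=
      (Lp.memLp _).locallyIntegrable (by norm_num)
    have hc : Continuous derivSymbol := by unfold derivSymbol; fun_prop
    exact h1.continuous_smul hc
  -- The transform of `f` is 2πiξ times that of `E`. It is checked against test functions η in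
  -- frequency, by integrating by parts in x against the inverse transform of η.
  have hae : ∀ᵐ ξ : ℝ, (𝓕 F : Lp ℂ 2 volume) ξ = derivSymbol ξ * (𝓕 G : Lp ℂ 2 volume) ξ := by
    refine ae_eq_of_integral_contDiff_smul_eq
      ((Lp.memLp _).locallyIntegrable (by norm_num)) hsl fun η h1 h2 => ?_
    have hη : IsTest η := ⟨h1, h2⟩
    set φ : SchwartzMap ℝ ℂ := 𝓕⁻ hη.schwartz with hφ
    have hφF : 𝓕 φ = hη.schwartz := by rw [hφ, FourierTransform.fourier_fourierInv_eq]
    have e1 := inner_schwartz_fourier (SchwartzMap.derivCLM ℂ ℂ φ) G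
    have e2 := inner_schwartz_fourier φ F
    have e3 : ∫ x, (starRingEnd ℂ) (SchwartzMap.derivCLM ℂ ℂ φ x) * G x =
        ∫ x, (starRingEnd ℂ) (SchwartzMap.derivCLM ℂ ℂ φ x) * (E x : ℂ) :=
      integral_congr_ae (hEc.coeFn_toLp.mono fun x hx => by simp only [hG, hx])
    have e4 : ∫ x, (starRingEnd ℂ) (φ x) * F x = ∫ x, (starRingEnd ℂ) (φ x) * (f x : ℂ) :=
      integral_congr_ae (hfc.coeFn_toLp.mono fun x hx => by simp only [hF, hx])
    rw [e3, hP.integral_conj_schwartz hE hf, ← e4, ← e2, hφF] at e1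
    simp only [fourier_derivCLM_apply, hφF, map_mul, hη.schwartz_apply] at e1
    have e5 : ∀ ξ : ℝ, (starRingEnd ℂ) (2 * Real.pi * Complex.I * ξ) = -derivSymbol ξ :=
      fun ξ => conj_derivSymbol ξ
    simp only [← map_mul, e5] at e1
    simp only [Complex.conj_ofReal, neg_mul, integral_neg, neg_inj] at e1
    rw [Eq.comm] at e1
    simp only [Complex.real_smul]
    rw [e1]
    refine integral_congr_ae (Eventually.of_forall fun ξ => ?_)
    simp only; ring
  have h1 : eLpNorm (fun ξ : ℝ => (((2 * Real.pi * |ξ|)⁻¹ : ℝ) : ℂ) * (𝓕 F : Lp ℂ 2 volume) ξ) 2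
      volume = eLpNorm (𝓕 G : Lp ℂ 2 volume) 2 volume := by
    refine eLpNorm_congr_enorm_ae ?_
    filter_upwards [hae, ae_ne_zero] with ξ h1 h2
    rw [h1, enorm_mul, ← enorm_derivSymbol_inv, ← enorm_mul, ← mul_assoc,
      inv_mul_cancel₀ (derivSymbol_ne_zero h2), one_mul]
  rw [h1]
  have h2 : eLpNorm (𝓕 G : Lp ℂ 2 volume) 2 volume = eLpNorm G 2 volume := by
    have : ‖𝓕 G‖ = ‖G‖ := Lp.norm_fourier_eq G
    rw [Lp.norm_def, Lp.norm_def] at this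
    exact (ENNReal.toReal_eq_toReal_iff' (Lp.eLpNorm_ne_top _) (Lp.eLpNorm_ne_top _)).1 this
  rw [h2, eLpNorm_congr_ae hEc.coeFn_toLp]
  refine le_of_eq (eLpNorm_congr_enorm_ae (Eventually.of_forall fun x => ?_))
  rw [← ofReal_norm, ← ofReal_norm, Complex.norm_real]

theorem hMinusOneNorm_congr {f₁ f₂ : ℝ → ℝ} (h : f₁ =ᵐ[volume] f₂) :
    hMinusOneNorm f₁ = hMinusOneNorm f₂ := by
  have hc : (fun x => (f₁ x : ℂ)) =ᵐ[volume] fun x => (f₂ x : ℂ) := h.mono fun x hx => by simp [hx]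
  by_cases h1 : MemLp (fun x => (f₁ x : ℂ)) 2 volume
  · have h2 := (memLp_congr_ae hc).1 h1
    have : h1.toLp _ = h2.toLp _ := (MemLp.toLp_eq_toLp_iff h1 h2).2 hc
    rw [hMinusOneNorm, hMinusOneNorm, dif_pos h1, dif_pos h2, this]
  · have h2 : ¬MemLp (fun x => (f₂ x : ℂ)) 2 volume := fun h => h1 ((memLp_congr_ae hc).2 h)
    rw [hMinusOneNorm, hMinusOneNorm, dif_neg h1, dif_neg h2]

theorem capNorm_congr {f₁ f₂ : ℝ → ℝ} (m : ℕ) (h : f₁ =ᵐ[volume] f₂) :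
    capNorm m f₁ = capNorm m f₂ := by
  rw [capNorm, capNorm, sobolevNorm_congr m h, hMinusOneNorm_congr h]

/-- Dual characterization of square integrable primitives. -/
theorem exists_prim_of_dual {f : ℝ → ℝ} (hf : LocallyIntegrable f) {B : ℝ} (hB : 0 ≤ B)
    (h : ∀ ψ, IsTest ψ → |∫ x, f x * ψ x| ≤ B * l2 (deriv ψ)) :
    ∃ E, Prim E f ∧ MemLp E 2 volume ∧ eLpNorm E 2 volume ≤ ENNReal.ofReal B := by
  obtain ⟨g, h1, h2, h3⟩ := exists_l2_of_test_bound 1 hB (fun ψ => -∫ x, f x * ψ x)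
    (fun ψ χ hψ hχ => by
      have := integral_mul_test_add hf 0 hψ hχ
      simp only [iteratedDeriv_zero] at this
      rw [this]; ring)
    (fun c ψ hψ => by
      have := integral_mul_test_smul (f := f) 0 c hψ
      simp only [iteratedDeriv_zero] at this
      rw [this]; ring)
    (fun ψ hψ => by rw [abs_neg, iteratedDeriv_one]; exact h ψ hψ)
  obtain ⟨E, hE, hP⟩ := exists_prim_of_weak (h1.locallyIntegrable (by norm_num)) hf
    fun ψ hψ => by rw [← iteratedDeriv_one, ← h3 ψ hψ]
  exact ⟨E, hP, (memLp_congr_ae hE).1 h1, by rwa [← eLpNorm_congr_ae hE]⟩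

theorem Prim.dual {E f : ℝ → ℝ} (hP : Prim E f) (hE : MemLp E 2 volume) {B : ℝ} (hB : 0 ≤ B)
    (hEB : eLpNorm E 2 volume ≤ ENNReal.ofReal B) {ψ : ℝ → ℝ} (hψ : IsTest ψ) :
    |∫ x, f x * ψ x| ≤ B * l2 (deriv ψ) := by
  have := hP.integral_mul_deriv (hψ.1.of_le (by exact_mod_cast le_top)) hψ.2
  rw [← abs_neg, ← this]
  exact (abs_integral_mul_le hE (hψ.deriv.memLp 2)).trans
    (mul_le_mul_of_nonneg_right (l2_le_of_le hB hEB) (l2_nonneg _))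

/-! ### Gagliardo–Nirenberg inequalities and tame products. -/

theorem hasDerivAt_abs_rpow_mul_self {q : ℝ} (hq : 0 < q) (y : ℝ) :
    HasDerivAt (fun y : ℝ => |y| ^ q * y) ((q + 1) * |y| ^ q) y := by
  rcases eq_or_ne y 0 with rfl | hy
  -- At the origin the difference quotient is |y|^q, which tends to 0.
  · rw [abs_zero, Real.zero_rpow hq.ne', mul_zero, hasDerivAt_iff_tendsto_slope]
    have h1 : Tendsto (fun y : ℝ => |y| ^ q) (𝓝[≠] 0) (𝓝 0) := by
      have : Continuous fun y : ℝ => |y| ^ q := continuous_abs.rpow_const fun _ => Or.inr hq.le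
      have := this.tendsto 0
      rw [abs_zero, Real.zero_rpow hq.ne'] at this
      exact this.mono_left nhdsWithin_le_nhds
    refine h1.congr' ?_
    filter_upwards [self_mem_nhdsWithin] with y hy
    have hy' : y ≠ 0 := hy
    rw [slope_def_field]
    simp [hy']
  · have h1 : HasDerivAt (fun y : ℝ => |y| ^ q) (SignType.sign y * q * |y| ^ (q - 1)) y :=
      (hasDerivAt_abs hy).rpow_const (Or.inl (abs_ne_zero.2 hy))
    have h2 := h1.mul (hasDerivAt_id y)
    refine h2.congr_deriv ?_
    have h3 : |y| ^ q = |y| ^ (q - 1) * |y| := by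
      rw [← Real.rpow_add_one (abs_ne_zero.2 hy)]; simp
    have h4 : (SignType.sign y : ℝ) * y = |y| := sign_mul_self y
    rw [h3]
    simp only [id]
    linear_combination q * |y| ^ (q - 1) * h4

theorem Prim.abs_rpow_mul_self {h w : ℝ → ℝ} (hP : Prim h w) {q : ℝ} (hq : 0 < q) :
    Prim (fun x => |h x| ^ q * h x) (fun x => (q + 1) * |h x| ^ q * w x) := by
  refine hP.comp_lipschitz (θ := fun y => |y| ^ q * y) (θ' := fun y => (q + 1) * |y| ^ q)
    (fun a b => ?_) fun x => hasDerivAt_abs_rpow_mul_self hq _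
  obtain ⟨r, hr⟩ :=
    ((isCompact_uIcc (a := a) (b := b)).image hP.continuous).isBounded.subset_closedBall 0
  refine ⟨((q + 1) * |r| ^ q).toNNReal, LipschitzOnWith.mono ?_ hr⟩
  refine (convex_closedBall (0 : ℝ) r).lipschitzOnWith_of_nnnorm_hasDerivWithin_le
    (fun y _ => (hasDerivAt_abs_rpow_mul_self hq y).hasDerivWithinAt) fun y hy => ?_
  rw [← NNReal.coe_le_coe, coe_nnnorm, Real.coe_toNNReal _ (by positivity), Real.norm_eq_abs,
    abs_of_nonneg (by positivity)]
  have : |y| ≤ |r| := by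
    simp at hy; exact hy.trans (le_abs_self r)
  gcongr

theorem memLp_of_bdd_of_two_le {h : ℝ → ℝ} {H p : ℝ} (hp : 2 ≤ p) (hb : ∀ x, |h x| ≤ H)
    (h2 : MemLp h 2 volume) : MemLp h (ENNReal.ofReal p) volume := by
  refine ⟨h2.1, ?_⟩
  have hp0 : 0 < p := by linarith
  have hH : 0 ≤ H := (abs_nonneg _).trans (hb 0)
  rw [eLpNorm_lt_top_iff_lintegral_rpow_enorm_lt_top (by simpa using hp0) (by simp),
    ENNReal.toReal_ofReal hp0.le]
  have h3 := (eLpNorm_lt_top_iff_lintegral_rpow_enorm_lt_top (by norm_num) (by norm_num)).1 h2.2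
  have h4 : ∀ x, ‖h x‖ₑ ^ p ≤ ENNReal.ofReal H ^ (p - 2) * ‖h x‖ₑ ^ (2 : ℝ) := by
    intro x
    have : p = (p - 2) + 2 := by ring
    conv_lhs => rw [this, ENNReal.rpow_add_of_nonneg _ _ (by linarith) (by norm_num)]
    gcongr
    rw [← ofReal_norm]
    exact ENNReal.ofReal_le_ofReal (hb x)
  refine (lintegral_mono h4).trans_lt ?_
  rw [lintegral_const_mul' _ _ (ENNReal.rpow_ne_top_of_nonneg (by linarith) ENNReal.ofReal_ne_top)]
  exact ENNReal.mul_lt_top (ENNReal.rpow_lt_top_of_nonneg (by linarith) ENNReal.ofReal_ne_top)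
    (by simpa using h3)

/-- The basic interpolation step of the Gagliardo-Nirenberg inequality. -/
theorem eLpNorm_sq_le_of_prim {f h w : ℝ → ℝ} {p H : ℝ} (hp : 2 < p) {q₀ q₁ : ℝ≥0∞}
    (hq : q₀⁻¹ + q₁⁻¹ = ENNReal.ofReal (2 / p)) (hf : Prim f h) (hh : Prim h w)
    (hb : ∀ x, |h x| ≤ H) (h2 : MemLp h 2 volume) (w2 : MemLp w 2 volume)
    (hv : MemLp (fun x => f x * |h x| ^ (p - 2)) 2 volume) :
    eLpNorm h (ENNReal.ofReal p) volume ^ 2 ≤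
      ENNReal.ofReal (p - 1) * (eLpNorm f q₀ volume * eLpNorm w q₁ volume) := by
  have hp0 : 0 < p := by linarith
  set N := eLpNorm h (ENNReal.ofReal p) volume with hN
  have hNtop : N ≠ ⊤ := (memLp_of_bdd_of_two_le hp.le hb h2).2.ne
  have hsp : ∀ x, |h x| ^ p = |h x| ^ (p - 2) * h x * h x := by
    intro x
    rw [mul_assoc, ← abs_mul_abs_self (h x), ← pow_two, ← Real.rpow_natCast,
      ← Real.rpow_add_of_nonneg (abs_nonneg _) (by linarith) (by norm_num)]
    congr 1; push_cast; ring
  have i1 : Integrable fun x => h x * (|h x| ^ (p - 2) * h x) := by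
    have h3 : MemLp (fun x => h x * |h x| ^ (p - 2)) 2 volume :=
      h2.mul_bdd (S := H ^ (p - 2))
        ((hh.continuous.abs.rpow_const fun _ => Or.inr (by linarith)).aestronglyMeasurable)
        fun x => by
          rw [abs_of_nonneg (by positivity)]
          exact Real.rpow_le_rpow (abs_nonneg _) (hb x) (by linarith)
    refine (h3.mul_integrable h2).congr (Eventually.of_forall fun x => ?_)
    simp only; ring
  have i2 : Integrable fun x => f x * ((p - 2 + 1) * |h x| ^ (p - 2) * w x) := by
    refine ((hv.mul_integrable w2).const_mul (p - 2 + 1)).congr (Eventually.of_forall fun x => ?_)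
    simp only; ring
  have i3 : Integrable fun x => f x * (|h x| ^ (p - 2) * h x) := by
    refine (hv.mul_integrable h2).congr (Eventually.of_forall fun x => ?_)
    simp only; ring
  -- The derivative of f |h|^{p-2} h is |h|^p + (p - 1) f |h|^{p-2} w, and its integral is zero.
  -- This expresses the p-th power of the norm of `h` through `f` and `w`.
  have hz := (hf.mul (hh.abs_rpow_mul_self (q := p - 2) (by linarith))).integral_eq_zero_of_integrable
    i3 (i1.add i2)
  rw [integral_add i1 i2] at hz
  have e1 : ∫ x, |h x| ^ p = -((p - 1) * ∫ x, f x * w x * |h x| ^ (p - 2)) := by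
    have a1 : ∫ x, |h x| ^ p = ∫ x, h x * (|h x| ^ (p - 2) * h x) :=
      integral_congr_ae (Eventually.of_forall fun x => by simp only [hsp]; ring)
    have a2 : ∫ x, f x * ((p - 2 + 1) * |h x| ^ (p - 2) * w x) =
        (p - 1) * ∫ x, f x * w x * |h x| ^ (p - 2) := by
      rw [← integral_const_mul]
      exact integral_congr_ae (Eventually.of_forall fun x => by simp only; ring)
    rw [a1, ← a2]; linarith
  have i4 : Integrable fun x => f x * w x * |h x| ^ (p - 2) := by
    refine (hv.mul_integrable w2).congr (Eventually.of_forall fun x => ?_)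
    simp only; ring
  have e2 : N ^ p = ENNReal.ofReal (∫ x, |h x| ^ p) := by
    rw [ofReal_integral_eq_lintegral_ofReal
      (i1.congr (Eventually.of_forall fun x => by simp only [hsp]; ring))
      (Eventually.of_forall fun x => by positivity), hN,
      eLpNorm_eq_lintegral_rpow_enorm_toReal (by simpa using hp0) (by simp),
      ENNReal.toReal_ofReal hp0.le, ← ENNReal.rpow_mul, one_div, inv_mul_cancel₀ hp0.ne',
      ENNReal.rpow_one]
    refine lintegral_congr fun x => ?_
    rw [← ofReal_norm, ENNReal.ofReal_rpow_of_nonneg (norm_nonneg _) hp0.le, Real.norm_eq_abs]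
  have e3 : ENNReal.ofReal (∫ x, |h x| ^ p) ≤ ENNReal.ofReal (p - 1) *
      eLpNorm (fun x => f x * w x * |h x| ^ (p - 2)) 1 volume := by
    rw [eLpNorm_one_eq_lintegral_enorm, ← ofReal_integral_norm_eq_lintegral_enorm i4,
      ← ENNReal.ofReal_mul (by linarith)]
    refine ENNReal.ofReal_le_ofReal ?_
    rw [e1, ← mul_neg]
    refine mul_le_mul_of_nonneg_left ?_ (by linarith)
    exact (neg_le_abs _).trans (abs_integral_le_integral_abs)
  -- Hölder's inequality: the factors f and w together take the reciprocal exponent 2/p, and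
  -- |h|^{p-2} takes the remaining (p - 2)/p.
  have hr : ENNReal.HolderTriple q₀ q₁ (ENNReal.ofReal (p / 2)) := ⟨by
    rw [hq, ← ENNReal.ofReal_inv_of_pos (by positivity), inv_div]⟩
  have hs : ENNReal.HolderTriple (ENNReal.ofReal (p / 2)) (ENNReal.ofReal (p / (p - 2))) 1 := ⟨by
    rw [← ENNReal.ofReal_inv_of_pos (by positivity), ← ENNReal.ofReal_inv_of_pos
      (div_pos hp0 (by linarith)), ← ENNReal.ofReal_add (by positivity)
      (inv_nonneg.2 (div_nonneg hp0.le (by linarith))), inv_one, ← ENNReal.ofReal_one]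
    congr 1
    rw [inv_div, inv_div, ← add_div, div_eq_one_iff_eq hp0.ne']
    ring⟩
  have hmh : AEStronglyMeasurable (fun x => |h x| ^ (p - 2)) volume :=
    (hh.continuous.abs.rpow_const fun _ => Or.inr (by linarith)).aestronglyMeasurable
  have e4 : eLpNorm (fun x => f x * w x * |h x| ^ (p - 2)) 1 volume ≤
      eLpNorm f q₀ volume * eLpNorm w q₁ volume * N ^ (p - 2) := by
    have b1 := eLpNorm_smul_le_mul_eLpNorm (p := ENNReal.ofReal (p / 2))
      (q := ENNReal.ofReal (p / (p - 2))) (r := 1) hmh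
      (hf.continuous.aestronglyMeasurable.mul w2.1)
    have b2 := eLpNorm_smul_le_mul_eLpNorm (p := q₀) (q := q₁) (r := ENNReal.ofReal (p / 2)) w2.1
      hf.continuous.aestronglyMeasurable
    have b3 : eLpNorm (fun x => |h x| ^ (p - 2)) (ENNReal.ofReal (p / (p - 2))) volume =
        N ^ (p - 2) := by
      have := eLpNorm_norm_rpow (p := ENNReal.ofReal (p / (p - 2))) (μ := volume) h
        (show 0 < p - 2 by linarith)
      simp only [Real.norm_eq_abs] at this
      rw [this, ← ENNReal.ofReal_mul (div_nonneg hp0.le (by linarith)),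
        div_mul_cancel₀ _ (by linarith)]
    rw [b3] at b1
    exact b1.trans (by gcongr; exact b2)
  -- The estimate so far reads N^p ≤ (p - 1)‖f‖‖w‖ N^{p-2}; cancelling the last factor needs 0 < N <
  -- ∞.
  rcases eq_or_ne N 0 with h0 | h0
  · rw [h0]; simp
  · have e5 : N ^ 2 * N ^ (p - 2) ≤
        ENNReal.ofReal (p - 1) * (eLpNorm f q₀ volume * eLpNorm w q₁ volume) * N ^ (p - 2) := by
      have : N ^ 2 * N ^ (p - 2) = N ^ p := by
        rw [← ENNReal.rpow_natCast, ← ENNReal.rpow_add _ _ h0 hNtop]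
        congr 1; push_cast; ring
      rw [this, e2, mul_assoc]
      exact e3.trans (by gcongr)
    exact (ENNReal.mul_le_mul_iff_left (ENNReal.rpow_pos (pos_iff_ne_zero.2 h0) hNtop).ne'
      (ENNReal.rpow_ne_top_of_nonneg (by linarith) hNtop)).1 e5

/-- A bounded function whose derivatives of orders `1, …, m` are square integrable. -/
structure BddJet (m : ℕ) (A : ℝ) (g : ℝ → ℝ) : Prop where
  bdd : ∀ x, |g x| ≤ A
  prim : ∀ i < m, Prim (iteratedDeriv i g) (iteratedDeriv (i + 1) g)
  memLp : ∀ i, 1 ≤ i → i ≤ m → MemLp (iteratedDeriv i g) 2 volume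

/-- The exponent `2m/i`. -/
noncomputable def gnExp (m i : ℕ) : ℝ≥0∞ := (ENNReal.ofReal (i / (2 * m)))⁻¹

theorem gnExp_inv (m i : ℕ) : (gnExp m i)⁻¹ = ENNReal.ofReal (i / (2 * m)) := inv_inv _

theorem gnExp_eq {m i : ℕ} (hi : 1 ≤ i) (hm : 1 ≤ m) : gnExp m i = ENNReal.ofReal (2 * m / i) := by
  have h1 : (0 : ℝ) < i := by exact_mod_cast hi
  have h2 : (0 : ℝ) < m := by exact_mod_cast hm
  rw [gnExp, ← ENNReal.ofReal_inv_of_pos (by positivity), inv_div]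

theorem gnExp_zero (m : ℕ) : gnExp m 0 = ⊤ := by simp [gnExp]

theorem gnExp_self {m : ℕ} (hm : 1 ≤ m) : gnExp m m = 2 := by
  have h2 : (0 : ℝ) < m := by exact_mod_cast hm
  rw [gnExp_eq hm hm, mul_div_assoc, div_self h2.ne']; simp

namespace BddJet

variable {m : ℕ} {A : ℝ} {g : ℝ → ℝ}

theorem exists_bound (h : BddJet m A g) {i : ℕ} (hi : i < m) :
    ∃ H, ∀ x, |iteratedDeriv i g x| ≤ H := by
  rcases Nat.eq_zero_or_pos i with rfl | hpos
  · exact ⟨A, by simpa using h.bdd⟩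
  · exact ⟨_, (h.prim i hi).abs_le (h.memLp i hpos hi.le) (h.memLp (i + 1) (by omega) hi)⟩

theorem memLp_gnExp (h : BddJet m A g) {i : ℕ} (hi : 1 ≤ i) (him : i ≤ m) :
    MemLp (iteratedDeriv i g) (gnExp m i) volume := by
  rcases him.lt_or_eq with hlt | rfl
  · obtain ⟨H, hH⟩ := h.exists_bound hlt
    rw [gnExp_eq hi (by omega)]
    refine memLp_of_bdd_of_two_le ?_ hH (h.memLp i hi him)
    rw [le_div_iff₀ (by exact_mod_cast hi)]
    have : (i : ℝ) ≤ m := by exact_mod_cast him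
    linarith
  · rw [gnExp_self hi]; exact h.memLp i hi le_rfl

theorem eLpNorm_zero_le (h : BddJet m A g) :
    eLpNorm (iteratedDeriv 0 g) (gnExp m 0) volume ≤ ENNReal.ofReal A := by
  rw [gnExp_zero, iteratedDeriv_zero, eLpNorm_exponent_top]
  exact eLpNormEssSup_le_of_ae_bound (Eventually.of_forall fun x => by
    rw [Real.norm_eq_abs]; exact h.bdd x)

theorem eLpNorm_ne_top (h : BddJet m A g) {i : ℕ} (him : i ≤ m) :
    eLpNorm (iteratedDeriv i g) (gnExp m i) volume ≠ ⊤ := by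
  rcases Nat.eq_zero_or_pos i with rfl | hpos
  · exact (h.eLpNorm_zero_le.trans_lt ENNReal.ofReal_lt_top).ne
  · exact (h.memLp_gnExp hpos him).2.ne

/-- The reciprocal exponents i/(2m) and (i + 2)/(2m) add up to 2/p for p = 2m/(i + 1), which is the
condition of the interpolation step. Since p - 1 ≤ 2m, the constant does not depend on i. -/
theorem sq_le (h : BddJet m A g) {i : ℕ} (hi : i + 2 ≤ m) :
    eLpNorm (iteratedDeriv (i + 1) g) (gnExp m (i + 1)) volume ^ 2 ≤
      ENNReal.ofReal (2 * m) * (eLpNorm (iteratedDeriv i g) (gnExp m i) volume *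
        eLpNorm (iteratedDeriv (i + 2) g) (gnExp m (i + 2)) volume) := by
  set p : ℝ := 2 * m / ((i + 1 : ℕ) : ℝ) with hp
  have hi0 : (0 : ℝ) < ((i + 1 : ℕ) : ℝ) := by positivity
  have hm0 : (0 : ℝ) < m := by
    have : 0 < m := by omega
    exact_mod_cast this
  have hmi : ((i + 1 : ℕ) : ℝ) + 1 ≤ m := by exact_mod_cast hi
  have hi1 : (1 : ℝ) ≤ ((i + 1 : ℕ) : ℝ) := by exact_mod_cast Nat.succ_pos i
  have hp2 : 2 < p := by
    rw [hp, lt_div_iff₀ hi0]; linarith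
  have hpm : p ≤ 2 * m := div_le_self (by positivity) hi1
  obtain ⟨H, hH⟩ := h.exists_bound (show i + 1 < m by omega)
  have hH0 : 0 ≤ H := (abs_nonneg _).trans (hH 0)
  obtain ⟨H', hH'⟩ := h.exists_bound (show i < m by omega)
  have c1 := (h.prim (i + 1) (by omega)).continuous
  have c0 := (h.prim i (by omega)).continuous
  have cq : ∀ {q : ℝ}, 0 ≤ q → Continuous fun x => |iteratedDeriv (i + 1) g x| ^ q :=
    fun {q} hq => c1.abs.rpow_const fun _ => Or.inr hq
  have bq : ∀ {q : ℝ}, 0 ≤ q → ∀ x, |iteratedDeriv (i + 1) g x| ^ q ≤ H ^ q := fun {q} hq x =>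
    Real.rpow_le_rpow (abs_nonneg _) (hH x) hq
  have hv : MemLp (fun x => iteratedDeriv i g x * |iteratedDeriv (i + 1) g x| ^ (p - 2)) 2
      volume := by
    -- For i = 0 the function `g` is bounded but need not be square integrable. One power of |g'|
    -- then provides the integrability, and p = 2m ≥ 4 leaves the nonnegative exponent p - 3.
    rcases Nat.eq_zero_or_pos i with hi0 | hpos
    · have hp4 : 3 ≤ p := by
        have : (2 : ℝ) ≤ m := by exact_mod_cast (by omega : 2 ≤ m)
        rw [hp, hi0]; norm_num; linarith
      have h3 : MemLp (fun x => |iteratedDeriv (i + 1) g x| *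
          (iteratedDeriv i g x * |iteratedDeriv (i + 1) g x| ^ (p - 3))) 2 volume := by
        refine (h.memLp (i + 1) (by omega) (by omega)).norm.mul_bdd (S := H' * H ^ (p - 3))
          (c0.mul (cq (by linarith))).aestronglyMeasurable fun x => ?_
        rw [abs_mul, abs_of_nonneg (Real.rpow_nonneg (abs_nonneg _) _)]
        exact mul_le_mul (hH' x) (bq (by linarith) x) (by positivity)
          ((abs_nonneg _).trans (hH' x))
      refine (memLp_congr_ae (Eventually.of_forall fun x => ?_)).1 h3
      have : p - 2 = 1 + (p - 3) := by ring
      rw [this, Real.rpow_add_of_nonneg (abs_nonneg _) (by norm_num) (by linarith),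
        Real.rpow_one]
      ring
    · refine (h.memLp i hpos (by omega)).mul_bdd (S := H ^ (p - 2))
        (cq (by linarith)).aestronglyMeasurable fun x => ?_
      rw [abs_of_nonneg (by positivity)]
      exact bq (by linarith) x
  have key := eLpNorm_sq_le_of_prim (q₀ := gnExp m i) (q₁ := gnExp m (i + 2)) hp2 (by
      rw [gnExp_inv, gnExp_inv, ← ENNReal.ofReal_add (by positivity) (by positivity)]
      congr 1
      rw [hp]; push_cast; field_simp; ring)
    (h.prim i (by omega)) (h.prim (i + 1) (by omega)) hH (h.memLp (i + 1) (by omega) (by omega))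
    (h.memLp (i + 2) (by omega) hi) hv
  rw [← gnExp_eq (by omega) (by omega)] at key
  refine key.trans ?_
  gcongr
  linarith

end BddJet

/-- A discrete maximum principle for sequences that are log-convex up to a constant. -/
theorem le_of_sq_le_mul {m : ℕ} {K : ℝ} (hK : 1 ≤ K) {c : ℕ → ℝ} (hc : ∀ i, 0 ≤ c i)
    (h : ∀ i, i + 2 ≤ m → c (i + 1) ^ 2 ≤ K ^ 2 * (c i * c (i + 2))) {i : ℕ} (hi : i ≤ m) :
    c i ≤ K ^ (m ^ 2) * (c 0 + c m) := by
  -- The sequence i² has second difference 2, so this weight absorbs K² and makes `d` log-convex.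
  set d : ℕ → ℝ := fun i => c i * K ^ (i ^ 2) with hd
  have hd0 : ∀ i, 0 ≤ d i := fun i => mul_nonneg (hc i) (by positivity)
  have hdc : ∀ i, i + 2 ≤ m → d (i + 1) ^ 2 ≤ d i * d (i + 2) := by
    intro i hi
    calc d (i + 1) ^ 2 = c (i + 1) ^ 2 * (K ^ ((i + 1) ^ 2)) ^ 2 := by simp only [hd]; ring
      _ ≤ K ^ 2 * (c i * c (i + 2)) * (K ^ ((i + 1) ^ 2)) ^ 2 := by gcongr; exact h i hi
      _ = d i * d (i + 2) := by simp only [hd]; ring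
  have hmax : ∀ i ≤ m, d i ≤ max (d 0) (d m) := by
    by_contra hcon
    push Not at hcon
    obtain ⟨i₀, hi₀, hlt₀⟩ := hcon
    obtain ⟨j, hj, hjmax⟩ := (Finset.range (m + 1)).exists_max_image d ⟨0, by simp⟩
    have hex : ∃ j, j ≤ m ∧ ∀ i ≤ m, d i ≤ d j :=
      ⟨j, by simpa [Nat.lt_succ_iff] using hj, fun i hi => hjmax i (by simp; omega)⟩
    classical
    -- The least index at which the maximum is attained. If it were interior, its left neighbour
    -- would be strictly smaller and its right neighbour not larger, against log-convexity.
    set j₀ := Nat.find hex with hj₀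
    obtain ⟨h1, h2⟩ := Nat.find_spec hex
    have hgt : max (d 0) (d m) < d j₀ := hlt₀.trans_le (h2 i₀ hi₀)
    have hne0 : j₀ ≠ 0 := fun h0 => by
      rw [h0] at hgt; exact absurd (le_max_left (d 0) (d m)) (not_le.2 hgt)
    have hnem : j₀ ≠ m := fun h0 => by
      rw [h0] at hgt; exact absurd (le_max_right (d 0) (d m)) (not_le.2 hgt)
    obtain ⟨k, hk⟩ := Nat.exists_eq_succ_of_ne_zero hne0
    have hkm : k + 2 ≤ m := by omega
    have hlt : d k < d j₀ := by
      by_contra hcon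
      refine Nat.find_min hex (m := k) (by omega) ⟨by omega, fun i hi => ?_⟩
      exact (h2 i hi).trans (not_lt.1 hcon)
    have h3 := hdc k hkm
    have h4 : d (k + 2) ≤ d j₀ := h2 _ hkm
    rw [← Nat.succ_eq_add_one, ← hk] at h3
    have hpos : 0 < d j₀ := (hd0 0).trans_lt ((le_max_left _ _).trans_lt hgt)
    nlinarith [hd0 k, hd0 (k + 2)]
  have h1 : c i ≤ d i := le_mul_of_one_le_right (hc i) (one_le_pow₀ hK)
  have h2 : max (d 0) (d m) ≤ K ^ (m ^ 2) * (c 0 + c m) := by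
    have hKm : 1 ≤ K ^ (m ^ 2) := one_le_pow₀ hK
    refine max_le ?_ ?_
    · simp only [hd, ne_eq, OfNat.ofNat_ne_zero, not_false_eq_true, zero_pow, pow_zero, mul_one]
      nlinarith [hc 0, hc m]
    · simp only [hd]
      nlinarith [hc 0, hc m]
  exact h1.trans ((hmax i hi).trans h2)

/-- Tame estimate for products of derivatives of total order `m`. -/
theorem BddJet.l2_mul_le {m : ℕ} (hm : 1 ≤ m) {A B : ℝ} {f g : ℝ → ℝ} (hf : BddJet m A f)
    (hg : BddJet m B g) {i : ℕ} (hi : i ≤ m) :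
    MemLp (fun x => iteratedDeriv i f x * iteratedDeriv (m - i) g x) 2 volume ∧
      l2 (fun x => iteratedDeriv i f x * iteratedDeriv (m - i) g x) ≤
      (2 * m) ^ (m ^ 2) * (A * l2 (iteratedDeriv m g) + B * l2 (iteratedDeriv m f)) := by
  have hm1 : (1 : ℝ) ≤ m := by exact_mod_cast hm
  have hA : 0 ≤ A := (abs_nonneg _).trans (hf.bdd 0)
  have hB : 0 ≤ B := (abs_nonneg _).trans (hg.bdd 0)
  set a : ℕ → ℝ≥0∞ := fun i => eLpNorm (iteratedDeriv i f) (gnExp m i) volume with ha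
  set b : ℕ → ℝ≥0∞ := fun i => eLpNorm (iteratedDeriv i g) (gnExp m i) volume with hb
  -- Each factor is log-convex up to 2m, so the product is up to (2m)². The product is bounded by
  -- its values at the ends, where one factor is a uniform norm and the other an L² norm of order m;
  -- no intermediate norm survives.
  set c : ℕ → ℝ := fun i => (a i).toReal * (b (m - i)).toReal with hc
  have hac : ∀ i, i + 2 ≤ m → (a (i + 1)).toReal ^ 2 ≤
      2 * m * ((a i).toReal * (a (i + 2)).toReal) := by
    intro i hi
    have := ENNReal.toReal_mono (by
      exact ENNReal.mul_ne_top ENNReal.ofReal_ne_top (ENNReal.mul_ne_top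
        (hf.eLpNorm_ne_top (by omega)) (hf.eLpNorm_ne_top (by omega)))) (hf.sq_le hi)
    rwa [ENNReal.toReal_pow, ENNReal.toReal_mul, ENNReal.toReal_mul,
      ENNReal.toReal_ofReal (by positivity)] at this
  have hbc : ∀ i, i + 2 ≤ m → (b (i + 1)).toReal ^ 2 ≤
      2 * m * ((b i).toReal * (b (i + 2)).toReal) := by
    intro i hi
    have := ENNReal.toReal_mono (by
      exact ENNReal.mul_ne_top ENNReal.ofReal_ne_top (ENNReal.mul_ne_top
        (hg.eLpNorm_ne_top (by omega)) (hg.eLpNorm_ne_top (by omega)))) (hg.sq_le hi)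
    rwa [ENNReal.toReal_pow, ENNReal.toReal_mul, ENNReal.toReal_mul,
      ENNReal.toReal_ofReal (by positivity)] at this
  have hcc := le_of_sq_le_mul (m := m) (K := 2 * m) (by linarith) (c := c)
    (fun i => mul_nonneg ENNReal.toReal_nonneg ENNReal.toReal_nonneg) (fun i hi => by
      have h1 := hac i hi
      have h2 := hbc (m - (i + 2)) (by omega)
      rw [show m - (i + 2) + 1 = m - (i + 1) by omega, show m - (i + 2) + 2 = m - i by omega] at h2
      calc c (i + 1) ^ 2 = (a (i + 1)).toReal ^ 2 * (b (m - (i + 1))).toReal ^ 2 := by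
            simp only [hc]; ring
        _ ≤ (2 * m * ((a i).toReal * (a (i + 2)).toReal)) *
            (2 * m * ((b (m - (i + 2))).toReal * (b (m - i)).toReal)) := by gcongr
        _ = (2 * m) ^ 2 * (c i * c (i + 2)) := by simp only [hc]; ring) hi
  have hmeas : ∀ {A : ℝ} {f : ℝ → ℝ}, BddJet m A f → ∀ i ≤ m,
      AEStronglyMeasurable (iteratedDeriv i f) volume := by
    intro A f hf i hi
    rcases hi.lt_or_eq with hlt | rfl
    · exact (hf.prim i hlt).continuous.aestronglyMeasurable
    · exact (hf.memLp i hm le_rfl).1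
  have hH : ENNReal.HolderTriple (gnExp m i) (gnExp m (m - i)) 2 := ⟨by
    rw [gnExp_inv, gnExp_inv, ← ENNReal.ofReal_add (by positivity) (by positivity),
      Nat.cast_sub hi, ← add_div, ← gnExp_self hm, gnExp_inv]
    congr 2; ring⟩
  have hle : eLpNorm (iteratedDeriv i f • iteratedDeriv (m - i) g) 2 volume ≤
      a i * b (m - i) :=
    eLpNorm_smul_le_mul_eLpNorm (hmeas hg (m - i) (by omega)) (hmeas hf i hi)
  change eLpNorm (fun x => iteratedDeriv i f x * iteratedDeriv (m - i) g x) 2 volume ≤ _ at hle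
  have htop : a i * b (m - i) ≠ ⊤ :=
    ENNReal.mul_ne_top (hf.eLpNorm_ne_top hi) (hg.eLpNorm_ne_top (by omega))
  refine ⟨⟨(hmeas hf i hi).mul (hmeas hg (m - i) (by omega)), hle.trans_lt htop.lt_top⟩, ?_⟩
  have h1 : l2 (fun x => iteratedDeriv i f x * iteratedDeriv (m - i) g x) ≤ c i := by
    have := ENNReal.toReal_mono htop hle
    rwa [ENNReal.toReal_mul] at this
  have hA0 : ∀ {A : ℝ} {f : ℝ → ℝ}, 0 ≤ A → BddJet m A f →
      (eLpNorm (iteratedDeriv 0 f) (gnExp m 0) volume).toReal ≤ A := by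
    intro A f hA hf
    have := ENNReal.toReal_mono ENNReal.ofReal_ne_top hf.eLpNorm_zero_le
    rwa [ENNReal.toReal_ofReal hA] at this
  have h2 : c 0 ≤ A * l2 (iteratedDeriv m g) := by
    simp only [hc, Nat.sub_zero, hb, gnExp_self hm]
    exact mul_le_mul_of_nonneg_right (hA0 hA hf) ENNReal.toReal_nonneg
  have h3 : c m ≤ B * l2 (iteratedDeriv m f) := by
    simp only [hc, Nat.sub_self, ha, gnExp_self hm]
    rw [mul_comm]
    exact mul_le_mul_of_nonneg_right (hA0 hB hg) ENNReal.toReal_nonneg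
  refine h1.trans (hcc.trans ?_)
  gcongr

/-! ### Flows of velocity fields. -/

theorem abs_intervalIntegral_le {f : ℝ → ℝ} {C : ℝ} (h : ∀ x, |f x| ≤ C) (a b : ℝ) :
    |∫ x in a..b, f x| ≤ C * |b - a| :=
  intervalIntegral.norm_integral_le_of_norm_le_const (f := f) fun x _ => h x

/-- A field bounded by A cannot leave the ball of radius A(n + 1) during a time n + 1, so
Picard–Lindelöf applies on [-(n + 1), n + 1] for every n. Uniqueness glues the solutions. -/
theorem exists_global_ode_solution {f : ℝ → ℝ → ℝ} {A : ℝ} {K : NNReal}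
    (hf : Continuous (Function.uncurry f)) (hA : ∀ t x, |f t x| ≤ A)
    (hK : ∀ t, LipschitzWith K (f t)) (α : ℝ) :
    ∃ X : ℝ → ℝ, X 0 = α ∧ ∀ t, HasDerivAt X (f t (X t)) t := by
  have hA0 : 0 ≤ A := (abs_nonneg _).trans (hA 0 0)
  have hloc : ∀ n : ℕ, ∃ X : ℝ → ℝ, X 0 = α ∧
      ∀ t ∈ Icc (-((n : ℝ) + 1)) (n + 1), HasDerivWithinAt X (f t (X t))
        (Icc (-((n : ℝ) + 1)) (n + 1)) t := by
    intro n
    have hn : (0 : ℝ) ≤ n := Nat.cast_nonneg n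
    have hP : IsPicardLindelof f (tmin := -((n : ℝ) + 1)) (tmax := n + 1)
        ⟨0, by constructor <;> linarith⟩ α (A.toNNReal * (n + 1)) 0 A.toNNReal K :=
      { lipschitzOnWith := fun t _ => (hK t).lipschitzOnWith
        continuousOn := fun x _ => (hf.comp (Continuous.prodMk_left x)).continuousOn
        norm_le := fun t _ x _ => by
          rw [Real.coe_toNNReal _ hA0]; exact hA t x
        mul_max_le := by simp }
    exact hP.exists_eq_forall_mem_Icc_hasDerivWithinAt₀
  choose Y hY0 hY using hloc
  have hYd : ∀ n : ℕ, ∀ t ∈ Ioo (-((n : ℝ) + 1)) (n + 1), HasDerivAt (Y n) (f t (Y n t)) t :=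
    fun n t ht => (hY n t (Ioo_subset_Icc_self ht)).hasDerivAt (Icc_mem_nhds ht.1 ht.2)
  have huniq : ∀ n m : ℕ, n ≤ m → EqOn (Y n) (Y m) (Icc (-((n : ℝ) + 1)) (n + 1)) := by
    intro n m hnm
    have hn : (0 : ℝ) ≤ n := Nat.cast_nonneg n
    have hnm' : (n : ℝ) ≤ m := by exact_mod_cast hnm
    refine ODE_solution_unique_of_mem_Icc (v := f) (s := fun _ => univ) (K := K) (t₀ := 0)
      (fun t _ => (hK t).lipschitzOnWith) ⟨by linarith, by linarith⟩
      (fun t ht => (hY n t ht).continuousWithinAt) (hYd n) (fun _ _ => mem_univ _)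
      (fun t ht => ((hY m t ⟨by linarith [ht.1], by linarith [ht.2]⟩).continuousWithinAt).mono
        (Icc_subset_Icc (by linarith) (by linarith)))
      (fun t ht => hYd m t ⟨by linarith [ht.1], by linarith [ht.2]⟩) (fun _ _ => mem_univ _)
      (by rw [hY0, hY0])
  refine ⟨fun t => Y ⌈|t|⌉₊ t, by simp [hY0], fun t => ?_⟩
  set n := ⌈|t|⌉₊ with hn
  have htn : |t| ≤ n := Nat.le_ceil _
  have hmem : ∀ τ : ℝ, |τ| < (n : ℝ) + 1 → Y ⌈|τ|⌉₊ τ = Y (n + 1) τ := by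
    intro τ hτ
    have h1 : ⌈|τ|⌉₊ ≤ n + 1 := Nat.ceil_le.2 (by push_cast; exact hτ.le)
    refine huniq _ _ h1 ?_
    have := Nat.le_ceil |τ|
    exact abs_le.1 (this.trans (by linarith))
  have hev : (fun τ => Y ⌈|τ|⌉₊ τ) =ᶠ[𝓝 t] Y (n + 1) := by
    have : {τ : ℝ | |τ| < (n : ℝ) + 1} ∈ 𝓝 t :=
      (isOpen_lt continuous_abs continuous_const).mem_nhds (by simp only [mem_ofPred_eq]; linarith)
    filter_upwards [this] with τ hτ using hmem τ hτ
  have h2 := hYd (n + 1) t (abs_lt.1 (by push_cast; linarith))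
  rw [← hmem t (by linarith)] at h2
  exact h2.congr_of_eventuallyEq hev

/-- A time dependent velocity field with continuous, bounded space derivative. -/
structure VField (A M : ℝ) (u ux : ℝ → ℝ → ℝ) : Prop where
  cont : Continuous (Function.uncurry u)
  cont_x : Continuous (Function.uncurry ux)
  hasDerivAt : ∀ t x, HasDerivAt (u t) (ux t x) x
  bdd : ∀ t x, |u t x| ≤ A
  bdd_x : ∀ t x, |ux t x| ≤ M

/-- `X t α` is the position at time `t` of the particle starting from `α` at time `0`. -/
structure VFlow (A M : ℝ) (u ux X : ℝ → ℝ → ℝ) : Prop where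
  field : VField A M u ux
  init : ∀ α, X 0 α = α
  ode : ∀ t α, HasDerivAt (fun t => X t α) (u t (X t α)) t

theorem VField.exists_flow {A M : ℝ} {u ux : ℝ → ℝ → ℝ} (h : VField A M u ux) :
    ∃ X, VFlow A M u ux X := by
  have hM : 0 ≤ M := (abs_nonneg _).trans (h.bdd_x 0 0)
  have hK : ∀ t, LipschitzWith M.toNNReal (u t) := fun t => by
    refine lipschitzWith_of_nnnorm_deriv_le (fun x => (h.hasDerivAt t x).differentiableAt) fun x => ?_
    rw [(h.hasDerivAt t x).deriv, ← NNReal.coe_le_coe, coe_nnnorm, Real.coe_toNNReal _ hM]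
    exact h.bdd_x t x
  choose Y hY using exists_global_ode_solution h.cont h.bdd hK
  exact ⟨fun t α => Y α t, h, fun α => (hY α).1, fun t α => (hY α).2 t⟩

/-- The Jacobian of the flow. -/
noncomputable def jac (ux X : ℝ → ℝ → ℝ) (t α : ℝ) : ℝ := Real.exp (∫ τ in (0 : ℝ)..t, ux τ (X τ α))

namespace VFlow

variable {A M : ℝ} {u ux X : ℝ → ℝ → ℝ}

theorem M_nonneg (h : VFlow A M u ux X) : 0 ≤ M := (abs_nonneg _).trans (h.field.bdd_x 0 0)

theorem continuous_time (h : VFlow A M u ux X) (α : ℝ) : Continuous fun t => X t α :=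
  continuous_iff_continuousAt.2 fun t => (h.ode t α).continuousAt

/-- The difference of two trajectories solves a linear equation whose coefficient is the mean of ∂ₓu
over the segment between them. The closed formula yields both the Lipschitz bound and the space
derivative of the flow. -/
theorem slope_eq (h : VFlow A M u ux X) (t α β : ℝ) : X t β - X t α = (β - α) *
    Real.exp (∫ τ in (0 : ℝ)..t, ∫ θ in (0 : ℝ)..1, ux τ (X τ α + θ * (X τ β - X τ α))) := by
  set a : ℝ → ℝ := fun τ => ∫ θ in (0 : ℝ)..1, ux τ (X τ α + θ * (X τ β - X τ α)) with ha
  have hac : Continuous a := by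
    refine intervalIntegral.continuous_parametric_intervalIntegral_of_continuous' ?_ _ _
    have h1 := (h.continuous_time α).comp (continuous_fst (X := ℝ) (Y := ℝ))
    have h2 := (h.continuous_time β).comp (continuous_fst (X := ℝ) (Y := ℝ))
    exact h.field.cont_x.comp (continuous_fst.prodMk
      (h1.add (continuous_snd.mul (h2.sub h1))))
  have hu : ∀ τ, u τ (X τ β) - u τ (X τ α) = a τ * (X τ β - X τ α) := by
    intro τ
    have h1 : ∀ θ : ℝ, HasDerivAt (fun θ : ℝ => u τ (X τ α + θ * (X τ β - X τ α)))
        (ux τ (X τ α + θ * (X τ β - X τ α)) * (X τ β - X τ α)) θ := by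
      intro θ
      have h2 : HasDerivAt (fun θ : ℝ => X τ α + θ * (X τ β - X τ α)) (X τ β - X τ α) θ := by
        simpa using ((hasDerivAt_id θ).mul_const (X τ β - X τ α)).const_add (X τ α)
      exact (h.field.hasDerivAt τ _).comp θ h2
    have h3 := intervalIntegral.integral_eq_sub_of_hasDerivAt (a := 0) (b := 1)
      (fun θ _ => h1 θ) (by
        refine Continuous.intervalIntegrable ?_ _ _
        refine Continuous.mul ?_ continuous_const
        exact h.field.cont_x.comp (by fun_prop : Continuous fun θ : ℝ =>
          (τ, X τ α + θ * (X τ β - X τ α))))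
    rw [intervalIntegral.integral_mul_const] at h3
    rw [ha]
    simp only [h3]
    simp
  have hd : ∀ τ, HasDerivAt (fun t => (X t β - X t α) * Real.exp (-∫ τ in (0 : ℝ)..t, a τ)) 0 τ := by
    intro τ
    have h1 := (hac.integral_hasStrictDerivAt 0 τ).hasDerivAt
    have h2 := ((h.ode τ β).sub (h.ode τ α)).mul h1.neg.exp
    refine h2.congr_deriv ?_
    rw [hu τ]
    simp only [Pi.sub_apply, Pi.neg_apply]
    ring
  have hconst := is_const_of_deriv_eq_zero (fun τ => (hd τ).differentiableAt)
    (fun τ => (hd τ).deriv) t 0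
  simp only [intervalIntegral.integral_same, neg_zero, Real.exp_zero, mul_one, h.init] at hconst
  rw [← hconst, mul_assoc, ← Real.exp_add]
  simp

theorem abs_sub_le (h : VFlow A M u ux X) (t α β : ℝ) :
    |X t β - X t α| ≤ |β - α| * Real.exp (M * |t|) := by
  rw [h.slope_eq, abs_mul, abs_of_pos (Real.exp_pos _)]
  refine mul_le_mul_of_nonneg_left (Real.exp_le_exp.2 ?_) (abs_nonneg _)
  refine (le_abs_self _).trans ?_
  have h1 : ∀ τ : ℝ, |∫ θ in (0 : ℝ)..1, ux τ (X τ α + θ * (X τ β - X τ α))| ≤ M := fun τ => by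
    simpa using abs_intervalIntegral_le (fun θ => h.field.bdd_x τ (X τ α + θ * (X τ β - X τ α))) 0 1
  simpa using abs_intervalIntegral_le h1 0 t

theorem continuous (h : VFlow A M u ux X) : Continuous (Function.uncurry X) := by
  rw [continuous_iff_continuousAt]
  rintro ⟨t, α⟩
  have h1 : Tendsto (fun p : ℝ × ℝ => |p.2 - α| * Real.exp (M * |p.1|) + |X p.1 α - X t α|)
      (𝓝 (t, α)) (𝓝 0) := by
    have hc : Continuous fun p : ℝ × ℝ =>
        |p.2 - α| * Real.exp (M * |p.1|) + |X p.1 α - X t α| := by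
      have h2 : Continuous fun p : ℝ × ℝ => X p.1 α := (h.continuous_time α).comp continuous_fst
      exact (by fun_prop : Continuous fun p : ℝ × ℝ => |p.2 - α| * Real.exp (M * |p.1|)).add
        (h2.sub continuous_const).abs
    simpa using hc.tendsto (t, α)
  refine tendsto_iff_dist_tendsto_zero.2 (squeeze_zero (fun _ => dist_nonneg) (fun p => ?_) h1)
  simp only [Function.uncurry, Real.dist_eq]
  exact (_root_.abs_sub_le _ (X p.1 α) _).trans (add_le_add (h.abs_sub_le _ _ _) le_rfl)

theorem continuous_comp (h : VFlow A M u ux X) {g : ℝ → ℝ → ℝ}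
    (hg : Continuous (Function.uncurry g)) :
    Continuous (Function.uncurry fun t α => g t (X t α)) :=
  hg.comp (continuous_fst.prodMk h.continuous)

theorem jac_pos (t α : ℝ) : 0 < jac ux X t α := Real.exp_pos _

theorem jac_hasDerivAt (h : VFlow A M u ux X) (t α : ℝ) :
    HasDerivAt (fun t => jac ux X t α) (ux t (X t α) * jac ux X t α) t := by
  have hc : Continuous fun t => ux t (X t α) :=
    (h.continuous_comp h.field.cont_x).comp (Continuous.prodMk_left α)
  have := (hc.integral_hasStrictDerivAt 0 t).hasDerivAt.exp
  rwa [mul_comm] at this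

theorem jac_continuous (h : VFlow A M u ux X) : Continuous (Function.uncurry (jac ux X)) := by
  refine Real.continuous_exp.comp ?_
  have hc := h.continuous_comp h.field.cont_x
  have := intervalIntegral.continuous_parametric_intervalIntegral_of_continuous (μ := volume)
    (f := fun p : ℝ × ℝ => fun τ => ux τ (X τ p.2)) (a₀ := 0) (s := fun p : ℝ × ℝ => p.1)
    (hc.comp (by fun_prop : Continuous fun q : (ℝ × ℝ) × ℝ => (q.2, q.1.2))) continuous_fst
  exact this

/-- By `slope_eq` the difference quotient is a continuous function of the second point, with the
Jacobian as its value on the diagonal. -/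
theorem hasDerivAt_space (h : VFlow A M u ux X) (t α : ℝ) :
    HasDerivAt (X t) (jac ux X t α) α := by
  set e : ℝ → ℝ := fun β =>
    Real.exp (∫ τ in (0 : ℝ)..t, ∫ θ in (0 : ℝ)..1, ux τ (X τ α + θ * (X τ β - X τ α))) with he
  have hec : Continuous e := by
    refine Real.continuous_exp.comp ?_
    refine intervalIntegral.continuous_parametric_intervalIntegral_of_continuous' ?_ _ _
    refine intervalIntegral.continuous_parametric_intervalIntegral_of_continuous'
      (f := fun p : ℝ × ℝ => fun θ => ux p.2 (X p.2 α + θ * (X p.2 p.1 - X p.2 α))) ?_ 0 1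
    have h1 : Continuous fun q : (ℝ × ℝ) × ℝ => X q.1.2 α :=
      h.continuous.comp (by fun_prop : Continuous fun q : (ℝ × ℝ) × ℝ => (q.1.2, α))
    have h2 : Continuous fun q : (ℝ × ℝ) × ℝ => X q.1.2 q.1.1 :=
      h.continuous.comp (by fun_prop : Continuous fun q : (ℝ × ℝ) × ℝ => (q.1.2, q.1.1))
    exact h.field.cont_x.comp ((continuous_snd.comp continuous_fst).prodMk
      (h1.add (continuous_snd.mul (h2.sub h1))))
  have h0 : e α = jac ux X t α := by simp [he, jac]
  rw [hasDerivAt_iff_tendsto_slope, ← h0]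
  refine ((hec.tendsto α).mono_left nhdsWithin_le_nhds).congr' ?_
  filter_upwards [self_mem_nhdsWithin] with β hβ
  have hβ' : β - α ≠ 0 := sub_ne_zero.2 hβ
  rw [slope_def_field, h.slope_eq, mul_div_cancel_left₀ _ hβ']

theorem jac_le (h : VFlow A M u ux X) (t τ α : ℝ) :
    jac ux X t α ≤ Real.exp (M * |t - τ|) * jac ux X τ α := by
  have hc : Continuous fun t => ux t (X t α) :=
    (h.continuous_comp h.field.cont_x).comp (Continuous.prodMk_left α)
  rw [jac, jac, ← Real.exp_add, Real.exp_le_exp, ← sub_le_iff_le_add,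
    intervalIntegral.integral_interval_sub_left (hc.intervalIntegrable _ _)
      (hc.intervalIntegrable _ _)]
  exact (le_abs_self _).trans (abs_intervalIntegral_le (fun s => h.field.bdd_x s _) _ _)

theorem jac_zero (α : ℝ) : jac ux X 0 α = 1 := by simp [jac]

theorem diffeo (h : VFlow A M u ux X) (t : ℝ) :
    Diffeo (Real.exp (-(M * |t|))) (X t) (jac ux X t) where
  pos := Real.exp_pos _
  hasDerivAt := h.hasDerivAt_space t
  lower := fun α => by
    have := h.jac_le 0 t α
    rw [jac_zero, zero_sub, abs_neg] at this
    rw [Real.exp_neg, inv_le_iff_one_le_mul₀ (Real.exp_pos _), mul_comm]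
    exact this

theorem abs_sub_self_le (h : VFlow A M u ux X) (t α : ℝ) : |X t α - α| ≤ A * |t| := by
  have h1 := intervalIntegral.integral_eq_sub_of_hasDerivAt (a := 0) (b := t)
    (fun τ _ => h.ode τ α) (((h.continuous_comp h.field.cont).comp
      (Continuous.prodMk_left α)).intervalIntegrable _ _)
  rw [h.init] at h1
  rw [← h1]
  simpa using abs_intervalIntegral_le (fun τ => h.field.bdd τ (X τ α)) 0 t

theorem surjective (h : VFlow A M u ux X) (t : ℝ) : Function.Surjective (X t) := by
  refine (h.diffeo t).continuous.surjective ?_ ?_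
  · refine tendsto_atTop_mono (fun α => ?_) (tendsto_atTop_add_const_right _ (-(A * |t|)) tendsto_id)
    have := (abs_le.1 (h.abs_sub_self_le t α)).1
    simp only [id]; linarith
  · refine tendsto_atBot_mono (fun α => ?_) (tendsto_atBot_add_const_right _ (A * |t|) tendsto_id)
    have := (abs_le.1 (h.abs_sub_self_le t α)).2
    simp only [id]; linarith

theorem integral_comp (h : VFlow A M u ux X) (t : ℝ) (g : ℝ → ℝ) :
    ∫ α, g (X t α) * jac ux X t α = ∫ x, g x := by
  have h1 := integral_image_eq_integral_abs_deriv_smul MeasurableSet.univ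
    (fun x _ => ((h.diffeo t).hasDerivAt x).hasDerivWithinAt)
    (h.diffeo t).strictMono.injective.injOn g
  rw [image_univ, (h.surjective t).range_eq, Measure.restrict_univ] at h1
  rw [h1]
  refine integral_congr_ae (Eventually.of_forall fun α => ?_)
  simp only [smul_eq_mul, abs_of_pos (jac_pos (ux := ux) (X := X) t α)]
  ring

/-- The flow map is a bijection of the line, and the weight √J makes the composition with it an
isometry of L². Splitting J into two square roots is what yields the exponent M|t|/2 in the
estimates. -/
theorem eLpNorm_comp (h : VFlow A M u ux X) (t : ℝ) (g : ℝ → ℝ) :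
    eLpNorm (fun α => g (X t α) * √(jac ux X t α)) 2 volume = eLpNorm g 2 volume := by
  have h1 := lintegral_image_eq_lintegral_abs_deriv_mul (MeasurableSet.univ)
    (fun x _ => ((h.diffeo t).hasDerivAt x).hasDerivWithinAt)
    (h.diffeo t).strictMono.injective.injOn (fun x => ‖g x‖ₑ ^ (2 : ℝ))
  rw [image_univ, (h.surjective t).range_eq, Measure.restrict_univ] at h1
  rw [eLpNorm_eq_lintegral_rpow_enorm_toReal (by norm_num) (by norm_num),
    eLpNorm_eq_lintegral_rpow_enorm_toReal (by norm_num) (by norm_num)]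
  simp only [ENNReal.toReal_ofNat]
  rw [h1]
  congr 1
  refine lintegral_congr fun α => ?_
  have hj := jac_pos (ux := ux) (X := X) t α
  rw [enorm_mul, ENNReal.mul_rpow_of_nonneg _ _ (by norm_num), mul_comm]
  congr 1
  rw [← ofReal_norm, ENNReal.ofReal_rpow_of_nonneg (norm_nonneg _) (by norm_num),
    Real.norm_eq_abs, abs_of_nonneg (Real.sqrt_nonneg _), abs_of_pos hj]
  norm_num [Real.sq_sqrt hj.le]

theorem memLp_comp (h : VFlow A M u ux X) (t : ℝ) {g : ℝ → ℝ} (hg : MemLp g 2 volume) :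
    MemLp (fun α => g (X t α) * √(jac ux X t α)) 2 volume := by
  refine ⟨(hg.1.comp_quasiMeasurePreserving (h.diffeo t).quasiMeasurePreserving).mul ?_, ?_⟩
  · exact (h.jac_continuous.comp (Continuous.prodMk_right t)).sqrt.aestronglyMeasurable
  · rw [h.eLpNorm_comp]; exact hg.2

theorem l2_comp (h : VFlow A M u ux X) (t : ℝ) (g : ℝ → ℝ) :
    l2 (fun α => g (X t α) * √(jac ux X t α)) = l2 g := by
  rw [l2, l2, h.eLpNorm_comp]

end VFlow

/-! ### Transport equations in Lagrangian form and their L² estimates. -/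

theorem hasDerivAt_timeIntegral {f f' : ℝ → ℝ → ℝ} (hf : Continuous (Function.uncurry f))
    (hf' : Continuous (Function.uncurry f')) (hd : ∀ τ x, HasDerivAt (f τ) (f' τ x) x) (a b x : ℝ) :
    HasDerivAt (fun x => ∫ τ in a..b, f τ x) (∫ τ in a..b, f' τ x) x := by
  obtain ⟨C, hC⟩ := ((isCompact_uIcc (a := a) (b := b)).prod
    (isCompact_closedBall x 1)).exists_bound_of_continuousOn hf'.continuousOn
  refine (intervalIntegral.hasDerivAt_integral_of_dominated_loc_of_deriv_le
    (F := fun x τ => f τ x) (F' := fun x τ => f' τ x) (bound := fun _ => C)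
    (Metric.closedBall_mem_nhds x one_pos) ?_ ?_ ?_ ?_ ?_ ?_).2
  · exact Eventually.of_forall fun y => (hf.comp (Continuous.prodMk_left y)).aestronglyMeasurable
  · exact (hf.comp (Continuous.prodMk_left x)).intervalIntegrable _ _
  · exact (hf'.comp (Continuous.prodMk_left x)).aestronglyMeasurable
  · exact Eventually.of_forall fun τ hτ y hy => hC (τ, y) ⟨uIoc_subset_uIcc hτ, hy⟩
  · simp
  · exact Eventually.of_forall fun τ _ y _ => hd τ y

/-- Derivative of a time integral along a moving point. -/
theorem hasDerivAt_integral_moving {g : ℝ → ℝ → ℝ} (hg : Continuous (Function.uncurry g))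
    {X : ℝ → ℝ} (hX : Continuous X) (t₀ : ℝ) :
    HasDerivAt (fun t => ∫ τ in t₀..t, g τ (X t)) (g t₀ (X t₀)) t₀ := by
  -- The substitution τ = t₀ + (t - t₀)θ turns the integral into t - t₀ times a continuous mean.
  -- Neither `g` nor `X` needs to be differentiable.
  set m : ℝ → ℝ := fun t => ∫ θ in (0 : ℝ)..1, g (t₀ + (t - t₀) * θ) (X t) with hm
  have hmc : Continuous m :=
    intervalIntegral.continuous_parametric_intervalIntegral_of_continuous'
      (f := fun t θ => g (t₀ + (t - t₀) * θ) (X t))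
      (hg.comp ((by fun_prop : Continuous fun p : ℝ × ℝ => t₀ + (p.1 - t₀) * p.2).prodMk
        (hX.comp continuous_fst))) 0 1
  have he : ∀ t, ∫ τ in t₀..t, g τ (X t) = (t - t₀) * m t := fun t => by
    rw [hm]
    simp only
    rw [intervalIntegral.mul_integral_comp_add_mul (f := fun τ => g τ (X t))]
    simp
  have h0 : m t₀ = g t₀ (X t₀) := by simp [hm]
  rw [hasDerivAt_iff_tendsto_slope, ← h0]
  refine ((hmc.tendsto t₀).mono_left nhdsWithin_le_nhds).congr' ?_
  filter_upwards [self_mem_nhdsWithin] with t ht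
  have ht' : t - t₀ ≠ 0 := sub_ne_zero.2 ht
  rw [slope_def_field, he, he]
  simp [ht']

theorem integral_eq_of_hasDerivWithinAt {F F' : ℝ → ℝ} {T : ℝ} (hF' : Continuous F')
    (h : ∀ t ∈ Icc 0 T, HasDerivWithinAt F (F' t) (Icc 0 T) t) {t : ℝ} (ht : t ∈ Icc 0 T) :
    F t = F 0 + ∫ τ in (0 : ℝ)..t, F' τ := by
  have hs : uIcc 0 t ⊆ Icc 0 T := by
    rw [uIcc_of_le ht.1]; exact Icc_subset_Icc le_rfl ht.2
  rw [intervalIntegral.integral_eq_sub_of_hasDeriv_right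
    (fun τ hτ => ((h τ (hs hτ)).continuousWithinAt).mono hs) (fun τ hτ => ?_)
    (hF'.intervalIntegrable _ _)]
  · ring
  · rw [min_eq_left ht.1, max_eq_right ht.1] at hτ
    exact ((h τ ⟨hτ.1.le, hτ.2.le.trans ht.2⟩).hasDerivAt
      (Icc_mem_nhds hτ.1 (hτ.2.trans_le ht.2))).hasDerivWithinAt

/-- Chain rule along a moving point. -/
theorem hasDerivWithinAt_along {w g : ℝ → ℝ → ℝ} {T : ℝ}
    (hw : ∀ t ∈ Icc 0 T, ∀ x, w t x = w 0 x + ∫ τ in (0 : ℝ)..t, g τ x)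
    (hg : Continuous (Function.uncurry g)) {X : ℝ → ℝ} (hX : Continuous X) {t₀ X' wx : ℝ}
    (ht₀ : t₀ ∈ Icc 0 T) (hd : HasDerivAt X X' t₀) (hwx : HasDerivAt (w t₀) wx (X t₀)) :
    HasDerivWithinAt (fun t => w t (X t)) (g t₀ (X t₀) + wx * X') (Icc 0 T) t₀ := by
  have h1 := ((hasDerivAt_integral_moving hg hX t₀).add (hwx.comp t₀ hd)).hasDerivWithinAt
    (s := Icc 0 T)
  refine h1.congr (fun t ht => ?_) (by simp)
  have hi : ∀ x a b, IntervalIntegrable (fun τ => g τ x) volume a b := fun x a b =>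
    (hg.comp (Continuous.prodMk_left x)).intervalIntegrable _ _
  simp only [Pi.add_apply, Function.comp]
  rw [hw t ht, hw t₀ ht₀, ← intervalIntegral.integral_add_adjacent_intervals
    (hi (X t) 0 t₀) (hi (X t) t₀ t)]
  ring

/-- `∂ₜ w + u ∂ₓ w = -ν w + G` on `[0, T]`, in Lagrangian form. -/
def Transported (X : ℝ → ℝ → ℝ) (T ν : ℝ) (w G : ℝ → ℝ → ℝ) : Prop :=
  ∀ t ∈ Icc 0 T, ∀ α, Real.exp (ν * t) * w t (X t α) =
    w 0 α + ∫ τ in (0 : ℝ)..t, Real.exp (ν * τ) * G τ (X τ α)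

namespace VFlow

variable {A M T ν : ℝ} {u ux X : ℝ → ℝ → ℝ}

/-- Along a trajectory the integrating factor e^{νt} turns the equation into the time derivative of
e^{νt} w. -/
theorem transported (h : VFlow A M u ux X) {w wx g G : ℝ → ℝ → ℝ}
    (hw : ∀ t ∈ Icc 0 T, ∀ x, w t x = w 0 x + ∫ τ in (0 : ℝ)..t, g τ x)
    (hg : Continuous (Function.uncurry g)) (hG : Continuous (Function.uncurry G))
    (hwx : ∀ t x, HasDerivAt (w t) (wx t x) x)
    (he : ∀ t x, g t x + u t x * wx t x + ν * w t x = G t x) : Transported X T ν w G := by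
  intro t ht α
  have hc := (h.continuous_comp hG).comp (Continuous.prodMk_left α)
  have hd : ∀ τ ∈ Icc 0 T, HasDerivWithinAt (fun t => Real.exp (ν * t) * w t (X t α))
      (Real.exp (ν * τ) * G τ (X τ α)) (Icc 0 T) τ := by
    intro τ hτ
    have h1 := hasDerivWithinAt_along hw hg (h.continuous_time α) hτ (h.ode τ α) (hwx τ _)
    have h2 : HasDerivWithinAt (fun t => Real.exp (ν * t)) (Real.exp (ν * τ) * ν) (Icc 0 T) τ := by
      simpa using ((hasDerivAt_id τ).const_mul ν).exp.hasDerivWithinAt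
    refine (h2.mul h1).congr_deriv ?_
    rw [← he]; ring
  have := integral_eq_of_hasDerivWithinAt
    ((by fun_prop : Continuous fun τ => Real.exp (ν * τ)).mul hc) hd ht
  simpa [h.init] using this

/-- Differentiation of the Lagrangian identity in α gives an equation for ∂ₓw · J. Dividing by J,
whose logarithmic time derivative is ∂ₓu, produces the term -∂ₓu ∂ₓw. No mixed derivative of `w` is
assumed to exist. -/
theorem transported_deriv (h : VFlow A M u ux X) {w wx G Gx : ℝ → ℝ → ℝ}
    (ht : Transported X T ν w G) (hG : Continuous (Function.uncurry G))
    (hGx : Continuous (Function.uncurry Gx)) (hGd : ∀ t x, HasDerivAt (G t) (Gx t x) x)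
    (hwd : ∀ t x, HasDerivAt (w t) (wx t x) x) :
    Transported X T ν wx fun t x => Gx t x - ux t x * wx t x := by
  intro t htT α
  have hexp : Continuous fun τ => Real.exp (ν * τ) := by fun_prop
  have hf : Continuous (Function.uncurry fun τ α => Real.exp (ν * τ) * G τ (X τ α)) :=
    (hexp.comp continuous_fst).mul (h.continuous_comp hG)
  have hf' : Continuous (Function.uncurry fun τ α =>
      Real.exp (ν * τ) * (Gx τ (X τ α) * jac ux X τ α)) :=
    (hexp.comp continuous_fst).mul ((h.continuous_comp hGx).mul h.jac_continuous)
  have hP : ∀ t ∈ Icc 0 T, Real.exp (ν * t) * (wx t (X t α) * jac ux X t α) =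
      wx 0 α + ∫ τ in (0 : ℝ)..t, Real.exp (ν * τ) * (Gx τ (X τ α) * jac ux X τ α) := by
    intro t htT
    have h1 : HasDerivAt (fun α => Real.exp (ν * t) * w t (X t α))
        (Real.exp (ν * t) * (wx t (X t α) * jac ux X t α)) α :=
      ((hwd t _).comp α (h.hasDerivAt_space t α)).const_mul _
    have h2 := (hwd 0 α).add (hasDerivAt_timeIntegral hf hf' (fun τ x =>
      ((hGd τ _).comp x (h.hasDerivAt_space τ x)).const_mul _) 0 t α)
    refine h1.unique (h2.congr_of_eventuallyEq (Eventually.of_forall fun β => ?_))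
    exact ht t htT β
  set P : ℝ → ℝ := fun t => wx 0 α +
    ∫ τ in (0 : ℝ)..t, Real.exp (ν * τ) * (Gx τ (X τ α) * jac ux X τ α) with hPdef
  have hPd : ∀ t, HasDerivAt P (Real.exp (ν * t) * (Gx t (X t α) * jac ux X t α)) t := fun t =>
    (((hf'.comp (Continuous.prodMk_left α)).integral_hasStrictDerivAt 0 t).hasDerivAt).const_add _
  have hJ := fun t => (jac_pos (ux := ux) (X := X) t α).ne'
  have hQd : ∀ t, HasDerivAt (fun t => P t / jac ux X t α)
      (Real.exp (ν * t) * Gx t (X t α) - ux t (X t α) * (P t / jac ux X t α)) t := by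
    intro t
    refine ((hPd t).div (h.jac_hasDerivAt t α) (hJ t)).congr_deriv ?_
    field_simp [hJ t]
  have hPc : Continuous P := continuous_iff_continuousAt.2 fun t => (hPd t).continuousAt
  have hJc : Continuous fun t => jac ux X t α := h.jac_continuous.comp (Continuous.prodMk_left α)
  have hi := intervalIntegral.integral_eq_sub_of_hasDerivAt (a := 0) (b := t) (fun τ _ => hQd τ)
    (((hexp.mul ((h.continuous_comp hGx).comp (Continuous.prodMk_left α))).sub
      (((h.continuous_comp h.field.cont_x).comp (Continuous.prodMk_left α)).mul
        (hPc.div hJc hJ))).intervalIntegrable _ _)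
  have hQ : ∀ t ∈ Icc 0 T, P t / jac ux X t α = Real.exp (ν * t) * wx t (X t α) := by
    intro t htT
    rw [hPdef]
    simp only
    rw [← hP t htT, ← mul_assoc, mul_div_cancel_right₀ _ (hJ t)]
  have hP0 : P 0 / jac ux X 0 α = wx 0 α := by simp [hPdef, jac]
  rw [hQ t htT, hP0] at hi
  rw [eq_comm, ← eq_sub_iff_add_eq', ← hi]
  refine intervalIntegral.integral_congr fun τ hτ => ?_
  rw [uIcc_of_le htT.1] at hτ
  simp only [hQ τ ⟨hτ.1, hτ.2.trans htT.2⟩]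
  ring

end VFlow

theorem abs_integral_mul_mul_le {f g r : ℝ → ℝ} {S : ℝ} (hf : MemLp f 2 volume)
    (hg : MemLp g 2 volume) (hr : ∀ x, |r x| ≤ S) :
    |∫ x, f x * g x * r x| ≤ S * (l2 f * l2 g) := by
  have hS : 0 ≤ S := (abs_nonneg _).trans (hr 0)
  have h1 : Integrable fun x => S * |f x * g x| := (hf.mul_integrable hg).abs.const_mul S
  rw [← Real.norm_eq_abs]
  refine (norm_integral_le_of_norm_le h1 (Eventually.of_forall fun x => ?_)).trans ?_
  · rw [Real.norm_eq_abs, abs_mul, mul_comm]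
    exact mul_le_mul_of_nonneg_right (hr x) (abs_nonneg _)
  · rw [integral_const_mul]
    exact mul_le_mul_of_nonneg_left (integral_abs_mul_le hf hg) hS

theorem l2_le_of_dual {f g : ℝ → ℝ} {j : ℕ} (h : IsWeakDeriv j f g) {B : ℝ} (hB : 0 ≤ B)
    (hb : ∀ ψ, IsTest ψ → |∫ x, f x * iteratedDeriv j ψ x| ≤ B * l2 ψ) : l2 g ≤ B := by
  obtain ⟨g', h1, h2, h3⟩ := IsWeakDeriv.of_bound h.1 j hB hb
  rw [l2_congr_ae (h.unique h1)]
  exact l2_le_of_le hB h3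

namespace VFlow

variable {A M T ν : ℝ} {u ux X : ℝ → ℝ → ℝ}

theorem jac_ratio_le (h : VFlow A M u ux X) (t τ α : ℝ) :
    √(jac ux X t α) / √(jac ux X τ α) ≤ Real.exp (M * |t - τ| / 2) := by
  rw [div_le_iff₀ (Real.sqrt_pos.2 (jac_pos _ _))]
  calc √(jac ux X t α) ≤ √(Real.exp (M * |t - τ|) * jac ux X τ α) :=
        Real.sqrt_le_sqrt (h.jac_le t τ α)
    _ = _ := by rw [Real.sqrt_mul (Real.exp_pos _).le, Real.exp_half]

/-- One √J at time τ makes the composition of g isometric, one √J at time t that of χ. The remaining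
factor is √J(t)/√J(τ). -/
theorem abs_pairing_le (h : VFlow A M u ux X) (t τ : ℝ) {g χ : ℝ → ℝ} (hg : MemLp g 2 volume)
    (hχ : MemLp χ 2 volume) :
    |∫ α, g (X τ α) * (χ (X t α) * jac ux X t α)| ≤
      Real.exp (M * |t - τ| / 2) * (l2 g * l2 χ) := by
  have h1 := abs_integral_mul_mul_le (S := Real.exp (M * |t - τ| / 2)) (h.memLp_comp τ hg)
    (h.memLp_comp t hχ) (r := fun α => √(jac ux X t α) / √(jac ux X τ α)) fun α => by
      rw [abs_of_nonneg (by positivity)]; exact h.jac_ratio_le t τ α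
  rw [h.l2_comp, h.l2_comp] at h1
  refine (le_of_eq ?_).trans h1
  congr 1
  refine integral_congr_ae (Eventually.of_forall fun α => ?_)
  have e1 := Real.mul_self_sqrt (jac_pos (ux := ux) (X := X) t α).le
  have e2 := (Real.sqrt_pos.2 (jac_pos (ux := ux) (X := X) τ α)).ne'
  simp only
  field_simp
  rw [pow_two, e1]

/-- The factor χ'(X) J is the α-derivative of χ ∘ X at time t. Integration by parts moves the
derivative to g ∘ X at time τ, which brings J(τ) in place of J(t). The remaining ratio is inverted
and obeys the same bound. Only an L² derivative of `g` is used. -/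
theorem abs_pairing_deriv_le (h : VFlow A M u ux X) (t τ : ℝ) {g g' χ : ℝ → ℝ} (hP : Prim g g')
    (hg : MemLp g' 2 volume) (hχ : IsTest χ) :
    |∫ α, g (X τ α) * (deriv χ (X t α) * jac ux X t α)| ≤
      Real.exp (M * |t - τ| / 2) * (l2 g' * l2 χ) := by
  have hd : ∀ α, HasDerivAt (fun α => χ (X t α)) (deriv χ (X t α) * jac ux X t α) α := fun α =>
    ((hχ.1.differentiable (by simp)) _).hasDerivAt.comp α (h.hasDerivAt_space t α)
  have hder : deriv (fun α => χ (X t α)) = fun α => deriv χ (X t α) * jac ux X t α :=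
    funext fun α => (hd α).deriv
  have hcd : ContDiff ℝ 1 fun α => χ (X t α) := by
    rw [contDiff_one_iff_deriv]
    refine ⟨fun α => (hd α).differentiableAt, ?_⟩
    rw [hder]
    exact (hχ.deriv.1.continuous.comp (h.diffeo t).continuous).mul
      (h.jac_continuous.comp (Continuous.prodMk_right t))
  have hcs : HasCompactSupport fun α => χ (X t α) := by
    obtain ⟨r, hr, hr0⟩ := hχ.exists_radius
    refine HasCompactSupport.of_support_subset_isCompact
      (isCompact_closedBall (0 : ℝ) (r + A * |t|)) fun α hα => ?_
    rw [mem_closedBall_zero_iff, Real.norm_eq_abs]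
    by_contra hcon
    refine hα (hr0 _ ?_)
    have h1 := h.abs_sub_self_le t α
    have h2 := abs_sub_abs_le_abs_sub α (X t α)
    rw [abs_sub_comm] at h2
    linarith [not_le.1 hcon]
  have h0 := ((hP.comp_diffeo (h.hasDerivAt_space τ) fun α => jac_pos τ α).integral_mul_deriv
    hcd hcs)
  rw [hder] at h0
  rw [h0, abs_neg]
  have h1 := abs_integral_mul_mul_le (S := Real.exp (M * |t - τ| / 2)) (h.memLp_comp τ hg)
    (h.memLp_comp t (hχ.memLp 2)) (r := fun α => √(jac ux X τ α) / √(jac ux X t α)) fun α => by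
      rw [abs_of_nonneg (by positivity), abs_sub_comm]; exact h.jac_ratio_le τ t α
  rw [h.l2_comp, h.l2_comp] at h1
  refine (le_of_eq ?_).trans h1
  congr 1
  refine integral_congr_ae (Eventually.of_forall fun α => ?_)
  have e1 := Real.mul_self_sqrt (jac_pos (ux := ux) (X := X) τ α).le
  have e2 := (Real.sqrt_pos.2 (jac_pos (ux := ux) (X := X) t α)).ne'
  simp only
  field_simp
  rw [pow_two, e1]; ring

/-- Change variables by the flow at time t, insert the Lagrangian identity, and exchange the
integrals over time and space. The damping only helps: e^{ν(τ - t)} ≤ 1 is discarded. The constant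
`R` serves only for integrability and does not enter the bound. -/
theorem pairing_le (h : VFlow A M u ux X) {w G : ℝ → ℝ → ℝ} (ht : Transported X T ν w G)
    (hG : Continuous (Function.uncurry G)) {R : ℝ} (hw0 : MemLp (w 0) 2 volume)
    (hGL : ∀ τ ∈ Icc 0 T, MemLp (G τ) 2 volume ∧ l2 (G τ) ≤ R) {χ b : ℝ → ℝ} {b₀ t : ℝ}
    (hχ : IsTest χ) (htT : t ∈ Icc 0 T) (hν : 0 ≤ ν)
    (hb : IntervalIntegrable b volume 0 t)
    (hb₀ : |∫ α, w 0 α * (χ (X t α) * jac ux X t α)| ≤ b₀)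
    (hbG : ∀ τ ∈ Icc 0 t, |∫ α, G τ (X τ α) * (χ (X t α) * jac ux X t α)| ≤ b τ) :
    |∫ x, w t x * χ x| ≤ b₀ + ∫ τ in (0 : ℝ)..t, b τ := by
  have hexp : Continuous fun τ => Real.exp (ν * τ) := by fun_prop
  have hcη : Continuous fun α => χ (X t α) * jac ux X t α :=
    (hχ.1.continuous.comp (h.diffeo t).continuous).mul
      (h.jac_continuous.comp (Continuous.prodMk_right t))
  have hη2 : MemLp (fun α => χ (X t α) * jac ux X t α) 2 volume := by
    have := (h.memLp_comp t (hχ.memLp 2)).mul_bdd (g := fun α => √(jac ux X t α))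
      (S := √(Real.exp (M * |t|)))
      (h.jac_continuous.comp (Continuous.prodMk_right t)).sqrt.aestronglyMeasurable fun α => by
        rw [abs_of_nonneg (Real.sqrt_nonneg _)]
        have := h.jac_le t 0 α
        rw [jac_zero, mul_one, sub_zero] at this
        exact Real.sqrt_le_sqrt this
    refine (memLp_congr_ae (Eventually.of_forall fun α => ?_)).1 this
    rw [mul_assoc, Real.mul_self_sqrt (jac_pos _ _).le]
  have hgL : ∀ τ ∈ Icc 0 t, MemLp (fun α => Real.exp (ν * τ) * G τ (X τ α)) 2 volume ∧
      l2 (fun α => Real.exp (ν * τ) * G τ (X τ α)) ≤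
        Real.exp (ν * t) * (Real.exp (M * |t| / 2) * |R|) := by
    intro τ hτ
    have h1 := hGL τ ⟨hτ.1, hτ.2.trans htT.2⟩
    refine ⟨((h.diffeo τ).memLp_comp h1.1).const_mul _, ?_⟩
    rw [l2_const_mul, abs_of_pos (Real.exp_pos _)]
    have h2 := (h.diffeo τ).l2_comp_le h1.1
    have h3 : (√(Real.exp (-(M * |τ|))))⁻¹ ≤ Real.exp (M * |t| / 2) := by
      rw [← Real.sqrt_inv, ← Real.exp_neg, neg_neg, ← Real.exp_half, Real.exp_le_exp,
        abs_of_nonneg hτ.1, abs_of_nonneg htT.1]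
      have := mul_le_mul_of_nonneg_left hτ.2 h.M_nonneg
      linarith
    have h4 : Real.exp (ν * τ) ≤ Real.exp (ν * t) :=
      Real.exp_le_exp.2 (mul_le_mul_of_nonneg_left hτ.2 hν)
    exact mul_le_mul h4 (h2.trans (mul_le_mul h3 (h1.2.trans (le_abs_self R)) (l2_nonneg _)
      (Real.exp_pos _).le)) (l2_nonneg _) (Real.exp_pos _).le
  have hgc : Continuous (Function.uncurry fun τ α => Real.exp (ν * τ) * G τ (X τ α)) :=
    (hexp.comp continuous_fst).mul (h.continuous_comp hG)
  have hI := abs_integral_timeIntegral_mul_le (B := fun τ => Real.exp (ν * t) * b τ) htT.1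
    hgc.aestronglyMeasurable
    ((ae_restrict_iff' measurableSet_Ioc).2 (Eventually.of_forall fun τ hτ =>
      hgL τ (Ioc_subset_Icc_self hτ))) hcη hη2 (hb.const_mul _)
    ((ae_restrict_iff' measurableSet_Ioc).2 (Eventually.of_forall fun τ hτ => by
      simp_rw [mul_assoc (Real.exp (ν * τ))]
      rw [integral_const_mul, abs_mul, abs_of_pos (Real.exp_pos _)]
      have h4 : Real.exp (ν * τ) ≤ Real.exp (ν * t) :=
        Real.exp_le_exp.2 (mul_le_mul_of_nonneg_left hτ.2 hν)
      exact mul_le_mul h4 (hbG τ (Ioc_subset_Icc_self hτ)) (abs_nonneg _) (Real.exp_pos _).le))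
  rw [intervalIntegral.integral_const_mul] at hI
  have hi1 : Integrable fun α => w 0 α * (χ (X t α) * jac ux X t α) := hw0.mul_integrable hη2
  have hi2 : Integrable fun α => (∫ τ in (0 : ℝ)..t, Real.exp (ν * τ) * G τ (X τ α)) *
      (χ (X t α) * jac ux X t α) := by
    have hcs : HasCompactSupport fun α => χ (X t α) * jac ux X t α := by
      obtain ⟨r, hr, hr0⟩ := hχ.exists_radius
      refine HasCompactSupport.of_support_subset_isCompact
        (isCompact_closedBall (0 : ℝ) (r + A * |t|)) fun α hα => ?_
      rw [mem_closedBall_zero_iff, Real.norm_eq_abs]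
      by_contra hcon
      refine hα ?_
      simp only
      rw [hr0 _, zero_mul]
      have h1 := h.abs_sub_self_le t α
      have h2 := abs_sub_abs_le_abs_sub α (X t α)
      rw [abs_sub_comm] at h2
      linarith [not_le.1 hcon]
    refine Continuous.integrable_of_hasCompactSupport (Continuous.mul ?_ hcη) hcs.mul_left
    exact intervalIntegral.continuous_parametric_intervalIntegral_of_continuous'
      (f := fun α τ => Real.exp (ν * τ) * G τ (X τ α)) (hgc.comp continuous_swap) 0 t
  have hmain : Real.exp (ν * t) * ∫ x, w t x * χ x =
      (∫ α, w 0 α * (χ (X t α) * jac ux X t α)) +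
      ∫ α, (∫ τ in (0 : ℝ)..t, Real.exp (ν * τ) * G τ (X τ α)) *
        (χ (X t α) * jac ux X t α) := by
    rw [← h.integral_comp t, ← integral_const_mul, ← integral_add hi1 hi2]
    refine integral_congr_ae (Eventually.of_forall fun α => ?_)
    have := ht t htT α
    simp only
    rw [← add_mul, ← this]; ring
  have h1 : 1 ≤ Real.exp (ν * t) := Real.one_le_exp (mul_nonneg hν htT.1)
  have hb₀0 : 0 ≤ b₀ := (abs_nonneg _).trans hb₀
  have h2 : Real.exp (ν * t) * |∫ x, w t x * χ x| ≤
      Real.exp (ν * t) * (b₀ + ∫ τ in (0 : ℝ)..t, b τ) := by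
    rw [← abs_of_pos (Real.exp_pos (ν * t)), ← abs_mul, abs_of_pos (Real.exp_pos (ν * t)), hmain,
      mul_add]
    refine (abs_add_le _ _).trans (add_le_add (hb₀.trans ?_) hI)
    exact le_mul_of_one_le_left hb₀0 h1
  exact le_of_mul_le_mul_left h2 (Real.exp_pos _)

/-- `L²` bound for a transported quantity. -/
theorem l2_le (h : VFlow A M u ux X) {w G : ℝ → ℝ → ℝ} (ht : Transported X T ν w G)
    (hG : Continuous (Function.uncurry G)) {R : ℝ} (hν : 0 ≤ ν)
    (hw : ∀ τ ∈ Icc 0 T, MemLp (w τ) 2 volume)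
    (hGL : ∀ τ ∈ Icc 0 T, MemLp (G τ) 2 volume ∧ l2 (G τ) ≤ R) {b : ℝ → ℝ} {t : ℝ}
    (htT : t ∈ Icc 0 T) (hb : IntervalIntegrable b volume 0 t)
    (hbG : ∀ τ ∈ Icc 0 t, l2 (G τ) ≤ b τ) :
    l2 (w t) ≤ Real.exp (M * t / 2) * l2 (w 0) +
      ∫ τ in (0 : ℝ)..t, Real.exp (M * (t - τ) / 2) * b τ := by
  have h0T : (0 : ℝ) ∈ Icc 0 T := ⟨le_rfl, htT.1.trans htT.2⟩
  have hb' : ∀ τ ∈ Icc 0 t, 0 ≤ b τ := fun τ hτ => (l2_nonneg _).trans (hbG τ hτ)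
  refine l2_le_of_dual (isWeakDeriv_zero ((hw t htT).locallyIntegrable (by norm_num)))
    (add_nonneg (mul_nonneg (Real.exp_pos _).le (l2_nonneg _))
      (intervalIntegral.integral_nonneg htT.1 fun τ hτ =>
        mul_nonneg (Real.exp_pos _).le (hb' τ hτ))) fun χ hχ => ?_
  rw [iteratedDeriv_zero, add_mul, ← intervalIntegral.integral_mul_const]
  refine h.pairing_le ht hG (hw 0 h0T) hGL hχ htT hν ((hb.continuousOn_mul
    (by fun_prop : Continuous fun τ => Real.exp (M * (t - τ) / 2)).continuousOn).mul_const _) ?_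
    fun τ hτ => ?_
  · have := h.abs_pairing_le t 0 (hw 0 h0T) (hχ.memLp 2)
    simp only [h.init, sub_zero, abs_of_nonneg htT.1] at this
    rwa [← mul_assoc] at this
  · have := h.abs_pairing_le t τ (hGL τ ⟨hτ.1, hτ.2.trans htT.2⟩).1 (hχ.memLp 2)
    rw [abs_of_nonneg (sub_nonneg.2 hτ.2), ← mul_assoc] at this
    refine this.trans (mul_le_mul_of_nonneg_right ?_ (l2_nonneg _))
    exact mul_le_mul_of_nonneg_left (hbG τ hτ) (Real.exp_pos _).le

/-- `L²` bound for the derivative of a transported quantity. -/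
theorem l2_deriv_le (h : VFlow A M u ux X) {w w' G G' : ℝ → ℝ → ℝ} (ht : Transported X T ν w G)
    (hG : Continuous (Function.uncurry G)) {R : ℝ} (hν : 0 ≤ ν)
    (hw : MemLp (w 0) 2 volume) (hGL : ∀ τ ∈ Icc 0 T, MemLp (G τ) 2 volume ∧ l2 (G τ) ≤ R)
    (hw' : ∀ τ ∈ Icc 0 T, Prim (w τ) (w' τ) ∧ MemLp (w' τ) 2 volume)
    (hG' : ∀ τ ∈ Icc 0 T, Prim (G τ) (G' τ) ∧ MemLp (G' τ) 2 volume) {b : ℝ → ℝ} {t : ℝ}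
    (htT : t ∈ Icc 0 T) (hb : IntervalIntegrable b volume 0 t)
    (hbG : ∀ τ ∈ Icc 0 t, l2 (G' τ) ≤ b τ) :
    l2 (w' t) ≤ Real.exp (M * t / 2) * l2 (w' 0) +
      ∫ τ in (0 : ℝ)..t, Real.exp (M * (t - τ) / 2) * b τ := by
  have h0T : (0 : ℝ) ∈ Icc 0 T := ⟨le_rfl, htT.1.trans htT.2⟩
  have hb' : ∀ τ ∈ Icc 0 t, 0 ≤ b τ := fun τ hτ => (l2_nonneg _).trans (hbG τ hτ)
  have hwd : IsWeakDeriv 1 (w t) (w' t) := by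
    refine ⟨(hw' t htT).1.continuous.locallyIntegrable,
      (hw' t htT).2.locallyIntegrable (by norm_num), fun ψ h1 h2 => ?_⟩
    rw [iteratedDeriv_one, (hw' t htT).1.integral_mul_deriv (h1.of_le (by exact_mod_cast le_top)) h2]
    ring
  refine l2_le_of_dual hwd
    (add_nonneg (mul_nonneg (Real.exp_pos _).le (l2_nonneg _))
      (intervalIntegral.integral_nonneg htT.1 fun τ hτ =>
        mul_nonneg (Real.exp_pos _).le (hb' τ hτ))) fun χ hχ => ?_
  rw [iteratedDeriv_one, add_mul, ← intervalIntegral.integral_mul_const]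
  refine h.pairing_le ht hG hw hGL hχ.deriv htT hν ((hb.continuousOn_mul
    (by fun_prop : Continuous fun τ => Real.exp (M * (t - τ) / 2)).continuousOn).mul_const _) ?_
    fun τ hτ => ?_
  · have := h.abs_pairing_deriv_le t 0 (hw' 0 h0T).1 (hw' 0 h0T).2 hχ
    simp only [h.init, sub_zero, abs_of_nonneg htT.1] at this
    rwa [← mul_assoc] at this
  · have h3 := hG' τ ⟨hτ.1, hτ.2.trans htT.2⟩
    have := h.abs_pairing_deriv_le t τ h3.1 h3.2 hχ
    rw [abs_of_nonneg (sub_nonneg.2 hτ.2), ← mul_assoc] at this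
    refine this.trans (mul_le_mul_of_nonneg_right ?_ (l2_nonneg _))
    exact mul_le_mul_of_nonneg_left (hbG τ hτ) (Real.exp_pos _).le

end VFlow

/-! ### Commutators and derivatives of transported quantities. -/

/-- The sum of the `L²` norms of the derivatives of orders `0, …, m`. -/
noncomputable def jetNorm (m : ℕ) (f : ℝ → ℝ) : ℝ :=
  ∑ i ∈ Finset.range (m + 1), l2 (iteratedDeriv i f)

theorem jetNorm_nonneg (m : ℕ) (f : ℝ → ℝ) : 0 ≤ jetNorm m f :=
  Finset.sum_nonneg fun _ _ => l2_nonneg _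

theorem l2_le_jetNorm {m i : ℕ} (hi : i ≤ m) (f : ℝ → ℝ) : l2 (iteratedDeriv i f) ≤ jetNorm m f :=
  Finset.single_le_sum (f := fun i => l2 (iteratedDeriv i f)) (fun _ _ => l2_nonneg _)
    (by simp; omega)

theorem HB.jetNorm_le {m : ℕ} {R : ℝ} {f : ℝ → ℝ} (h : HB m R f) (hR : 0 ≤ R) :
    jetNorm m f ≤ (m + 1) * R := by
  have := Finset.sum_le_card_nsmul (Finset.range (m + 1)) (fun i => l2 (iteratedDeriv i f)) R
    fun i hi => h.l2_le hR (by simp at hi; omega)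
  simpa [jetNorm] using this

theorem HB.abs_iteratedDeriv_le_jetNorm {m : ℕ} {R : ℝ} {f : ℝ → ℝ} (h : HB m R f) {j : ℕ}
    (hj : j < m) (x : ℝ) : |iteratedDeriv j f x| ≤ jetNorm m f := by
  refine ((h.prim j hj).abs_le (h.memLp hj.le) (h.memLp hj) x).trans ?_
  have := Finset.sum_le_sum_of_subset_of_nonneg (s := {j, j + 1}) (t := Finset.range (m + 1))
    (f := fun i => l2 (iteratedDeriv i f)) (by
      intro i hi; simp at hi ⊢; omega) fun _ _ _ => l2_nonneg _
  rwa [Finset.sum_pair (by omega)] at this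

theorem BddJet.of_chain {m : ℕ} {A : ℝ} {G : ℕ → ℝ → ℝ} (h : ∀ j < m, Prim (G j) (G (j + 1)))
    (hb : ∀ x, |G 0 x| ≤ A) (hL : ∀ i, 1 ≤ i → i ≤ m → MemLp (G i) 2 volume) :
    BddJet m A (G 0) ∧ ∀ i ≤ m, iteratedDeriv i (G 0) =ᵐ[volume] G i := by
  have h1 := iteratedDeriv_of_chain h
  have h2 : ∀ i ≤ m, iteratedDeriv i (G 0) =ᵐ[volume] G i := by
    intro i hi
    rcases hi.lt_or_eq with hlt | rfl
    · rw [h1.1 i hlt]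
    · exact h1.2
  refine ⟨⟨hb, prim_of_chain h, fun i hi him => (memLp_congr_ae (h2 i him)).2 (hL i hi him)⟩, h2⟩

/-- The commutator terms in the equation for a `j`-th derivative. -/
noncomputable def commSum (f g : ℕ → ℝ → ℝ) (j : ℕ) (x : ℝ) : ℝ :=
  ∑ i ∈ Finset.range j, (j.choose (i + 1) : ℝ) * (f i x * g (j - 1 - i) x)

/-- The derivative of `commSum` when each family consists of successive derivatives; for i < j the
index j - i is the successor of j - 1 - i. -/
noncomputable def commSumDeriv (f g : ℕ → ℝ → ℝ) (j : ℕ) (x : ℝ) : ℝ :=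
  ∑ i ∈ Finset.range j, (j.choose (i + 1) : ℝ) *
    (f (i + 1) x * g (j - 1 - i) x + f i x * g (j - i) x)

/-- Pascal's rule. The extra term is the commutator of the new derivative with the transport term.
-/
theorem commSum_succ (f g : ℕ → ℝ → ℝ) (j : ℕ) (x : ℝ) :
    commSum f g (j + 1) x = commSumDeriv f g j x + f 0 x * g j x := by
  have h1 : ∀ i ∈ Finset.range (j + 1), ((j + 1).choose (i + 1) : ℝ) * (f i x * g (j + 1 - 1 - i) x) =
      (j.choose i : ℝ) * (f i x * g (j - i) x) + (j.choose (i + 1) : ℝ) * (f i x * g (j - i) x) := by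
    intro i _
    rw [Nat.choose_succ_succ, Nat.add_sub_cancel]; push_cast; ring
  rw [commSum, Finset.sum_congr rfl h1, Finset.sum_add_distrib, Finset.sum_range_succ',
    Finset.sum_range_succ (fun i => (j.choose (i + 1) : ℝ) * _), commSumDeriv]
  simp only [Nat.sub_sub, add_comm 1, Nat.choose_succ_self, Nat.cast_zero, zero_mul, add_zero, Nat.choose_zero_right,
    Nat.cast_one, one_mul, Nat.sub_zero]
  have h3 : ∀ i, (j.choose (i + 1) : ℝ) * (f (i + 1) x * g (j - (i + 1)) x + f i x * g (j - i) x) =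
      (j.choose (i + 1) : ℝ) * (f (i + 1) x * g (j - (i + 1)) x) +
      (j.choose (i + 1) : ℝ) * (f i x * g (j - i) x) := fun i => mul_add _ _ _
  simp only [h3, Finset.sum_add_distrib]
  ring

theorem prim_zero : Prim (fun _ => 0) (fun _ => 0) :=
  ⟨locallyIntegrable_const 0, fun a b => by simp⟩

theorem Prim.sum {ι : Type*} (s : Finset ι) {f g : ι → ℝ → ℝ} (h : ∀ i ∈ s, Prim (f i) (g i)) :
    Prim (fun x => ∑ i ∈ s, f i x) (fun x => ∑ i ∈ s, g i x) := by
  classical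
  induction s using Finset.induction_on with
  | empty => simpa using prim_zero
  | insert a s ha ih =>
    simp only [Finset.sum_insert ha]
    exact (h a (by simp)).add (ih fun i hi => h i (by simp [hi]))

theorem prim_commSum {f g : ℕ → ℝ → ℝ} {j : ℕ} (hf : ∀ i < j, Prim (f i) (f (i + 1)))
    (hg : ∀ i < j, Prim (g i) (g (i + 1))) : Prim (commSum f g j) (commSumDeriv f g j) := by
  refine Prim.sum _ fun i hi => Prim.const_mul _ ?_
  have hi' : i < j := by simpa using hi
  have h1 := hg (j - 1 - i) (by omega)
  rw [show j - 1 - i + 1 = j - i by omega] at h1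
  exact ((hf i hi').mul h1).congr_right (Eventually.of_forall fun x => by ring)

theorem memLp_l2_sum_le {ι : Type*} (s : Finset ι) {f : ι → ℝ → ℝ} {c : ι → ℝ}
    (h : ∀ i ∈ s, MemLp (f i) 2 volume ∧ l2 (f i) ≤ c i) :
    MemLp (fun x => ∑ i ∈ s, f i x) 2 volume ∧ l2 (fun x => ∑ i ∈ s, f i x) ≤ ∑ i ∈ s, c i := by
  classical
  induction s using Finset.induction_on with
  | empty => simp [l2]
  | insert a s ha ih =>
    obtain ⟨h1, h2⟩ := ih fun i hi => h i (by simp [hi])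
    obtain ⟨h3, h4⟩ := h a (by simp)
    simp only [Finset.sum_insert ha]
    exact ⟨h3.add h1, (l2_add_le h3 h1).trans (add_le_add h4 h2)⟩

theorem sum_choose_le (j : ℕ) : ∑ i ∈ Finset.range j, (j.choose (i + 1) : ℝ) ≤ 2 ^ j := by
  have h1 : ∑ i ∈ Finset.range (j + 1), (j.choose i : ℝ) = 2 ^ j := by
    exact_mod_cast Nat.sum_range_choose j
  rw [← h1, Finset.sum_range_succ']
  simp

theorem l2_commSum_le {f g : ℕ → ℝ → ℝ} {j : ℕ} {c : ℝ} (hc : 0 ≤ c)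
    (h : ∀ i l, i + l + 1 = j → MemLp (fun x => f i x * g l x) 2 volume ∧
      l2 (fun x => f i x * g l x) ≤ c) :
    MemLp (commSum f g j) 2 volume ∧ l2 (commSum f g j) ≤ 2 ^ j * c := by
  have h1 := memLp_l2_sum_le (Finset.range j)
    (f := fun i x => (j.choose (i + 1) : ℝ) * (f i x * g (j - 1 - i) x))
    (c := fun i => (j.choose (i + 1) : ℝ) * c) fun i hi => by
      have hi' : i < j := by simpa using hi
      obtain ⟨h2, h3⟩ := h i (j - 1 - i) (by omega)
      refine ⟨h2.const_mul _, ?_⟩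
      rw [l2_const_mul, abs_of_nonneg (Nat.cast_nonneg _)]
      exact mul_le_mul_of_nonneg_left h3 (Nat.cast_nonneg _)
  refine ⟨h1.1, h1.2.trans ?_⟩
  rw [← Finset.sum_mul]
  exact mul_le_mul_of_nonneg_right (sum_choose_le j) hc

theorem l2_commSumDeriv_le {f g : ℕ → ℝ → ℝ} {j : ℕ} {c : ℝ} (hc : 0 ≤ c)
    (h : ∀ i l, i + l = j → MemLp (fun x => f i x * g l x) 2 volume ∧
      l2 (fun x => f i x * g l x) ≤ c) :
    MemLp (commSumDeriv f g j) 2 volume ∧ l2 (commSumDeriv f g j) ≤ 2 ^ j * (2 * c) := by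
  have h1 := memLp_l2_sum_le (Finset.range j)
    (f := fun i x => (j.choose (i + 1) : ℝ) *
      (f (i + 1) x * g (j - 1 - i) x + f i x * g (j - i) x))
    (c := fun i => (j.choose (i + 1) : ℝ) * (2 * c)) fun i hi => by
      have hi' : i < j := by simpa using hi
      obtain ⟨h2, h3⟩ := h (i + 1) (j - 1 - i) (by omega)
      obtain ⟨h4, h5⟩ := h i (j - i) (by omega)
      refine ⟨(h2.add h4).const_mul _, ?_⟩
      rw [l2_const_mul, abs_of_nonneg (Nat.cast_nonneg _)]
      refine mul_le_mul_of_nonneg_left ((l2_add_le h2 h4).trans ?_) (Nat.cast_nonneg _)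
      linarith
  refine ⟨h1.1, h1.2.trans ?_⟩
  rw [← Finset.sum_mul]
  exact mul_le_mul_of_nonneg_right (sum_choose_le j) (by positivity)

/-- Tame product estimate for chains of primitives. -/
theorem l2_mul_le_of_chain {m : ℕ} (hm : 1 ≤ m) {A B : ℝ} {F G : ℕ → ℝ → ℝ}
    (hF : ∀ j < m, Prim (F j) (F (j + 1))) (hG : ∀ j < m, Prim (G j) (G (j + 1)))
    (hA : ∀ x, |F 0 x| ≤ A) (hB : ∀ x, |G 0 x| ≤ B)
    (hF2 : ∀ i, 1 ≤ i → i ≤ m → MemLp (F i) 2 volume)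
    (hG2 : ∀ i, 1 ≤ i → i ≤ m → MemLp (G i) 2 volume) {i l : ℕ} (hil : i + l = m) :
    MemLp (fun x => F i x * G l x) 2 volume ∧
      l2 (fun x => F i x * G l x) ≤ (2 * m) ^ (m ^ 2) * (A * l2 (G m) + B * l2 (F m)) := by
  obtain ⟨h1, h2⟩ := BddJet.of_chain hF hA hF2
  obtain ⟨h3, h4⟩ := BddJet.of_chain hG hB hG2
  obtain ⟨h5, h6⟩ := h1.l2_mul_le hm h3 (show i ≤ m by omega)
  have hl : m - i = l := by omega
  rw [hl] at h5 h6
  have he : (fun x => iteratedDeriv i (F 0) x * iteratedDeriv l (G 0) x) =ᵐ[volume]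
      fun x => F i x * G l x := by
    filter_upwards [h2 i (by omega), h4 l (by omega)] with x h7 h8
    rw [h7, h8]
  rw [l2_congr_ae he, l2_congr_ae (h2 m le_rfl), l2_congr_ae (h4 m le_rfl)] at h6
  exact ⟨(memLp_congr_ae he).1 h5, h6⟩

/-- A quantity `w` with `∂ₜ w + u ∂ₓ w = -ν w + F - u e` on `[0, T]`; all functions are extended in
time beyond `[0, T]`. -/
structure Transport (s : ℕ) (R S M κ T ν : ℝ) (u w F : ℝ → ℝ → ℝ) (e : ℝ → ℝ)
    (X : ℝ → ℝ → ℝ) : Prop where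
  one_le : 1 ≤ s
  R_nonneg : 0 ≤ R
  κ_nonneg : 0 ≤ κ
  ν_nonneg : 0 ≤ ν
  hu : ∀ t, HB (s + 1) R (u t)
  hw : ∀ t, HB (s + 1) R (w t)
  hF : ∀ t, HB (s + 1) R (F t)
  cu : ∀ x, Continuous fun t => u t x
  cw : ∀ x, Continuous fun t => w t x
  cF : ∀ x, Continuous fun t => F t x
  e_bdd : ∀ x, |e x| ≤ S
  e_prim : Prim e (deriv e)
  e_hb : HB s κ (deriv e)
  flow : VFlow (2 * R) M u (fun t => deriv (u t)) X
  bdd : ∀ t x, |deriv (w t) x + e x| ≤ M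
  eqn : ∀ t ∈ Icc 0 T, ∀ x, w t x = w 0 x + ∫ τ in (0 : ℝ)..t,
    (F τ x - u τ x * e x - u τ x * deriv (w τ) x - ν * w τ x)

namespace Transport

variable {s : ℕ} {R S M κ T ν : ℝ} {u w F : ℝ → ℝ → ℝ} {e : ℝ → ℝ} {X : ℝ → ℝ → ℝ}

/-- Source of the equation for the `j`-th derivative of `w`. -/
noncomputable def src (u w F : ℝ → ℝ → ℝ) (e : ℝ → ℝ) (j : ℕ) (t x : ℝ) : ℝ :=
  iteratedDeriv j (F t) x - u t x * iteratedDeriv j e x -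
    commSum (fun i => iteratedDeriv (i + 1) (u t))
      (fun i x => iteratedDeriv (i + 1) (w t) x + iteratedDeriv i e x) j x

/-- The space derivative of `src`. For j = s it is known only as an L² function, and its L² bound
enters the estimate of the derivative of order s + 1. -/
noncomputable def srcDeriv (u w F : ℝ → ℝ → ℝ) (e : ℝ → ℝ) (j : ℕ) (t x : ℝ) : ℝ :=
  iteratedDeriv (j + 1) (F t) x -
    (deriv (u t) x * iteratedDeriv j e x + u t x * iteratedDeriv (j + 1) e x) -
    commSumDeriv (fun i => iteratedDeriv (i + 1) (u t))
      (fun i x => iteratedDeriv (i + 1) (w t) x + iteratedDeriv i e x) j x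

theorem src_succ (j : ℕ) (t x : ℝ) :
    src u w F e (j + 1) t x =
      srcDeriv u w F e j t x - deriv (u t) x * iteratedDeriv (j + 1) (w t) x := by
  rw [src, srcDeriv, commSum_succ]
  simp only [zero_add, iteratedDeriv_one]
  ring

theorem prim_e (h : Transport s R S M κ T ν u w F e X) {j : ℕ} (hj : j < s + 1) :
    Prim (iteratedDeriv j e) (iteratedDeriv (j + 1) e) := by
  rcases j with _ | j
  · simpa using h.e_prim
  · have := h.e_hb.prim j (by omega)
    simpa only [← iteratedDeriv_succ'] using this

theorem memLp_e (h : Transport s R S M κ T ν u w F e X) {j : ℕ} (hj : 1 ≤ j) (hjs : j ≤ s + 1) :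
    MemLp (iteratedDeriv j e) 2 volume ∧ l2 (iteratedDeriv j e) ≤ κ := by
  obtain ⟨j, rfl⟩ := Nat.exists_eq_add_of_le' hj
  rw [iteratedDeriv_succ']
  exact ⟨h.e_hb.memLp (by omega), h.e_hb.l2_le h.κ_nonneg (by omega)⟩

theorem prim_g (h : Transport s R S M κ T ν u w F e X) (t : ℝ) {i : ℕ} (hi : i < s) :
    Prim (fun x => iteratedDeriv (i + 1) (w t) x + iteratedDeriv i e x)
      (fun x => iteratedDeriv (i + 1 + 1) (w t) x + iteratedDeriv (i + 1) e x) :=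
  ((h.hw t).prim (i + 1) (by omega)).add (h.prim_e (by omega))

theorem prim_src (h : Transport s R S M κ T ν u w F e X) (t : ℝ) {j : ℕ} (hj : j ≤ s) :
    Prim (src u w F e j t) (srcDeriv u w F e j t) := by
  have h1 := (h.hF t).prim j (by omega)
  have h2 := ((h.hu t).prim' ).mul (h.prim_e (j := j) (by omega))
  have h3 := prim_commSum (f := fun i => iteratedDeriv (i + 1) (u t))
    (g := fun i x => iteratedDeriv (i + 1) (w t) x + iteratedDeriv i e x) (j := j)
    (fun i hi => (h.hu t).prim (i + 1) (by omega)) (fun i hi => h.prim_g t (by omega))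
  exact (h1.sub h2).sub h3

theorem continuous_src (h : Transport s R S M κ T ν u w F e X) {j : ℕ} (hj : j ≤ s) :
    Continuous (Function.uncurry (src u w F e j)) := by
  have c1 := HB.continuous_uncurry h.R_nonneg h.hF h.cF (j := j) (by omega)
  have c2 := HB.continuous_uncurry h.R_nonneg h.hu h.cu (j := 0) (by omega)
  have c3 : ∀ i, i < s + 1 → Continuous fun p : ℝ × ℝ => iteratedDeriv i e p.2 := fun i hi =>
    (h.prim_e hi).continuous.comp continuous_snd
  have c4 : Continuous fun p : ℝ × ℝ => ∑ i ∈ Finset.range j, (j.choose (i + 1) : ℝ) *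
      (iteratedDeriv (i + 1) (u p.1) p.2 * (iteratedDeriv (j - 1 - i + 1) (w p.1) p.2 +
        iteratedDeriv (j - 1 - i) e p.2)) := by
    refine continuous_finsetSum _ fun i hi => ?_
    have hi' : i < j := by simpa using hi
    exact continuous_const.mul ((HB.continuous_uncurry h.R_nonneg h.hu h.cu (by omega)).mul
      ((HB.continuous_uncurry h.R_nonneg h.hw h.cw (by omega)).add (c3 _ (by omega))))
  simp only [iteratedDeriv_zero] at c2
  exact (c1.sub (c2.mul (c3 j (by omega)))).sub c4

theorem continuous_w (h : Transport s R S M κ T ν u w F e X) {j : ℕ} (hj : j ≤ s) :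
    Continuous (Function.uncurry fun t x => iteratedDeriv j (w t) x) :=
  HB.continuous_uncurry h.R_nonneg h.hw h.cw (by omega)

theorem hasDerivAt_w (h : Transport s R S M κ T ν u w F e X) {j : ℕ} (hj : j < s) (t x : ℝ) :
    HasDerivAt (iteratedDeriv j (w t)) (iteratedDeriv (j + 1) (w t) x) x :=
  ((h.hw t).prim j (by omega)).hasDerivAt ((h.hw t).continuous (by omega)) x

/-- Induction by `VFlow.transported_deriv`; the term ∂ₓu ∂ʲ⁺¹w that it creates is the one added by
Pascal's rule in the next commutator. The induction stops at s, because the derivative of order s +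
1 need not be continuous. -/
theorem transported (h : Transport s R S M κ T ν u w F e X) {j : ℕ} (hj : j ≤ s) :
    Transported X T ν (fun t => iteratedDeriv j (w t)) (src u w F e j) := by
  induction j with
  | zero =>
    have hs := h.one_le
    have cw := h.continuous_w (j := 0) (by omega)
    have cw1 := h.continuous_w (j := 1) (by omega)
    have cu := h.flow.field.cont
    have cF := HB.continuous_uncurry h.R_nonneg h.hF h.cF (j := 0) (by omega)
    simp only [iteratedDeriv_zero, iteratedDeriv_one] at cw cw1 cF ⊢
    have hg : Continuous (Function.uncurry fun τ x =>
        F τ x - u τ x * e x - u τ x * deriv (w τ) x - ν * w τ x) :=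
      ((cF.sub (cu.mul (h.e_prim.continuous.comp continuous_snd))).sub (cu.mul cw1)).sub
        (continuous_const.mul cw)
    refine h.flow.transported h.eqn hg (h.continuous_src (by omega))
      (wx := fun t => deriv (w t)) (fun t x => ?_) fun t x => ?_
    · have := h.hasDerivAt_w (j := 0) (by omega) t x
      simpa using this
    · simp [src, commSum]; ring
  | succ j ih =>
    have hc : Continuous (Function.uncurry (srcDeriv u w F e j)) := by
      have he : (srcDeriv u w F e j) = fun t x =>
          src u w F e (j + 1) t x + deriv (u t) x * iteratedDeriv (j + 1) (w t) x := by
        funext t x; rw [src_succ]; ring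
      have c1 := h.continuous_src hj
      have c2 := h.flow.field.cont_x
      have c3 := h.continuous_w hj
      rw [he]
      exact c1.add (c2.mul c3)
    have hct : ∀ t, Continuous (srcDeriv u w F e j t) := fun t =>
      hc.uncurry_left t
    have hd : ∀ t x, HasDerivAt (src u w F e j t) (srcDeriv u w F e j t x) x := fun t x =>
      (h.prim_src t (j := j) (by omega)).hasDerivAt (hct t) x
    have := h.flow.transported_deriv (wx := fun t => iteratedDeriv (j + 1) (w t))
      (ih (by omega)) (h.continuous_src (j := j) (by omega)) hc hd
      (fun t x => h.hasDerivAt_w (j := j) (by omega) t x)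
    have he : src u w F e (j + 1) = fun t x =>
        srcDeriv u w F e j t x - deriv (u t) x * iteratedDeriv (j + 1) (w t) x := by
      funext t x; rw [src_succ]
    rw [he]
    exact this

/-- The constant in the tame estimates. -/
noncomputable def tameConst (s : ℕ) : ℝ := 2 * (2 * s) ^ (s ^ 2)

theorem le_tameConst {s m : ℕ} (hm : 1 ≤ m) (hms : m ≤ s) :
    2 * (2 * (m : ℝ)) ^ (m ^ 2) ≤ tameConst s := by
  have h1 : (1 : ℝ) ≤ m := by exact_mod_cast hm
  have h2 : (m : ℝ) ≤ s := by exact_mod_cast hms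
  have h3 : (2 * (m : ℝ)) ^ (m ^ 2) ≤ (2 * s) ^ (s ^ 2) :=
    (pow_le_pow_left₀ (by linarith) (by linarith) _).trans
      (pow_le_pow_right₀ (by linarith) (Nat.pow_le_pow_left hms 2))
  unfold tameConst
  linarith

theorem one_le_tameConst {s : ℕ} (hs : 1 ≤ s) : 1 ≤ tameConst s := by
  have h2 : (1 : ℝ) ≤ s := by exact_mod_cast hs
  have : (1 : ℝ) ≤ (2 * s) ^ (s ^ 2) := one_le_pow₀ (by linarith)
  unfold tameConst; linarith

/-- The factors are derivatives of ∂ₓu and of ∂ₓw + e, both bounded by M, so the tame product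
estimate gives a bound linear in the high norm. Keeping ∂ₓw and e together is essential: for w = N
their sum is the density. The case i + l = 0 is separate because the interpolation needs a positive
order. -/
theorem l2_product_le (h : Transport s R S M κ T ν u w F e X) (t : ℝ) {y : ℝ}
    (hyu : jetNorm (s + 1) (u t) ≤ y) (hyw : jetNorm (s + 1) (w t) ≤ y) {i l : ℕ} (hil : i + l ≤ s) :
    MemLp (fun x => iteratedDeriv (i + 1) (u t) x *
      (iteratedDeriv (l + 1) (w t) x + iteratedDeriv l e x)) 2 volume ∧
    l2 (fun x => iteratedDeriv (i + 1) (u t) x *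
      (iteratedDeriv (l + 1) (w t) x + iteratedDeriv l e x)) ≤ tameConst s * (M + κ) * y := by
  have hs := h.one_le
  have hy : 0 ≤ y := (jetNorm_nonneg _ _).trans hyu
  have hM := h.flow.M_nonneg
  have hκ := h.κ_nonneg
  have hT := one_le_tameConst hs
  have hg0 : ∀ x, |iteratedDeriv (0 + 1) (w t) x + iteratedDeriv 0 e x| ≤ M := fun x => by
    simpa using h.bdd t x
  rcases Nat.eq_zero_or_pos (i + l) with h0 | hpos
  · obtain ⟨rfl, rfl⟩ : i = 0 ∧ l = 0 := by omega
    have hm := (h.hu t).memLp (j := 0 + 1) (by omega)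
    have hgc : AEStronglyMeasurable
        (fun x => iteratedDeriv (0 + 1) (w t) x + iteratedDeriv 0 e x) volume :=
      (h.prim_g t (i := 0) (by omega)).continuous.aestronglyMeasurable
    refine ⟨hm.mul_bdd hgc hg0, (l2_mul_le_of_bdd hM hm hg0).trans ?_⟩
    have h1 := (l2_le_jetNorm (show 0 + 1 ≤ s + 1 by omega) (u t)).trans hyu
    calc M * l2 (iteratedDeriv (0 + 1) (u t)) ≤ M * y := by gcongr
      _ ≤ 1 * (M + κ) * y := by nlinarith
      _ ≤ _ := by gcongr
  -- The bound of ∂ₓu multiplies y + κ. Against y it is estimated by M; against κ it is estimated by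
  -- y through the Sobolev embedding, since Mκ is not controlled by a multiple of y.
  · set A := min M y with hA
    have hAM : A ≤ M := min_le_left _ _
    have hAy : A ≤ y := min_le_right _ _
    have hA0 : 0 ≤ A := le_min hM hy
    obtain ⟨h1, h2⟩ := l2_mul_le_of_chain (m := i + l) hpos (A := A) (B := M)
      (F := fun i => iteratedDeriv (i + 1) (u t))
      (G := fun l x => iteratedDeriv (l + 1) (w t) x + iteratedDeriv l e x)
      (fun j hj => (h.hu t).prim (j + 1) (by omega)) (fun j hj => h.prim_g t (by omega))
      (fun x => le_min (by simpa using h.flow.field.bdd_x t x)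
        (((h.hu t).abs_iteratedDeriv_le_jetNorm (by omega) x).trans hyu)) hg0
      (fun j _ hj => (h.hu t).memLp (by omega))
      (fun j hj1 hj => ((h.hw t).memLp (by omega)).add (h.memLp_e hj1 (by omega)).1)
      (i := i) (l := l) rfl
    refine ⟨h1, h2.trans ?_⟩
    have h3 : l2 (fun x => iteratedDeriv (i + l + 1) (w t) x + iteratedDeriv (i + l) e x) ≤ y + κ :=
      (l2_add_le ((h.hw t).memLp (by omega)) (h.memLp_e hpos (by omega)).1).trans
        (add_le_add ((l2_le_jetNorm (by omega) _).trans hyw) (h.memLp_e hpos (by omega)).2)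
    have h4 : l2 (iteratedDeriv (i + l + 1) (u t)) ≤ y := (l2_le_jetNorm (by omega) _).trans hyu
    have h5 : A * l2 (fun x => iteratedDeriv (i + l + 1) (w t) x + iteratedDeriv (i + l) e x) +
        M * l2 (iteratedDeriv (i + l + 1) (u t)) ≤ 2 * ((M + κ) * y) := by
      have e1 : A * l2 (fun x => iteratedDeriv (i + l + 1) (w t) x + iteratedDeriv (i + l) e x) ≤
          A * (y + κ) := by gcongr
      have e2 : M * l2 (iteratedDeriv (i + l + 1) (u t)) ≤ M * y := by gcongr
      have e3 : A * y ≤ M * y := by gcongr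
      have e4 : A * κ ≤ y * κ := by gcongr
      have e5 : 0 ≤ κ * y := by positivity
      linarith
    calc (2 * ((i + l : ℕ) : ℝ)) ^ ((i + l) ^ 2) * _ ≤
        (2 * ((i + l : ℕ) : ℝ)) ^ ((i + l) ^ 2) * (2 * ((M + κ) * y)) := by gcongr
      _ = (2 * (2 * ((i + l : ℕ) : ℝ)) ^ ((i + l) ^ 2)) * ((M + κ) * y) := by ring
      _ ≤ tameConst s * ((M + κ) * y) := by
        gcongr; exact le_tameConst hpos hil
      _ = _ := by ring

theorem l2_u_mul_le (h : Transport s R S M κ T ν u w F e X) (t : ℝ) {y : ℝ}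
    (hyu : jetNorm (s + 1) (u t) ≤ y) {i j : ℕ} (hi : i ≤ s) (hj : 1 ≤ j) (hjs : j ≤ s + 1) :
    MemLp (fun x => iteratedDeriv i (u t) x * iteratedDeriv j e x) 2 volume ∧
      l2 (fun x => iteratedDeriv i (u t) x * iteratedDeriv j e x) ≤ κ * y := by
  have hb : ∀ x, |iteratedDeriv i (u t) x| ≤ y := fun x =>
    ((h.hu t).abs_iteratedDeriv_le_jetNorm (by omega) x).trans hyu
  have hy : 0 ≤ y := (jetNorm_nonneg _ _).trans hyu
  have he := h.memLp_e hj hjs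
  have h1 := he.1.mul_bdd ((h.hu t).continuous (j := i) (by omega)).aestronglyMeasurable hb
  have h2 := l2_mul_le_of_bdd hy he.1 hb
  simp only [mul_comm (iteratedDeriv j e _)] at h1 h2
  refine ⟨h1, h2.trans ?_⟩
  rw [mul_comm]
  gcongr
  exact he.2

/-- The constant in the bounds for the sources. -/
noncomputable def srcConst (s : ℕ) : ℝ := 2 + 2 ^ s * (2 * tameConst s)

theorem l2_src_le (h : Transport s R S M κ T ν u w F e X) (t : ℝ) {y : ℝ}
    (hyu : jetNorm (s + 1) (u t) ≤ y) (hyw : jetNorm (s + 1) (w t) ≤ y) {j : ℕ} (hj : 1 ≤ j)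
    (hjs : j ≤ s) : MemLp (src u w F e j t) 2 volume ∧
      l2 (src u w F e j t) ≤ l2 (iteratedDeriv j (F t)) + srcConst s * (M + κ) * y := by
  have hs := h.one_le
  have hy : 0 ≤ y := (jetNorm_nonneg _ _).trans hyu
  have hM := h.flow.M_nonneg
  have hκ := h.κ_nonneg
  have hT := one_le_tameConst hs
  have hc : 0 ≤ tameConst s * (M + κ) * y := by positivity
  have h1 := (h.hF t).memLp (j := j) (by omega)
  obtain ⟨h2, h3⟩ := h.l2_u_mul_le t hyu (i := 0) (j := j) (by omega) hj (by omega)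
  obtain ⟨h4, h5⟩ := l2_commSum_le (f := fun i => iteratedDeriv (i + 1) (u t))
    (g := fun i x => iteratedDeriv (i + 1) (w t) x + iteratedDeriv i e x) (j := j) hc
    fun i l hil => h.l2_product_le t hyu hyw (by omega)
  simp only [iteratedDeriv_zero] at h2 h3
  refine ⟨(h1.sub h2).sub h4, ?_⟩
  have h6 : l2 (src u w F e j t) ≤
      l2 (fun x => iteratedDeriv j (F t) x - u t x * iteratedDeriv j e x) + _ :=
    l2_sub_le (h1.sub h2) h4
  have h7 := l2_sub_le h1 h2
  have h8 : (2 : ℝ) ^ j * (tameConst s * (M + κ) * y) ≤ 2 ^ s * (tameConst s * (M + κ) * y) := by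
    gcongr; norm_num
  have h9 : 0 ≤ 2 ^ s * (tameConst s * (M + κ) * y) := by positivity
  have h10 : 0 ≤ M * y := by positivity
  have h11 : 0 ≤ κ * y := by positivity
  refine h6.trans ?_
  simp only [srcConst]
  nlinarith

theorem l2_srcDeriv_le (h : Transport s R S M κ T ν u w F e X) (t : ℝ) {y : ℝ}
    (hyu : jetNorm (s + 1) (u t) ≤ y) (hyw : jetNorm (s + 1) (w t) ≤ y) :
    MemLp (srcDeriv u w F e s t) 2 volume ∧
      l2 (srcDeriv u w F e s t) ≤ l2 (iteratedDeriv (s + 1) (F t)) + srcConst s * (M + κ) * y := by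
  have hs := h.one_le
  have hy : 0 ≤ y := (jetNorm_nonneg _ _).trans hyu
  have hM := h.flow.M_nonneg
  have hκ := h.κ_nonneg
  have hT := one_le_tameConst hs
  have hc : 0 ≤ tameConst s * (M + κ) * y := by positivity
  have h1 := (h.hF t).memLp (j := s + 1) (by omega)
  obtain ⟨h2, h3⟩ := h.l2_u_mul_le t hyu (i := 0) (j := s + 1) (by omega) (by omega) (by omega)
  obtain ⟨h2', h3'⟩ := h.l2_u_mul_le t hyu (i := 1) (j := s) (by omega) (by omega) (by omega)
  obtain ⟨h4, h5⟩ := l2_commSumDeriv_le (f := fun i => iteratedDeriv (i + 1) (u t))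
    (g := fun i x => iteratedDeriv (i + 1) (w t) x + iteratedDeriv i e x) (j := s) hc
    fun i l hil => h.l2_product_le t hyu hyw (by omega)
  simp only [iteratedDeriv_zero, iteratedDeriv_one] at h2 h3 h2' h3'
  refine ⟨(h1.sub (h2'.add h2)).sub h4, ?_⟩
  have h6 : l2 (srcDeriv u w F e s t) ≤ l2 (fun x => iteratedDeriv (s + 1) (F t) x -
      (deriv (u t) x * iteratedDeriv s e x + u t x * iteratedDeriv (s + 1) e x)) + _ :=
    l2_sub_le (h1.sub (h2'.add h2)) h4
  have h7 : l2 (fun x => iteratedDeriv (s + 1) (F t) x -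
      (deriv (u t) x * iteratedDeriv s e x + u t x * iteratedDeriv (s + 1) e x)) ≤ _ +
      l2 (fun x => deriv (u t) x * iteratedDeriv s e x + u t x * iteratedDeriv (s + 1) e x) :=
    l2_sub_le h1 (h2'.add h2)
  have h8 := l2_add_le h2' h2
  have h10 : 0 ≤ M * y := by positivity
  have h11 : 0 ≤ κ * y := by positivity
  refine h6.trans ?_
  simp only [srcConst]
  nlinarith

/-- `L²` bounds for the derivatives of `w` of positive order. -/
theorem l2_le (h : Transport s R S M κ T ν u w F e X) {y b : ℝ → ℝ}
    {j : ℕ} (hj : 1 ≤ j) (hjs : j ≤ s + 1) {t : ℝ} (ht : t ∈ Icc 0 T)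
    (hyu : ∀ τ ∈ Icc 0 t, jetNorm (s + 1) (u τ) ≤ y τ)
    (hyw : ∀ τ ∈ Icc 0 t, jetNorm (s + 1) (w τ) ≤ y τ)
    (hb : IntervalIntegrable b volume 0 t)
    (hbF : ∀ τ ∈ Icc 0 t, l2 (iteratedDeriv j (F τ)) + srcConst s * (M + κ) * y τ ≤ b τ) :
    l2 (iteratedDeriv j (w t)) ≤ Real.exp (M * t / 2) * l2 (iteratedDeriv j (w 0)) +
      ∫ τ in (0 : ℝ)..t, Real.exp (M * (t - τ) / 2) * b τ := by
  have hs := h.one_le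
  have hR := h.R_nonneg
  -- A crude bound, uniform in time, that serves only for the use of Fubini's theorem.
  have hunif : ∀ j, 1 ≤ j → j ≤ s → ∀ τ, MemLp (src u w F e j τ) 2 volume ∧
      l2 (src u w F e j τ) ≤ R + srcConst s * (M + κ) * ((s + 1 + 1) * R) := by
    intro j hj hjs τ
    obtain ⟨h1, h2⟩ := h.l2_src_le τ (y := (s + 1 + 1) * R)
      (by exact_mod_cast (h.hu τ).jetNorm_le hR) (by exact_mod_cast (h.hw τ).jetNorm_le hR) hj hjs
    exact ⟨h1, h2.trans (add_le_add ((h.hF τ).l2_le hR (by omega)) le_rfl)⟩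
  -- Orders up to s have their own transport equation. The order s + 1 is estimated from the
  -- equation of order s by integration by parts in the pairing.
  rcases hjs.lt_or_eq with hlt | rfl
  · exact h.flow.l2_le (h.transported (by omega)) (h.continuous_src (by omega)) h.ν_nonneg
      (fun τ _ => (h.hw τ).memLp (by omega)) (fun τ _ => hunif j hj (by omega) τ) ht hb
      fun τ hτ => ((h.l2_src_le τ (hyu τ hτ) (hyw τ hτ) hj (by omega)).2).trans (hbF τ hτ)
  · exact h.flow.l2_deriv_le (w' := fun t => iteratedDeriv (s + 1) (w t))
      (G' := srcDeriv u w F e s) (h.transported le_rfl) (h.continuous_src le_rfl)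
      h.ν_nonneg ((h.hw 0).memLp (by omega)) (fun τ _ => hunif s hs le_rfl τ)
      (fun τ _ => ⟨(h.hw τ).prim s (by omega), (h.hw τ).memLp le_rfl⟩)
      (fun τ _ => ⟨h.prim_src τ le_rfl,
        (h.l2_srcDeriv_le τ (le_max_left _ _) (le_max_right _ _)).1⟩) ht hb
      fun τ hτ => ((h.l2_srcDeriv_le τ (hyu τ hτ) (hyw τ hτ)).2).trans (hbF τ hτ)

end Transport

/-! ### Gronwall's inequality and the a priori estimate for N and u. -/

/-- Gronwall's inequality in integral form. -/
theorem le_exp_of_le_integral {f : ℝ → ℝ} {a c d T : ℝ} (hc : 0 ≤ c) (hd : 0 ≤ d)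
    (hf : MonotoneOn f (Icc 0 T))
    (h : ∀ t ∈ Icc 0 T, f t ≤ a + ∫ τ in (0 : ℝ)..t, (c * f τ + d)) {t : ℝ} (ht : t ∈ Icc 0 T) :
    f t ≤ (a + d * t) * Real.exp (c * t) := by
  have hT : 0 ≤ T := ht.1.trans ht.2
  have hfi : IntervalIntegrable f volume 0 T := by
    refine MonotoneOn.intervalIntegrable ?_
    rwa [uIcc_of_le hT]
  have hfi' : ∀ t ∈ Icc 0 T, IntervalIntegrable f volume 0 t := fun t ht =>
    hfi.mono_set (by rw [uIcc_of_le hT, uIcc_of_le ht.1]; exact Icc_subset_Icc le_rfl ht.2)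
  -- A monotone `f` may jump, so its majorant Φ is continuous but perhaps not differentiable.
  -- Inserting Φ for `f` in the integral once more gives the differentiable majorant Θ, for which Θ'
  -- ≤ cΘ + d.
  set Φ : ℝ → ℝ := fun t => a + ∫ τ in (0 : ℝ)..t, (c * f τ + d) with hΦ
  have hΦc : ContinuousOn Φ (Icc 0 T) := by
    refine continuousOn_const.add ?_
    have := intervalIntegral.continuousOn_primitive_interval'
      ((hfi.const_mul c).add (intervalIntegrable_const (c := d))) (left_mem_uIcc)
    rwa [uIcc_of_le hT] at this
  set Ψ : ℝ → ℝ := IccExtend hT (fun t : Icc 0 T => Φ t) with hΨ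
  have hΨc : Continuous Ψ := (continuousOn_iff_continuous_domRestrict.1 hΦc).Icc_extend'
  have hΨe : ∀ t ∈ Icc 0 T, Ψ t = Φ t := fun t ht => IccExtend_of_mem hT _ ht
  set Θ : ℝ → ℝ := fun t => a + ∫ τ in (0 : ℝ)..t, (c * Ψ τ + d) with hΘ
  have hgc : Continuous fun τ => c * Ψ τ + d := by fun_prop
  have hΘd : ∀ t, HasDerivAt Θ (c * Ψ t + d) t := fun t =>
    ((hgc.integral_hasStrictDerivAt 0 t).hasDerivAt).const_add a
  have hΦΘ : ∀ t ∈ Icc 0 T, Φ t ≤ Θ t := by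
    intro t ht
    refine add_le_add le_rfl (intervalIntegral.integral_mono_on ht.1
      (((hfi' t ht).const_mul c).add intervalIntegrable_const) (hgc.intervalIntegrable _ _)
      fun τ hτ => ?_)
    have hτT : τ ∈ Icc 0 T := ⟨hτ.1, hτ.2.trans ht.2⟩
    rw [hΨe τ hτT]
    exact add_le_add (mul_le_mul_of_nonneg_left (h τ hτT) hc) le_rfl
  have hgd : ∀ t, HasDerivAt (fun t => Θ t * Real.exp (-(c * t)) - d * t)
      ((c * Ψ t + d) * Real.exp (-(c * t)) + Θ t * (Real.exp (-(c * t)) * -c) - d) t := by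
    intro t
    have h1 : HasDerivAt (fun t => Real.exp (-(c * t))) (Real.exp (-(c * t)) * -c) t := by
      simpa using ((hasDerivAt_id t).const_mul c).neg.exp
    have h2 : HasDerivAt (fun t => d * t) d t := by
      simpa using (hasDerivAt_id t).const_mul d
    exact ((hΘd t).mul h1).sub h2
  have hanti : AntitoneOn (fun t => Θ t * Real.exp (-(c * t)) - d * t) (Icc 0 T) := by
    refine antitoneOn_of_deriv_nonpos (convex_Icc 0 T)
      (fun t _ => (hgd t).continuousAt.continuousWithinAt)
      (fun t _ => (hgd t).differentiableAt.differentiableWithinAt) fun t ht => ?_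
    rw [interior_Icc] at ht
    have htT : t ∈ Icc 0 T := Ioo_subset_Icc_self ht
    rw [(hgd t).deriv]
    have h1 : Ψ t ≤ Θ t := by rw [hΨe t htT]; exact hΦΘ t htT
    have h2 : Real.exp (-(c * t)) ≤ 1 := Real.exp_le_one_iff.2 (by
      have := mul_nonneg hc ht.1.le; linarith)
    have h3 := Real.exp_pos (-(c * t))
    have h4 : c * (Ψ t - Θ t) * Real.exp (-(c * t)) ≤ 0 :=
      mul_nonpos_of_nonpos_of_nonneg (mul_nonpos_of_nonneg_of_nonpos hc (by linarith)) h3.le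
    nlinarith
  have h1 := hanti ⟨le_rfl, hT⟩ ht ht.1
  simp only [mul_zero, neg_zero, Real.exp_zero, mul_one, sub_zero] at h1
  have h2 : Θ 0 = a := by simp [hΘ]
  rw [h2, Real.exp_neg, ← div_eq_mul_inv, sub_le_iff_le_add, div_le_iff₀ (Real.exp_pos _)] at h1
  exact (h t ht).trans ((hΦΘ t ht).trans h1)

/-- The system in the variables `N` and `u`, where `∂ₓ N = ρ - c₀`, on `[0, T]`. All functions are
extended in time beyond `[0, T]`. -/
structure RegSol (s : ℕ) (R S κ T k ν : ℝ) (c₀ : ℝ → ℝ) (B N u : ℝ → ℝ → ℝ) : Prop where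
  two_le : 2 ≤ s
  R_nonneg : 0 ≤ R
  κ_nonneg : 0 ≤ κ
  ν_nonneg : 0 ≤ ν
  abs_k : |k| = 1
  hB : ∀ t, HB (s + 1) R (B t)
  hN : ∀ t, HB (s + 1) R (N t)
  hu : ∀ t, HB (s + 1) R (u t)
  cB : ∀ x, Continuous fun t => B t x
  cN : ∀ x, Continuous fun t => N t x
  cu : ∀ x, Continuous fun t => u t x
  c_bdd : ∀ x, |c₀ x| ≤ S
  c_prim : Prim c₀ (deriv c₀)
  c_hb : HB s κ (deriv c₀)
  eqN : ∀ t ∈ Icc 0 T, ∀ x, N t x = N 0 x + ∫ τ in (0 : ℝ)..t, -((deriv (N τ) x + c₀ x) * u τ x)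
  equ : ∀ t ∈ Icc 0 T, ∀ x, u t x = u 0 x + ∫ τ in (0 : ℝ)..t,
    (-(u τ x * deriv (u τ) x) - ν * u τ x + k * (N τ x - B τ x))

theorem l2_iteratedDeriv_sub_le {m j : ℕ} {R S : ℝ} {f g : ℝ → ℝ} (hf : HB m R f) (hg : HB m S g)
    (k : ℝ) (hj : j ≤ m) : l2 (iteratedDeriv j fun x => k * (f x - g x)) ≤
      |k| * (l2 (iteratedDeriv j f) + l2 (iteratedDeriv j g)) := by
  have h1 := iteratedDeriv_of_chain (m := j)
    (G := fun j x => k * (iteratedDeriv j f x - iteratedDeriv j g x)) fun i hi =>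
      ((hf.prim i (by omega)).sub (hg.prim i (by omega))).const_mul k
  simp only [iteratedDeriv_zero] at h1
  rw [l2_congr_ae h1.2, l2_const_mul]
  exact mul_le_mul_of_nonneg_left (l2_sub_le (hf.memLp hj) (hg.memLp hj)) (abs_nonneg _)

namespace RegSol

variable {s : ℕ} {R S κ T k ν M b : ℝ} {c₀ : ℝ → ℝ} {B N u : ℝ → ℝ → ℝ}

theorem vfield (h : RegSol s R S κ T k ν c₀ B N u) {R' : ℝ} (hR' : R ≤ R')
    (hM : ∀ t x, |deriv (u t) x| ≤ M) : VField (2 * R') M u fun t => deriv (u t) where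
  cont := by
    have := HB.continuous_uncurry h.R_nonneg h.hu h.cu (j := 0) (by omega)
    simpa only [iteratedDeriv_zero] using this
  cont_x := by
    have hs := h.two_le
    have := HB.continuous_uncurry h.R_nonneg h.hu h.cu (j := 1) (by omega)
    simpa only [iteratedDeriv_one] using this
  hasDerivAt := fun t x => (h.hu t).prim'.hasDerivAt ((h.hu t).deriv.mono
    (m' := 1) (by have := h.two_le; omega) le_rfl).continuous' x
  bdd := fun t x => ((h.hu t).abs_le h.R_nonneg x).trans (by linarith)
  bdd_x := hM

theorem hF (h : RegSol s R S κ T k ν c₀ B N u) (t : ℝ) :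
    HB (s + 1) (2 * R) fun x => k * (N t x - B t x) := by
  have := ((h.hN t).sub (h.hB t) h.R_nonneg h.R_nonneg).const_mul k
  rw [h.abs_k] at this
  exact this.mono le_rfl (by linarith)

theorem cF (h : RegSol s R S κ T k ν c₀ B N u) (x : ℝ) :
    Continuous fun t => k * (N t x - B t x) :=
  continuous_const.mul ((h.cN x).sub (h.cB x))

theorem transport_u (h : RegSol s R S κ T k ν c₀ B N u) (hM : ∀ t x, |deriv (u t) x| ≤ M)
    {X : ℝ → ℝ → ℝ} (hX : VFlow (2 * (2 * R)) M u (fun t => deriv (u t)) X) :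
    Transport s (2 * R) 0 M κ T ν u u (fun t x => k * (N t x - B t x)) (fun _ => 0) X where
  one_le := by have := h.two_le; omega
  R_nonneg := by have := h.R_nonneg; positivity
  κ_nonneg := h.κ_nonneg
  ν_nonneg := h.ν_nonneg
  hu := fun t => (h.hu t).mono le_rfl (by linarith [h.R_nonneg])
  hw := fun t => (h.hu t).mono le_rfl (by linarith [h.R_nonneg])
  hF := h.hF
  cu := h.cu
  cw := h.cu
  cF := h.cF
  e_bdd := by simp
  e_prim := by simpa using prim_zero
  e_hb := by
    have := (h.c_hb).const_mul 0
    simp only [zero_mul, abs_zero] at this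
    simpa using this.mono le_rfl h.κ_nonneg
  flow := hX
  bdd := fun t x => by simpa using hM t x
  eqn := fun t ht x => by
    rw [h.equ t ht x]
    congr 1
    refine intervalIntegral.integral_congr fun τ _ => ?_
    ring

/-- With e = c₀ the quantity ∂ₓw + e is the density, so the bound on the density is the one that the
commutator estimates require. -/
theorem transport_N (h : RegSol s R S κ T k ν c₀ B N u)
    (hρ : ∀ t x, |deriv (N t) x + c₀ x| ≤ M)
    {X : ℝ → ℝ → ℝ} (hX : VFlow (2 * (2 * R)) M u (fun t => deriv (u t)) X) :
    Transport s (2 * R) S M κ T 0 u N (fun _ _ => 0) c₀ X where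
  one_le := by have := h.two_le; omega
  R_nonneg := by have := h.R_nonneg; positivity
  κ_nonneg := h.κ_nonneg
  ν_nonneg := le_rfl
  hu := fun t => (h.hu t).mono le_rfl (by linarith [h.R_nonneg])
  hw := fun t => (h.hN t).mono le_rfl (by linarith [h.R_nonneg])
  hF := fun t => by
    have := (h.hN t).const_mul 0
    simp only [zero_mul, abs_zero] at this
    exact this.mono le_rfl (by linarith [h.R_nonneg])
  cu := h.cu
  cw := h.cN
  cF := fun _ => continuous_const
  e_bdd := h.c_bdd
  e_prim := h.c_prim
  e_hb := h.c_hb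
  flow := hX
  bdd := hρ
  eqn := fun t ht x => by
    rw [h.eqN t ht x]
    congr 1
    refine intervalIntegral.integral_congr fun τ _ => ?_
    ring

theorem continuous_ρu (h : RegSol s R S κ T k ν c₀ B N u) :
    Continuous (Function.uncurry fun t x => -((deriv (N t) x + c₀ x) * u t x)) := by
  have hs := h.two_le
  have h1 := HB.continuous_uncurry h.R_nonneg h.hN h.cN (j := 1) (by omega)
  have h2 := HB.continuous_uncurry h.R_nonneg h.hu h.cu (j := 0) (by omega)
  simp only [iteratedDeriv_zero, iteratedDeriv_one] at h1 h2
  exact ((h1.add (h.c_prim.continuous.comp continuous_snd)).mul h2).neg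

/-- `L²` bound for `N` that does not involve the size of the background. -/
theorem l2_N_le (h : RegSol s R S κ T k ν c₀ B N u) (hρ : ∀ t x, |deriv (N t) x + c₀ x| ≤ M)
    {b : ℝ → ℝ} {t : ℝ} (ht : t ∈ Icc 0 T) (hb : IntervalIntegrable b volume 0 t)
    (hbu : ∀ τ ∈ Icc 0 t, M * l2 (u τ) ≤ b τ) :
    l2 (N t) ≤ l2 (N 0) + ∫ τ in (0 : ℝ)..t, b τ := by
  have hs := h.two_le
  have hM : 0 ≤ M := (abs_nonneg _).trans (hρ 0 0)
  -- At order zero the flow is taken trivial and the whole flux ρu is a source, bounded by M‖u‖.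
  -- Splitting off c₀ u would bring in the supremum of the background.
  have hid : VFlow 0 0 (fun _ _ => 0) (fun _ _ => 0) (fun _ α => α) :=
    { field :=
        { cont := continuous_const
          cont_x := continuous_const
          hasDerivAt := fun t x => hasDerivAt_const x 0
          bdd := by simp
          bdd_x := by simp }
      init := fun _ => rfl
      ode := fun t α => hasDerivAt_const t α }
  have htr : Transported (fun _ α => α) T 0 N fun t x => -((deriv (N t) x + c₀ x) * u t x) := by
    intro t ht α
    simpa using h.eqN t ht α
  have hbd : ∀ τ, MemLp (fun x => -((deriv (N τ) x + c₀ x) * u τ x)) 2 volume ∧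
      l2 (fun x => -((deriv (N τ) x + c₀ x) * u τ x)) ≤ M * l2 (u τ) := by
    intro τ
    have hb1 : ∀ x, |-(deriv (N τ) x + c₀ x)| ≤ M := fun x => by rw [abs_neg]; exact hρ τ x
    have hm : AEStronglyMeasurable (fun x => -(deriv (N τ) x + c₀ x)) volume :=
      (((h.hN τ).deriv.mono (m' := 1) (by omega) le_rfl).continuous'.add
        h.c_prim.continuous).neg.aestronglyMeasurable
    have e1 := (h.hu τ).memLp'.mul_bdd hm hb1
    have e2 := l2_mul_le_of_bdd hM (h.hu τ).memLp' hb1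
    have e3 : (fun x => u τ x * -(deriv (N τ) x + c₀ x)) =
        fun x => -((deriv (N τ) x + c₀ x) * u τ x) := by funext x; ring
    rw [e3] at e1 e2
    exact ⟨e1, e2⟩
  have := hid.l2_le htr h.continuous_ρu (R := M * R) le_rfl (fun τ _ => (h.hN τ).memLp')
    (fun τ _ => ⟨(hbd τ).1, (hbd τ).2.trans (mul_le_mul_of_nonneg_left (by
      simpa using (h.hu τ).l2_le h.R_nonneg (Nat.zero_le _)) hM)⟩) ht hb
    fun τ hτ => (hbd τ).2.trans (hbu τ hτ)
  simpa using this

theorem one_le_srcConst (hs : 1 ≤ s) : 1 ≤ Transport.srcConst s := by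
  have h1 := Transport.one_le_tameConst hs
  have : 0 ≤ (2 : ℝ) ^ s * (2 * Transport.tameConst s) := by positivity
  unfold Transport.srcConst
  linarith

/-- The constant in the exponential growth bound. -/
noncomputable def growthConst (s : ℕ) : ℝ := 2 * (s + 2) * Transport.srcConst s + 1

/-- A priori estimate. -/
theorem jetNorm_le (h : RegSol s R S κ T k ν c₀ B N u) (hρ : ∀ t x, |deriv (N t) x + c₀ x| ≤ M)
    (hM : ∀ t x, |deriv (u t) x| ≤ M) (hb0 : 0 ≤ b) (hb : ∀ t, HB (s + 1) b (B t)) {t : ℝ}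
    (ht : t ∈ Icc 0 T) :
    jetNorm (s + 1) (N t) + jetNorm (s + 1) (u t) ≤
      (jetNorm (s + 1) (N 0) + jetNorm (s + 1) (u 0) + 2 * (s + 2) * b * T) *
        Real.exp (growthConst s * (M + κ + 1) * T) := by
  have hs := h.two_le
  have hR := h.R_nonneg
  have hκ := h.κ_nonneg
  have hM0 : 0 ≤ M := (abs_nonneg _).trans (hM 0 0)
  have hc1 := one_le_srcConst (s := s) (by omega)
  obtain ⟨X, hX⟩ := (h.vfield (R' := 2 * R) (by linarith) hM).exists_flow
  have htu := h.transport_u hM hX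
  have htN := h.transport_N hρ hX
  set y : ℝ → ℝ := fun τ => jetNorm (s + 1) (N τ) + jetNorm (s + 1) (u τ) with hy
  have hNy : ∀ τ, jetNorm (s + 1) (N τ) ≤ y τ := fun τ => le_add_of_nonneg_right (jetNorm_nonneg _ _)
  have huy : ∀ τ, jetNorm (s + 1) (u τ) ≤ y τ := fun τ => le_add_of_nonneg_left (jetNorm_nonneg _ _)
  have hy0 : ∀ τ, 0 ≤ y τ := fun τ => (jetNorm_nonneg _ _).trans (hNy τ)
  -- This weight removes the kernel e^{M(t - τ)/2} produced by the flow.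
  set Z : ℝ → ℝ := fun τ => Real.exp (-(M * τ / 2)) * y τ with hZ
  have hZb : ∀ τ, BddAbove (Z '' Icc 0 τ) := by
    refine fun τ => ⟨(s + 1 + 1) * R + (s + 1 + 1) * R, ?_⟩
    rintro _ ⟨σ, hσ, rfl⟩
    have h1 : Real.exp (-(M * σ / 2)) ≤ 1 := Real.exp_le_one_iff.2 (by
      have := mul_nonneg hM0 hσ.1; linarith)
    have h2 : y σ ≤ (s + 1 + 1) * R + (s + 1 + 1) * R := by
      refine add_le_add ?_ ?_
      · exact_mod_cast (h.hN σ).jetNorm_le hR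
      · exact_mod_cast (h.hu σ).jetNorm_le hR
    exact (mul_le_of_le_one_left (hy0 σ) h1).trans h2
  -- The running supremum is monotone, hence integrable, so no measurability in time of the Sobolev
  -- norms has to be known.
  set Zs : ℝ → ℝ := fun τ => sSup (Z '' Icc 0 τ) with hZs
  have hZle : ∀ σ τ, 0 ≤ σ → σ ≤ τ → Z σ ≤ Zs τ := fun σ τ h1 h2 =>
    le_csSup (hZb τ) ⟨σ, ⟨h1, h2⟩, rfl⟩
  have hmono : MonotoneOn Zs (Icc 0 T) := fun σ hσ τ _ hστ =>
    csSup_le_csSup (hZb τ) ⟨Z 0, 0, ⟨le_rfl, hσ.1⟩, rfl⟩ (image_mono (Icc_subset_Icc le_rfl hστ))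
  have hyZ : ∀ τ, 0 ≤ τ → y τ ≤ Real.exp (M * τ / 2) * Zs τ := by
    intro τ hτ
    have h1 := mul_le_mul_of_nonneg_left (hZle τ τ hτ le_rfl) (Real.exp_pos (M * τ / 2)).le
    rwa [hZ, ← mul_assoc, ← Real.exp_add, add_neg_cancel, Real.exp_zero, one_mul] at h1
  -- The part M + κ bounds the commutators and the flux, the summand 1 the contribution of N to the
  -- force k (N - B).
  set l : ℝ := Transport.srcConst s * (M + κ + 1) with hl
  have hl0 : 0 ≤ l := by positivity
  set b' : ℝ → ℝ := fun τ => l * (Real.exp (M * τ / 2) * Zs τ) + b with hb'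
  have hb'i : ∀ t ∈ Icc 0 T, IntervalIntegrable b' volume 0 t := by
    intro t ht
    have h1 : IntervalIntegrable Zs volume 0 t := by
      refine MonotoneOn.intervalIntegrable (hmono.mono ?_)
      rw [uIcc_of_le ht.1]; exact Icc_subset_Icc le_rfl ht.2
    exact ((h1.continuousOn_mul (by fun_prop)).const_mul l).add intervalIntegrable_const
  have hlb : ∀ τ, 0 ≤ τ → l * y τ + b ≤ b' τ := fun τ hτ => by
    have := mul_le_mul_of_nonneg_left (hyZ τ hτ) hl0
    simp only [hb']; linarith
  have hsplit : ∀ τ, y τ + Transport.srcConst s * (M + κ) * y τ ≤ l * y τ := fun τ => by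
    have : y τ ≤ Transport.srcConst s * y τ := le_mul_of_one_le_left (hy0 τ) hc1
    rw [hl]; nlinarith
  have hexp1 : ∀ t τ : ℝ, τ ≤ t → 1 ≤ Real.exp (M * (t - τ) / 2) := fun t τ hτ =>
    Real.one_le_exp (by have := mul_nonneg hM0 (sub_nonneg.2 hτ); linarith)
  have hb'0 : ∀ τ, 0 ≤ τ → 0 ≤ b' τ := fun τ hτ =>
    (add_nonneg (mul_nonneg hl0 (hy0 τ)) hb0).trans (hlb τ hτ)
  have hFl : ∀ τ, ∀ j ≤ s + 1, l2 (iteratedDeriv j fun x => k * (N τ x - B τ x)) ≤ y τ + b := by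
    intro τ j hj
    have h1 : l2 (iteratedDeriv j (B τ)) ≤ b := (hb τ).l2_le hb0 hj
    have h2 := (l2_le_jetNorm hj (N τ)).trans (hNy τ)
    have h3 := l2_iteratedDeriv_sub_le (h.hN τ) (h.hB τ) k hj
    rw [h.abs_k] at h3
    linarith
  have hu : ∀ t ∈ Icc 0 T, ∀ j ≤ s + 1, l2 (iteratedDeriv j (u t)) ≤
      Real.exp (M * t / 2) * l2 (iteratedDeriv j (u 0)) +
        ∫ τ in (0 : ℝ)..t, Real.exp (M * (t - τ) / 2) * b' τ := by
    intro t ht j hj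
    rcases Nat.eq_zero_or_pos j with rfl | hpos
    · have hsrc : Transport.src u u (fun t x => k * (N t x - B t x)) (fun _ => 0) 0 =
          fun t x => k * (N t x - B t x) := by
        funext t x; simp [Transport.src, commSum]
      have htr := htu.transported (j := 0) (by omega)
      have hcs := htu.continuous_src (j := 0) (by omega)
      rw [hsrc] at htr hcs
      refine hX.l2_le htr hcs (R := 2 * R) h.ν_nonneg
        (fun τ _ => (h.hu τ).memLp (by omega))
        (fun τ _ => ⟨(h.hF τ).memLp', ?_⟩) ht (hb'i t ht) fun τ hτ => ?_
      · simpa using (h.hF τ).l2_le (by linarith) (Nat.zero_le _)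
      · have h1 := hFl τ 0 (by omega)
        rw [iteratedDeriv_zero] at h1
        have h2 := hsplit τ
        have h3 : 0 ≤ Transport.srcConst s * (M + κ) * y τ := mul_nonneg (by positivity) (hy0 τ)
        linarith [hlb τ hτ.1]
    · refine htu.l2_le hpos hj ht (fun τ _ => huy τ) (fun τ _ => huy τ) (hb'i t ht) fun τ hτ => ?_
      linarith [hlb τ hτ.1, hsplit τ, hFl τ j hj]
  have hN : ∀ t ∈ Icc 0 T, ∀ j ≤ s + 1, l2 (iteratedDeriv j (N t)) ≤
      Real.exp (M * t / 2) * l2 (iteratedDeriv j (N 0)) +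
        ∫ τ in (0 : ℝ)..t, Real.exp (M * (t - τ) / 2) * b' τ := by
    intro t ht j hj
    rcases Nat.eq_zero_or_pos j with rfl | hpos
    · simp only [iteratedDeriv_zero]
      refine (h.l2_N_le hρ ht (hb'i t ht) fun τ hτ => ?_).trans (add_le_add ?_ ?_)
      · have h1 : l2 (u τ) ≤ y τ := by
          simpa using (l2_le_jetNorm (Nat.zero_le (s + 1)) (u τ)).trans (huy τ)
        have h2 : M * l2 (u τ) ≤ M * y τ := by gcongr
        have h3 : M * y τ ≤ l * y τ := by
          refine mul_le_mul_of_nonneg_right ?_ (hy0 τ)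
          rw [hl]; nlinarith
        linarith [hlb τ hτ.1]
      · refine le_mul_of_one_le_left (l2_nonneg _) ?_
        simpa using hexp1 t 0 ht.1
      · refine intervalIntegral.integral_mono_on ht.1 (hb'i t ht)
          ((hb'i t ht).continuousOn_mul (by fun_prop)) fun τ hτ => ?_
        exact le_mul_of_one_le_left (hb'0 τ hτ.1) (hexp1 t τ hτ.2)
    · refine htN.l2_le hpos hj ht (fun τ _ => huy τ) (fun τ _ => hNy τ) (hb'i t ht) fun τ hτ => ?_
      have h0 : l2 (iteratedDeriv j fun _ : ℝ => (0 : ℝ)) = 0 := by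
        have : iteratedDeriv j (fun _ : ℝ => (0 : ℝ)) = 0 := by
          funext x; rw [iteratedDeriv_const]; simp
        rw [this]; simp [l2]
      rw [h0]
      linarith [hlb τ hτ.1, hsplit τ, hy0 τ]
  have hsum : ∀ t ∈ Icc 0 T, Z t ≤ y 0 + ∫ τ in (0 : ℝ)..t,
      (2 * (s + 2) * l * Zs τ + 2 * (s + 2) * b) := by
    intro t ht
    set I := ∫ τ in (0 : ℝ)..t, Real.exp (M * (t - τ) / 2) * b' τ with hI
    have hjet : ∀ f : ℝ → ℝ → ℝ, (∀ j ≤ s + 1, l2 (iteratedDeriv j (f t)) ≤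
        Real.exp (M * t / 2) * l2 (iteratedDeriv j (f 0)) + I) →
        jetNorm (s + 1) (f t) ≤ Real.exp (M * t / 2) * jetNorm (s + 1) (f 0) + (s + 2) * I := by
      intro f hf
      refine (Finset.sum_le_sum fun j hj => hf j (by simp at hj; omega)).trans_eq ?_
      rw [Finset.sum_add_distrib, ← Finset.mul_sum, jetNorm, Finset.sum_const, Finset.card_range,
        nsmul_eq_mul]
      push_cast; ring
    have h1 : y t ≤ Real.exp (M * t / 2) * y 0 + 2 * (s + 2) * I := by
      have := add_le_add (hjet N (hN t ht)) (hjet u (hu t ht))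
      simp only [hy]; linarith
    have h2 : Real.exp (-(M * t / 2)) * I ≤ ∫ τ in (0 : ℝ)..t, (l * Zs τ + b) := by
      rw [hI, ← intervalIntegral.integral_const_mul]
      have hZi : IntervalIntegrable Zs volume 0 t := by
        refine MonotoneOn.intervalIntegrable (hmono.mono ?_)
        rw [uIcc_of_le ht.1]; exact Icc_subset_Icc le_rfl ht.2
      refine intervalIntegral.integral_mono_on ht.1
        (((hb'i t ht).continuousOn_mul (by fun_prop)).const_mul _)
        ((hZi.const_mul l).add intervalIntegrable_const) fun τ hτ => ?_
      have e1 : Real.exp (-(M * t / 2)) * (Real.exp (M * (t - τ) / 2) * b' τ) =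
          l * Zs τ + Real.exp (-(M * τ / 2)) * b := by
        rw [← mul_assoc, ← Real.exp_add, show -(M * t / 2) + M * (t - τ) / 2 = -(M * τ / 2) by ring]
        simp only [hb']
        rw [mul_add, mul_left_comm, ← mul_assoc (Real.exp _) (Real.exp _), ← Real.exp_add,
          neg_add_cancel, Real.exp_zero, one_mul]
      rw [e1]
      have e2 : Real.exp (-(M * τ / 2)) ≤ 1 := Real.exp_le_one_iff.2 (by
        have := mul_nonneg hM0 hτ.1; linarith)
      have e3 := mul_le_of_le_one_left hb0 e2
      linarith
    have h3 : ∫ τ in (0 : ℝ)..t, (2 * (s + 2) * l * Zs τ + 2 * (s + 2) * b) =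
        2 * (s + 2) * ∫ τ in (0 : ℝ)..t, (l * Zs τ + b) := by
      rw [← intervalIntegral.integral_const_mul]
      exact intervalIntegral.integral_congr fun τ _ => by ring
    have h4 : Real.exp (-(M * t / 2)) * y t ≤
        Real.exp (-(M * t / 2)) * (Real.exp (M * t / 2) * y 0 + 2 * (s + 2) * I) :=
      mul_le_mul_of_nonneg_left h1 (Real.exp_pos (-(M * t / 2))).le
    have h6 : Real.exp (-(M * t / 2)) * (Real.exp (M * t / 2) * y 0 + 2 * (s + 2) * I) =
        y 0 + 2 * (s + 2) * (Real.exp (-(M * t / 2)) * I) := by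
      have : Real.exp (-(M * t / 2)) * Real.exp (M * t / 2) = 1 := by rw [← Real.exp_add]; simp
      linear_combination y 0 * this
    rw [h6] at h4
    rw [h3]
    have h5 : 2 * ((s : ℝ) + 2) * (Real.exp (-(M * t / 2)) * I) ≤
        2 * (s + 2) * ∫ τ in (0 : ℝ)..t, (l * Zs τ + b) := by gcongr
    simp only [hZ]
    linarith
  have hZs' : ∀ t ∈ Icc 0 T, Zs t ≤ y 0 + ∫ τ in (0 : ℝ)..t,
      (2 * (s + 2) * l * Zs τ + 2 * (s + 2) * b) := by
    intro t ht
    have hT : 0 ≤ T := ht.1.trans ht.2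
    refine csSup_le ⟨Z 0, 0, ⟨le_rfl, ht.1⟩, rfl⟩ ?_
    rintro _ ⟨σ, hσ, rfl⟩
    refine (hsum σ ⟨hσ.1, hσ.2.trans ht.2⟩).trans (add_le_add le_rfl ?_)
    have hZi : IntervalIntegrable Zs volume 0 t := by
      refine MonotoneOn.intervalIntegrable (hmono.mono ?_)
      rw [uIcc_of_le ht.1]; exact Icc_subset_Icc le_rfl ht.2
    refine intervalIntegral.integral_mono_interval le_rfl hσ.1 hσ.2 ?_
      ((hZi.const_mul _).add intervalIntegrable_const)
    refine (ae_restrict_iff' measurableSet_Ioc).2 (Eventually.of_forall fun τ hτ => ?_)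
    have : 0 ≤ Zs τ := (mul_nonneg (Real.exp_pos _).le (hy0 τ)).trans (hZle τ τ hτ.1.le le_rfl)
    simp only [Pi.zero_apply]
    positivity
  have hfin := le_exp_of_le_integral (by positivity) (by positivity) hmono hZs' ht
  have hT : 0 ≤ T := ht.1.trans ht.2
  have hy0' := hy0 0
  have h1 := hyZ t ht.1
  calc y t ≤ Real.exp (M * t / 2) * Zs t := h1
    _ ≤ Real.exp (M * T / 2) * ((y 0 + 2 * (s + 2) * b * T) *
        Real.exp (2 * (s + 2) * l * T)) := by
      have e1 : Zs t ≤ (y 0 + 2 * (s + 2) * b * T) * Real.exp (2 * (s + 2) * l * T) := by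
        refine hfin.trans ?_
        have := ht.1
        have := ht.2
        gcongr
      have e2 : 0 ≤ (y 0 + 2 * (s + 2) * b * T) * Real.exp (2 * (s + 2) * l * T) := by positivity
      have e3 : Real.exp (M * t / 2) ≤ Real.exp (M * T / 2) := by
        have := ht.2
        gcongr
      exact mul_le_mul e3 e1 ((mul_nonneg (Real.exp_pos _).le (hy0 t)).trans
        (hZle t t ht.1 le_rfl)) (Real.exp_pos _).le
    _ = (y 0 + 2 * (s + 2) * b * T) * Real.exp (M * T / 2 + 2 * (s + 2) * l * T) := by
      rw [Real.exp_add]; ring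
    _ ≤ _ := by
      refine mul_le_mul_of_nonneg_left (Real.exp_le_exp.2 ?_) (by positivity)
      rw [growthConst, hl]
      have : 0 ≤ M * T := by positivity
      have : 0 ≤ κ * T := by positivity
      nlinarith

end RegSol

/-! ### Bounds at almost every time become bounds at every time; the background. -/

theorem Prim.eq_of_memLp {E E' f : ℝ → ℝ} (h : Prim E f) (h' : Prim E' f) (hE : MemLp E 2 volume)
    (hE' : MemLp E' 2 volume) : E = E' := by
  have h1 : ∀ x, E x - E' x = E 0 - E' 0 := fun x => by
    have e1 := h.2 0 x
    have e2 := h'.2 0 x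
    linarith
  have h2 : MemLp (fun _ : ℝ => E 0 - E' 0) 2 volume :=
    (memLp_congr_ae (Eventually.of_forall h1)).1 (hE.sub hE')
  -- The primitives differ by a constant, and zero is the only square integrable constant. This
  -- uniqueness is what fixes all constants of integration below.
  have h3 : E 0 - E' 0 = 0 := by
    rcases (memLp_const_iff (by norm_num) (by norm_num)).1 h2 with h3 | h3
    · exact h3
    · simp at h3
  funext x
  have := h1 x
  linarith

/-- `f` has a primitive in `Hᵐ⁺¹`. -/
def CapB (m : ℕ) (R : ℝ) (f : ℝ → ℝ) : Prop := ∃ E, Prim E f ∧ HB (m + 1) R E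

theorem CapB.hb {m : ℕ} {R : ℝ} {f : ℝ → ℝ} (hf : Continuous f) (h : CapB m R f) :
    HB m R f := by
  obtain ⟨E, hP, hE⟩ := h
  rw [← hP.deriv_eq hf]; exact hE.deriv

theorem CapB.of_dual {m : ℕ} {R : ℝ} {f : ℝ → ℝ} (hf : Continuous f) (hR : 0 ≤ R)
    (h : ∀ j ≤ m, ∀ ψ, IsTest ψ → |∫ x, f x * iteratedDeriv j ψ x| ≤ R * l2 ψ)
    (h' : ∀ ψ, IsTest ψ → |∫ x, f x * ψ x| ≤ R * l2 (deriv ψ)) : CapB m R f := by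
  obtain ⟨E, hP, -, hE⟩ := exists_prim_of_dual hf.locallyIntegrable hR h'
  exact ⟨E, hP, HB.of_prim hE hP (HB.of_dual hf hR h)⟩

/-- The norm becomes a family of estimates for pairings with fixed test functions, which is the form
that survives limits and time integrals. The function need not be continuous. -/
theorem dual_of_capNorm {m : ℕ} {R : ℝ} {f : ℝ → ℝ} (hm : 1 ≤ m) (hR : 0 ≤ R)
    (h : capNorm m f ≤ ENNReal.ofReal R) :
    (MemLp f 2 volume ∧ l2 f ≤ R) ∧
    (∀ j ≤ m, ∀ ψ, IsTest ψ → |∫ x, f x * iteratedDeriv j ψ x| ≤ R * l2 ψ) ∧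
    (∀ ψ, IsTest ψ → |∫ x, f x * ψ x| ≤ R * l2 (deriv ψ)) := by
  obtain ⟨F, hF, hFB⟩ := exists_hb_of_sobolevNorm hm (le_self_add.trans h)
  have h2 : hMinusOneNorm f ≤ ENNReal.ofReal R := le_add_self.trans h
  obtain ⟨E, hP, hE, hER⟩ := exists_prim_of_hMinusOneNorm (h2.trans_lt ENNReal.ofReal_lt_top)
  refine ⟨⟨(memLp_congr_ae hF).2 hFB.memLp', ?_⟩, fun j hj ψ hψ => ?_, fun ψ hψ =>
    hP.dual hE hR (hER.trans h2) hψ⟩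
  · rw [l2_congr_ae hF]; simpa using hFB.l2_le hR (Nat.zero_le m)
  · have : ∫ x, f x * iteratedDeriv j ψ x = ∫ x, F x * iteratedDeriv j ψ x :=
      integral_congr_ae (hF.mono fun x hx => by simp only [hx])
    rw [this]; exact hFB.dual hR hj hψ

theorem CapB.of_capNorm {m : ℕ} {R : ℝ} {f : ℝ → ℝ} (hm : 1 ≤ m) (hR : 0 ≤ R) (hf : Continuous f)
    (h : capNorm m f ≤ ENNReal.ofReal R) : CapB m R f :=
  CapB.of_dual hf hR (dual_of_capNorm hm hR h).2.1 (dual_of_capNorm hm hR h).2.2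

theorem tendsto_integral_mul_test {F : ℕ → ℝ → ℝ} {f ψ : ℝ → ℝ} {C : ℝ} (hψ : IsTest ψ)
    (hF : ∀ n, Continuous (F n)) (hC : ∀ n x, |F n x| ≤ C)
    (h : ∀ x, Tendsto (fun n => F n x) atTop (𝓝 (f x))) :
    Tendsto (fun n => ∫ x, F n x * ψ x) atTop (𝓝 (∫ x, f x * ψ x)) := by
  refine tendsto_integral_of_dominated_convergence (fun x => C * |ψ x|)
    (fun n => ((hF n).mul hψ.1.continuous).aestronglyMeasurable)
    (hψ.integrable.abs.const_mul _) (fun n => Eventually.of_forall fun x => ?_)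
    (Eventually.of_forall fun x => (h x).mul_const _)
  rw [Real.norm_eq_abs, abs_mul]
  exact mul_le_mul_of_nonneg_right (hC n x) (abs_nonneg _)

theorem CapB.of_tendsto {m : ℕ} {R : ℝ} (hm : 1 ≤ m) (hR : 0 ≤ R) {F : ℕ → ℝ → ℝ} {f : ℝ → ℝ}
    (hf : Continuous f) (hFc : ∀ n, Continuous (F n)) (hF : ∀ n, CapB m R (F n))
    (h : ∀ x, Tendsto (fun n => F n x) atTop (𝓝 (f x))) : CapB m R f := by
  obtain ⟨m, rfl⟩ := Nat.exists_eq_succ_of_ne_zero (by omega : m ≠ 0)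
  have hb := fun n => (hF n).hb (hFc n)
  have hC : ∀ n x, |F n x| ≤ 2 * R := fun n x => (hb n).abs_le hR x
  refine CapB.of_dual hf hR (fun j hj ψ hψ => ?_) fun ψ hψ => ?_
  · exact le_of_tendsto' (tendsto_integral_mul_test (hψ.iteratedDeriv j) hFc hC h).abs
      fun n => (hb n).dual hR hj hψ
  · refine le_of_tendsto' (tendsto_integral_mul_test hψ hFc hC h).abs fun n => ?_
    obtain ⟨E, hP, hE⟩ := hF n
    exact hP.dual hE.memLp' hR (by simpa using hE.le 0 (Nat.zero_le _)) hψ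

/-- A property that holds at almost every time holds along a sequence tending to any given time. -/
theorem exists_seq_of_ae {T : ℝ} (hT : 0 < T) {P : ℝ → Prop}
    (h : ∀ᵐ t ∂volume.restrict (Ioo 0 T), P t) {t : ℝ} (ht : t ∈ Icc 0 T) :
    ∃ τ : ℕ → ℝ, Tendsto τ atTop (𝓝 t) ∧ ∀ n, τ n ∈ Ioo 0 T ∧ P (τ n) := by
  have hcl : t ∈ closure (Ioo 0 T ∩ {t | P t}) := by
    rw [mem_closure_iff]
    intro U hU htU
    have h1 : (U ∩ Ioo 0 T).Nonempty := by
      have : t ∈ closure (Ioo 0 T) := by rwa [closure_Ioo hT.ne]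
      exact mem_closure_iff.1 this U hU htU
    have h2 : 0 < volume (U ∩ Ioo 0 T) := (hU.inter isOpen_Ioo).measure_pos volume h1
    by_contra hcon
    rw [not_nonempty_iff_eq_empty] at hcon
    have h3 : volume ({t | ¬P t} ∩ Ioo 0 T) = 0 := by
      rw [ae_restrict_iff' measurableSet_Ioo, ae_iff] at h
      refine measure_mono_null (fun x hx => ?_) h
      simp only [mem_ofPred_eq, Classical.not_imp]
      exact ⟨hx.2, hx.1⟩
    have h4 : U ∩ Ioo 0 T ⊆ {t | ¬P t} ∩ Ioo 0 T := by
      refine fun x hx => ⟨fun hP => ?_, hx.2⟩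
      have : x ∈ U ∩ (Ioo 0 T ∩ {t | P t}) := ⟨hx.1, hx.2, hP⟩
      rw [hcon] at this
      exact this
    exact h2.ne' (measure_mono_null h4 h3)
  obtain ⟨τ, h1, h2⟩ := mem_closure_iff_seq_limit.1 hcl
  exact ⟨τ, h2, fun n => ⟨(h1 n).1, (h1 n).2⟩⟩

namespace IsBackground

variable {s : ℕ} {cm cp T β κ : ℝ} {c ct : ℝ → ℝ → ℝ}

theorem continuous (h : IsBackground s cm cp c ct) {t : ℝ} (ht : 0 ≤ t) : Continuous (c t) :=
  (h.diff_x t ht).continuous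

theorem sub_eq (h : IsBackground s cm cp c ct) {a b : ℝ} (ha : 0 ≤ a) (hb : 0 ≤ b) (x : ℝ) :
    c b x - c a x = ∫ τ in a..b, ct τ x := by
  rw [h.eq_integral a ha, h.eq_integral b hb, add_sub_add_left_eq_sub,
    intervalIntegral.integral_interval_sub_left (h.integrable_ct b hb x) (h.integrable_ct a ha x)]

/-- The increment is a time integral of `ct`. After pairing with a test function and exchanging
integrals, the dual bounds on `ct` are used only at almost every time. -/
theorem capB_sub (h : IsBackground s cm cp c ct) (hs : 1 ≤ s) (hβ : 0 ≤ β)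
    (hct : timeEssSup (Ioo 0 T) (fun t => capNorm s (ct t)) ≤ ENNReal.ofReal β) {a b : ℝ}
    (ha : 0 ≤ a) (hab : a ≤ b) (hbT : b ≤ T) :
    CapB s ((b - a) * β) fun x => c b x - c a x := by
  have hae : ∀ᵐ τ ∂volume.restrict (Ioc a b), capNorm s (ct τ) ≤ ENNReal.ofReal β := by
    have h1 := ENNReal.ae_le_essSup (μ := volume.restrict (Ioo 0 T)) fun t => capNorm s (ct t)
    have h2 : ∀ᵐ τ ∂volume.restrict (Ioo a b), capNorm s (ct τ) ≤ ENNReal.ofReal β :=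
      (ae_restrict_of_ae_restrict_of_subset (Ioo_subset_Ioo ha hbT) h1).mono
        fun τ hτ => hτ.trans hct
    rwa [Measure.restrict_congr_set Ioo_ae_eq_Ioc] at h2
  have hd := hae.mono fun τ hτ => dual_of_capNorm hs hβ hτ
  have key : ∀ χ, IsTest χ → ∀ K, (∀ᵐ τ ∂volume.restrict (Ioc a b), |∫ x, ct τ x * χ x| ≤ K) →
      |∫ x, (c b x - c a x) * χ x| ≤ (b - a) * K := by
    intro χ hχ K hK
    have := abs_integral_timeIntegral_mul_le (B := fun _ => K) hab
      h.measurable_ct.aestronglyMeasurable (hd.mono fun τ hτ => hτ.1) hχ.1.continuous (hχ.memLp 2)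
      (by simp) hK
    rw [intervalIntegral.integral_const, smul_eq_mul] at this
    simpa only [h.sub_eq ha (ha.trans hab)] using this
  have hc : Continuous fun x => c b x - c a x :=
    (h.continuous (ha.trans hab)).sub (h.continuous ha)
  refine CapB.of_dual hc (mul_nonneg (sub_nonneg.2 hab) hβ) (fun j hj ψ hψ => ?_) fun ψ hψ => ?_
  · rw [mul_assoc]
    exact key _ (hψ.iteratedDeriv j) _ (hd.mono fun τ hτ => hτ.2.1 j hj ψ hψ)
  · rw [mul_assoc]
    exact key _ hψ _ (hd.mono fun τ hτ => hτ.2.2 ψ hψ)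

/-- Square integrable primitives of `c t - c 0`. -/
theorem exists_primitive (h : IsBackground s cm cp c ct) (hs : 1 ≤ s) (hβ : 0 ≤ β)
    (hct : timeEssSup (Ioo 0 T) (fun t => capNorm s (ct t)) ≤ ENNReal.ofReal β) :
    ∃ B : ℝ → ℝ → ℝ, (∀ t ∈ Icc 0 T, Prim (B t) fun x => c t x - c 0 x) ∧
      (∀ t ∈ Icc 0 T, HB (s + 1) (t * β) (B t)) ∧
      ∀ a b, 0 ≤ a → a ≤ b → b ≤ T → ∀ x, |B b x - B a x| ≤ 2 * ((b - a) * β) := by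
  have hex : ∀ t, ∃ B, t ∈ Icc 0 T → Prim B (fun x => c t x - c 0 x) ∧ HB (s + 1) (t * β) B := by
    intro t
    by_cases ht : t ∈ Icc 0 T
    · obtain ⟨B, h1, h2⟩ := h.capB_sub hs hβ hct le_rfl ht.1 ht.2
      rw [sub_zero] at h2
      exact ⟨B, fun _ => ⟨h1, h2⟩⟩
    · exact ⟨0, fun h => absurd h ht⟩
  choose B hB using hex
  refine ⟨B, fun t ht => (hB t ht).1, fun t ht => (hB t ht).2, fun a b ha hab hb x => ?_⟩
  obtain ⟨E, h1, h2⟩ := h.capB_sub hs hβ hct ha hab hb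
  obtain ⟨h3, h4⟩ := hB a ⟨ha, hab.trans hb⟩
  obtain ⟨h5, h6⟩ := hB b ⟨ha.trans hab, hb⟩
  -- By uniqueness of square integrable primitives the increment of `B` is the primitive already
  -- estimated on [a, b], and the Sobolev embedding gives the Lipschitz bound in time.
  have h7 : (fun x => B b x - B a x) = E := by
    refine Prim.eq_of_memLp ?_ h1 (h6.memLp'.sub h4.memLp') h2.memLp'
    exact (h5.sub h3).congr_right (Eventually.of_forall fun x => by simp)
  have := h2.abs_le (mul_nonneg (sub_nonneg.2 hab) hβ) x
  rwa [← h7] at this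

theorem tendsto_time (h : IsBackground s cm cp c ct) {t : ℝ} (ht : 0 ≤ t)
    {τ : ℕ → ℝ} (hτ0 : ∀ n, 0 ≤ τ n) (hτ : Tendsto τ atTop (𝓝 t)) (x : ℝ) :
    Tendsto (fun n => c (τ n) x) atTop (𝓝 (c t x)) := by
  have h1 : ContinuousOn (fun t => c 0 x + ∫ τ in (0 : ℝ)..t, ct τ x) (Icc 0 (t + 1)) := by
    have := intervalIntegral.continuousOn_primitive_interval'
      (h.integrable_ct (t + 1) (by linarith) x) left_mem_uIcc
    rw [uIcc_of_le (by linarith)] at this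
    exact continuousOn_const.add this
  have h2 := h1.continuousWithinAt (x := t) ⟨ht, by linarith⟩
  have h3 : Tendsto τ atTop (𝓝[Icc 0 (t + 1)] t) := by
    refine tendsto_nhdsWithin_iff.2 ⟨hτ, ?_⟩
    filter_upwards [hτ.eventually (gt_mem_nhds (lt_add_one t))] with n hn
    exact ⟨hτ0 n, hn.le⟩
  have h4 := h2.tendsto.comp h3
  rw [← h.eq_integral t ht x] at h4
  refine h4.congr fun n => ?_
  simp only [Function.comp]
  rw [← h.eq_integral _ (hτ0 n)]

/-- Regularity of the initial background. -/
theorem deriv_hb (h : IsBackground s cm cp c ct) (hs : 1 ≤ s) (hκ : 0 ≤ κ) (hT : 0 < T)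
    (hcx : timeEssSup (Ioo 0 T) (fun t => sobolevNorm s (deriv (c t))) ≤ ENNReal.ofReal κ) :
    Prim (c 0) (deriv (c 0)) ∧ HB s κ (deriv (c 0)) := by
  have hae : ∀ᵐ t ∂volume.restrict (Ioo 0 T), sobolevNorm s (deriv (c t)) ≤ ENNReal.ofReal κ :=
    (ENNReal.ae_le_essSup (μ := volume.restrict (Ioo 0 T)) fun t => sobolevNorm s (deriv (c t))).mono
      fun t ht => ht.trans hcx
  -- The bound on ∂ₓc holds only at almost every time, so time 0 is approached through good times.
  -- The limit is taken in the dual bounds of orders 1 to s + 1 on `c` itself, which is bounded and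
  -- continuous in time at each point.
  obtain ⟨τ, hτ, hτ'⟩ := exists_seq_of_ae hT hae (t := 0) ⟨le_rfl, hT.le⟩
  have hτ0 : ∀ n, 0 ≤ τ n := fun n => (hτ' n).1.1.le
  have hd : ∀ n, ∀ j ≤ s, ∀ ψ, IsTest ψ →
      |∫ x, c (τ n) x * iteratedDeriv (j + 1) ψ x| ≤ κ * l2 ψ := by
    intro n j hj ψ hψ
    obtain ⟨g, hg, hgB⟩ := exists_hb_of_sobolevNorm hs (hτ' n).2
    have hP : Prim (c (τ n)) g := by
      have h1 : LocallyIntegrable (deriv (c (τ n))) := by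
        obtain ⟨s, rfl⟩ := Nat.exists_eq_succ_of_ne_zero (by omega : s ≠ 0)
        exact hgB.continuous'.locallyIntegrable.congr hg.symm
      exact (Prim.of_hasDerivAt (fun x => (h.diff_x _ (hτ0 n) x).hasDerivAt) h1).congr_right hg
    have h2 := hP.integral_mul_deriv ((hψ.iteratedDeriv j).1.of_le (by exact_mod_cast le_top))
      (hψ.iteratedDeriv j).2
    rw [iteratedDeriv_succ, h2, abs_neg]
    exact hgB.dual hκ hj hψ
  have hd0 : ∀ j ≤ s, ∀ ψ, IsTest ψ → |∫ x, c 0 x * iteratedDeriv (j + 1) ψ x| ≤ κ * l2 ψ := by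
    intro j hj ψ hψ
    refine le_of_tendsto' (tendsto_integral_mul_test (F := fun n => c (τ n))
      (C := max |cm| |cp|) (hψ.iteratedDeriv (j + 1))
      (fun n => h.continuous (hτ0 n)) (fun n x => ?_) fun x => h.tendsto_time le_rfl hτ0 hτ x).abs
      fun n => hd n j hj ψ hψ
    exact abs_le_max_abs_abs (h.bounds _ (hτ0 n) x).1 (h.bounds _ (hτ0 n) x).2
  have hc0 := h.continuous le_rfl
  have hex : ∀ j, ∃ g, 1 ≤ j → j ≤ s + 1 → IsWeakDeriv j (c 0) g ∧ MemLp g 2 volume ∧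
      eLpNorm g 2 volume ≤ ENNReal.ofReal κ := by
    intro j
    by_cases hj : 1 ≤ j ∧ j ≤ s + 1
    · obtain ⟨i, rfl⟩ := Nat.exists_eq_add_of_le' hj.1
      obtain ⟨g, hg⟩ := IsWeakDeriv.of_bound hc0.locallyIntegrable (i + 1) hκ
        (hd0 i (by omega))
      exact ⟨g, fun _ _ => hg⟩
    · exact ⟨0, fun h1 h2 => absurd ⟨h1, h2⟩ hj⟩
  choose g hg using hex
  obtain ⟨h1, h2⟩ := chain_of_isWeakDeriv hc0 (m := s + 1) (g := g) fun j hj hjs => (hg j hj hjs).1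
  refine ⟨by simpa using h1 0 (by omega), fun j hj => ?_, fun j hj => ?_, fun j hj => ?_⟩
  · simpa only [← iteratedDeriv_succ'] using h1 (j + 1) (by omega)
  · rw [← iteratedDeriv_succ']
    exact (hg (j + 1) (by omega) (by omega)).2.1.1.congr (h2 (j + 1) (by omega) (by omega)).symm
  · rw [← iteratedDeriv_succ', eLpNorm_congr_ae (h2 (j + 1) (by omega) (by omega))]
    exact (hg (j + 1) (by omega) (by omega)).2.2

end IsBackground

/-- The nearest point of `[0, T]`. -/
noncomputable def clamp (T t : ℝ) : ℝ := max 0 (min T t)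

theorem clamp_mem {T : ℝ} (hT : 0 ≤ T) (t : ℝ) : clamp T t ∈ Icc 0 T :=
  ⟨le_max_left _ _, max_le hT (min_le_left _ _)⟩

theorem clamp_of_mem {T t : ℝ} (ht : t ∈ Icc 0 T) : clamp T t = t := by
  rw [clamp, min_eq_right ht.2, max_eq_right ht.1]

theorem clamp_zero {T : ℝ} (hT : 0 ≤ T) : clamp T 0 = 0 := clamp_of_mem ⟨le_rfl, hT⟩

theorem continuous_clamp (T : ℝ) : Continuous (clamp T) := by
  unfold clamp; fun_prop

theorem ContinuousOn.comp_clamp {T : ℝ} (hT : 0 ≤ T) {f : ℝ → ℝ} (hf : ContinuousOn f (Icc 0 T)) :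
    Continuous fun t => f (clamp T t) :=
  hf.comp_continuous (continuous_clamp T) (clamp_mem hT)

/-- `B t` is the square integrable primitive of `c t - c 0`. -/
structure BackgroundPrimitive (s : ℕ) (T β : ℝ) (c B : ℝ → ℝ → ℝ) : Prop where
  nonneg : 0 ≤ β
  prim : ∀ t ∈ Icc 0 T, Prim (B t) fun x => c t x - c 0 x
  hb : ∀ t ∈ Icc 0 T, HB (s + 1) (t * β) (B t)
  lip : ∀ a b, 0 ≤ a → a ≤ b → b ≤ T → ∀ x, |B b x - B a x| ≤ 2 * ((b - a) * β)

namespace BackgroundPrimitive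

variable {s : ℕ} {T β : ℝ} {c B : ℝ → ℝ → ℝ}

theorem hb_clamp (h : BackgroundPrimitive s T β c B) (hT : 0 ≤ T) (t : ℝ) :
    HB (s + 1) (T * β) (B (clamp T t)) :=
  (h.hb _ (clamp_mem hT t)).mono le_rfl
    (mul_le_mul_of_nonneg_right (clamp_mem hT t).2 h.nonneg)

theorem prim_clamp (h : BackgroundPrimitive s T β c B) (hT : 0 ≤ T) (t : ℝ) :
    Prim (B (clamp T t)) fun x => c (clamp T t) x - c 0 x := h.prim _ (clamp_mem hT t)

theorem abs_sub_le (h : BackgroundPrimitive s T β c B) {a b : ℝ} (ha : a ∈ Icc 0 T)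
    (hb : b ∈ Icc 0 T) (x : ℝ) : |B b x - B a x| ≤ 2 * β * |b - a| := by
  rcases le_total a b with hab | hab
  · rw [abs_of_nonneg (sub_nonneg.2 hab)]
    linarith [h.lip a b ha.1 hab hb.2 x]
  · rw [abs_sub_comm, abs_sub_comm b a, abs_of_nonneg (sub_nonneg.2 hab)]
    linarith [h.lip b a hb.1 hab ha.2 x]

theorem continuous_clamp (h : BackgroundPrimitive s T β c B) (hT : 0 ≤ T) (x : ℝ) :
    Continuous fun t => B (clamp T t) x := by
  refine ContinuousOn.comp_clamp (f := fun t => B t x) hT fun t ht => ?_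
  rw [ContinuousWithinAt, tendsto_iff_dist_tendsto_zero]
  refine squeeze_zero' (Eventually.of_forall fun _ => dist_nonneg)
    (eventually_mem_nhdsWithin.mono fun τ hτ => h.abs_sub_le ht hτ x) ?_
  have h1 : Continuous fun τ => 2 * β * |τ - t| := by fun_prop
  have h2 := (h1.tendsto t).mono_left (nhdsWithin_le_nhds (s := Icc 0 T))
  simpa using h2

theorem eq_zero (h : BackgroundPrimitive s T β c B) (hT : 0 ≤ T) : B 0 = 0 := by
  funext x
  have := (h.hb 0 ⟨le_rfl, hT⟩).abs_le (by simp) x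
  simpa using this

end BackgroundPrimitive

theorem IsBackground.exists_backgroundPrimitive {s : ℕ} {cm cp T β : ℝ} {c ct : ℝ → ℝ → ℝ}
    (h : IsBackground s cm cp c ct) (hs : 1 ≤ s) (hβ : 0 ≤ β)
    (hct : timeEssSup (Ioo 0 T) (fun t => capNorm s (ct t)) ≤ ENNReal.ofReal β) :
    ∃ B, BackgroundPrimitive s T β c B := by
  obtain ⟨B, h1, h2, h3⟩ := h.exists_primitive hs hβ hct
  exact ⟨B, hβ, h1, h2, h3⟩

theorem eq_of_prim_add {f g : ℝ → ℝ} {a : ℝ} (h : ∀ x, f x = g x + a) (hf : MemLp f 2 volume)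
    (hg : MemLp g 2 volume) : f = g := by
  have h2 : MemLp (fun _ : ℝ => a) 2 volume :=
    (memLp_congr_ae (Eventually.of_forall fun x => by
      rw [Pi.sub_apply, h x]; ring)).1 (hf.sub hg)
  rcases (memLp_const_iff (by norm_num) (by norm_num)).1 h2 with h3 | h3
  · funext x; rw [h x, h3, add_zero]
  · simp at h3

theorem hb_mul_of_bdd {R S : ℝ} (hS : 0 ≤ S) {f g : ℝ → ℝ → ℝ}
    (hf : ∀ t, HB 1 R (f t)) (hg : ∀ t x, |g t x| ≤ S) (hgm : ∀ t, Continuous (g t)) (t : ℝ) :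
    HB 0 (S * R) fun x => f t x * g t x := by
  refine HB.zero_iff.2 ⟨((hf t).memLp'.mul_bdd (hgm t).aestronglyMeasurable (hg t)).1,
    (eLpNorm_mul_le_of_bdd (hg t)).trans ?_⟩
  rw [ENNReal.ofReal_mul hS]
  gcongr
  simpa using (hf t).le 0 (by omega)

/-! ### From solutions of the Euler–Poisson system to the variables N and u. -/

namespace IsEPSolution

variable {s : ℕ} {k ν cm cp T β κ : ℝ} {c ct B ρ u : ℝ → ℝ → ℝ} {ρ₀ u₀ : ℝ → ℝ}

/-- The regularity of a solution, at all times instead of almost all times. -/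
theorem exists_bound (h : IsEPSolution s k ν c T ρ₀ u₀ ρ u) (hbg : IsBackground s cm cp c ct)
    (hs : 1 ≤ s) (hT : 0 < T) : ∃ R, 0 ≤ R ∧
      (∀ x, ContinuousOn (fun t => ρ t x) (Icc 0 T)) ∧
      (∀ x, ContinuousOn (fun t => u t x) (Icc 0 T)) ∧
      (∀ t ∈ Icc 0 T, CapB s R fun x => ρ t x - c t x) ∧ ∀ t ∈ Icc 0 T, HB (s + 1) R (u t) := by
  obtain ⟨⟨φ, hφ⟩, hn, hu⟩ := h
  have hcρ : ∀ x, ContinuousOn (fun t => ρ t x) (Icc 0 T) := fun x t ht =>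
    (hφ.mass t ht x).continuousWithinAt
  have hcu : ∀ x, ContinuousOn (fun t => u t x) (Icc 0 T) := fun x t ht =>
    (hφ.momentum t ht x).continuousWithinAt
  set a := timeEssSup (Ioo 0 T) (fun t => capNorm s (fun x => ρ t x - c t x)) with ha
  set b := timeEssSup (Ioo 0 T) (fun t => sobolevNorm (s + 1) (u t)) with hb
  set R := max a.toReal b.toReal with hR
  have hR0 : 0 ≤ R := ENNReal.toReal_nonneg.trans (le_max_left _ _)
  have haR : a ≤ ENNReal.ofReal R :=
    (ENNReal.ofReal_toReal hn.ne).symm.le.trans (ENNReal.ofReal_le_ofReal (le_max_left _ _))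
  have hbR : b ≤ ENNReal.ofReal R :=
    (ENNReal.ofReal_toReal hu.ne).symm.le.trans (ENNReal.ofReal_le_ofReal (le_max_right _ _))
  have hae1 := (ENNReal.ae_le_essSup (μ := volume.restrict (Ioo 0 T))
    fun t => capNorm s (fun x => ρ t x - c t x)).mono fun t ht => ht.trans haR
  have hae2 := (ENNReal.ae_le_essSup (μ := volume.restrict (Ioo 0 T))
    fun t => sobolevNorm (s + 1) (u t)).mono fun t ht => ht.trans hbR
  have htend : ∀ {f : ℝ → ℝ → ℝ}, (∀ x, ContinuousOn (fun t => f t x) (Icc 0 T)) →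
      ∀ {t} {τ : ℕ → ℝ}, t ∈ Icc 0 T → Tendsto τ atTop (𝓝 t) → (∀ n, τ n ∈ Icc 0 T) →
      ∀ x, Tendsto (fun n => f (τ n) x) atTop (𝓝 (f t x)) := by
    intro f hf t τ ht hτ hτ' x
    exact (hf x t ht).tendsto.comp (tendsto_nhdsWithin_iff.2 ⟨hτ, Eventually.of_forall hτ'⟩)
  have hcn : ∀ t ∈ Icc 0 T, Continuous fun x => ρ t x - c t x := fun t ht =>
    (hφ.diff_ρ t ht).continuous.sub (hbg.continuous ht.1)
  refine ⟨R, hR0, hcρ, hcu, fun t ht => ?_, fun t ht => ?_⟩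
  -- Good times accumulate at every `t`, and pointwise continuity in time carries the dual bounds
  -- over to `t`.
  · obtain ⟨τ, h1, h2⟩ := exists_seq_of_ae hT hae1 ht
    have h3 : ∀ n, τ n ∈ Icc 0 T := fun n => Ioo_subset_Icc_self (h2 n).1
    exact CapB.of_tendsto hs hR0 (hcn t ht) (fun n => hcn _ (h3 n))
      (fun n => CapB.of_capNorm hs hR0 (hcn _ (h3 n)) (h2 n).2) fun x =>
      (htend hcρ ht h1 h3 x).sub (hbg.tendsto_time ht.1 (fun n => (h3 n).1) h1 x)
  · obtain ⟨τ, h1, h2⟩ := exists_seq_of_ae hT hae2 ht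
    have h3 : ∀ n, τ n ∈ Icc 0 T := fun n => Ioo_subset_Icc_self (h2 n).1
    exact HB.of_tendsto hR0 (hφ.diff_u t ht).continuous
      (fun n => hb_of_sobolevNorm (by omega) (hφ.diff_u _ (h3 n)).continuous (h2 n).2) fun x =>
      htend hcu ht h1 h3 x

/-- N = E + B, where E is the square integrable primitive of ρ - c. The mass equation integrated in
x gives the equation of N, and the Poisson equation gives ∂ₓφ = -E up to a function of time. Both
constants of integration are excluded by square integrability. Composition with `clamp` freezes the
functions outside [0, T], so that they are defined for all times. -/
theorem exists_regSol (h : IsEPSolution s k ν c T ρ₀ u₀ ρ u) (hbg : IsBackground s cm cp c ct)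
    (hB : BackgroundPrimitive s T β c B) (hs : 2 ≤ s) (hT : 0 < T) (hk : |k| = 1) (hν : 0 ≤ ν)
    (hκ : 0 ≤ κ)
    (hcx : timeEssSup (Ioo 0 T) (fun t => sobolevNorm s (deriv (c t))) ≤ ENNReal.ofReal κ) :
    ∃ R N, RegSol s R (max |cm| |cp|) κ T k ν (c 0) (fun t => B (clamp T t)) N
        (fun t => u (clamp T t)) ∧ ∀ t, Prim (N t) fun x => ρ (clamp T t) x - c 0 x := by
  obtain ⟨R, hR, hcρ, hcu, hn, hu⟩ := h.exists_bound hbg (by omega) hT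
  obtain ⟨⟨φ, hφ⟩, -, -⟩ := h
  have hm : ∀ t, clamp T t ∈ Icc 0 T := clamp_mem hT.le
  have hβ := hB.nonneg
  obtain ⟨hcP, hcH⟩ := hbg.deriv_hb (by omega) hκ hT hcx
  have hcb : ∀ x, |c 0 x| ≤ max |cm| |cp| := fun x =>
    abs_le_max_abs_abs (hbg.bounds 0 le_rfl x).1 (hbg.bounds 0 le_rfl x).2
  have hc0' : Continuous (deriv (c 0)) := (hcH.mono (m' := 1) (by omega) le_rfl).continuous'
  choose E hEP hEH using fun t => hn (clamp T t) (hm t)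
  set N : ℝ → ℝ → ℝ := fun t x => E t x + B (clamp T t) x with hN
  have hNP : ∀ t, Prim (N t) fun x => ρ (clamp T t) x - c 0 x := fun t =>
    ((hEP t).add (hB.prim_clamp hT.le t)).congr_right (Eventually.of_forall fun x => by simp)
  have hTβ : 0 ≤ T * β := by positivity
  have hNH : ∀ t, HB (s + 1) (R + T * β) (N t) := fun t =>
    (hEH t).add (hB.hb_clamp hT.le t) hR hTβ
  set r : ℝ → ℝ → ℝ := fun t x => ρ (clamp T t) x - c 0 x with hr
  have hρc : ∀ t, Continuous (ρ (clamp T t)) := fun t => (hφ.diff_ρ _ (hm t)).continuous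
  have hrN : ∀ t, deriv (N t) = r t := fun t =>
    (hNP t).deriv_eq ((hρc t).sub (hbg.continuous le_rfl))
  have hrH : ∀ t, HB s (R + T * β) (r t) := fun t => by
    have := (hNH t).deriv
    rwa [hrN] at this
  have hrt : ∀ x, Continuous fun t => r t x := fun x =>
    (ContinuousOn.comp_clamp hT.le (hcρ x)).sub continuous_const
  have hut : ∀ x, Continuous fun t => u (clamp T t) x := fun x =>
    ContinuousOn.comp_clamp hT.le (hcu x)
  have huH : ∀ t, HB (s + 1) R (u (clamp T t)) := fun t => hu _ (hm t)
  have hR' : 0 ≤ R + T * β := by positivity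
  have jr := HB.continuous_uncurry hR' hrH hrt (j := 0) (by omega)
  have jr' := HB.continuous_uncurry hR' hrH hrt (j := 1) (by omega)
  have ju := HB.continuous_uncurry hR huH hut (j := 0) (by omega)
  have ju' := HB.continuous_uncurry hR huH hut (j := 1) (by omega)
  simp only [iteratedDeriv_zero, iteratedDeriv_one] at jr jr' ju ju'
  have hrd : ∀ t x, HasDerivAt (r t) (deriv (r t) x) x := fun t x =>
    ((hrH t).mono (m' := 1) (by omega) le_rfl).prim'.hasDerivAt (jr'.uncurry_left t) x
  have hud : ∀ t x, HasDerivAt (u (clamp T t)) (deriv (u (clamp T t)) x) x := fun t x =>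
    (huH t).prim'.hasDerivAt (ju'.uncurry_left t) x
  have hcd : ∀ x, HasDerivAt (c 0) (deriv (c 0) x) x := hcP.hasDerivAt hc0'
  set P : ℝ → ℝ → ℝ := fun t x => (r t x + c 0 x) * u (clamp T t) x with hP
  set P' : ℝ → ℝ → ℝ := fun t x => (deriv (r t) x + deriv (c 0) x) * u (clamp T t) x +
    (r t x + c 0 x) * deriv (u (clamp T t)) x with hP'
  have jc : Continuous fun p : ℝ × ℝ => c 0 p.2 := (hbg.continuous le_rfl).comp continuous_snd
  have jc' : Continuous fun p : ℝ × ℝ => deriv (c 0) p.2 := hc0'.comp continuous_snd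
  have jP : Continuous (Function.uncurry P) := (jr.add jc).mul ju
  have jP' : Continuous (Function.uncurry P') := ((jr'.add jc').mul ju).add ((jr.add jc).mul ju')
  have hPd : ∀ t x, HasDerivAt (P t) (P' t x) x := fun t x =>
    ((hrd t x).add (hcd x)).mul (hud t x)
  have hmass : ∀ t ∈ Icc 0 T, ∀ x, ρ t x = ρ 0 x - ∫ τ in (0 : ℝ)..t, P' τ x := by
    intro t ht x
    have := integral_eq_of_hasDerivWithinAt (F := fun t => ρ t x) (F' := fun τ => -P' τ x) (T := T)
      (jP'.comp (Continuous.prodMk_left x)).neg (fun τ hτ => ?_) ht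
    · rw [this, intervalIntegral.integral_neg, sub_eq_add_neg]
    · have e : deriv (fun y => ρ τ y * u τ y) x = P' τ x := by
        rw [← (hPd τ x).deriv]
        congr 1
        funext y
        simp only [hP, hr, clamp_of_mem hτ, sub_add_cancel]
      rw [← e]
      exact hφ.mass τ hτ x
  have hPb : ∀ t, HB 0 ((2 * (R + T * β) + max |cm| |cp|) * R)
      fun x => u (clamp T t) x * (r t x + c 0 x) :=
    hb_mul_of_bdd (by positivity) (fun t => (huH t).mono (by omega) le_rfl)
      (fun t x => (abs_add_le _ _).trans (add_le_add
        (((hrH t).mono (m' := 1) (by omega) le_rfl).abs_le hR' x) (hcb x)))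
      fun t => (jr.uncurry_left t).add (hbg.continuous le_rfl)
  -- Both sides have the same x-derivative by the mass equation, and both are square integrable, so
  -- they agree.
  have hNeq : ∀ t ∈ Icc 0 T, N t = fun x => N 0 x - ∫ τ in (0 : ℝ)..t, P τ x := by
    intro t ht
    refine Prim.eq_of_memLp (hNP t) ?_ (hNH t).memLp' ((hNH 0).memLp'.sub ?_)
    · refine Prim.of_hasDerivAt_continuous (fun x => ?_) (jr.uncurry_left t)
      have h1 := ((hNP 0).hasDerivAt (jr.uncurry_left 0) x).sub
        (hasDerivAt_timeIntegral jP jP' hPd 0 t x)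
      refine h1.congr_deriv ?_
      rw [clamp_zero hT.le, clamp_of_mem ht, hmass t ht x]
      ring
    · have := HB.timeIntegral (by positivity) jP ht.1 (R := (2 * (R + T * β) + max |cm| |cp|) * R)
        (m := 0) fun τ _ => by
          have := hPb τ
          simp_rw [mul_comm (u (clamp T τ) _)] at this
          exact this
      exact this.memLp'
  -- The primitives were chosen separately at each time; uniqueness makes the choices consistent.
  have hNcl : ∀ t, N t = N (clamp T t) := by
    intro t
    refine Prim.eq_of_memLp (hNP t) ?_ (hNH t).memLp' (hNH _).memLp'
    have := hNP (clamp T t)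
    rwa [clamp_of_mem (hm t)] at this
  have hNt : ∀ x, Continuous fun t => N t x := by
    intro x
    have h1 : Continuous fun t => N 0 x - ∫ τ in (0 : ℝ)..(clamp T t), P τ x :=
      continuous_const.sub ((intervalIntegral.continuous_primitive (fun a b =>
        (jP.comp (Continuous.prodMk_left x)).intervalIntegrable a b) 0).comp (continuous_clamp T))
    refine h1.congr fun t => ?_
    rw [hNcl t, hNeq _ (hm t)]
  have hEt : ∀ x, Continuous fun t => E t x := fun x => by
    refine ((hNt x).sub (hB.continuous_clamp hT.le x)).congr fun t => ?_
    simp [hN]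
  have jE := HB.continuous_uncurry hR hEH hEt (j := 0) (by omega)
  simp only [iteratedDeriv_zero] at jE
  set G : ℝ → ℝ → ℝ := fun t x => -(u (clamp T t) x * deriv (u (clamp T t)) x) -
    ν * u (clamp T t) x + k * E t x with hG
  have jG : Continuous (Function.uncurry G) :=
    ((ju.mul ju').neg.sub (continuous_const.mul ju)).add (continuous_const.mul jE)
  have hGH : ∀ t, HB 0 (2 * R * R + ν * R + R) (G t) := by
    intro t
    have h1 := hb_mul_of_bdd (f := fun t => u (clamp T t)) (g := fun t x => -deriv (u (clamp T t)) x)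
      (S := 2 * R) (by positivity)
      (fun t => (huH t).mono (by omega) le_rfl)
      (fun t x => by
        rw [abs_neg]
        exact ((huH t).deriv.mono (m' := 1) (by omega) le_rfl).abs_le hR x)
      (fun t => (ju'.uncurry_left t).neg) t
    have h2 := ((huH t).mono (m' := 0) (by omega) le_rfl).const_mul ν
    have h3 := ((hEH t).mono (m' := 0) (by omega) le_rfl).const_mul k
    rw [hk, one_mul] at h3
    rw [abs_of_nonneg hν] at h2
    have h4 := (h1.sub h2 (by positivity) (by positivity)).add h3 (by positivity) hR
    simpa only [hG, mul_neg] using h4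
  have hueq : ∀ t ∈ Icc 0 T, ∀ x, u t x = u 0 x + ∫ τ in (0 : ℝ)..t, G τ x := by
    have ha : ∀ t ∈ Icc 0 T, ∀ x, deriv (φ t) x + E t x = deriv (φ t) 0 + E t 0 := by
      intro t ht x
      have hd : ∀ x, HasDerivAt (fun x => deriv (φ t) x + E t x) 0 x := by
        intro x
        have h1 := (hφ.diff_φx t ht x).hasDerivAt
        have h2 := (hEP t).hasDerivAt ((hρc t).sub (hbg.continuous (hm t).1)) x
        refine (h1.add h2).congr_deriv ?_
        rw [clamp_of_mem ht, ← hφ.poisson t ht x]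
        ring
      exact is_const_of_deriv_eq_zero (fun x => (hd x).differentiableAt) (fun x => (hd x).deriv) x 0
    -- The error made in the momentum equation when ∂ₓφ is replaced by -E. Its time derivative is
    -- independent of x, hence so is `D`; being a difference of two square integrable functions, it
    -- is zero.
    set D : ℝ → ℝ → ℝ := fun t x => u t x - (u 0 x + ∫ τ in (0 : ℝ)..t, G τ x) with hD
    have hDd : ∀ t ∈ Icc 0 T, ∀ x, HasDerivWithinAt (fun t => D t x)
        (-k * (deriv (φ t) 0 + E t 0)) (Icc 0 T) t := by
      intro t ht x
      have h1 := (intervalIntegral.integral_hasDerivAt_right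
        ((jG.comp (Continuous.prodMk_left x)).intervalIntegrable 0 t)
        (jG.comp (Continuous.prodMk_left x)).stronglyMeasurable.stronglyMeasurableAtFilter
        (jG.comp (Continuous.prodMk_left x)).continuousAt).hasDerivWithinAt (s := Icc 0 T)
      refine ((hφ.momentum t ht x).sub (h1.const_add (u 0 x))).congr_deriv ?_
      simp only [Function.comp_apply, Function.uncurry_apply_pair, hG, clamp_of_mem ht]
      rw [← ha t ht x]
      ring
    have hD0 : ∀ x, D 0 x = 0 := fun x => by simp [hD]
    have hDc : ∀ t ∈ Icc 0 T, ∀ x, D t x = D t 0 := by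
      intro t ht x
      have := integral_eq_of_hasDerivWithinAt (F := fun t => D t x - D t 0) (F' := fun _ => 0)
        continuous_const (fun τ hτ => ((hDd τ hτ x).sub (hDd τ hτ 0)).congr_deriv (by ring)) ht
      simp only [hD0] at this
      simpa [sub_eq_zero] using this
    intro t ht
    have h0 : (0 : ℝ) ∈ Icc 0 T := ⟨le_rfl, hT.le⟩
    have hI := (HB.timeIntegral (by positivity) jG ht.1 fun τ _ => hGH τ).memLp'
    have := eq_of_prim_add (f := u t) (g := fun x => u 0 x + ∫ τ in (0 : ℝ)..t, G τ x)
      (a := D t 0) (fun x => by rw [← hDc t ht x]; simp only [hD]; ring) (hu t ht).memLp'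
      ((hu 0 h0).memLp'.add hI)
    exact fun x => congrFun this x
  refine ⟨R + T * β, N, ⟨hs, hR', hκ, hν, hk, fun t => (hB.hb_clamp hT.le t).mono le_rfl (by linarith),
    hNH, fun t => (huH t).mono le_rfl (by linarith), hB.continuous_clamp hT.le, hNt, hut, hcb, hcP, hcH,
    fun t ht x => ?_, fun t ht x => ?_⟩, hNP⟩
  · rw [hNeq t ht]
    simp only [hrN, intervalIntegral.integral_neg]
    rfl
  · simp only [clamp_of_mem ht, clamp_zero hT.le]
    rw [hueq t ht x]
    simp only [hG, hN, add_sub_cancel_right]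

end IsEPSolution

/-! ### The growth estimate in the original norms. -/

theorem abs_le_of_eLpNorm_top {f : ℝ → ℝ} {M : ℝ} (hf : Continuous f) (hM : 0 ≤ M)
    (h : eLpNorm f ⊤ volume ≤ ENNReal.ofReal M) (x : ℝ) : |f x| ≤ M := by
  rw [eLpNorm_exponent_top] at h
  have hae : ∀ᵐ x, |f x| ≤ M := (ae_le_eLpNormEssSup (f := f) (μ := volume)).mono fun x hx => by
    have := hx.trans h
    rwa [← ofReal_norm, ENNReal.ofReal_le_ofReal_iff hM] at this
  have ho : IsOpen {x | ¬|f x| ≤ M} := by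
    simp only [not_le]
    exact isOpen_lt continuous_const hf.abs
  have := (ho.measure_eq_zero_iff volume).1 (ae_iff.1 hae)
  by_contra hx
  have h1 : x ∈ {x | ¬|f x| ≤ M} := hx
  rw [this] at h1
  exact h1

theorem HB.sobolevNorm_le_jetNorm {m : ℕ} {R : ℝ} {f : ℝ → ℝ} (h : HB m R f) :
    sobolevNorm m f ≤ ENNReal.ofReal (jetNorm m f) := by
  refine h.sobolevNorm_le.trans ?_
  rw [jetNorm, ENNReal.ofReal_sum_of_nonneg fun _ _ => l2_nonneg _]
  exact Finset.sum_le_sum fun j hj => (h.memLp (by simp at hj; omega)).ofReal_l2.ge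

/-- The term of order zero in the jet norm of E bounds the Ḣ⁻¹ part, and the terms of orders 1 to m
+ 1 bound the Hᵐ part. -/
theorem HB.capNorm_le_jetNorm {m : ℕ} {R : ℝ} {E f : ℝ → ℝ} (h : HB (m + 1) R E) (hP : Prim E f)
    (hf : Continuous f) : capNorm m f ≤ ENNReal.ofReal (jetNorm (m + 1) E) := by
  have hd := hP.deriv_eq hf
  have h1 := h.deriv.sobolevNorm_le_jetNorm
  rw [hd] at h1
  have hfm : MemLp f 2 volume := hd ▸ h.deriv.memLp'
  have h2 := hMinusOneNorm_le_of_prim hP h.memLp' hfm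
  rw [← h.memLp'.ofReal_l2] at h2
  refine (add_le_add h1 h2).trans_eq ?_
  rw [← ENNReal.ofReal_add (jetNorm_nonneg _ _) (l2_nonneg _), jetNorm, jetNorm,
    Finset.sum_range_succ' _ (m + 1), iteratedDeriv_zero]
  simp only [iteratedDeriv_succ', hd]

theorem HB.of_capNorm {m : ℕ} {R : ℝ} {E f : ℝ → ℝ} (hm : 1 ≤ m) (hR : 0 ≤ R) (hf : Continuous f)
    (hP : Prim E f) (hE : MemLp E 2 volume) (h : capNorm m f ≤ ENNReal.ofReal R) :
    HB (m + 1) R E := by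
  obtain ⟨E', h1, h2⟩ := CapB.of_capNorm hm hR hf h
  rwa [hP.eq_of_memLp h1 hE h2.memLp']

theorem jetNorm_sub_le {m : ℕ} {R S : ℝ} {f g : ℝ → ℝ} (hf : HB m R f) (hg : HB m S g) :
    jetNorm m (fun x => f x - g x) ≤ jetNorm m f + jetNorm m g := by
  rw [jetNorm, jetNorm, jetNorm, ← Finset.sum_add_distrib]
  refine Finset.sum_le_sum fun j hj => ?_
  have := l2_iteratedDeriv_sub_le hf hg 1 (j := j) (by simp at hj; omega)
  simpa using this

theorem timeEssSup_mono_set {I J : Set ℝ} (h : I ⊆ J) (f : ℝ → ℝ≥0∞) :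
    timeEssSup I f ≤ timeEssSup J f :=
  essSup_mono_measure' (Measure.restrict_mono_set volume h)

namespace IsEPSolution

variable {s : ℕ} {k ν cm cp T : ℝ} {c ct ρ u : ℝ → ℝ → ℝ} {ρ₀ u₀ : ℝ → ℝ}

theorem abs_le_lowNorm (h : IsEPSolution s k ν c T ρ₀ u₀ ρ u) (hlow : lowNorm T ρ u < ⊤)
    (hu : ∀ t ∈ Icc 0 T, Continuous (deriv (u t))) {t : ℝ} (ht : t ∈ Icc 0 T) (x : ℝ) :
    |ρ t x| ≤ (lowNorm T ρ u).toReal ∧ |deriv (u t) x| ≤ (lowNorm T ρ u).toReal := by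
  obtain ⟨⟨φ, hφ⟩, -, -⟩ := h
  have h1 : eLpNorm (ρ t) ⊤ volume + eLpNorm (deriv (u t)) ⊤ volume ≤
      ENNReal.ofReal (lowNorm T ρ u).toReal := by
    rw [ENNReal.ofReal_toReal hlow.ne]
    exact le_iSup₂ (f := fun t (_ : t ∈ Icc 0 T) =>
      eLpNorm (ρ t) ⊤ volume + eLpNorm (deriv (u t)) ⊤ volume) t ht
  exact ⟨abs_le_of_eLpNorm_top (hφ.diff_ρ t ht).continuous ENNReal.toReal_nonneg
    (le_self_add.trans h1) x,
    abs_le_of_eLpNorm_top (hu t ht) ENNReal.toReal_nonneg (le_add_self.trans h1) x⟩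

/-- Growth of a solution in terms of its low norm. -/
theorem stateNorm_le (h : IsEPSolution s k ν c T ρ₀ u₀ ρ u) (hbg : IsBackground s cm cp c ct)
    (hs : 2 ≤ s) (hT : 0 < T) (hk : |k| = 1) (hν : 0 ≤ ν) (hlow : lowNorm T ρ u < ⊤)
    (hρ₀ : capNorm s (fun x => ρ₀ x - c 0 x) < ⊤) (hu₀ : sobolevNorm (s + 1) u₀ < ⊤) {t : ℝ}
    (ht : t ∈ Icc 0 T) :
    stateNorm s (fun x => ρ t x - c t x) (u t) ≤ ENNReal.ofReal (3 * (s + 2)) *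
      (stateNorm s (fun x => ρ₀ x - c 0 x) u₀ +
        ENNReal.ofReal T * timeEssSup (Ioo 0 T) (fun t => capNorm s (ct t))) *
      ENNReal.ofReal (Real.exp ((RegSol.growthConst s + 1) *
        (growthRate s c ct T ρ u).toReal * T)) := by
  have hm : ∀ t, clamp T t ∈ Icc 0 T := clamp_mem hT.le
  have h0 : (0 : ℝ) ∈ Icc 0 T := ⟨le_rfl, hT.le⟩
  have hct := (timeEssSup_mono_set (I := Ioo 0 T) Ioo_subset_Ioi_self (fun t => capNorm s (ct t))).trans_lt
    hbg.ct_mem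
  have hcx := (timeEssSup_mono_set (I := Ioo 0 T) Ioo_subset_Ioi_self
    (fun t => sobolevNorm s (deriv (c t)))).trans_lt hbg.cx_mem
  set bS := timeEssSup (Ioo 0 T) (fun t => capNorm s (ct t)) with hbS
  set kS := timeEssSup (Ioo 0 T) (fun t => sobolevNorm s (deriv (c t))) with hkS
  set M := (lowNorm T ρ u).toReal with hM
  have hβ0 : 0 ≤ bS.toReal := ENNReal.toReal_nonneg
  have hκ0 : 0 ≤ kS.toReal := ENNReal.toReal_nonneg
  have hM0 : 0 ≤ M := ENNReal.toReal_nonneg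
  obtain ⟨B, hB⟩ := hbg.exists_backgroundPrimitive (by omega) hβ0
    (ENNReal.ofReal_toReal hct.ne).ge
  obtain ⟨R, N, hreg, hNP⟩ := h.exists_regSol hbg hB hs hT hk hν hκ0
    (ENNReal.ofReal_toReal hcx.ne).ge
  have hcont : ∀ t ∈ Icc 0 T, Continuous (deriv (u t)) := fun t ht => by
    have := ((hreg.hu t).deriv.mono (m' := 1) (by omega) le_rfl).continuous'
    rwa [clamp_of_mem ht] at this
  have hbd := fun t => h.abs_le_lowNorm hlow hcont (hm t)
  obtain ⟨⟨φ, hφ⟩, -, -⟩ := h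
  have hρc : ∀ t, Continuous (ρ (clamp T t)) := fun t => (hφ.diff_ρ _ (hm t)).continuous
  have hNd : ∀ t, deriv (N t) = fun x => ρ (clamp T t) x - c 0 x := fun t =>
    (hNP t).deriv_eq ((hρc t).sub (hbg.continuous le_rfl))
  -- `B` vanishes at time 0 and grows at most at the rate β = ‖∂ₜc‖, so Tβ bounds it on [0, T]. As a
  -- forcing term it contributes Tβ · T.
  have hjet := hreg.jetNorm_le (M := M) (b := T * bS.toReal)
    (fun t x => by rw [hNd, sub_add_cancel]; exact (hbd t x).1) (fun t x => (hbd t x).2)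
    (by positivity) (hB.hb_clamp hT.le) ht
  simp only [clamp_of_mem ht, clamp_zero hT.le] at hjet
  set g := (growthRate s c ct T ρ u).toReal with hg
  have hg' : g = M + bS.toReal + kS.toReal + 1 := by
    rw [hg, growthRate, ENNReal.toReal_add (by finiteness) (by finiteness),
      ENNReal.toReal_add (by finiteness) (by finiteness), ENNReal.toReal_add hlow.ne hct.ne,
      ENNReal.toReal_one]
  have hE : ∀ t ∈ Icc 0 T, Prim (fun x => N t x - B t x) fun x => ρ t x - c t x := fun t ht => by
    have h1 := hNP t
    rw [clamp_of_mem ht] at h1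
    exact (h1.sub (hB.prim t ht)).congr_right (Eventually.of_forall fun x => by simp)
  have hEc : ∀ t ∈ Icc 0 T, Continuous fun x => ρ t x - c t x := fun t ht =>
    (hφ.diff_ρ t ht).continuous.sub (hbg.continuous ht.1)
  have hTb : 0 ≤ T * bS.toReal := by positivity
  have hEH : ∀ t ∈ Icc 0 T, HB (s + 1) (R + t * bS.toReal) fun x => N t x - B t x := fun t ht =>
    (hreg.hN t).sub (hB.hb t ht) hreg.R_nonneg (mul_nonneg ht.1 hβ0)
  have huH : ∀ t ∈ Icc 0 T, HB (s + 1) R (u t) := fun t ht => by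
    have := hreg.hu t
    rwa [clamp_of_mem ht] at this
  have hjB : jetNorm (s + 1) (B t) ≤ (s + 2) * (T * bS.toReal) := by
    have h1 := hB.hb_clamp hT.le t
    rw [clamp_of_mem ht] at h1
    refine (h1.jetNorm_le hTb).trans_eq ?_
    push_cast; ring
  have hstate : stateNorm s (fun x => ρ t x - c t x) (u t) ≤ ENNReal.ofReal
      (jetNorm (s + 1) (N t) + jetNorm (s + 1) (u t) + (s + 2) * (T * bS.toReal)) := by
    refine (add_le_add ((hEH t ht).capNorm_le_jetNorm (hE t ht) (hEc t ht))
      (huH t ht).sobolevNorm_le_jetNorm).trans ?_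
    rw [← ENNReal.ofReal_add (jetNorm_nonneg _ _) (jetNorm_nonneg _ _)]
    refine ENNReal.ofReal_le_ofReal ?_
    have := jetNorm_sub_le (hreg.hN t) (hB.hb t ht)
    linarith
  set X₀ := stateNorm s (fun x => ρ₀ x - c 0 x) u₀ with hX₀
  have hX₀f : X₀ ≠ ⊤ := (ENNReal.add_lt_top.2 ⟨hρ₀, hu₀⟩).ne
  have hy0 : jetNorm (s + 1) (N 0) + jetNorm (s + 1) (u 0) ≤ (s + 2) * X₀.toReal := by
    have e1 : capNorm s (fun x => ρ 0 x - c 0 x) = capNorm s fun x => ρ₀ x - c 0 x :=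
      capNorm_congr s (hφ.init_ρ.mono fun x hx => by simp [hx])
    have e2 : sobolevNorm (s + 1) (u 0) = sobolevNorm (s + 1) u₀ :=
      sobolevNorm_congr _ hφ.init_u
    have e3 : (fun x => N 0 x - B 0 x) = N 0 := by
      funext x; simp [hB.eq_zero hT.le]
    have e4 := hE 0 h0
    rw [e3] at e4
    have h1 : HB (s + 1) (capNorm s fun x => ρ₀ x - c 0 x).toReal (N 0) :=
      HB.of_capNorm (by omega) ENNReal.toReal_nonneg (hEc 0 h0) e4 (hreg.hN 0).memLp' (by
        rw [e1, ENNReal.ofReal_toReal hρ₀.ne])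
    have h2 : HB (s + 1) (sobolevNorm (s + 1) u₀).toReal (u 0) :=
      hb_of_sobolevNorm (by omega) (huH 0 h0).continuous' (by
        rw [e2, ENNReal.ofReal_toReal hu₀.ne])
    have h3 := h1.jetNorm_le ENNReal.toReal_nonneg
    have h4 := h2.jetNorm_le ENNReal.toReal_nonneg
    push_cast at h3 h4
    rw [hX₀, stateNorm, ENNReal.toReal_add hρ₀.ne hu₀.ne]
    linarith
  have hX0 : 0 ≤ X₀.toReal := ENNReal.toReal_nonneg
  have hG0 : 0 ≤ RegSol.growthConst s := by
    have := RegSol.one_le_srcConst (s := s) (by omega)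
    unfold RegSol.growthConst
    positivity
  set e := Real.exp ((RegSol.growthConst s + 1) * g * T) with he
  -- Of the factor 3, two units come from the forcing by `B` and one from replacing N by N - B.
  have hlin : jetNorm (s + 1) (N t) + jetNorm (s + 1) (u t) + (s + 2) * (T * bS.toReal) ≤
      3 * (s + 2) * (X₀.toReal + T * bS.toReal) * e := by
    set e' := Real.exp (RegSol.growthConst s * (M + kS.toReal + 1) * T) with he'
    have h1 : 0 < e' := Real.exp_pos _
    -- The growth rate is at least 1, so the additional 1 in the exponential constant leaves a
    -- factor e^T. It absorbs the surplus factor T of the forcing term.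
    have h2 : e' * Real.exp T ≤ e := by
      rw [he', he, ← Real.exp_add, Real.exp_le_exp]
      have h3 : RegSol.growthConst s * (M + kS.toReal + 1) ≤ RegSol.growthConst s * g :=
        mul_le_mul_of_nonneg_left (by linarith) hG0
      nlinarith
    have h3 : 1 ≤ Real.exp T := Real.one_le_exp hT.le
    have h4 : T ≤ Real.exp T := by linarith [Real.add_one_le_exp T]
    have h5 : e' ≤ e := (le_mul_of_one_le_right h1.le h3).trans h2
    have h6 : T * e' ≤ e := (mul_le_mul_of_nonneg_right h4 h1.le).trans (by linarith)
    have h7 : 1 ≤ e := Real.one_le_exp (by positivity)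
    have h8 : (jetNorm (s + 1) (N 0) + jetNorm (s + 1) (u 0)) * e' ≤
        (s + 2) * X₀.toReal * e :=
      mul_le_mul hy0 h5 h1.le (by positivity)
    have h9 : 2 * ((s : ℝ) + 2) * (T * bS.toReal) * (T * e') ≤
        2 * (s + 2) * (T * bS.toReal) * e := by gcongr
    have h10 : ((s : ℝ) + 2) * (T * bS.toReal) * 1 ≤ (s + 2) * (T * bS.toReal) * e := by gcongr
    have h11 : 0 ≤ ((s : ℝ) + 2) * X₀.toReal * e := by positivity
    calc _ ≤ (jetNorm (s + 1) (N 0) + jetNorm (s + 1) (u 0) +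
          2 * (s + 2) * (T * bS.toReal) * T) * e' + (s + 2) * (T * bS.toReal) :=
          add_le_add hjet le_rfl
      _ ≤ _ := by linarith
  refine hstate.trans ((ENNReal.ofReal_le_ofReal hlin).trans_eq ?_)
  rw [ENNReal.ofReal_mul (by positivity), ENNReal.ofReal_mul (by positivity),
    ENNReal.ofReal_add hX0 hTb, ENNReal.ofReal_mul hT.le, ENNReal.ofReal_toReal hX₀f,
    ENNReal.ofReal_toReal hct.ne]

end IsEPSolution

/-! ### Uniqueness. -/

namespace RegSol

variable {s : ℕ} {R R' S κ T k ν : ℝ} {c₀ : ℝ → ℝ} {B N u N' u' : ℝ → ℝ → ℝ}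

theorem abs_deriv_u_le (h : RegSol s R S κ T k ν c₀ B N u) (t x : ℝ) : |deriv (u t) x| ≤ 2 * R :=
  ((h.hu t).deriv.mono (m' := 1) (by have := h.two_le; omega) le_rfl).abs_le h.R_nonneg x

theorem abs_deriv_N_le (h : RegSol s R S κ T k ν c₀ B N u) (t x : ℝ) : |deriv (N t) x| ≤ 2 * R :=
  ((h.hN t).deriv.mono (m' := 1) (by have := h.two_le; omega) le_rfl).abs_le h.R_nonneg x

theorem continuous_uncurry (h : RegSol s R S κ T k ν c₀ B N u) :
    (Continuous (Function.uncurry N) ∧ Continuous (Function.uncurry fun t => deriv (N t))) ∧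
    (Continuous (Function.uncurry u) ∧ Continuous (Function.uncurry fun t => deriv (u t))) ∧
    Continuous (Function.uncurry B) := by
  have hs := h.two_le
  have h1 := HB.continuous_uncurry h.R_nonneg h.hN h.cN (j := 1) (by omega)
  have h2 := HB.continuous_uncurry h.R_nonneg h.hN h.cN (j := 0) (by omega)
  have h3 := HB.continuous_uncurry h.R_nonneg h.hu h.cu (j := 1) (by omega)
  have h4 := HB.continuous_uncurry h.R_nonneg h.hu h.cu (j := 0) (by omega)
  have h5 := HB.continuous_uncurry h.R_nonneg h.hB h.cB (j := 0) (by omega)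
  simp only [iteratedDeriv_zero, iteratedDeriv_one] at h1 h2 h3 h4 h5
  exact ⟨⟨h2, h1⟩, ⟨h4, h3⟩, h5⟩

theorem hasDerivAt_N (h : RegSol s R S κ T k ν c₀ B N u) (t x : ℝ) :
    HasDerivAt (N t) (deriv (N t) x) x :=
  (h.hN t).prim'.hasDerivAt (h.continuous_uncurry.1.2.uncurry_left t) x

theorem hasDerivAt_u (h : RegSol s R S κ T k ν c₀ B N u) (t x : ℝ) :
    HasDerivAt (u t) (deriv (u t) x) x :=
  (h.hu t).prim'.hasDerivAt (h.continuous_uncurry.2.1.2.uncurry_left t) x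

/-- Uniqueness, by a Gronwall argument for the uniform norm along the flow of `u`. -/
theorem unique (h : RegSol s R S κ T k ν c₀ B N u) (h' : RegSol s R' S κ T k ν c₀ B N' u')
    (hN0 : N 0 = N' 0) (hu0 : u 0 = u' 0) {t : ℝ} (ht : t ∈ Icc 0 T) : N t = N' t ∧ u t = u' t := by
  obtain ⟨⟨jN, jNx⟩, ⟨ju, jux⟩, jB⟩ := h.continuous_uncurry
  obtain ⟨⟨jN', jNx'⟩, ⟨ju', jux'⟩, -⟩ := h'.continuous_uncurry
  have hR := h.R_nonneg
  have hR' := h'.R_nonneg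
  have hν := h.ν_nonneg
  have hS : 0 ≤ S := (abs_nonneg _).trans (h.c_bdd 0)
  have jc : Continuous fun p : ℝ × ℝ => c₀ p.2 := h.c_prim.continuous.comp continuous_snd
  set D : ℝ → ℝ → ℝ := fun t x => N t x - N' t x with hD
  set U : ℝ → ℝ → ℝ := fun t x => u t x - u' t x with hU
  obtain ⟨X, hX⟩ := (h.vfield le_rfl h.abs_deriv_u_le).exists_flow
  have hi : ∀ {g : ℝ → ℝ → ℝ}, Continuous (Function.uncurry g) → ∀ x t,
      IntervalIntegrable (fun τ => g τ x) volume 0 t := fun hg x t =>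
    (hg.comp (Continuous.prodMk_left x)).intervalIntegrable _ _
  have jgN := h.continuous_ρu
  have jgN' := h'.continuous_ρu
  have jgu : Continuous (Function.uncurry fun τ x =>
      -(u τ x * deriv (u τ) x) - ν * u τ x + k * (N τ x - B τ x)) :=
    ((ju.mul jux).neg.sub (continuous_const.mul ju)).add (continuous_const.mul (jN.sub jB))
  have jgu' : Continuous (Function.uncurry fun τ x =>
      -(u' τ x * deriv (u' τ) x) - ν * u' τ x + k * (N' τ x - B τ x)) :=
    ((ju'.mul jux').neg.sub (continuous_const.mul ju')).add (continuous_const.mul (jN'.sub jB))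
  -- Transporting the differences along `u` puts all space derivatives in the sources on the second
  -- solution, where they are bounded. No derivative of a difference remains.
  set GD : ℝ → ℝ → ℝ := fun t x => -((deriv (N' t) x + c₀ x) * U t x) with hGD
  set GU : ℝ → ℝ → ℝ := fun t x => -(U t x * deriv (u' t) x) - ν * U t x + k * D t x with hGU
  have jGD : Continuous (Function.uncurry GD) := ((jNx'.add jc).mul (ju.sub ju')).neg
  have jGU : Continuous (Function.uncurry GU) :=
    (((ju.sub ju').mul jux').neg.sub (continuous_const.mul (ju.sub ju'))).add
      (continuous_const.mul (jN.sub jN'))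
  have hDt : Transported X T 0 D GD := by
    refine hX.transported (g := fun t x => -((deriv (N t) x + c₀ x) * u t x) -
        -((deriv (N' t) x + c₀ x) * u' t x)) (fun t ht x => ?_) (jgN.sub jgN') jGD
      (fun t x => (h.hasDerivAt_N t x).sub (h'.hasDerivAt_N t x)) fun t x => ?_
    · simp only [hD]
      rw [h.eqN t ht x, h'.eqN t ht x, intervalIntegral.integral_sub (hi jgN x t) (hi jgN' x t)]
      ring
    · simp only [hGD, hU]; ring
  have hUt : Transported X T 0 U GU := by
    refine hX.transported (g := fun t x =>
        (-(u t x * deriv (u t) x) - ν * u t x + k * (N t x - B t x)) -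
        (-(u' t x * deriv (u' t) x) - ν * u' t x + k * (N' t x - B t x)))
      (fun t ht x => ?_) (jgu.sub jgu') jGU
      (fun t x => (h.hasDerivAt_u t x).sub (h'.hasDerivAt_u t x)) fun t x => ?_
    · simp only [hU]
      rw [h.equ t ht x, h'.equ t ht x, intervalIntegral.integral_sub (hi jgu x t) (hi jgu' x t)]
      ring
    · simp only [hGU, hU, hD]; ring
  set w : ℝ → ℝ → ℝ := fun t x => |D t x| + |U t x| with hw
  have hwb : ∀ t x, w t x ≤ 2 * (2 * R + 2 * R') := by
    intro t x
    have h1 := abs_sub (N t x) (N' t x)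
    have h2 := abs_sub (u t x) (u' t x)
    have h3 := (h.hN t).abs_le hR x
    have h4 := (h'.hN t).abs_le hR' x
    have h5 := (h.hu t).abs_le hR x
    have h6 := (h'.hu t).abs_le hR' x
    simp only [hw, hD, hU]
    linarith
  set Q : ℝ → Set ℝ := fun t => (fun p : ℝ × ℝ => w p.1 p.2) '' (Icc 0 t ×ˢ univ) with hQ
  have hQb : ∀ t, BddAbove (Q t) := by
    refine fun t => ⟨2 * (2 * R + 2 * R'), ?_⟩
    rintro _ ⟨p, -, rfl⟩
    exact hwb _ _
  have hQn : ∀ t, 0 ≤ t → (Q t).Nonempty := fun t ht => ⟨_, (0, 0), ⟨⟨le_rfl, ht⟩, mem_univ _⟩, rfl⟩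
  set f : ℝ → ℝ := fun t => sSup (Q t) with hf
  have hwf : ∀ σ τ x, 0 ≤ σ → σ ≤ τ → w σ x ≤ f τ := fun σ τ x h1 h2 =>
    le_csSup (hQb τ) ⟨(σ, x), ⟨⟨h1, h2⟩, mem_univ _⟩, rfl⟩
  have hmono : MonotoneOn f (Icc 0 T) := fun σ hσ τ _ hστ =>
    csSup_le_csSup (hQb τ) (hQn σ hσ.1)
      (image_mono (prod_mono (Icc_subset_Icc le_rfl hστ) subset_rfl))
  have hfi : ∀ t ∈ Icc 0 T, IntervalIntegrable f volume 0 t := fun t ht => by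
    refine MonotoneOn.intervalIntegrable (hmono.mono ?_)
    rw [uIcc_of_le ht.1]; exact Icc_subset_Icc le_rfl ht.2
  have hw0 : ∀ t x, 0 ≤ w t x := fun t x => by positivity
  set L : ℝ := 2 * R' + S + (2 * R' + ν + 1) with hL
  have hL0 : 0 ≤ L := by positivity
  have hG : ∀ τ x, |GD τ x| + |GU τ x| ≤ L * w τ x := by
    intro τ x
    have h1 : |GD τ x| ≤ (2 * R' + S) * |U τ x| := by
      simp only [hGD]
      rw [abs_neg, abs_mul]
      gcongr
      exact (abs_add_le _ _).trans (add_le_add (h'.abs_deriv_N_le τ x) (h.c_bdd x))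
    have h2 : |GU τ x| ≤ 2 * R' * |U τ x| + ν * |U τ x| + |D τ x| := by
      refine (abs_add_le _ _).trans (add_le_add ((abs_sub _ _).trans (add_le_add ?_ ?_)) ?_)
      · rw [abs_neg, abs_mul, mul_comm]
        exact mul_le_mul_of_nonneg_right (h'.abs_deriv_u_le τ x) (abs_nonneg _)
      · rw [abs_mul, abs_of_nonneg hν]
      · rw [abs_mul, h.abs_k, one_mul]
    have h3 : 0 ≤ (2 * R' + S + (2 * R' + ν)) * |D τ x| := by positivity
    have h4 : 0 ≤ |U τ x| := abs_nonneg _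
    simp only [hL, hw]
    linarith
  have hle : ∀ t ∈ Icc 0 T, f t ≤ 0 + ∫ τ in (0 : ℝ)..t, (L * f τ + 0) := by
    intro t ht
    refine csSup_le (hQn t ht.1) ?_
    rintro _ ⟨⟨σ, x⟩, ⟨hσ, -⟩, rfl⟩
    have hσT : σ ∈ Icc 0 T := ⟨hσ.1, hσ.2.trans ht.2⟩
    -- Every point lies on a trajectory, along which both differences start from zero.
    obtain ⟨α, rfl⟩ := hX.surjective σ x
    have e1 := hDt σ hσT α
    have e2 := hUt σ hσT α
    have hD0 : D 0 α = 0 := by simp [hD, hN0]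
    have hU0 : U 0 α = 0 := by simp [hU, hu0]
    simp only [zero_mul, Real.exp_zero, one_mul, hD0, hU0, zero_add] at e1 e2
    have c1 : Continuous fun τ => GD τ (X τ α) :=
      (hX.continuous_comp jGD).comp (Continuous.prodMk_left α)
    have c2 : Continuous fun τ => GU τ (X τ α) :=
      (hX.continuous_comp jGU).comp (Continuous.prodMk_left α)
    simp only [hw]
    rw [e1, e2, zero_add]
    have i1 := intervalIntegral.abs_integral_le_integral_abs (f := fun τ => GD τ (X τ α))
      (μ := volume) hσ.1
    have i2 := intervalIntegral.abs_integral_le_integral_abs (f := fun τ => GU τ (X τ α))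
      (μ := volume) hσ.1
    refine (add_le_add i1 i2).trans ?_
    rw [← intervalIntegral.integral_add (c1.abs.intervalIntegrable _ _)
      (c2.abs.intervalIntegrable _ _)]
    have hint : ∀ t ∈ Icc 0 T, IntervalIntegrable (fun τ => L * f τ + 0) volume 0 t := fun t ht =>
      ((hfi t ht).const_mul L).add intervalIntegrable_const
    refine (intervalIntegral.integral_mono_on hσ.1 ((c1.abs.add c2.abs).intervalIntegrable _ _)
      (hint σ hσT) fun τ hτ => ?_).trans ?_
    · rw [add_zero]
      exact (hG τ _).trans (mul_le_mul_of_nonneg_left (hwf τ τ _ hτ.1 le_rfl) hL0)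
    · refine intervalIntegral.integral_mono_interval le_rfl hσ.1 hσ.2 ?_ (hint t ht)
      refine (ae_restrict_iff' measurableSet_Ioc).2 (Eventually.of_forall fun τ hτ => ?_)
      have : 0 ≤ f τ := (hw0 τ 0).trans (hwf τ τ 0 hτ.1.le le_rfl)
      simp only [Pi.zero_apply, add_zero]
      positivity
  have hfin := le_exp_of_le_integral hL0 le_rfl hmono hle ht
  simp only [zero_mul, add_zero] at hfin
  have hz : ∀ x, |D t x| + |U t x| ≤ 0 := fun x => (hwf t t x ht.1 le_rfl).trans hfin
  refine ⟨funext fun x => ?_, funext fun x => ?_⟩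
  · have h1 : |D t x| ≤ 0 := by linarith [hz x, abs_nonneg (U t x)]
    exact sub_eq_zero.1 (abs_nonpos_iff.1 h1)
  · have h1 : |U t x| ≤ 0 := by linarith [hz x, abs_nonneg (D t x)]
    exact sub_eq_zero.1 (abs_nonpos_iff.1 h1)

end RegSol

/-- Uniqueness of solutions. -/
theorem IsEPSolution.unique {s : ℕ} {k ν cm cp T : ℝ} {c ct ρ u ρ' u' : ℝ → ℝ → ℝ}
    {ρ₀ u₀ : ℝ → ℝ} (h : IsEPSolution s k ν c T ρ₀ u₀ ρ u)
    (h' : IsEPSolution s k ν c T ρ₀ u₀ ρ' u') (hbg : IsBackground s cm cp c ct)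
    (hs : 2 ≤ s) (hT : 0 < T) (hk : |k| = 1) (hν : 0 ≤ ν) {t : ℝ} (ht : t ∈ Icc 0 T) :
    ρ' t = ρ t ∧ u' t = u t := by
  have hct := (timeEssSup_mono_set (I := Ioo 0 T) Ioo_subset_Ioi_self
    (fun t => capNorm s (ct t))).trans_lt hbg.ct_mem
  have hcx := (timeEssSup_mono_set (I := Ioo 0 T) Ioo_subset_Ioi_self
    (fun t => sobolevNorm s (deriv (c t)))).trans_lt hbg.cx_mem
  obtain ⟨B, hB⟩ := hbg.exists_backgroundPrimitive (T := T) (by omega) ENNReal.toReal_nonneg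
    (ENNReal.ofReal_toReal hct.ne).ge
  obtain ⟨R, N, hr, hN⟩ := h.exists_regSol hbg hB hs hT hk hν ENNReal.toReal_nonneg
    (ENNReal.ofReal_toReal hcx.ne).ge
  obtain ⟨R', N', hr', hN'⟩ := h'.exists_regSol hbg hB hs hT hk hν ENNReal.toReal_nonneg
    (ENNReal.ofReal_toReal hcx.ne).ge
  obtain ⟨⟨φ, hφ⟩, -, -⟩ := h
  obtain ⟨⟨φ', hφ'⟩, -, -⟩ := h'
  have h0 : (0 : ℝ) ∈ Icc 0 T := ⟨le_rfl, hT.le⟩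
  -- The data are attained only almost everywhere, but both solutions are continuous in x at time 0
  -- and therefore coincide there.
  have hρ0 : ρ' 0 = ρ 0 := ((hφ'.diff_ρ 0 h0).continuous.ae_eq_iff_eq volume
    (hφ.diff_ρ 0 h0).continuous).1 (hφ'.init_ρ.trans hφ.init_ρ.symm)
  have hu0 : u' 0 = u 0 := ((hφ'.diff_u 0 h0).continuous.ae_eq_iff_eq volume
    (hφ.diff_u 0 h0).continuous).1 (hφ'.init_u.trans hφ.init_u.symm)
  have hN0 : N' 0 = N 0 := by
    have e1 := hN 0
    have e2 := hN' 0
    rw [clamp_zero hT.le] at e1 e2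
    rw [hρ0] at e2
    exact e2.eq_of_memLp e1 (hr'.hN 0).memLp' (hr.hN 0).memLp'
  obtain ⟨e1, e2⟩ := hr'.unique hr hN0 (by simp only [clamp_zero hT.le, hu0]) ht
  simp only [clamp_of_mem ht] at e2
  refine ⟨?_, e2⟩
  have d1 := hN t
  have d2 := hN' t
  rw [clamp_of_mem ht] at d1 d2
  have d3 := d1.deriv_eq ((hφ.diff_ρ t ht).continuous.sub (hbg.continuous le_rfl))
  have d4 := d2.deriv_eq ((hφ'.diff_ρ t ht).continuous.sub (hbg.continuous le_rfl))
  rw [e1, d3] at d4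
  funext x
  have := congrFun d4 x
  linarith

/-! ### From the variables N and u back to the Euler–Poisson system. -/

theorem hasDerivWithinAt_of_eq_integral {w g : ℝ → ℝ} {T : ℝ} (hg : Continuous g)
    (h : ∀ t ∈ Icc 0 T, w t = w 0 + ∫ τ in (0 : ℝ)..t, g τ) {t : ℝ} (ht : t ∈ Icc 0 T) :
    HasDerivWithinAt w (g t) (Icc 0 T) t := by
  have h1 := (((hg.integral_hasStrictDerivAt 0 t).hasDerivAt).const_add (w 0)).hasDerivWithinAt
    (s := Icc 0 T)
  exact h1.congr (fun τ hτ => h τ hτ) (h t ht)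

namespace RegSol

variable {s : ℕ} {R S κ β T k ν cm cp : ℝ} {c ct B N u : ℝ → ℝ → ℝ} {ρ₀ u₀ : ℝ → ℝ}

/-- The density is recovered as ∂ₓN + c₀, and the x-derivative of the equation of N is the mass
equation. This needs ∂ₓₓN continuous, which is where s ≥ 2 enters. The potential is minus a
primitive of N - B. -/
theorem isEPSolution (h : RegSol s R S κ T k ν (c 0) (fun t => B (clamp T t)) N u)
    (hB : BackgroundPrimitive s T β c B) (hbg : IsBackground s cm cp c ct) (hT : 0 < T)
    (hN0 : Prim (N 0) fun x => ρ₀ x - c 0 x) (hu0 : u 0 =ᵐ[volume] u₀) :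
    IsEPSolution s k ν c T ρ₀ u₀ (fun t x => deriv (N t) x + c 0 x) u := by
  obtain ⟨⟨jN, jNx⟩, ⟨ju, jux⟩, jB⟩ := h.continuous_uncurry
  have hs := h.two_le
  have hR := h.R_nonneg
  have jNxx := HB.continuous_uncurry hR h.hN h.cN (j := 2) (by omega)
  rw [show (fun t x => iteratedDeriv 2 (N t) x) = fun t => deriv (deriv (N t)) by
    funext t x; rw [iteratedDeriv_succ, iteratedDeriv_one]] at jNxx
  have hc0' : Continuous (deriv (c 0)) := ((h.c_hb).mono (m' := 1) (by omega) le_rfl).continuous'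
  have hcd : ∀ x, HasDerivAt (c 0) (deriv (c 0) x) x := h.c_prim.hasDerivAt hc0'
  have jc : Continuous fun p : ℝ × ℝ => c 0 p.2 := h.c_prim.continuous.comp continuous_snd
  have jc' : Continuous fun p : ℝ × ℝ => deriv (c 0) p.2 := hc0'.comp continuous_snd
  have hNxd : ∀ t x, HasDerivAt (deriv (N t)) (deriv (deriv (N t)) x) x := fun t x =>
    ((h.hN t).deriv.mono (m' := 1) (by omega) le_rfl).prim'.hasDerivAt (jNxx.uncurry_left t) x
  have hρd : ∀ t x, HasDerivAt (fun x => deriv (N t) x + c 0 x)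
      (deriv (deriv (N t)) x + deriv (c 0) x) x := fun t x => (hNxd t x).add (hcd x)
  set P' : ℝ → ℝ → ℝ := fun t x => -((deriv (deriv (N t)) x + deriv (c 0) x) * u t x +
    (deriv (N t) x + c 0 x) * deriv (u t) x) with hP'
  have hPd : ∀ t x, HasDerivAt (fun x => -((deriv (N t) x + c 0 x) * u t x)) (P' t x) x :=
    fun t x => ((hρd t x).mul (h.hasDerivAt_u t x)).neg
  have jP' : Continuous (Function.uncurry P') :=
    (((jNxx.add jc').mul ju).add ((jNx.add jc).mul jux)).neg
  have hmass : ∀ t ∈ Icc 0 T, ∀ x, deriv (N t) x + c 0 x =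
      (deriv (N 0) x + c 0 x) + ∫ τ in (0 : ℝ)..t, P' τ x := by
    intro t ht x
    have h1 := (h.hasDerivAt_N 0 x).add (hasDerivAt_timeIntegral h.continuous_ρu jP' hPd 0 t x)
    have h2 : N t = fun x => N 0 x + ∫ τ in (0 : ℝ)..t, -((deriv (N τ) x + c 0 x) * u τ x) :=
      funext fun x => h.eqN t ht x
    have h3 : deriv (N t) x = deriv (N 0) x + ∫ τ in (0 : ℝ)..t, P' τ x := by
      rw [h2]; exact h1.deriv
    rw [h3]; ring
  set E : ℝ → ℝ → ℝ := fun t x => N t x - B (clamp T t) x with hE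
  have hEH : ∀ t, HB (s + 1) (R + R) (E t) := fun t => (h.hN t).sub (h.hB t) hR hR
  have hEc : ∀ t, Continuous (E t) := fun t => (hEH t).continuous'
  have hEP : ∀ t ∈ Icc 0 T, Prim (E t) fun x => deriv (N t) x + c 0 x - c t x := by
    intro t ht
    have h1 := (h.hN t).prim'.sub (hB.prim_clamp hT.le t)
    rw [clamp_of_mem ht] at h1
    simp only [hE, clamp_of_mem ht]
    exact h1.congr_right (Eventually.of_forall fun x => by ring)
  have hnc : ∀ t ∈ Icc 0 T, Continuous fun x => deriv (N t) x + c 0 x - c t x := fun t ht =>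
    ((jNx.uncurry_left t).add (hbg.continuous le_rfl)).sub (hbg.continuous ht.1)
  have hEd : ∀ t ∈ Icc 0 T, ∀ x, HasDerivAt (E t) (deriv (N t) x + c 0 x - c t x) x :=
    fun t ht => (hEP t ht).hasDerivAt (hnc t ht)
  have hφd : ∀ t x, HasDerivAt (fun x => -∫ y in (0 : ℝ)..x, E t y) (-E t x) x := fun t x =>
    ((hEc t).integral_hasStrictDerivAt 0 x).hasDerivAt.neg
  have hφ' : ∀ t, deriv (fun x => -∫ y in (0 : ℝ)..x, E t y) = fun x => -E t x := fun t =>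
    funext fun x => (hφd t x).deriv
  have jgu : Continuous (Function.uncurry fun τ x =>
      -(u τ x * deriv (u τ) x) - ν * u τ x + k * (N τ x - B (clamp T τ) x)) :=
    ((ju.mul jux).neg.sub (continuous_const.mul ju)).add (continuous_const.mul (jN.sub jB))
  have htop : ENNReal.ofReal ((s + 2) * (R + R)) < ⊤ := ENNReal.ofReal_lt_top
  refine ⟨⟨fun t x => -∫ y in (0 : ℝ)..x, E t y, ⟨fun t _ x => (hρd t x).differentiableAt,
    fun t _ x => (h.hasDerivAt_u t x).differentiableAt, fun t _ x => (hφd t x).differentiableAt,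
    fun t ht x => ?_, fun t ht x => ?_, fun t ht x => ?_, fun t ht x => ?_, ?_, hu0⟩⟩, ?_, ?_⟩
  · rw [hφ' t]; exact (hEd t ht x).neg.differentiableAt
  · rw [← deriv.fun_neg, (hPd t x).deriv]
    exact hasDerivWithinAt_of_eq_integral (jP'.comp (Continuous.prodMk_left x))
      (fun t ht => hmass t ht x) ht
  · have h1 := hasDerivWithinAt_of_eq_integral (jgu.comp (Continuous.prodMk_left x))
      (fun t ht => h.equ t ht x) ht
    refine h1.congr_deriv ?_
    rw [hφ' t]
    simp only [Function.comp_apply, Function.uncurry_apply_pair, hE]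
    ring
  · rw [hφ' t, (hEd t ht x).fun_neg.deriv]
    ring
  · exact hN0.ae_deriv.mono fun x hx => by simp [hx]
  · refine lt_of_le_of_lt (essSup_le_of_ae_le (ENNReal.ofReal ((s + 2) * (R + R))) ?_) htop
    refine (ae_restrict_iff' measurableSet_Ioo).2 (Eventually.of_forall fun t ht => ?_)
    have ht' : t ∈ Icc 0 T := Ioo_subset_Icc_self ht
    refine ((hEH t).capNorm_le_jetNorm (hEP t ht') (hnc t ht')).trans
      (ENNReal.ofReal_le_ofReal (((hEH t).jetNorm_le (by linarith)).trans_eq ?_))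
    push_cast; ring
  · refine lt_of_le_of_lt (essSup_le_of_ae_le (ENNReal.ofReal ((s + 2) * (R + R))) ?_) htop
    refine Eventually.of_forall fun t => (h.hu t).sobolevNorm_le_jetNorm.trans
      (ENNReal.ofReal_le_ofReal (((h.hu t).jetNorm_le hR).trans ?_))
    push_cast
    nlinarith [(Nat.cast_nonneg s : (0 : ℝ) ≤ s)]

end RegSol

/-! ### Local existence in Lagrangian variables. -/

theorem tendsto_of_abs_sub_le_geometric {F : ℕ → ℝ} {f K : ℝ} (h : ∀ n, |F n - f| ≤ K / 2 ^ n) :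
    Tendsto F atTop (𝓝 f) := by
  rw [tendsto_iff_dist_tendsto_zero]
  refine squeeze_zero (fun _ => dist_nonneg) h ?_
  have := (tendsto_pow_atTop_nhds_zero_of_lt_one (r := (1 / 2 : ℝ)) (by norm_num)
    (by norm_num)).const_mul K
  rw [mul_zero] at this
  refine this.congr fun n => ?_
  rw [one_div, inv_pow, div_eq_mul_inv]

theorem continuous_of_abs_sub_le_geometric {F : ℕ → ℝ → ℝ} {f : ℝ → ℝ} {K : ℝ}
    (hF : ∀ n, Continuous (F n)) (h : ∀ n x, |F n x - f x| ≤ K / 2 ^ n) : Continuous f := by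
  refine TendstoUniformly.continuous (F := F) (p := atTop) ?_ (Frequently.of_forall hF)
  rw [Metric.tendstoUniformly_iff]
  intro ε hε
  have hK := tendsto_of_abs_sub_le_geometric (F := fun n => K / 2 ^ n) (f := 0) (K := |K|)
    fun n => by rw [sub_zero, abs_div, abs_of_pos (by positivity : (0 : ℝ) < 2 ^ n)]
  filter_upwards [hK.eventually (gt_mem_nhds hε)] with n hn x
  rw [dist_comm]
  exact (h n x).trans_lt hn

/-- The contraction principle for the uniform distance. -/
theorem exists_fixed_point {I : (ℝ → ℝ → ℝ) → Prop} {G : (ℝ → ℝ → ℝ) → ℝ → ℝ → ℝ}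
    {f₀ : ℝ → ℝ → ℝ} {C : ℝ} (hI₀ : I f₀) (hG : ∀ f, I f → I (G f))
    (hC : ∀ f, I f → ∀ t x, |f t x| ≤ C)
    (hL : ∀ f g, I f → I g → ∀ δ, (∀ t x, |f t x - g t x| ≤ δ) →
      ∀ t x, |G f t x - G g t x| ≤ δ / 2)
    (hlim : ∀ (F : ℕ → ℝ → ℝ → ℝ) (f : ℝ → ℝ → ℝ), (∀ n, I (F n)) →
      (∀ n t x, |F n t x - f t x| ≤ 4 * C / 2 ^ n) → I f) : ∃ f, I f ∧ G f = f := by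
  set F : ℕ → ℝ → ℝ → ℝ := fun n => G^[n] f₀ with hF
  have hFs : ∀ n, F (n + 1) = G (F n) := fun n => Function.iterate_succ_apply' G n f₀
  have hI : ∀ n, I (F n) := by
    intro n
    induction n with
    | zero => exact hI₀
    | succ n ih => rw [hFs]; exact hG _ ih
  -- The first two iterates differ by at most 2C, and each application halves the distance. The form
  -- 4C/2/2ⁿ is the one whose tails sum to 4C/2ⁿ.
  have hstep : ∀ n t x, |F n t x - F (n + 1) t x| ≤ 4 * C / 2 / 2 ^ n := by
    intro n
    induction n with
    | zero =>
      intro t x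
      have h1 := hC _ (hI 0) t x
      have h2 := hC _ (hI 1) t x
      have h3 := abs_sub (F 0 t x) (F 1 t x)
      rw [pow_zero, zero_add]; linarith
    | succ n ih =>
      intro t x
      have := hL _ _ (hI n) (hI (n + 1)) _ ih t x
      rw [← hFs, ← hFs] at this
      refine this.trans_eq ?_
      rw [pow_succ]; field_simp
  have hcs : ∀ t x, ∃ y, Tendsto (fun n => F n t x) atTop (𝓝 y) := fun t x =>
    cauchySeq_tendsto_of_complete (cauchySeq_of_le_geometric_two (C := 4 * C) fun n => hstep n t x)
  choose f hf using hcs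
  have hd : ∀ n t x, |F n t x - f t x| ≤ 4 * C / 2 ^ n := fun n t x =>
    dist_le_of_le_geometric_two_of_tendsto (fun n => hstep n t x) (hf t x) n
  have hfI := hlim F f hI hd
  refine ⟨f, hfI, funext fun t => funext fun x => ?_⟩
  have h1 : Tendsto (fun n => F (n + 1) t x) atTop (𝓝 (G f t x)) :=
    tendsto_of_abs_sub_le_geometric (K := 2 * C) fun n => by
      rw [hFs]
      refine (hL _ _ (hI n) hfI _ (hd n) t x).trans_eq ?_
      ring
  exact tendsto_nhds_unique h1 ((hf t x).comp (tendsto_add_atTop_nat 1))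

theorem Prim.abs_sub_le {f g : ℝ → ℝ} {S : ℝ} (h : Prim f g) (hg : ∀ x, |g x| ≤ S) (a b : ℝ) :
    |f b - f a| ≤ S * |b - a| := by
  rw [h.2 a b]
  exact intervalIntegral.norm_integral_le_of_norm_le_const fun x _ => (Real.norm_eq_abs _).trans_le (hg x)

theorem HB.eLpNorm_le_of_abs_le {m : ℕ} {R K : ℝ} {f g : ℝ → ℝ} (hg : HB m R g) (hK : 0 ≤ K)
    (h : ∀ x, |f x| ≤ K * |g x|) : eLpNorm f 2 volume ≤ ENNReal.ofReal (K * R) := by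
  refine (eLpNorm_le_mul_eLpNorm_of_ae_le_mul (f := f) (g := g)
    (Eventually.of_forall fun x => by simpa only [Real.norm_eq_abs] using h x) 2).trans ?_
  rw [ENNReal.ofReal_mul hK]
  gcongr
  simpa using hg.le 0 (Nat.zero_le m)

/-- A small displacement gives a change of variables. -/
theorem HB.diffeo_add {s : ℕ} {d : ℝ → ℝ} (hs : 1 ≤ s) (h : HB (s + 1) (1 / 8) d) :
    Diffeo (1 / 2) (fun α => α + d α) (fun α => 1 + _root_.deriv d α) ∧
      WB s 2 fun α => 1 + _root_.deriv d α := by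
  obtain ⟨m, rfl⟩ := Nat.exists_eq_succ_of_ne_zero (by omega : s ≠ 0)
  -- The Sobolev embedding doubles the radius 1/8, so 1 + d' lies between 3/4 and 5/4.
  have hb : ∀ x, |_root_.deriv d x| ≤ 2 * (1 / 8) := h.deriv.abs_le (by norm_num)
  have hP : Prim (fun α => 1 + _root_.deriv d α) (_root_.deriv (_root_.deriv d)) :=
    ⟨h.deriv.prim'.1, fun a b => by rw [← h.deriv.prim'.2 a b]; ring⟩
  refine ⟨⟨by norm_num, fun x => ?_, fun x => ?_⟩, WB.of_prim (fun x => ?_) hP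
    (h.deriv.deriv.mono le_rfl (by norm_num))⟩
  · exact (hasDerivAt_id x).add (h.prim'.hasDerivAt h.deriv.continuous' x)
  · linarith [(_root_.abs_le.1 (hb x)).1]
  · have := _root_.abs_le.1 (hb x)
    exact _root_.abs_le.2 ⟨by linarith, by linarith⟩

/-- The electric force at time `t`, in Lagrangian variables: `X = α + d`, `C₀' = c₀`. -/
noncomputable def lagForce (N₀ C₀ B d : ℝ → ℝ) (α : ℝ) : ℝ :=
  N₀ α - (C₀ (α + d α) - C₀ α) - B (α + d α)

/-- C₀ and c₀ need not be square integrable; only their increments are controlled, by S|d| and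
2κ|d|. The derivative of C₀(α + d) - C₀(α) is c₀(α + d) - c₀(α) plus d' c₀(α + d). The first term is
controlled through its own derivative, and in the second c₀(α + d) acts as a multiplier. -/
theorem exists_lagForce_bound {s : ℕ} (hs : 1 ≤ s) {R RB S κ : ℝ} (hR : 0 ≤ R) (hRB : 0 ≤ RB)
    (hS : 0 ≤ S) (hκ : 0 ≤ κ) : ∃ K, 0 ≤ K ∧ ∀ N₀ C₀ c₀ B d : ℝ → ℝ, HB (s + 1) R N₀ →
      Prim C₀ c₀ → (∀ x, |c₀ x| ≤ S) → Prim c₀ (deriv c₀) → HB s κ (deriv c₀) →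
      HB (s + 1) RB B → HB (s + 1) (1 / 8) d → HB (s + 1) K (lagForce N₀ C₀ B d) := by
  obtain ⟨C1, hC1, hcomp1⟩ := HB.exists_comp (s + 1) (κ := 1 / 2) (S := 2)
  obtain ⟨C2, hC2, hcomp2⟩ := HB.exists_comp s (κ := 1 / 2) (S := 2)
  set K1 : ℝ := 3 ^ s * (C2 * κ * 2) with hK1
  set K2 : ℝ := 3 ^ s * (1 / 8 * max S K1) with hK2
  have hK1' : 0 ≤ K1 := by positivity
  have hK2' : 0 ≤ K2 := by positivity
  refine ⟨R + (K1 + κ + K2 + S) + C1 * RB, by positivity,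
    fun N₀ C₀ c₀ B d hN hC hcS hcP hcH hB hd => ?_⟩
  obtain ⟨hΦ, hΦ'⟩ := hd.diffeo_add hs
  have hc' : Continuous (deriv c₀) := (hcH.mono (m' := 1) hs le_rfl).continuous'
  have hcc := hcP.continuous
  have hBΦ := hcomp1 _ _ B RB s hΦ hΦ' le_rfl hRB hB
  have hg1 : HB s K1 fun α => deriv c₀ (α + d α) * (1 + deriv d α) :=
    (hcomp2 _ _ _ κ s hΦ hΦ' (by omega) hκ hcH).mul le_rfl hΦ' (by positivity)
  have hcΦP : Prim (fun α => c₀ (α + d α)) fun α => deriv c₀ (α + d α) * (1 + deriv d α) :=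
    hcP.comp_diffeo hΦ.hasDerivAt hΦ.deriv_pos
  have hcΦW : WB (s + 1) (max S K1) fun α => c₀ (α + d α) :=
    WB.of_prim (fun x => (hcS _).trans (le_max_left _ _)) hcΦP (hg1.mono le_rfl (le_max_right _ _))
  have h2 : HB s K2 fun α => deriv d α * c₀ (α + d α) :=
    hd.deriv.mul (by omega) hcΦW (by norm_num)
  have h3 : HB (s + 1) (K1 + κ) fun α => c₀ (α + d α) - c₀ α := by
    refine HB.of_prim ?_ (hcΦP.sub hcP) (hg1.sub hcH hK1' hκ)
    refine (hd.eLpNorm_le_of_abs_le (K := 2 * κ) (by positivity) fun x => ?_).trans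
      (ENNReal.ofReal_le_ofReal (by linarith))
    have := hcP.abs_sub_le (S := 2 * κ) (fun x => (hcH.mono (m' := 1) hs le_rfl).abs_le hκ x)
      x (x + d x)
    rwa [add_sub_cancel_left] at this
  have h4 : HB (s + 1) (K1 + κ + K2 + S) fun α => C₀ (α + d α) - C₀ α := by
    refine HB.of_prim ?_ ((hC.comp_diffeo hΦ.hasDerivAt hΦ.deriv_pos).sub hC) ?_
    · refine (hd.eLpNorm_le_of_abs_le hS fun x => ?_).trans
        (ENNReal.ofReal_le_ofReal (by linarith))
      have := hC.abs_sub_le hcS x (x + d x)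
      rwa [add_sub_cancel_left] at this
    · have := ((h3.mono (m' := s) (by omega) le_rfl).add h2 (by positivity) hK2').mono
        le_rfl (by linarith : K1 + κ + K2 ≤ K1 + κ + K2 + S)
      convert this using 2
      ring
  exact (hN.sub h4 hR (by positivity)).sub hBΦ (by positivity) (by positivity)

/-- The displacement of the particles with velocities `U` on `[0, T]`. -/
noncomputable def displacement (T : ℝ) (U : ℝ → ℝ → ℝ) (t α : ℝ) : ℝ :=
  ∫ τ in (0 : ℝ)..clamp T t, U τ α

theorem HB.clampIntegral {m : ℕ} {R T : ℝ} (hR : 0 ≤ R) (hT : 0 ≤ T) {g : ℝ → ℝ → ℝ}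
    (hc : Continuous (Function.uncurry g)) (h : ∀ τ, HB m R (g τ)) :
    (∀ t, HB m (T * R) fun x => ∫ τ in (0 : ℝ)..clamp T t, g τ x) ∧
      ∀ x, Continuous fun t => ∫ τ in (0 : ℝ)..clamp T t, g τ x := by
  refine ⟨fun t => ?_, fun x => (intervalIntegral.continuous_primitive (fun a b =>
    (hc.comp (Continuous.prodMk_left x)).intervalIntegrable a b) 0).comp (continuous_clamp T)⟩
  refine (HB.timeIntegral hR hc (clamp_mem hT t).1 fun τ _ => h τ).mono le_rfl ?_
  rw [sub_zero]
  exact mul_le_mul_of_nonneg_right (clamp_mem hT t).2 hR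

theorem abs_clampIntegral_sub_le {T δ : ℝ} (hT : 0 ≤ T) {f g : ℝ → ℝ} (hf : Continuous f)
    (hg : Continuous g) (h : ∀ τ, |f τ - g τ| ≤ δ) (t : ℝ) :
    |(∫ τ in (0 : ℝ)..clamp T t, f τ) - ∫ τ in (0 : ℝ)..clamp T t, g τ| ≤ T * δ := by
  have hδ : 0 ≤ δ := (abs_nonneg _).trans (h 0)
  rw [← intervalIntegral.integral_sub (hf.intervalIntegrable _ _) (hg.intervalIntegrable _ _)]
  have h1 := intervalIntegral.norm_integral_le_of_norm_le_const (a := 0) (b := clamp T t)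
    fun τ _ => (Real.norm_eq_abs _).trans_le (h τ)
  have h2 := clamp_mem hT t
  rw [sub_zero, abs_of_nonneg h2.1, mul_comm] at h1
  exact h1.trans (mul_le_mul_of_nonneg_right h2.2 hδ)

/-- Local solution of the equations of motion of the particles. -/
theorem exists_lagrangian_velocity {s : ℕ} {R RB S K T k ν : ℝ} {N₀ C₀ c₀ u₀ : ℝ → ℝ}
    {B : ℝ → ℝ → ℝ} (hR : 0 ≤ R) (hRB : 0 ≤ RB) (hK : 0 ≤ K) (hT : 0 ≤ T) (hk : |k| = 1)
    (hν : 0 ≤ ν) (hN : Continuous N₀) (hu : HB (s + 1) R u₀) (hC : Prim C₀ c₀)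
    (hcS : ∀ x, |c₀ x| ≤ S) (hs : 1 ≤ s)
    (hB : ∀ t, HB (s + 1) RB (B t)) (hBt : ∀ x, Continuous fun t => B t x)
    (hF : ∀ t d, HB (s + 1) (1 / 8) d → HB (s + 1) K (lagForce N₀ C₀ (B t) d))
    (hT0 : T ≤ 1) (hT1 : T * (R + 1) ≤ 1 / 8) (hT2 : T * (ν * (R + 1) + K) ≤ 1)
    (hT3 : T * (ν + (S + 2 * RB)) ≤ 1 / 2) :
    ∃ U : ℝ → ℝ → ℝ, (∀ t, HB (s + 1) (R + 1) (U t)) ∧ (∀ x, Continuous fun t => U t x) ∧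
      ∀ t α, U t α = u₀ α + ∫ τ in (0 : ℝ)..clamp T t,
        (-ν * U τ α + k * lagForce N₀ C₀ (B τ) (displacement T U τ) α) := by
  have hR1 : 0 ≤ R + 1 := by positivity
  have hS : 0 ≤ S := (abs_nonneg _).trans (hcS 0)
  have jB := HB.continuous_uncurry hRB hB hBt (j := 0) (by omega)
  simp only [iteratedDeriv_zero] at jB
  set I : (ℝ → ℝ → ℝ) → Prop := fun U =>
    (∀ t, HB (s + 1) (R + 1) (U t)) ∧ ∀ x, Continuous fun t => U t x with hI
  have jU : ∀ U, I U → Continuous (Function.uncurry U) := fun U hU => by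
    simpa only [iteratedDeriv_zero] using
      HB.continuous_uncurry hR1 hU.1 hU.2 (j := 0) (by omega)
  have hd : ∀ U, I U → (∀ t, HB (s + 1) (1 / 8) (displacement T U t)) ∧
      Continuous (Function.uncurry (displacement T U)) := by
    intro U hU
    obtain ⟨h1, h2⟩ := HB.clampIntegral hR1 hT (jU U hU) hU.1
    have h3 : ∀ t, HB (s + 1) (1 / 8) (displacement T U t) := fun t => (h1 t).mono le_rfl hT1
    refine ⟨h3, ?_⟩
    simpa only [iteratedDeriv_zero] using
      HB.continuous_uncurry (by norm_num) h3 h2 (j := 0) (by omega)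
  set g : (ℝ → ℝ → ℝ) → ℝ → ℝ → ℝ := fun U τ α =>
    -ν * U τ α + k * lagForce N₀ C₀ (B τ) (displacement T U τ) α with hg
  have jg : ∀ U, I U → Continuous (Function.uncurry (g U)) := by
    intro U hU
    have h1 := jU U hU
    have h2 := (hd U hU).2
    have h3 : Continuous fun p : ℝ × ℝ => p.2 + displacement T U p.1 p.2 := continuous_snd.add h2
    have h4 := hC.continuous
    exact (continuous_const.mul h1).add (continuous_const.mul
      (((hN.comp continuous_snd).sub ((h4.comp h3).sub (h4.comp continuous_snd))).sub
        (jB.comp (continuous_fst.prodMk h3))))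
  have hgH : ∀ U, I U → ∀ t, HB (s + 1) (ν * (R + 1) + K) (g U t) := by
    intro U hU t
    have h1 := (hU.1 t).const_mul (-ν)
    have h2 := (hF t _ ((hd U hU).1 t)).const_mul k
    rw [abs_neg, abs_of_nonneg hν] at h1
    rw [hk, one_mul] at h2
    exact h1.add h2 (by positivity) hK
  -- The ball of radius R + 1 in Hˢ⁺¹ is invariant by `hT2`. The contraction is only in the uniform
  -- norm: the force is Lipschitz in the displacement with constant S + 2RB, and `hT3` gives the
  -- factor 1/2. The ball is closed under uniform limits by `HB.of_tendsto`.
  obtain ⟨U, hU, hUe⟩ := exists_fixed_point (I := I) (f₀ := fun _ => u₀) (C := 2 * (R + 1))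
    (G := fun U t α => u₀ α + ∫ τ in (0 : ℝ)..clamp T t, g U τ α)
    ⟨fun _ => hu.mono le_rfl (by linarith), fun _ => continuous_const⟩
    (fun U hU => by
      obtain ⟨h1, h2⟩ := HB.clampIntegral (by positivity) hT (jg U hU) (hgH U hU)
      exact ⟨fun t => (hu.add (h1 t) hR (by positivity)).mono le_rfl (by linarith),
        fun x => continuous_const.add (h2 x)⟩)
    (fun U hU t x => (hU.1 t).abs_le hR1 x)
    (fun U V hU hV δ hδ t x => by
      have hδ0 : 0 ≤ δ := (abs_nonneg _).trans (hδ 0 0)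
      have cU : ∀ {W : ℝ → ℝ → ℝ}, Continuous (Function.uncurry W) → Continuous fun τ => W τ x :=
        fun hW => hW.comp (Continuous.prodMk_left x)
      have hdd : ∀ τ, |displacement T U τ x - displacement T V τ x| ≤ δ := fun τ =>
        (abs_clampIntegral_sub_le hT (cU (jU U hU)) (cU (jU V hV)) (fun σ => hδ σ x) τ).trans
          (mul_le_of_le_one_left hδ0 hT0)
      rw [add_sub_add_left_eq_sub]
      refine (abs_clampIntegral_sub_le (δ := (ν + (S + 2 * RB)) * δ) hT (cU (jg U hU))
        (cU (jg V hV)) (fun τ => ?_) t).trans ?_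
      · set a := displacement T U τ x
        set b := displacement T V τ x
        have e : g U τ x - g V τ x = -(ν * (U τ x - V τ x)) +
            -(k * ((C₀ (x + a) - C₀ (x + b)) + (B τ (x + a) - B τ (x + b)))) := by
          simp only [hg, lagForce]; ring
        have h1 := hC.abs_sub_le hcS (x + b) (x + a)
        have h2 := (hB τ).prim'.abs_sub_le (S := 2 * RB)
          (((hB τ).deriv.mono (m' := 1) hs le_rfl).abs_le hRB) (x + b) (x + a)
        rw [add_sub_add_left_eq_sub] at h1 h2
        rw [e]
        refine (abs_add_le _ _).trans ?_
        rw [abs_neg, abs_neg, abs_mul, abs_mul, hk, one_mul, abs_of_nonneg hν, add_mul, add_mul]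
        refine add_le_add (mul_le_mul_of_nonneg_left (hδ τ x) hν) ((abs_add_le _ _).trans
          (add_le_add (h1.trans ?_) (h2.trans ?_)))
        · exact mul_le_mul_of_nonneg_left (hdd τ) hS
        · exact mul_le_mul_of_nonneg_left (hdd τ) (by positivity)
      · rw [← mul_assoc]
        linarith [mul_le_mul_of_nonneg_right hT3 hδ0])
    (fun F f hF hFf => by
      refine ⟨fun t => HB.of_tendsto hR1 (continuous_of_abs_sub_le_geometric
        (fun n => ((hF n).1 t).continuous') fun n x => hFf n t x) (fun n => (hF n).1 t) fun x =>
          tendsto_of_abs_sub_le_geometric fun n => hFf n t x, fun x =>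
        continuous_of_abs_sub_le_geometric (fun n => (hF n).2 x) fun n t => hFf n t x⟩)
  exact ⟨U, hU.1, hU.2, fun t α => (congrFun (congrFun hUe t) α).symm⟩

namespace Diffeo

variable {κ c : ℝ} {Φ Φ' : ℝ → ℝ}

theorem mul_abs_sub_le (h : Diffeo κ Φ Φ') (a b : ℝ) : κ * |b - a| ≤ |Φ b - Φ a| := by
  have hd : Differentiable ℝ Φ := fun x => (h.hasDerivAt x).differentiableAt
  have key : ∀ a b, a ≤ b → κ * |b - a| ≤ |Φ b - Φ a| := by
    intro a b hab
    rw [abs_of_nonneg (sub_nonneg.2 hab)]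
    exact (mul_sub_le_image_sub_of_le_deriv hd (fun x => by
      rw [(h.hasDerivAt x).deriv]; exact h.lower x) hab).trans (le_abs_self _)
  rcases le_total a b with hab | hab
  · exact key a b hab
  · rw [abs_sub_comm, abs_sub_comm (Φ b)]; exact key b a hab

/-- A bounded displacement forces surjectivity, and the lower bound on the derivative makes the
inverse Lipschitz; its derivative follows. -/
theorem exists_inverse (h : Diffeo κ Φ Φ') (hb : ∀ x, |Φ x - x| ≤ c) :
    ∃ A : ℝ → ℝ, (∀ x, Φ (A x) = x) ∧ (∀ α, A (Φ α) = α) ∧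
      ∀ x, HasDerivAt A (Φ' (A x))⁻¹ x := by
  have hsurj : Function.Surjective Φ := by
    refine h.continuous.surjective ?_ ?_
    · refine tendsto_atTop_mono (fun α => ?_) (tendsto_atTop_add_const_right _ (-c) tendsto_id)
      have := (abs_le.1 (hb α)).1
      simp only [id]; linarith
    · refine tendsto_atBot_mono (fun α => ?_) (tendsto_atBot_add_const_right _ c tendsto_id)
      have := (abs_le.1 (hb α)).2
      simp only [id]; linarith
  choose A hA using hsurj
  have hAc : Continuous A := by
    rw [continuous_iff_continuousAt]
    intro x
    rw [ContinuousAt, tendsto_iff_dist_tendsto_zero]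
    refine squeeze_zero (g := fun y => κ⁻¹ * |y - x|) (fun _ => dist_nonneg) (fun y => ?_) ?_
    · have := h.mul_abs_sub_le (A x) (A y)
      rw [hA, hA] at this
      rw [Real.dist_eq, inv_mul_eq_div, le_div_iff₀ h.pos, mul_comm]
      exact this
    · have h1 : Continuous fun y => κ⁻¹ * |y - x| := by fun_prop
      simpa using h1.tendsto x
  exact ⟨A, hA, fun α => h.strictMono.injective (hA (Φ α)), fun x =>
    (h.hasDerivAt (A x)).of_local_left_inverse hAc.continuousAt (h.deriv_pos _).ne'
      (Eventually.of_forall hA)⟩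

end Diffeo

/-- Time derivative at a fixed point from the derivative along a curve. -/
theorem hasDerivWithinAt_eulerian {w wx : ℝ → ℝ → ℝ} {X : ℝ → ℝ} {J : Set ℝ} {t₀ v W' : ℝ}
    (hwx : ∀ t x, HasDerivAt (w t) (wx t x) x) (jwx : Continuous (Function.uncurry wx))
    (hXc : Continuous X) (hX : HasDerivWithinAt X v J t₀)
    (hW : HasDerivWithinAt (fun t => w t (X t)) W' J t₀) :
    HasDerivWithinAt (fun t => w t (X t₀)) (W' - wx t₀ (X t₀) * v) J t₀ := by
  -- The mean slope of `w t` between X t₀ and X t. It is continuous in t, so the convective part of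
  -- the derivative along the curve can be subtracted although nothing is known yet about the time
  -- derivative of `w` at a fixed point.
  set q : ℝ → ℝ := fun t => ∫ θ in (0 : ℝ)..1, wx t (X t₀ + θ * (X t - X t₀)) with hq
  have hqc : Continuous q :=
    intervalIntegral.continuous_parametric_intervalIntegral_of_continuous'
      (f := fun t θ => wx t (X t₀ + θ * (X t - X t₀)))
      (jwx.comp (continuous_fst.prodMk (continuous_const.add
        (continuous_snd.mul ((hXc.comp continuous_fst).sub continuous_const))))) 0 1
  have hkey : ∀ t, w t (X t) - w t (X t₀) = q t * (X t - X t₀) := by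
    intro t
    have h1 : ∀ θ, HasDerivAt (fun θ => w t (X t₀ + θ * (X t - X t₀)))
        (wx t (X t₀ + θ * (X t - X t₀)) * (X t - X t₀)) θ := fun θ => by
      have h2 : HasDerivAt (fun θ => X t₀ + θ * (X t - X t₀)) (X t - X t₀) θ := by
        simpa using ((hasDerivAt_id θ).mul_const (X t - X t₀)).const_add (X t₀)
      exact (hwx t _).comp θ h2
    have h2 : Continuous fun θ => wx t (X t₀ + θ * (X t - X t₀)) * (X t - X t₀) :=
      ((jwx.uncurry_left t).comp (by fun_prop)).mul continuous_const
    have h3 := intervalIntegral.integral_eq_sub_of_hasDerivAt (fun θ _ => h1 θ)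
      (h2.intervalIntegrable 0 1)
    rw [intervalIntegral.integral_mul_const] at h3
    simp only [one_mul, zero_mul, add_zero, add_sub_cancel] at h3
    exact h3.symm
  have hprod : HasDerivWithinAt (fun t => q t * (X t - X t₀)) (wx t₀ (X t₀) * v) J t₀ := by
    rw [hasDerivWithinAt_iff_tendsto_slope] at hX ⊢
    have h0 : q t₀ = wx t₀ (X t₀) := by simp [hq]
    rw [← h0]
    refine ((hqc.tendsto t₀).mono_left nhdsWithin_le_nhds).mul hX |>.congr fun t => ?_
    rw [slope_def_field, slope_def_field]
    ring
  refine (hW.sub hprod).congr (fun t _ => ?_) ?_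
  · simp only [Pi.sub_apply]
    rw [← hkey]; ring
  · simp

/-- Passage from the velocities of the particles to a solution in Eulerian variables. -/
theorem exists_regSol_of_velocity {s : ℕ} {R RB RU S κ K T k ν : ℝ} {N₀ C₀ c₀ u₀ : ℝ → ℝ}
    {B U : ℝ → ℝ → ℝ} (hs : 2 ≤ s) (hRB : 0 ≤ RB) (hRU : 0 ≤ RU) (hK : 0 ≤ K) (hT : 0 ≤ T)
    (hk : |k| = 1) (hν : 0 ≤ ν) (hκ : 0 ≤ κ) (hN : HB (s + 1) R N₀) (hC : Prim C₀ c₀)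
    (hcS : ∀ x, |c₀ x| ≤ S) (hcP : Prim c₀ (deriv c₀)) (hcH : HB s κ (deriv c₀))
    (hB : ∀ t, HB (s + 1) RB (B t)) (hBt : ∀ x, Continuous fun t => B t x)
    (hF : ∀ d, HB (s + 1) (1 / 8) d → HB (s + 1) K (lagForce N₀ C₀ (fun _ => 0) d))
    (hU : ∀ t, HB (s + 1) RU (U t)) (hUt : ∀ x, Continuous fun t => U t x) (hTU : T * RU ≤ 1 / 8)
    (hUe : ∀ t α, U t α = u₀ α + ∫ τ in (0 : ℝ)..clamp T t,
        (-ν * U τ α + k * lagForce N₀ C₀ (B τ) (displacement T U τ) α)) :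
    ∃ R' N u, RegSol s R' S κ T k ν c₀ B N u ∧ N 0 = N₀ ∧ u 0 = u₀ := by
  have jU := HB.continuous_uncurry hRU hU hUt (j := 0) (by omega)
  have jB := HB.continuous_uncurry hRB hB hBt (j := 0) (by omega)
  simp only [iteratedDeriv_zero] at jU jB
  set d := displacement T U with hd
  obtain ⟨hd1, hdt⟩ := HB.clampIntegral hRU hT jU hU
  have hdH : ∀ t, HB (s + 1) (1 / 8) (d t) := fun t => (hd1 t).mono le_rfl hTU
  have jd := HB.continuous_uncurry (by norm_num) hdH hdt (j := 0) (by omega)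
  simp only [iteratedDeriv_zero] at jd
  have hcc : Continuous C₀ := hC.continuous
  have hΦ := fun t => (hdH t).diffeo_add (by omega)
  choose A hA hA' hAd using fun t => (hΦ t).1.exists_inverse (c := 2 * (1 / 8)) fun x => by
    rw [add_sub_cancel_left]; exact (hdH t).abs_le (by norm_num) x
  have hAt : ∀ x, Continuous fun t => A t x := by
    intro x
    rw [continuous_iff_continuousAt]
    intro t
    rw [ContinuousAt, tendsto_iff_dist_tendsto_zero]
    -- The particle maps expand distances by at least 1/2, so the inverse inherits continuity in
    -- time from the displacement.
    refine squeeze_zero (g := fun τ => 2 * |d τ (A t x) - d t (A t x)|) (fun _ => dist_nonneg)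
      (fun τ => ?_) ?_
    · have h1 := (hΦ τ).1.mul_abs_sub_le (A τ x) (A t x)
      have h2 := hA τ x
      have h3 := hA t x
      have e : A t x + d τ (A t x) - (A τ x + d τ (A τ x)) = d τ (A t x) - d t (A t x) := by
        linarith
      rw [e, abs_sub_comm] at h1
      rw [Real.dist_eq]
      linarith
    · have h1 : Continuous fun τ => 2 * |d τ (A t x) - d t (A t x)| :=
        continuous_const.mul ((hdt (A t x)).sub continuous_const).abs
      simpa using h1.tendsto t
  -- The inverse map has derivative r ∘ A with r = 1/(1 + d'), and `r` is a multiplier in the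
  -- Lagrangian variable. Composition with `A` then preserves Hˢ⁺¹.
  obtain ⟨S', -, hinv⟩ := WB.exists_inv s (S := 2) (by norm_num)
  obtain ⟨C, hC0, hcomp⟩ := HB.exists_comp_inv (s + 1) (κ := 1 / 2) (S := S')
  have hcompA : ∀ {f : ℝ → ℝ} {Q : ℝ} (t : ℝ), 0 ≤ Q → HB (s + 1) Q f →
      HB (s + 1) (C * Q) fun x => f (A t x) := by
    intro f Q t hQ hf
    refine hcomp (A t) (fun α => (1 + deriv (d t) α)⁻¹) f Q s ⟨by norm_num, hAd t, fun x => ?_⟩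
      (hinv _ (hΦ t).2 (hΦ t).1.lower) le_rfl hQ hf
    have h1 := (hΦ t).1.deriv_pos (A t x)
    have h2 := (le_abs_self _).trans ((hΦ t).2.bdd (A t x))
    rw [one_div]
    exact inv_anti₀ h1 h2
  set u : ℝ → ℝ → ℝ := fun t x => U t (A t x) with hu
  -- Conservation of N + C₀ along trajectories, read in Eulerian variables. Writing it as a force
  -- with B = 0 makes the Sobolev bound for the force apply.
  set N : ℝ → ℝ → ℝ := fun t x => lagForce N₀ C₀ (fun _ => 0) (d t) (A t x) with hNdef
  have hNe : ∀ t x, N t x = N₀ (A t x) - (C₀ x - C₀ (A t x)) := fun t x => by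
    simp only [hNdef, lagForce, sub_zero]
    rw [hA t x]
  have huX : ∀ t α, u t (α + d t α) = U t α := fun t α => by simp only [hu]; rw [hA']
  have hNX : ∀ t α, N t (α + d t α) = N₀ α - (C₀ (α + d t α) - C₀ α) := fun t α => by
    rw [hNe, hA']
  set R' := RB + C * K + C * RU with hR'
  have hCK : 0 ≤ C * K := by positivity
  have hCU : 0 ≤ C * RU := by positivity
  have hR'0 : 0 ≤ R' := by positivity
  have huH : ∀ t, HB (s + 1) R' (u t) := fun t => (hcompA t hRU (hU t)).mono le_rfl (by linarith)
  have hNH : ∀ t, HB (s + 1) R' (N t) := fun t =>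
    (hcompA t hK (hF _ (hdH t))).mono le_rfl (by linarith)
  have hut : ∀ x, Continuous fun t => u t x := fun x => jU.comp (continuous_id.prodMk (hAt x))
  have hNt : ∀ x, Continuous fun t => N t x := fun x => by
    refine Continuous.congr ?_ fun t => (hNe t x).symm
    exact (hN.continuous'.comp (hAt x)).sub (continuous_const.sub (hcc.comp (hAt x)))
  have ju := HB.continuous_uncurry hR'0 huH hut (j := 0) (by omega)
  have jux := HB.continuous_uncurry hR'0 huH hut (j := 1) (by omega)
  have jN := HB.continuous_uncurry hR'0 hNH hNt (j := 0) (by omega)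
  have jNx := HB.continuous_uncurry hR'0 hNH hNt (j := 1) (by omega)
  simp only [iteratedDeriv_zero, iteratedDeriv_one] at ju jux jN jNx
  have hud : ∀ t x, HasDerivAt (u t) (deriv (u t) x) x := fun t x =>
    (huH t).prim'.hasDerivAt (jux.uncurry_left t) x
  have hNd : ∀ t x, HasDerivAt (N t) (deriv (N t) x) x := fun t x =>
    (hNH t).prim'.hasDerivAt (jNx.uncurry_left t) x
  have hXd : ∀ α, ∀ t ∈ Icc 0 T, HasDerivWithinAt (fun t => α + d t α) (U t α) (Icc 0 T) t := by
    intro α t ht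
    refine (hasDerivWithinAt_of_eq_integral (hUt α) (fun t ht => ?_) ht).const_add α
    simp only [hd, displacement, clamp_of_mem ht, clamp_zero hT, intervalIntegral.integral_same,
      zero_add]
  have hUd : ∀ α, ∀ t ∈ Icc 0 T, HasDerivWithinAt (fun t => U t α)
      (-ν * U t α + k * lagForce N₀ C₀ (B t) (d t) α) (Icc 0 T) t := by
    intro α t ht
    have hX : Continuous fun τ => α + d τ α := continuous_const.add (hdt α)
    refine hasDerivWithinAt_of_eq_integral (g := fun t => -ν * U t α +
      k * lagForce N₀ C₀ (B t) (d t) α) ?_ (fun t ht => ?_) ht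
    · exact (continuous_const.mul (hUt α)).add (continuous_const.mul
        ((continuous_const.sub ((hcc.comp hX).sub continuous_const)).sub
          (jB.comp (continuous_id.prodMk hX))))
    · have h1 := hUe t α
      have h2 := hUe 0 α
      rw [clamp_of_mem ht] at h1
      rw [clamp_zero hT, intervalIntegral.integral_same, add_zero] at h2
      rw [h1, h2]
  have hXc : ∀ α, Continuous fun t => α + d t α := fun α => continuous_const.add (hdt α)
  have hut' : ∀ t ∈ Icc 0 T, ∀ x, HasDerivWithinAt (fun t => u t x)
      (-(u t x * deriv (u t) x) - ν * u t x + k * (N t x - B t x)) (Icc 0 T) t := by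
    intro t ht x
    have h1 := hasDerivWithinAt_eulerian hud jux (hXc (A t x)) (hXd (A t x) t ht)
      ((hUd (A t x) t ht).congr (fun τ _ => huX τ _) (huX t _))
    simp only [hA t x] at h1
    refine h1.congr_deriv ?_
    have e1 : U t (A t x) = u t x := rfl
    have e2 : lagForce N₀ C₀ (B t) (d t) (A t x) = N t x - B t x := by
      rw [hNe, lagForce, hA t x]
    rw [e1, e2]
    ring
  have hNt' : ∀ t ∈ Icc 0 T, ∀ x, HasDerivWithinAt (fun t => N t x)
      (-((deriv (N t) x + c₀ x) * u t x)) (Icc 0 T) t := by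
    intro t ht x
    have h0 := (((hC.hasDerivAt hcP.continuous _).comp_hasDerivWithinAt t
      (hXd (A t x) t ht)).sub_const (C₀ (A t x))).const_sub (N₀ (A t x))
    have h1 := hasDerivWithinAt_eulerian hNd jNx (hXc (A t x)) (hXd (A t x) t ht)
      (h0.congr (fun τ _ => hNX τ _) (hNX t _))
    simp only [hA t x] at h1
    refine h1.congr_deriv ?_
    have e1 : U t (A t x) = u t x := rfl
    rw [e1]
    ring
  have hA0 : ∀ x, A 0 x = x := fun x => by
    have h1 := hA 0 x
    simpa [hd, displacement, clamp_zero hT] using h1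
  refine ⟨R', N, u, ⟨hs, hR'0, hκ, hν, hk, fun t => (hB t).mono le_rfl (by linarith), hNH, huH, hBt,
    hNt, hut, hcS, hcP, hcH, fun t ht x => ?_, fun t ht x => ?_⟩, ?_, ?_⟩
  · refine integral_eq_of_hasDerivWithinAt
      (F' := fun t => -((deriv (N t) x + c₀ x) * u t x)) ?_ (fun t ht => hNt' t ht x) ht
    exact (((jNx.comp (Continuous.prodMk_left x)).add continuous_const).mul (hut x)).neg
  · refine integral_eq_of_hasDerivWithinAt (F' := fun t => -(u t x * deriv (u t) x) - ν * u t x +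
      k * (N t x - B t x)) ?_ (fun t ht => hut' t ht x) ht
    exact (((hut x).mul (jux.comp (Continuous.prodMk_left x))).neg.sub
      (continuous_const.mul (hut x))).add (continuous_const.mul ((hNt x).sub (hBt x)))
  · funext x
    rw [hNe, hA0]; ring
  · funext x
    simp only [hu, hA0]
    rw [hUe, clamp_zero hT, intervalIntegral.integral_same, add_zero]

theorem BackgroundPrimitive.mono {s : ℕ} {T T' β : ℝ} {c B : ℝ → ℝ → ℝ}
    (h : BackgroundPrimitive s T β c B) (hT : T' ≤ T) : BackgroundPrimitive s T' β c B :=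
  ⟨h.nonneg, fun t ht => h.prim t ⟨ht.1, ht.2.trans hT⟩, fun t ht => h.hb t ⟨ht.1, ht.2.trans hT⟩,
    fun a b ha hab hb => h.lip a b ha hab (hb.trans hT)⟩

/-- Local existence. -/
theorem exists_isEPSolution {s : ℕ} {k ν cm cp : ℝ} {c ct : ℝ → ℝ → ℝ} {ρ₀ u₀ : ℝ → ℝ}
    (hbg : IsBackground s cm cp c ct) (hs : 2 ≤ s) (hk : |k| = 1) (hν : 0 ≤ ν)
    (hρ₀ : capNorm s (fun x => ρ₀ x - c 0 x) < ⊤) (hu₀ : sobolevNorm (s + 1) u₀ < ⊤) :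
    ∃ T : ℝ, 0 < T ∧ ∃ ρ u : ℝ → ℝ → ℝ, IsEPSolution s k ν c T ρ₀ u₀ ρ u := by
  have hct := (timeEssSup_mono_set (I := Ioo 0 1) Ioo_subset_Ioi_self
    (fun t => capNorm s (ct t))).trans_lt hbg.ct_mem
  have hcx := (timeEssSup_mono_set (I := Ioo 0 1) Ioo_subset_Ioi_self
    (fun t => sobolevNorm s (deriv (c t)))).trans_lt hbg.cx_mem
  obtain ⟨B, hB⟩ := hbg.exists_backgroundPrimitive (T := 1) (by omega) ENNReal.toReal_nonneg
    (ENNReal.ofReal_toReal hct.ne).ge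
  obtain ⟨hcP, hcH⟩ := hbg.deriv_hb (T := 1) (by omega) ENNReal.toReal_nonneg one_pos
    (ENNReal.ofReal_toReal hcx.ne).ge
  set β := (timeEssSup (Ioo 0 1) fun t => capNorm s (ct t)).toReal with hβ
  set κ := (timeEssSup (Ioo 0 1) fun t => sobolevNorm s (deriv (c t))).toReal with hκ
  have hβ0 : 0 ≤ β := ENNReal.toReal_nonneg
  have hκ0 : 0 ≤ κ := ENNReal.toReal_nonneg
  have hcS : ∀ x, |c 0 x| ≤ max |cm| |cp| := fun x =>
    abs_le_max_abs_abs (hbg.bounds 0 le_rfl x).1 (hbg.bounds 0 le_rfl x).2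
  set S := max |cm| |cp| with hS
  have hS0 : 0 ≤ S := (abs_nonneg _).trans (hcS 0)
  have hcc : Continuous (c 0) := hbg.continuous le_rfl
  have hC : Prim (fun x => ∫ y in (0 : ℝ)..x, c 0 y) (c 0) :=
    Prim.of_hasDerivAt_continuous (fun x => (hcc.integral_hasStrictDerivAt 0 x).hasDerivAt) hcc
  obtain ⟨N₀, R, hR, hN₀P, hN₀⟩ : ∃ N₀ R, 0 ≤ R ∧ Prim N₀ (fun x => ρ₀ x - c 0 x) ∧
      HB (s + 1) R N₀ := by
    set a := (capNorm s fun x => ρ₀ x - c 0 x).toReal with ha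
    have hle : capNorm s (fun x => ρ₀ x - c 0 x) ≤ ENNReal.ofReal a :=
      (ENNReal.ofReal_toReal hρ₀.ne).ge
    obtain ⟨E, hP, hE, hEa⟩ := exists_prim_of_hMinusOneNorm (le_add_self.trans_lt hρ₀)
    obtain ⟨F, hF, hFH⟩ := exists_hb_of_sobolevNorm (m := s) (by omega) (le_self_add.trans hle)
    exact ⟨E, a, ENNReal.toReal_nonneg, hP,
      HB.of_prim (hEa.trans (le_add_self.trans hle)) (hP.congr_right hF) hFH⟩
  obtain ⟨v, hv, hvH⟩ := exists_hb_of_sobolevNorm (m := s + 1) (by omega)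
    (ENNReal.ofReal_toReal hu₀.ne).ge
  set Q := R + (sobolevNorm (s + 1) u₀).toReal with hQ
  have hQ0 : 0 ≤ Q := add_nonneg hR ENNReal.toReal_nonneg
  have hN₀' : HB (s + 1) Q N₀ := hN₀.mono le_rfl (le_add_of_nonneg_right ENNReal.toReal_nonneg)
  have hvH' : HB (s + 1) Q v := hvH.mono le_rfl (le_add_of_nonneg_left hR)
  obtain ⟨K, hK, hforce⟩ := exists_lagForce_bound (s := s) (by omega) hQ0 hβ0 hS0 hκ0
  -- The time of existence is 1/W. The three summands yield T(Q + 1) ≤ 1/8, T(ν(Q + 1) + K) ≤ 1 and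
  -- T(ν + S + 2β) ≤ 1/2, and W ≥ 1 yields T ≤ 1.
  set W : ℝ := 8 * (Q + 1) + (ν * (Q + 1) + K) + 2 * (ν + (S + 2 * β)) with hW
  have hW1 : 1 ≤ W := by
    have : 0 ≤ ν * (Q + 1) := by positivity
    linarith
  have hW0 : 0 < W := by linarith
  have hTle : ∀ {a b : ℝ}, a ≤ W * b → W⁻¹ * a ≤ b := fun {a b} hab => by
    rw [inv_mul_le_iff₀ hW0]; exact hab
  have hT : 0 < W⁻¹ := inv_pos.2 hW0
  have hT1 : W⁻¹ ≤ 1 := inv_le_one_of_one_le₀ hW1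
  have hνQ : 0 ≤ ν * (Q + 1) := by positivity
  have hBT := hB.mono hT1
  have hBH : ∀ t, HB (s + 1) β (B (clamp W⁻¹ t)) := fun t =>
    (hBT.hb_clamp hT.le t).mono le_rfl (mul_le_of_le_one_left hβ0 hT1)
  have hBt := hBT.continuous_clamp hT.le
  have hzero : HB (s + 1) β fun _ => (0 : ℝ) := by
    have h := hvH'.const_mul 0
    simp only [zero_mul, abs_zero] at h
    exact h.mono le_rfl hβ0
  have hb1 : W⁻¹ * (Q + 1) ≤ 1 / 8 := hTle (by linarith)
  obtain ⟨U, hU, hUt, hUe⟩ := exists_lagrangian_velocity (T := W⁻¹) (ν := ν) (k := k)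
    (B := fun t => B (clamp W⁻¹ t)) hQ0 hβ0 hK hT.le hk
    hν hN₀.continuous' hvH' hC hcS (by omega) hBH hBt
    (fun t d hd => hforce _ _ _ _ _ hN₀' hC hcS hcP hcH (hBH t) hd) hT1 hb1
    (hTle (by linarith)) (hTle (by linarith))
  obtain ⟨R', N, u, hreg, hNi, hui⟩ := exists_regSol_of_velocity (B := fun t => B (clamp W⁻¹ t))
    hs hβ0 (by positivity) hK hT.le hk hν hκ0 hN₀' hC hcS hcP hcH hBH hBt
    (fun d hd => hforce _ _ _ _ _ hN₀' hC hcS hcP hcH hzero hd) hU hUt hb1 hUe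
  exact ⟨W⁻¹, hT, _, u, hreg.isEPSolution hBT hbg hT (hNi ▸ hN₀P) (hui ▸ hv.symm)⟩

/-! ### The theorem. -/

theorem theorem1p1 (s : ℕ) (hs : 2 ≤ s) :
    ∃ C K : ℝ, 0 < C ∧ 0 < K ∧
      ∀ (k ν : ℝ) (_ : k = 1 ∨ k = -1) (_ : 0 ≤ ν)
        (cm cp : ℝ) (c ct : ℝ → ℝ → ℝ) (_ : IsBackground s cm cp c ct)
        (ρ₀ u₀ : ℝ → ℝ) (_ : capNorm s (fun x => ρ₀ x - c 0 x) < ⊤)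
        (_ : sobolevNorm (s + 1) u₀ < ⊤),
        (∃ T : ℝ, 0 < T ∧ ∃ ρ u : ℝ → ℝ → ℝ,
          IsEPSolution s k ν c T ρ₀ u₀ ρ u ∧
          ∀ ρ' u' : ℝ → ℝ → ℝ, IsEPSolution s k ν c T ρ₀ u₀ ρ' u' →
            ∀ t ∈ Icc 0 T, ∀ x, ρ' t x = ρ t x ∧ u' t x = u t x) ∧
        (∀ (T : ℝ) (_ : 0 < T) (ρ u : ℝ → ℝ → ℝ) (_ : IsEPSolution s k ν c T ρ₀ u₀ ρ u)
          (_ : lowNorm T ρ u < ⊤),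
          ⨆ t ∈ Icc 0 T, stateNorm s (fun x => ρ t x - c t x) (u t) ≤
            ENNReal.ofReal C *
              (stateNorm s (fun x => ρ₀ x - c 0 x) u₀ +
                ENNReal.ofReal T * timeEssSup (Ioo 0 T) (fun t => capNorm s (ct t))) *
              ENNReal.ofReal (Real.exp (K * (growthRate s c ct T ρ u).toReal * T))) := by
  have hG : 0 ≤ RegSol.growthConst s := by
    have := RegSol.one_le_srcConst (s := s) (by omega)
    unfold RegSol.growthConst
    positivity
  refine ⟨3 * (s + 2), RegSol.growthConst s + 1, by positivity, by positivity, ?_⟩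
  intro k ν hk hν cm cp c ct hbg ρ₀ u₀ hρ₀ hu₀
  have hk' : |k| = 1 := by rcases hk with rfl | rfl <;> simp
  refine ⟨?_, fun T hT ρ u h hlow => iSup₂_le fun t ht =>
    h.stateNorm_le hbg hs hT hk' hν hlow hρ₀ hu₀ ht⟩
  obtain ⟨T, hT, ρ, u, h⟩ := exists_isEPSolution hbg hs hk' hν hρ₀ hu₀
  refine ⟨T, hT, ρ, u, h, fun ρ' u' h' t ht x => ?_⟩
  obtain ⟨h1, h2⟩ := h.unique h' hbg hs hT hk' hν ht
  exact ⟨congrFun h1 x, congrFun h2 x⟩
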